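/- **Model.** A sender $S$ and a receiver $R$ play an infinitely repeated game with common discount factor $\delta\in[0,1)$. In every period a state $\theta\in[0,1]$ is drawn independently from a distribution $F$ with a strictly positive density. First a public signal $\psi(\theta)$ realizes. Then there is an ex-ante round of voluntary transfers, in which first $S$ and then $R$ chooses a nonnegative gross transfer to the other player and a nonnegative amount of money to burn. Next $S$ privately observes $\theta$, sends a message and makes an interim transfer; $R$ makes an interim transfer and chooses a decision $d\in\mathbb R$; and $S$ and then $R$ make ex-post transfers. Everything except the state is publicly observed (the payoffs are not). The stage payoff of player $i$ is $u_i(d,\theta)$ minus $i$'s net transfers (own gross transfers, minus those of the other player, plus own burned money). On $\mathbb R\times[0,1]$, $u_S$ and $u_R$ are twice differentiable, $\partial^2u_S/\partial d^2\le 0$, $\partial^2u_R/\partial d^2<0$, $\partial^2u_i/\partial d\,\partial\theta>0$ for $i=S,R$, and for every $\theta$ both $\partial u_R/\partial d(\cdot,\theta)$ and $\partial (u_S+u_R)/\partial d(\cdot,\theta)$ have a zero. A signal rule is deterministic and monotone: it is a partition of $[0,1]$ into convex sets, and $\psi(\theta)$ is the element containing $\theta$. Let $V=V(\psi)\subset\mathbb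 R^2$ be the set of payoff pairs (normalized discounted expected payoffs, evaluated before the first signal) of pure-strategy perfect Bayesian equilibria with public, measurable strategies whose decisions and transfers are bounded. In them, off-path beliefs are concentrated on the closure of the current signal realization. Let $\underline v_S,\underline v_R$ be the infima over $V$ of the two players' payoffs, $\overline v$ the supremum over $V$ of the joint payoff (all three finite), and $L=\frac{\delta}{1-\delta}(\overline v-\underline v_S-\underline v_R)$. For convex $m\subset[0,1]$ let $u_i(d,m)=\mathbb E[u_i(d,\theta)\mid\theta\in m]$, $w_R(d,m)=\max_{d'}u_R(d',m)-u_R(d,m)$ and $[\rho_-(m),\rho_+(m)]=\{d:w_R(d,m)\le L\}$. *Penal rules* of the sender on a set $s$ of states are a monotone message rule $\mu$ on $s$ (a partition of $s$ into convex sets), a decision rule $\rho$ and a state $\theta^p\in s$, with $m^p=\mu(\theta^p)$, that minimize $$u_S(\rho(m^p),\theta^p)+\mathbb E\Big[\int_{\theta^p}^{\theta}\frac{\partial u_S}{\partial\theta}(\rho(\mu(x)),x)\,dx\ \Big|\ \theta\in s\Big]$$ subject to: $\rho(\mu(\theta))$ is nondecreasing in $\theta\in s$; $\rho(m)=\rho_-(m)$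 for $m>m^p$; $\rho(m)=\rho_+(m)$ for $m<m^p$; and $\rho(m^p)\in\{\rho_-(m^p),\rho_+(m^p)\}$. A penal decision outcome under $\psi$ is the function $\theta\mapsto\rho(\mu(\theta))$ obtained from penal rules on each signal realization $s$. Endpoints that a realization lacks are included as limit states: the problem is posed on the closure of $s$, and monotonicity of the outcome is understood on the closures. The signal $\psi$ is *strictly more informative* than $\hat\psi$ if $\psi$ is a refinement of $\hat\psi$ and, with strictly positive probability, $\hat\psi(\theta)\setminus\psi(\theta)$ has positive probability under $F$. **Proposition.** Let $\psi$ be strictly more informative than $\hat\psi$, and let $V$ and $\hat V$ be the equilibrium payoff sets under $\psi$ and $\hat\psi$. If some penal decision outcome of the sender under $\psi$ is nondecreasing in $\theta$ on $[0,1]$, then $V\subsetneq\hat V$. -/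

import Mathlib

open MeasureTheory Set
open scoped NNReal

namespace RepeatedCommunication

/-! ## Primitives -/

/-- The two players. -/
inductive Player
  | sender
  | receiver

/-- The data of the stage game: payoffs `u i d θ`, the density `f` of the state, and the
common discount factor `δ`. -/
structure Env where
  u : Player → ℝ → ℝ → ℝ
  f : ℝ → ℝ
  δ : ℝ

/-- `v` is twice differentiable in `(d, θ)` on `ℝ × [0,1]`. -/
def TwiceDifferentiable (v : ℝ → ℝ → ℝ) : Prop :=
  DifferentiableOn ℝ (Function.uncurry v) (univ ×ˢ Icc 0 1) ∧
  DifferentiableOn ℝ (fderivWithin ℝ (Function.uncurry v) (univ ×ˢ Icc 0 1)) (univ ×ˢ Icc 0 1)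

/-- The partial derivative in the decision, `∂v/∂d (d, θ)`. -/
noncomputable def partialD (v : ℝ → ℝ → ℝ) (d θ : ℝ) : ℝ := deriv (fun d' => v d' θ) d

/-- The partial derivative in the state, `∂v/∂θ (d, θ)`, one-sided at the ends of `[0,1]`. -/
noncomputable def partialTheta (v : ℝ → ℝ → ℝ) (d θ : ℝ) : ℝ :=
  derivWithin (fun θ' => v d θ') (Icc 0 1) θ

namespace Env

variable (E : Env)

/-- The prior distribution of the state, with density `f` on `[0,1]`. -/
noncomputable def prior : Measure ℝ :=
  (volume.restrict (Icc 0 1)).withDensity (fun θ => ENNReal.ofReal (E.f θ))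

/-- The standing assumptions of the model (Crawford–Sobel payoffs, a strictly positive density,
a discount factor in `[0,1)`). -/
structure Standing : Prop where
  delta_nonneg : 0 ≤ E.δ
  delta_lt_one : E.δ < 1
  measurable_f : Measurable E.f
  f_pos : ∀ θ ∈ Icc (0 : ℝ) 1, 0 < E.f θ
  prior_univ : E.prior univ = 1
  twice_differentiable : ∀ i, TwiceDifferentiable (E.u i)
  concave_sender : ∀ d, ∀ θ ∈ Icc (0 : ℝ) 1, deriv (fun d' => partialD (E.u .sender) d' θ) d ≤ 0
  concave_receiver :
    ∀ d, ∀ θ ∈ Icc (0 : ℝ) 1, deriv (fun d' => partialD (E.u .receiver) d' θ) d < 0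
  preferred_receiver : ∃ ρR : ℝ → ℝ, ∀ θ ∈ Icc (0 : ℝ) 1, partialD (E.u .receiver) (ρR θ) θ = 0
  first_best : ∃ ρFB : ℝ → ℝ, ∀ θ ∈ Icc (0 : ℝ) 1,
    partialD (fun d θ' => E.u .sender d θ' + E.u .receiver d θ') (ρFB θ) θ = 0
  sorting : ∀ i, ∀ d, ∀ θ ∈ Icc (0 : ℝ) 1, 0 < deriv (fun d' => partialTheta (E.u i) d' θ) d

end Env

/-! ## Monotone partitions, signals -/

/-- A monotone deterministic rule on a set `S` of states.  Every realization is identified with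
the set of states that induce it, `cell θ` is the realization in state `θ`, and every realization
is convex (a singleton or an interval).  The values of `cell` outside `S` play no role. -/
structure MonotoneRule (S : Set ℝ) where
  cell : ℝ → Set ℝ
  mem_cell : ∀ θ ∈ S, θ ∈ cell θ
  cell_subset : ∀ θ ∈ S, cell θ ⊆ S
  cell_eq : ∀ θ ∈ S, ∀ θ' ∈ cell θ, cell θ' = cell θ
  ordConnected : ∀ θ ∈ S, (cell θ).OrdConnected

/-- A monotone public signal rule. -/
abbrev Signal := MonotoneRule (Icc (0 : ℝ) 1)

/-- `ψ` is more informative than `ψ'`: it is a refinement of `ψ'`. -/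
def MoreInformative (ψ ψ' : Signal) : Prop :=
  ∀ θ ∈ Icc (0 : ℝ) 1, ψ.cell θ ⊆ ψ'.cell θ

/-- `ψ` is strictly more informative than `ψ'`: it is a refinement of `ψ'`, and with strictly
positive probability the two realizations differ by more than a null set of states. -/
def StrictlyMoreInformative (E : Env) (ψ ψ' : Signal) : Prop :=
  MoreInformative ψ ψ' ∧
    0 < E.prior {θ | θ ∈ Icc (0 : ℝ) 1 ∧ 0 < E.prior (ψ'.cell θ \ ψ.cell θ)}

open Classical in
/-- The law of the state given that it lies in the convex set `m`.  When `m` has probability zero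
it is a singleton (the density is positive), and the law is the point mass there. -/
noncomputable def condLaw (P : Measure ℝ) (m : Set ℝ) : Measure ℝ :=
  if P m = 0 then Measure.dirac (sInf m) else ProbabilityTheory.cond P m

/-! ## One period of play

In every period: the public signal realizes; ex-ante transfers (sender, then receiver); the sender
learns the state, sends a message and makes an interim transfer; the receiver makes an interim
transfer and then a decision; ex-post transfers (sender, then receiver).  Everything but the state
is public. -/

/-- A transfer choice: a gross transfer to the other player, and an amount of money to burn. -/
abbrev Transfer := ℝ≥0 × ℝ≥0

/-- The public record of a period after the ex-ante round. -/
structure Opening where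
  signal : Set ℝ
  exS : Transfer
  exR : Transfer

/-- ... after the sender's message and interim transfer, -/
structure Reported extends Opening where
  msg : Set ℝ
  inS : Transfer

/-- ... after the receiver's interim transfer, -/
structure Paid extends Reported where
  inR : Transfer

/-- ... after the decision, -/
structure Decided extends Paid where
  dec : ℝ

/-- ... after the sender's ex-post transfer, -/
structure Settling extends Decided where
  postS : Transfer

/-- ... after the receiver's ex-post transfer: the full public record of a period. -/
structure Record extends Settling where
  postR : Transfer

/-- A public history: the records of the past periods, oldest first. -/
abbrev History := List Record

/-- The net transfer of a player in a round: own gross transfer, minus the other player's gross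
transfer, plus own burned money. -/
noncomputable def netTransfer (own other : Transfer) : ℝ := own.1 - other.1 + own.2

/-- The total net transfer of a player in a period. -/
noncomputable def Record.net (r : Record) : Player → ℝ
  | .sender => netTransfer r.exS r.exR + netTransfer r.inS r.inR + netTransfer r.postS r.postR
  | .receiver => netTransfer r.exR r.exS + netTransfer r.inR r.inS + netTransfer r.postR r.postS

/-- The stage payoff of player `i` in state `θ`, given the public record of the period. -/
noncomputable def Env.stage (E : Env) (i : Player) (θ : ℝ) (r : Record) : ℝ :=
  E.u i r.dec θ - r.net i

/-! ## Strategies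

Pure strategies that depend on the public history, and, for the sender's report, on the current
state.  The message and the interim transfer of the sender, which he chooses one right after the
other, are one report. -/

structure SenderStrategy where
  exAnte : History → Set ℝ → Transfer
  report : History → Opening → ℝ → Set ℝ × Transfer
  exPost : History → Decided → Transfer

structure ReceiverStrategy where
  exAnte : History → Set ℝ → Transfer → Transfer
  interim : History → Reported → Transfer
  decide : History → Paid → ℝ
  exPost : History → Settling → Transfer

structure Profile where
  S : SenderStrategy
  R : ReceiverStrategy

def TransferLE (p : Transfer) (B : ℝ≥0) : Prop := p.1 ≤ B ∧ p.2 ≤ B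

/-- All choices of the strategy lie in a common compact set. -/
def SenderStrategy.Bounded (S : SenderStrategy) : Prop :=
  ∃ B : ℝ≥0, (∀ h s, TransferLE (S.exAnte h s) B) ∧
    (∀ h x θ, TransferLE (S.report h x θ).2 B) ∧ (∀ h x, TransferLE (S.exPost h x) B)

/-- All choices of the strategy lie in a common compact set. -/
def ReceiverStrategy.Bounded (R : ReceiverStrategy) : Prop :=
  ∃ B : ℝ≥0, (∀ h s p, TransferLE (R.exAnte h s p) B) ∧ (∀ h x, TransferLE (R.interim h x) B) ∧
    (∀ h x, |R.decide h x| ≤ B) ∧ (∀ h x, TransferLE (R.exPost h x) B)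

namespace Profile

variable (σ : Profile) (h : History)

/-! The record that results when the current period is completed according to `σ`, from each of
the points at which a player moves. -/

def afterSettling (x : Settling) : Record := ⟨x, σ.R.exPost h x⟩

def afterDecided (x : Decided) : Record := σ.afterSettling h ⟨x, σ.S.exPost h x⟩

def afterPaid (x : Paid) : Record := σ.afterDecided h ⟨x, σ.R.decide h x⟩

def afterReported (x : Reported) : Record := σ.afterPaid h ⟨x, σ.R.interim h x⟩

def afterOpening (x : Opening) (θ : ℝ) : Record :=
  σ.afterReported h ⟨x, (σ.S.report h x θ).1, (σ.S.report h x θ).2⟩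

def afterSenderExAnte (s : Set ℝ) (p : Transfer) (θ : ℝ) : Record :=
  σ.afterOpening h ⟨s, p, σ.R.exAnte h s p⟩ θ

def afterSignal (s : Set ℝ) (θ : ℝ) : Record :=
  σ.afterSenderExAnte h s (σ.S.exAnte h s) θ

/-- The record of the period that starts at `h` when the state is `θ`. -/
def play (ψ : Signal) (θ : ℝ) : Record := σ.afterSignal h (ψ.cell θ) θ

end Profile

/-! ## Payoffs of the repeated game -/

namespace Env

variable (E : Env) (ψ : Signal) (σ : Profile)

/-- The expected stage payoff of player `i`, `k` periods after the period that starts at the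
history `h`, when `σ` is played from `h` on (the states are independent draws from the prior). -/
noncomputable def ahead (i : Player) : ℕ → History → ℝ
  | 0, h => ∫ θ, E.stage i θ (σ.play h ψ θ) ∂E.prior
  | k + 1, h => ∫ θ, ahead i k (h ++ [σ.play h ψ θ]) ∂E.prior

/-- The expected normalized discounted payoff of player `i` from the history `h` on. -/
noncomputable def value (i : Player) (h : History) : ℝ :=
  (1 - E.δ) * ∑' k : ℕ, E.δ ^ k * E.ahead ψ σ i k h

/-- The payoff of player `i` from the period that starts at `h` on, when the state of that period
is `θ`, its public record is `r`, and `σ` is played from the next period on. -/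
noncomputable def total (i : Player) (h : History) (θ : ℝ) (r : Record) : ℝ :=
  (1 - E.δ) * E.stage i θ r + E.δ * E.value ψ σ i (h ++ [r])

/-- Measurability in the state of what a state-dependent record `r` of the period that starts at
`h` gives rise to. -/
def MeasurableOutcome (κ : Measure ℝ) (h : History) (r : ℝ → Record) : Prop :=
  AEMeasurable (fun θ => (r θ).dec) κ ∧ (∀ i, AEMeasurable (fun θ => (r θ).net i) κ) ∧
    ∀ i k, AEMeasurable (fun θ => E.ahead ψ σ i k (h ++ [r θ])) κ

/-- The measurability requirement on a profile, at all histories that extend `h₀`: reports are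
measurable in the state, and so are the decisions, transfers and expected future payoffs that
result.  (Histories carry no σ-algebra; only the dependence on the state matters.) -/
def MeasurableFrom (h₀ : History) : Prop :=
  ∀ h, h₀ <+: h →
    E.MeasurableOutcome ψ σ E.prior h (σ.play h ψ) ∧
    ∀ θ₀ ∈ Icc (0 : ℝ) 1, ∀ p q : Transfer,
      (∀ y, MeasurableSet {θ | θ ∈ ψ.cell θ₀ ∧ σ.S.report h ⟨ψ.cell θ₀, p, q⟩ θ = y}) ∧
      E.MeasurableOutcome ψ σ (condLaw E.prior (ψ.cell θ₀)) h
        (σ.afterOpening h ⟨ψ.cell θ₀, p, q⟩)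

/-! ## Perfect Bayesian equilibrium -/

/-- Consistency of the receiver's beliefs `β h x` after a report.  They are always concentrated on
(the closure of) the set of states compatible with the public signal, and after a report that the
sender's strategy prescribes in some of these states they are given by Bayes' rule: concentrated
on the states that lead to this report, and a disintegration of the law given the signal. -/
def Consistent (β : History → Reported → Measure ℝ) : Prop :=
  ∀ h, ∀ θ₀ ∈ Icc (0 : ℝ) 1, ∀ x : Opening, x.signal = ψ.cell θ₀ →
    (∀ m p, β h ⟨x, m, p⟩ univ = 1 ∧ β h ⟨x, m, p⟩ (closure x.signal)ᶜ = 0) ∧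
    let b : ℝ → Measure ℝ := fun θ => β h ⟨x, (σ.S.report h x θ).1, (σ.S.report h x θ).2⟩
    (∀ θ ∈ x.signal, b θ {θ' | θ' ∈ x.signal ∧ σ.S.report h x θ' = σ.S.report h x θ}ᶜ = 0) ∧
    ∀ A, MeasurableSet A → AEMeasurable (fun θ => b θ A) (condLaw E.prior x.signal) ∧
      ∫⁻ θ, b θ A ∂condLaw E.prior x.signal = condLaw E.prior x.signal A

/-- At no point at which the sender moves does he gain by switching to another strategy. -/
def SenderRational : Prop :=
  ∀ h, ∀ S' : SenderStrategy, S'.Bounded → E.MeasurableFrom ψ ⟨S', σ.R⟩ h →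
    let σ' : Profile := ⟨S', σ.R⟩
    ∀ θ₀ ∈ Icc (0 : ℝ) 1,
      (∫ θ, E.total ψ σ' .sender h θ (σ'.afterSignal h (ψ.cell θ₀) θ)
            ∂condLaw E.prior (ψ.cell θ₀) ≤
          ∫ θ, E.total ψ σ .sender h θ (σ.afterSignal h (ψ.cell θ₀) θ)
            ∂condLaw E.prior (ψ.cell θ₀)) ∧
      (∀ x : Opening, x.signal = ψ.cell θ₀ → ∀ θ ∈ x.signal,
        E.total ψ σ' .sender h θ (σ'.afterOpening h x θ) ≤
          E.total ψ σ .sender h θ (σ.afterOpening h x θ)) ∧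
      (∀ x : Decided, x.signal = ψ.cell θ₀ → ∀ θ ∈ x.signal,
        E.total ψ σ' .sender h θ (σ'.afterDecided h x) ≤
          E.total ψ σ .sender h θ (σ.afterDecided h x))

/-- At no point at which the receiver moves does she gain, given her beliefs, by switching to
another strategy. -/
def ReceiverRational (β : History → Reported → Measure ℝ) : Prop :=
  ∀ h, ∀ R' : ReceiverStrategy, R'.Bounded → E.MeasurableFrom ψ ⟨σ.S, R'⟩ h →
    let σ' : Profile := ⟨σ.S, R'⟩
    ∀ θ₀ ∈ Icc (0 : ℝ) 1,
      (∀ p : Transfer,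
        ∫ θ, E.total ψ σ' .receiver h θ (σ'.afterSenderExAnte h (ψ.cell θ₀) p θ)
            ∂condLaw E.prior (ψ.cell θ₀) ≤
          ∫ θ, E.total ψ σ .receiver h θ (σ.afterSenderExAnte h (ψ.cell θ₀) p θ)
            ∂condLaw E.prior (ψ.cell θ₀)) ∧
      (∀ x : Reported, x.signal = ψ.cell θ₀ →
        ∫ θ, E.total ψ σ' .receiver h θ (σ'.afterReported h x) ∂β h x ≤
          ∫ θ, E.total ψ σ .receiver h θ (σ.afterReported h x) ∂β h x) ∧
      (∀ x : Paid, x.signal = ψ.cell θ₀ →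
        ∫ θ, E.total ψ σ' .receiver h θ (σ'.afterPaid h x) ∂β h x.toReported ≤
          ∫ θ, E.total ψ σ .receiver h θ (σ.afterPaid h x) ∂β h x.toReported) ∧
      (∀ x : Settling, x.signal = ψ.cell θ₀ →
        ∫ θ, E.total ψ σ' .receiver h θ (σ'.afterSettling h x) ∂β h x.toReported ≤
          ∫ θ, E.total ψ σ .receiver h θ (σ.afterSettling h x) ∂β h x.toReported)

/-- The strategy profile `σ` with the beliefs `β` is a pure-strategy perfect Bayesian
equilibrium of the repeated game with public signal `ψ`. -/
structure IsEquilibrium (β : History → Reported → Measure ℝ) : Prop where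
  sender_bounded : σ.S.Bounded
  receiver_bounded : σ.R.Bounded
  measurable : E.MeasurableFrom ψ σ []
  consistent : E.Consistent ψ σ β
  sender_rational : E.SenderRational ψ σ
  receiver_rational : E.ReceiverRational ψ σ β

/-- The set `V` of equilibrium payoff pairs `(v_S, v_R)` under the public signal `ψ`. -/
def equilibriumPayoffs : Set (ℝ × ℝ) :=
  {v | ∃ σ β, E.IsEquilibrium ψ σ β ∧ v = (E.value ψ σ .sender [], E.value ψ σ .receiver [])}

/-! ## The sender's penal message and decision rules -/

/-- `u_i(d, m) = 𝔼[u_i(d, θ) | m]`. -/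
noncomputable def mean (i : Player) (d : ℝ) (m : Set ℝ) : ℝ := ∫ θ, E.u i d θ ∂condLaw E.prior m

/-- The receiver's temptation `w_R(d, m) = max_{d'} u_R(d', m) - u_R(d, m)`. -/
noncomputable def temptation (d : ℝ) (m : Set ℝ) : ℝ :=
  (⨆ d', E.mean .receiver d' m) - E.mean .receiver d m

/-- `m` lies below `m'`. -/
def Below (m m' : Set ℝ) : Prop := ∀ x ∈ m, ∀ y ∈ m', x < y

/-- A monotone message rule `msg` on a set `S` of states, a decision rule `dec`, and a
punishment state `pt`. -/
structure PenalRules (S : Set ℝ) where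
  msg : MonotoneRule S
  dec : Set ℝ → ℝ
  pt : ℝ

/-- The decision in state `θ`. -/
def PenalRules.outcome {S : Set ℝ} (r : PenalRules S) (θ : ℝ) : ℝ := r.dec (r.msg.cell θ)

/-- The constraints of the penal problem on `S` when the discounted surplus is `L`.  With
`{d | w_R(d, m) ≤ L} = [ρ₋(m), ρ₊(m)]` and `m^p` the message in the punishment state, the decision
is nondecreasing in the state, it is `ρ₋(m)` for messages `m > m^p`, `ρ₊(m)` for messages
`m < m^p`, and one of the two for `m = m^p`. -/
structure PenalFeasible (L : ℝ) {S : Set ℝ} (r : PenalRules S) : Prop where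
  pt_mem : r.pt ∈ S
  monotone : MonotoneOn r.outcome S
  above : ∀ θ ∈ S, Below (r.msg.cell r.pt) (r.msg.cell θ) →
    IsLeast {d | E.temptation d (r.msg.cell θ) ≤ L} (r.outcome θ)
  at_pt : IsLeast {d | E.temptation d (r.msg.cell r.pt) ≤ L} (r.outcome r.pt) ∨
    IsGreatest {d | E.temptation d (r.msg.cell r.pt) ≤ L} (r.outcome r.pt)
  below : ∀ θ ∈ S, Below (r.msg.cell θ) (r.msg.cell r.pt) →
    IsGreatest {d | E.temptation d (r.msg.cell θ) ≤ L} (r.outcome θ)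

/-- The objective of the penal problem on `S`:
`u_S(ρ(m^p), θ^p) + 𝔼[∫_{θ^p}^θ ∂u_S/∂θ (ρ(μ(x)), x) dx | S]`. -/
noncomputable def penalValue {S : Set ℝ} (r : PenalRules S) : ℝ :=
  E.u .sender (r.outcome r.pt) r.pt +
    ∫ θ, (∫ x in r.pt..θ, partialTheta (E.u .sender) (r.outcome x) x) ∂condLaw E.prior S

/-- `r` solves the penal problem on `S`: it minimizes the objective subject to the constraints. -/
def SolvesPenal (L : ℝ) {S : Set ℝ} (r : PenalRules S) : Prop :=
  E.PenalFeasible L r ∧ ∀ r' : PenalRules S, E.PenalFeasible L r' → E.penalValue r ≤ E.penalValue r'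

/-- The sender's penal decision outcome under `ψ` is nondecreasing in the state.

Here `vS`, `vR` are the worst equilibrium payoffs of the two players and `vbar` is the best joint
payoff; `L = δ/(1-δ) (vbar - vS - vR)` is the discounted surplus.  For each signal realization `s`,
`r s` are penal rules given that the set of states is (the closure of) `s`.  For closed
realizations the last clause says that the outcome, as a function of the state, is nondecreasing
on `[0,1]`; an endpoint which a realization lacks is treated as a limit of states in it. -/
def PenalOutcomeMonotone : Prop :=
  ∃ vS vR vbar : ℝ,
    IsGLB (Prod.fst '' E.equilibriumPayoffs ψ) vS ∧
    IsGLB (Prod.snd '' E.equilibriumPayoffs ψ) vR ∧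
    IsLUB ((fun v : ℝ × ℝ => v.1 + v.2) '' E.equilibriumPayoffs ψ) vbar ∧
    ∃ r : (s : Set ℝ) → PenalRules (closure s),
      (∀ θ ∈ Icc (0 : ℝ) 1,
        E.SolvesPenal (E.δ / (1 - E.δ) * (vbar - vS - vR)) (r (ψ.cell θ))) ∧
      ∀ θ ∈ Icc (0 : ℝ) 1, ∀ θ' ∈ Icc (0 : ℝ) 1, θ ≤ θ' →
        ∀ x ∈ closure (ψ.cell θ), ∀ y ∈ closure (ψ.cell θ'), x ≤ y →
          (r (ψ.cell θ)).outcome x ≤ (r (ψ.cell θ')).outcome y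

end Env

end RepeatedCommunication

/-! Let `vS`, `vR`, `vbar` be the extremal payoffs under `ψ` and `L` the discounted surplus that
they define. Necessary conditions for equilibria under `ψ` are matched with a family of equilibria
under `ψ'`.

Receiver's temptation. Adding the receiver's constraint at the decision to the sender's constraint
on ex-post transfers cancels all transfers between them. So in equilibrium no decision tempts the
receiver by more than `L` (`tol_of_equilibrium`), and this survives pooling of messages
(`poolable_of_equilibrium`).

Sender's floor. If the sender skips his ex-ante transfer, his payoff as a function of the state
still deters imitation, so decisions are monotone and the envelope formula holds. He can also report
without paying and then face some tolerable decision `d`. Start the envelope formula at the state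
where the decisions cross `d`. Lowering the decisions above that state and raising those below it,
within tolerance, can only lower the resulting value. What is left differs from penal rules only in
the middle decision. The value is concave in that decision, so it can be moved to an extreme one.
Hence the penal value bounds the expected rent from below (`exists_rent`,
`exists_penalRules_of_step`, `penalValue_le_rent`).

Receiver's floor. She can ignore reports, pay nothing and take her best decision given the signal
(`receiver_lower`).

Passage to the coarser signal. Within a realization of `ψ'` the sender can reveal by his report what
`ψ` would have revealed. Monotone tolerable decisions can be induced in this way by suitable
payments, and the rents can be made as small as any fitting reaction to unexpected reports allows
(`exists_mode`). The penal outcome is monotone across realizations of `ψ` by hypothesis, so under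
`ψ'` the sender can be held to the penal values of the realizations of `ψ` (`exists_penal_mode`).
The jointly best tolerable decisions are monotone automatically, by increasing differences, so no
joint payoff is lost either (`exists_mode_of_equilibrium`). Without reports the receiver is strictly
worse off under `ψ'` (`integral_babbleDec_lt`).

Construction. A `Scheme` plays a cooperative mode `K` on the path, a mode `P` for the current period
if the sender withholds his ex-ante transfer, and babbling `B` once the receiver has deviated. Only
the receiver's standing is carried over to later periods. First-period transfers and burned money
divide the surplus, so every payoff above the floors from `P` and `B` and weakly below the joint
payoff of `K` is an equilibrium payoff (`mem_equilibriumPayoffs`).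

Conclusion. The floors `pS`, `pR` of `P` and `B` satisfy `pS ≤ vS` and `pR < vR`. The strict gap
makes the surplus under `ψ'` at least `L` even when `vbar` is only approached, so all tolerances
needed are available under `ψ'`. Every payoff under `ψ` is thus one under `ψ'`, and `(pS, pR)` is a
new one because `pR < vR`. -/

namespace RepeatedCommunication

/-! ## The primitives -/

/-- The point of `[0,1]` closest to `θ`. -/
noncomputable def clampUnit (θ : ℝ) : ℝ := max 0 (min 1 θ)

lemma clampUnit_mem (θ : ℝ) : clampUnit θ ∈ Icc (0 : ℝ) 1 :=
  ⟨le_max_left _ _, max_le zero_le_one (min_le_left _ _)⟩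

lemma clampUnit_of_mem {θ : ℝ} (h : θ ∈ Icc (0 : ℝ) 1) : clampUnit θ = θ := by
  simp [clampUnit, h.1, h.2]

lemma continuous_clampUnit : Continuous clampUnit := by
  unfold clampUnit; fun_prop

namespace TwiceDifferentiable

variable {v : ℝ → ℝ → ℝ}

lemma hasDerivAt_partialD (hv : TwiceDifferentiable v) (d : ℝ) {θ : ℝ} (hθ : θ ∈ Icc (0 : ℝ) 1) :
    HasDerivAt (fun d' => v d' θ)
      (fderivWithin ℝ (Function.uncurry v) (univ ×ˢ Icc 0 1) (d, θ) (1, 0)) d := by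
  have h1 : HasFDerivWithinAt (Function.uncurry v)
      (fderivWithin ℝ (Function.uncurry v) (univ ×ˢ Icc 0 1) (d, θ)) (univ ×ˢ Icc 0 1) (d, θ) :=
    (hv.1 (d, θ) ⟨mem_univ _, hθ⟩).hasFDerivWithinAt
  have h2 : HasDerivWithinAt (fun d' : ℝ => (d', θ)) ((1 : ℝ), (0 : ℝ)) univ d :=
    ((hasDerivAt_id d).prodMk (hasDerivAt_const d θ)).hasDerivWithinAt
  have := h1.comp_hasDerivWithinAt d h2
    (by intro x _; exact ⟨mem_univ _, hθ⟩)
  simpa [Function.comp_def, hasDerivWithinAt_univ] using this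

lemma partialD_eq (hv : TwiceDifferentiable v) (d : ℝ) {θ : ℝ} (hθ : θ ∈ Icc (0 : ℝ) 1) :
    partialD v d θ = fderivWithin ℝ (Function.uncurry v) (univ ×ˢ Icc 0 1) (d, θ) (1, 0) :=
  (hv.hasDerivAt_partialD d hθ).deriv

lemma hasDerivWithinAt_partialTheta (hv : TwiceDifferentiable v) (d : ℝ) {θ : ℝ}
    (hθ : θ ∈ Icc (0 : ℝ) 1) :
    HasDerivWithinAt (fun θ' => v d θ')
      (fderivWithin ℝ (Function.uncurry v) (univ ×ˢ Icc 0 1) (d, θ) (0, 1)) (Icc 0 1) θ := by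
  have h1 : HasFDerivWithinAt (Function.uncurry v)
      (fderivWithin ℝ (Function.uncurry v) (univ ×ˢ Icc 0 1) (d, θ)) (univ ×ˢ Icc 0 1) (d, θ) :=
    (hv.1 (d, θ) ⟨mem_univ _, hθ⟩).hasFDerivWithinAt
  have h2 : HasDerivWithinAt (fun θ' : ℝ => (d, θ')) ((0 : ℝ), (1 : ℝ)) (Icc 0 1) θ :=
    ((hasDerivAt_const θ d).prodMk (hasDerivAt_id θ)).hasDerivWithinAt
  exact h1.comp_hasDerivWithinAt θ h2 (fun x hx => ⟨mem_univ _, hx⟩)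

lemma partialTheta_eq (hv : TwiceDifferentiable v) (d : ℝ) {θ : ℝ} (hθ : θ ∈ Icc (0 : ℝ) 1) :
    partialTheta v d θ = fderivWithin ℝ (Function.uncurry v) (univ ×ˢ Icc 0 1) (d, θ) (0, 1) :=
  (hv.hasDerivWithinAt_partialTheta d hθ).derivWithin
    (uniqueDiffOn_Icc zero_lt_one θ hθ)

/-- Composing the state with `clampUnit` turns continuity on `ℝ × [0,1]` into continuity on the
whole plane, as measurability and compactness arguments prefer. The clamp disappears wherever the
state lies in `[0,1]`. -/
lemma continuous_clamped (hv : TwiceDifferentiable v) :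
    Continuous fun p : ℝ × ℝ => v p.1 (clampUnit p.2) := by
  have h := hv.1.continuousOn
  have h2 : Continuous fun p : ℝ × ℝ => (p.1, clampUnit p.2) :=
    continuous_fst.prodMk (continuous_clampUnit.comp continuous_snd)
  exact h.comp_continuous h2 (fun p => ⟨mem_univ _, clampUnit_mem _⟩)

lemma continuous_partialTheta_clamped (hv : TwiceDifferentiable v) :
    Continuous fun p : ℝ × ℝ => partialTheta v p.1 (clampUnit p.2) := by
  have h := hv.2.continuousOn
  have h2 : Continuous fun p : ℝ × ℝ => (p.1, clampUnit p.2) :=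
    continuous_fst.prodMk (continuous_clampUnit.comp continuous_snd)
  have h3 := h.comp_continuous h2 (fun p => ⟨mem_univ _, clampUnit_mem _⟩)
  have h4 : Continuous fun p : ℝ × ℝ =>
      fderivWithin ℝ (Function.uncurry v) (univ ×ˢ Icc 0 1) (p.1, clampUnit p.2) (0, 1) :=
    h3.clm_apply continuous_const
  refine h4.congr fun p => ?_
  rw [hv.partialTheta_eq _ (clampUnit_mem _)]

lemma continuous_partialD_clamped (hv : TwiceDifferentiable v) :
    Continuous fun p : ℝ × ℝ => partialD v p.1 (clampUnit p.2) := by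
  have h := hv.2.continuousOn
  have h2 : Continuous fun p : ℝ × ℝ => (p.1, clampUnit p.2) :=
    continuous_fst.prodMk (continuous_clampUnit.comp continuous_snd)
  have h3 := h.comp_continuous h2 (fun p => ⟨mem_univ _, clampUnit_mem _⟩)
  have h4 : Continuous fun p : ℝ × ℝ =>
      fderivWithin ℝ (Function.uncurry v) (univ ×ˢ Icc 0 1) (p.1, clampUnit p.2) (1, 0) :=
    h3.clm_apply continuous_const
  refine h4.congr fun p => ?_
  rw [hv.partialD_eq _ (clampUnit_mem _)]

lemma hasDerivAt_second (hv : TwiceDifferentiable v) (d : ℝ) {θ : ℝ} (hθ : θ ∈ Icc (0 : ℝ) 1)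
    (w : ℝ × ℝ) :
    HasDerivAt
      (fun d' => fderivWithin ℝ (Function.uncurry v) (univ ×ˢ Icc 0 1) (d', θ) w)
      (fderivWithin ℝ (fderivWithin ℝ (Function.uncurry v) (univ ×ˢ Icc 0 1)) (univ ×ˢ Icc 0 1)
        (d, θ) (1, 0) w) d := by
  have h1 := (hv.2 (d, θ) ⟨mem_univ _, hθ⟩).hasFDerivWithinAt
  have h2 : HasDerivWithinAt (fun d' : ℝ => (d', θ)) ((1 : ℝ), (0 : ℝ)) univ d :=
    ((hasDerivAt_id d).prodMk (hasDerivAt_const d θ)).hasDerivWithinAt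
  have h3 := h1.comp_hasDerivWithinAt d h2
    (by intro x _; exact ⟨mem_univ _, hθ⟩)
  rw [hasDerivWithinAt_univ] at h3
  have := h3.clm_apply (hasDerivAt_const d w)
  simpa [Function.comp_def] using this

lemma hasDerivWithinAt_second (hv : TwiceDifferentiable v) (d : ℝ) {θ : ℝ}
    (hθ : θ ∈ Icc (0 : ℝ) 1) (w : ℝ × ℝ) :
    HasDerivWithinAt
      (fun θ' => fderivWithin ℝ (Function.uncurry v) (univ ×ˢ Icc 0 1) (d, θ') w)
      (fderivWithin ℝ (fderivWithin ℝ (Function.uncurry v) (univ ×ˢ Icc 0 1)) (univ ×ˢ Icc 0 1)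
        (d, θ) (0, 1) w) (Icc 0 1) θ := by
  have h1 := (hv.2 (d, θ) ⟨mem_univ _, hθ⟩).hasFDerivWithinAt
  have h2 : HasDerivWithinAt (fun θ' : ℝ => (d, θ')) ((0 : ℝ), (1 : ℝ)) (Icc 0 1) θ :=
    ((hasDerivAt_const θ d).prodMk (hasDerivAt_id θ)).hasDerivWithinAt
  have h3 := h1.comp_hasDerivWithinAt θ h2 (fun x hx => ⟨mem_univ _, hx⟩)
  have := h3.clm_apply (hasDerivWithinAt_const θ _ w)
  simpa [Function.comp_def] using this

/-- Continuity of the second derivative is not assumed. Differentiability of the derivative within a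
convex set with nonempty interior suffices for symmetry, also at the boundary states. -/
lemma second_symm (hv : TwiceDifferentiable v) (d : ℝ) {θ : ℝ} (hθ : θ ∈ Icc (0 : ℝ) 1)
    (w w' : ℝ × ℝ) :
    fderivWithin ℝ (fderivWithin ℝ (Function.uncurry v) (univ ×ˢ Icc 0 1)) (univ ×ˢ Icc 0 1)
        (d, θ) w w' =
      fderivWithin ℝ (fderivWithin ℝ (Function.uncurry v) (univ ×ˢ Icc 0 1)) (univ ×ˢ Icc 0 1)
        (d, θ) w' w := by
  have hconv : Convex ℝ ((univ : Set ℝ) ×ˢ Icc (0 : ℝ) 1) := convex_univ.prod (convex_Icc _ _)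
  have hne : (interior ((univ : Set ℝ) ×ˢ Icc (0 : ℝ) 1)).Nonempty := by
    rw [interior_prod_eq, interior_univ, interior_Icc]
    exact ⟨(0, 1 / 2), mem_univ _, by norm_num, by norm_num⟩
  refine hconv.second_derivative_within_at_symmetric (f := Function.uncurry v)
    (f' := fderivWithin ℝ (Function.uncurry v) (univ ×ˢ Icc 0 1)) hne (fun x hx => ?_)
    (x := (d, θ)) ⟨mem_univ _, hθ⟩ ?_ w w'
  · exact (hv.1 x (interior_subset hx)).hasFDerivWithinAt.hasFDerivAt
      (mem_interior_iff_mem_nhds.1 hx)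
  · exact (hv.2 (d, θ) ⟨mem_univ _, hθ⟩).hasFDerivWithinAt.mono interior_subset

end TwiceDifferentiable

/-! ### Concavity, sorting and bounds of the payoffs -/

namespace Env
namespace Standing

variable {E : Env} (hE : E.Standing)
include hE

lemma hasDerivAt_u (i : Player) (d : ℝ) {θ : ℝ} (hθ : θ ∈ Icc (0 : ℝ) 1) :
    HasDerivAt (fun d' => E.u i d' θ) (partialD (E.u i) d θ) d := by
  rw [(hE.twice_differentiable i).partialD_eq d hθ]
  exact (hE.twice_differentiable i).hasDerivAt_partialD d hθ

lemma continuous_u (i : Player) : Continuous fun p : ℝ × ℝ => E.u i p.1 (clampUnit p.2) :=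
  (hE.twice_differentiable i).continuous_clamped

lemma continuous_partialTheta (i : Player) :
    Continuous fun p : ℝ × ℝ => partialTheta (E.u i) p.1 (clampUnit p.2) :=
  (hE.twice_differentiable i).continuous_partialTheta_clamped

lemma continuous_u_left (i : Player) {θ : ℝ} (hθ : θ ∈ Icc (0 : ℝ) 1) :
    Continuous fun d => E.u i d θ := by
  have := (hE.continuous_u i).comp (continuous_id.prodMk (continuous_const (y := θ)))
  simpa [Function.comp_def, clampUnit_of_mem hθ] using this

lemma integral_partialTheta (i : Player) (d : ℝ) {θ θ' : ℝ} (hθ : θ ∈ Icc (0 : ℝ) 1)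
    (hθ' : θ' ∈ Icc (0 : ℝ) 1) :
    ∫ x in θ..θ', partialTheta (E.u i) d x = E.u i d θ' - E.u i d θ := by
  have hsub : uIcc θ θ' ⊆ Icc 0 1 := ordConnected_Icc.uIcc_subset hθ hθ'
  have hd : ∀ x ∈ Icc (0 : ℝ) 1, HasDerivWithinAt (fun θ' => E.u i d θ')
      (partialTheta (E.u i) d x) (Icc 0 1) x := fun x hx => by
    rw [(hE.twice_differentiable i).partialTheta_eq d hx]
    exact (hE.twice_differentiable i).hasDerivWithinAt_partialTheta d hx
  have hc : ContinuousOn (fun θ' => E.u i d θ') (uIcc θ θ') :=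
    fun x hx => (hd x (hsub hx)).continuousWithinAt.mono hsub
  refine MeasureTheory.integral_eq_of_hasDerivAt_off_countable (fun θ' => E.u i d θ') _
    countable_empty hc (fun x hx => ?_) ?_
  · have hx' : x ∈ Ioo (0 : ℝ) 1 := by
      have h1 := hx.1.1
      have h2 := hx.1.2
      exact ⟨lt_of_le_of_lt (le_min hθ.1 hθ'.1) h1, lt_of_lt_of_le h2 (max_le hθ.2 hθ'.2)⟩
    exact (hd x ⟨hx'.1.le, hx'.2.le⟩).hasDerivAt (Icc_mem_nhds hx'.1 hx'.2)
  · have h := (hE.continuous_partialTheta i).comp ((continuous_const (y := d)).prodMk continuous_id)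
    refine ContinuousOn.intervalIntegrable ?_
    refine h.continuousOn.congr fun x hx => ?_
    simp [clampUnit_of_mem (hsub hx)]

lemma strictMono_partialTheta (i : Player) {θ : ℝ} (hθ : θ ∈ Icc (0 : ℝ) 1) :
    StrictMono fun d => partialTheta (E.u i) d θ :=
  strictMono_of_deriv_pos fun d => hE.sorting i d θ hθ

/-- By sorting, `∂u/∂θ` increases strictly with the decision. Integrate this over `[θ, θ']`. -/
lemma increasing_differences (i : Player) {d d' θ θ' : ℝ} (hd : d < d') (hθ : θ ∈ Icc (0 : ℝ) 1)
    (hθ' : θ' ∈ Icc (0 : ℝ) 1) (h : θ < θ') :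
    E.u i d' θ - E.u i d θ < E.u i d' θ' - E.u i d θ' := by
  have hsub : Icc θ θ' ⊆ Icc 0 1 := ordConnected_Icc.out hθ hθ'
  have hc : ∀ d, ContinuousOn (fun x => partialTheta (E.u i) d x) (Icc θ θ') := fun d => by
    have h := (hE.continuous_partialTheta i).comp
      ((continuous_const (y := d)).prodMk continuous_id)
    refine h.continuousOn.congr fun x hx => ?_
    simp [clampUnit_of_mem (hsub hx)]
  have := intervalIntegral.integral_lt_integral_of_continuousOn_of_le_of_exists_lt h (hc d) (hc d')
    (fun x hx => (hE.strictMono_partialTheta i (hsub (Ioc_subset_Icc_self hx))).monotone hd.le)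
    ⟨θ, left_mem_Icc.2 h.le, hE.strictMono_partialTheta i hθ hd⟩
  rw [hE.integral_partialTheta i d hθ hθ', hE.integral_partialTheta i d' hθ hθ'] at this
  linarith

lemma increasing_differences_le (i : Player) {d d' θ θ' : ℝ} (hd : d ≤ d')
    (hθ : θ ∈ Icc (0 : ℝ) 1) (hθ' : θ' ∈ Icc (0 : ℝ) 1) (h : θ ≤ θ') :
    E.u i d' θ - E.u i d θ ≤ E.u i d' θ' - E.u i d θ' := by
  rcases hd.eq_or_lt with rfl | hd
  · simp
  rcases h.eq_or_lt with rfl | h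
  · simp
  exact (hE.increasing_differences i hd hθ hθ' h).le

lemma concaveOn_u (i : Player) {θ : ℝ} (hθ : θ ∈ Icc (0 : ℝ) 1) :
    ConcaveOn ℝ univ fun d => E.u i d θ := by
  refine Antitone.concaveOn_univ_of_deriv (fun d => (hE.hasDerivAt_u i d hθ).differentiableAt) ?_
  have heq : deriv (fun d => E.u i d θ) = fun d => partialD (E.u i) d θ := rfl
  rw [heq]
  refine antitone_of_deriv_nonpos (fun d => ?_) fun d => ?_
  · have := (hE.twice_differentiable i).hasDerivAt_second d hθ (1, 0)
    refine (this.congr_of_eventuallyEq (.of_forall fun d' => ?_)).differentiableAt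
    exact (hE.twice_differentiable i).partialD_eq d' hθ
  · cases i
    · exact hE.concave_sender d θ hθ
    · exact (hE.concave_receiver d θ hθ).le

lemma strictConcaveOn_receiver {θ : ℝ} (hθ : θ ∈ Icc (0 : ℝ) 1) :
    StrictConcaveOn ℝ univ fun d => E.u .receiver d θ := by
  refine StrictAnti.strictConcaveOn_univ_of_deriv (hE.continuous_u_left _ hθ) ?_
  have heq : deriv (fun d => E.u .receiver d θ) = fun d => partialD (E.u .receiver) d θ := rfl
  rw [heq]
  exact strictAnti_of_deriv_neg fun d => hE.concave_receiver d θ hθ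

/-- By `second_symm` the derivative of `∂u/∂d` in the state is the cross derivative whose sign
`sorting` gives. This serves the strict value of information, in `not_tol_of_below`. -/
lemma strictMonoOn_partialD (i : Player) (d : ℝ) :
    StrictMonoOn (fun θ => partialD (E.u i) d θ) (Icc 0 1) := by
  have h2 := hE.twice_differentiable i
  have hder : ∀ θ ∈ Icc (0 : ℝ) 1, HasDerivWithinAt (fun θ => partialD (E.u i) d θ)
      (deriv (fun d' => partialTheta (E.u i) d' θ) d) (Icc 0 1) θ := fun θ hθ => by
    have ha := h2.hasDerivWithinAt_second d hθ (1, 0)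
    have hb := h2.hasDerivAt_second d hθ (0, 1)
    have hc : deriv (fun d' => partialTheta (E.u i) d' θ) d = _ :=
      (hb.congr_of_eventuallyEq (.of_forall fun d' => h2.partialTheta_eq d' hθ)).deriv
    rw [hc, h2.second_symm d hθ]
    exact ha.congr (fun θ' hθ' => h2.partialD_eq d hθ') (h2.partialD_eq d hθ)
  refine strictMonoOn_of_deriv_pos (convex_Icc 0 1) (fun θ hθ => (hder θ hθ).continuousWithinAt)
    fun θ hθ => ?_
  rw [interior_Icc] at hθ
  have hθ' : θ ∈ Icc (0 : ℝ) 1 := ⟨hθ.1.le, hθ.2.le⟩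
  rw [((hder θ hθ').hasDerivAt (Icc_mem_nhds hθ.1 hθ.2)).deriv]
  exact hE.sorting i d θ hθ'

/-- The receiver's preferred decisions lie in a compact interval. -/
lemma exists_preferred : ∃ ρ : ℝ → ℝ, (∀ θ ∈ Icc (0 : ℝ) 1, ∀ d, E.u .receiver d θ ≤
    E.u .receiver (ρ θ) θ) ∧ MonotoneOn ρ (Icc 0 1) := by
  obtain ⟨ρ, hρ⟩ := hE.preferred_receiver
  have hmax : ∀ θ ∈ Icc (0 : ℝ) 1, ∀ d, E.u .receiver d θ ≤ E.u .receiver (ρ θ) θ := by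
    intro θ hθ d
    have h1 := hE.hasDerivAt_u .receiver (ρ θ) hθ
    rw [hρ θ hθ] at h1
    have h2 := (hE.concaveOn_u .receiver hθ)
    have : IsMaxOn (fun d => E.u .receiver d θ) univ (ρ θ) := by
      have hanti : StrictAnti fun d => partialD (E.u .receiver) d θ :=
        strictAnti_of_deriv_neg fun d => hE.concave_receiver d θ hθ
      have hc := hE.continuous_u_left .receiver hθ
      intro x _
      simp only [mem_ofPred_eq]
      rcases le_total x (ρ θ) with hx | hx
      · refine monotoneOn_of_deriv_nonneg (convex_Iic (ρ θ)) hc.continuousOn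
          (fun y _ => (hE.hasDerivAt_u .receiver y hθ).differentiableAt.differentiableWithinAt)
          (fun y hy => ?_) hx (mem_Iic.2 le_rfl) hx
        rw [interior_Iic] at hy
        rw [← hρ θ hθ]
        exact (hanti (mem_Iio.1 hy)).le
      · refine antitoneOn_of_deriv_nonpos (convex_Ici (ρ θ)) hc.continuousOn
          (fun y _ => (hE.hasDerivAt_u .receiver y hθ).differentiableAt.differentiableWithinAt)
          (fun y hy => ?_) (mem_Ici.2 le_rfl) hx hx
        rw [interior_Ici] at hy
        rw [← hρ θ hθ]
        exact (hanti (mem_Ioi.1 hy)).le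
    exact this (mem_univ d)
  refine ⟨ρ, hmax, fun θ hθ θ' hθ' h => ?_⟩
  by_contra hlt
  push Not at hlt
  rcases h.eq_or_lt with rfl | h
  · exact lt_irrefl _ hlt
  have h1 := hE.increasing_differences .receiver hlt hθ hθ' h
  have h2 := hmax θ hθ (ρ θ')
  have h3 := hmax θ' hθ' (ρ θ)
  linarith

lemma bounded_u (B : ℝ) : ∃ C, ∀ i d θ, |d| ≤ B → θ ∈ Icc (0 : ℝ) 1 → |E.u i d θ| ≤ C := by
  have h : ∀ i, ∃ C, ∀ p ∈ Icc (-B) B ×ˢ Icc (0 : ℝ) 1, ‖E.u i p.1 (clampUnit p.2)‖ ≤ C :=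
    fun i => (isCompact_Icc.prod isCompact_Icc).exists_bound_of_continuousOn
      (hE.continuous_u i).continuousOn
  choose C hC using h
  refine ⟨max (C .sender) (C .receiver), fun i d θ hd hθ => ?_⟩
  have := hC i (d, θ) ⟨abs_le.1 hd, hθ⟩
  simp only [clampUnit_of_mem hθ, Real.norm_eq_abs] at this
  cases i
  · exact this.trans (le_max_left _ _)
  · exact this.trans (le_max_right _ _)

lemma bounded_partialTheta (i : Player) (B : ℝ) :
    ∃ C, ∀ d θ, |d| ≤ B → θ ∈ Icc (0 : ℝ) 1 → |partialTheta (E.u i) d θ| ≤ C := by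
  obtain ⟨C, hC⟩ := (isCompact_Icc.prod isCompact_Icc).exists_bound_of_continuousOn
    (s := Icc (-B) B ×ˢ Icc (0 : ℝ) 1) (hE.continuous_partialTheta i).continuousOn
  refine ⟨C, fun d θ hd hθ => ?_⟩
  have := hC (d, θ) ⟨abs_le.1 hd, hθ⟩
  simpa only [clampUnit_of_mem hθ, Real.norm_eq_abs] using this

end Standing
end Env

/-! ## Convex sets of states and conditional laws -/

/-- A nonempty convex set of states. -/
structure IsCell (m : Set ℝ) : Prop where
  nonempty : m.Nonempty
  subset : m ⊆ Icc 0 1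
  ordConnected : m.OrdConnected

lemma IsCell.measurableSet {m : Set ℝ} (h : IsCell m) : MeasurableSet m :=
  h.ordConnected.measurableSet

lemma isCell_unit : IsCell (Icc 0 1) :=
  ⟨⟨0, by simp⟩, subset_rfl, ordConnected_Icc⟩

lemma IsCell.closure {m : Set ℝ} (h : IsCell m) : IsCell (closure m) :=
  ⟨h.nonempty.closure, closure_minimal h.subset isClosed_Icc,
    (convex_iff_ordConnected.2 h.ordConnected).closure.ordConnected⟩

lemma MonotoneRule.isCell {S : Set ℝ} (μ : MonotoneRule S) (hS : S ⊆ Icc 0 1) {θ : ℝ}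
    (hθ : θ ∈ S) : IsCell (μ.cell θ) :=
  ⟨⟨θ, μ.mem_cell θ hθ⟩, (μ.cell_subset θ hθ).trans hS, μ.ordConnected θ hθ⟩

lemma MonotoneRule.eq_or_disjoint {S : Set ℝ} (μ : MonotoneRule S) {θ θ' : ℝ} (hθ : θ ∈ S)
    (hθ' : θ' ∈ S) : μ.cell θ = μ.cell θ' ∨ Disjoint (μ.cell θ) (μ.cell θ') := by
  by_cases h : Disjoint (μ.cell θ) (μ.cell θ')
  · exact .inr h
  · obtain ⟨x, hx, hx'⟩ := Set.not_disjoint_iff.1 h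
    exact .inl ((μ.cell_eq θ hθ x hx).symm.trans (μ.cell_eq θ' hθ' x hx'))

/-- Two different realizations of a monotone rule are ordered. -/
lemma MonotoneRule.below_or {S : Set ℝ} (μ : MonotoneRule S) {θ θ' : ℝ} (hθ : θ ∈ S)
    (hθ' : θ' ∈ S) (hlt : θ < θ') (hne : μ.cell θ ≠ μ.cell θ') :
    Env.Below (μ.cell θ) (μ.cell θ') := by
  have hd := (μ.eq_or_disjoint hθ hθ').resolve_left hne
  intro x hx y hy
  by_contra hxy
  push Not at hxy
  have hx0 := μ.mem_cell θ hθ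
  have hy0 := μ.mem_cell θ' hθ'
  have o1 := μ.ordConnected θ hθ
  have o2 := μ.ordConnected θ' hθ'
  rcases le_total y θ with h | h
  · exact Set.disjoint_left.1 hd hx0 (o2.out hy hy0 ⟨h, hlt.le⟩)
  · exact Set.disjoint_left.1 hd (o1.out hx0 hx ⟨h, hxy⟩) hy

/-! ### Laws conditional on convex sets, and averaging over monotone rules -/

namespace Env
namespace Standing

variable {E : Env} (hE : E.Standing)
include hE

lemma isProbabilityMeasure : IsProbabilityMeasure E.prior := ⟨hE.prior_univ⟩

lemma prior_compl : E.prior (Icc 0 1)ᶜ = 0 := by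
  refine withDensity_absolutelyContinuous _ _ ?_
  rw [Measure.restrict_apply measurableSet_Icc.compl]
  simp

lemma ae_mem : ∀ᵐ θ ∂E.prior, θ ∈ Icc (0 : ℝ) 1 := hE.prior_compl

lemma prior_singleton (θ : ℝ) : E.prior {θ} = 0 := by
  refine withDensity_absolutelyContinuous _ _ ?_
  refine le_antisymm ((Measure.restrict_apply_le _ _).trans ?_) (zero_le)
  simp

lemma noAtoms : NullSingletonClass E.prior := ⟨hE.prior_singleton⟩

lemma prior_Icc_pos {a b : ℝ} (ha : 0 ≤ a) (hab : a < b) (hb : b ≤ 1) :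
    0 < E.prior (Icc a b) := by
  rw [pos_iff_ne_zero]
  intro h
  have hm : Measurable fun θ => ENNReal.ofReal (E.f θ) := hE.measurable_f.ennreal_ofReal
  rw [Env.prior, withDensity_apply_eq_zero hm] at h
  have hsub : Icc a b ⊆ {x | ENNReal.ofReal (E.f x) ≠ 0} ∩ Icc a b := fun x hx =>
    ⟨by simpa using hE.f_pos x ⟨ha.trans hx.1, hx.2.trans hb⟩, hx⟩
  have h2 := measure_mono_null hsub h
  rw [Measure.restrict_apply measurableSet_Icc,
    inter_eq_left.2 (Icc_subset_Icc ha hb), Real.volume_Icc] at h2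
  simp only [ENNReal.ofReal_eq_zero] at h2
  linarith

/-- A convex set with two points contains an interval, which the positive density charges. So every
null realization is a point, and its conditional law is the point mass there. -/
lemma eq_singleton {m : Set ℝ} (hm : IsCell m) (h : E.prior m = 0) {θ : ℝ} (hθ : θ ∈ m) :
    m = {θ} := by
  refine Set.Subsingleton.eq_singleton_of_mem (fun x hx y hy => ?_) hθ
  have key : ∀ x ∈ m, ∀ y ∈ m, ¬ x < y := fun x hx y hy hlt =>
    (hE.prior_Icc_pos (hm.subset hx).1 hlt (hm.subset hy).2).ne'
      (measure_mono_null (hm.ordConnected.out hx hy) h)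
  exact le_antisymm (not_lt.1 (key y hy x hx)) (not_lt.1 (key x hx y hy))

lemma condLaw_singleton (θ : ℝ) : condLaw E.prior {θ} = Measure.dirac θ := by
  simp [condLaw, hE.prior_singleton]

omit hE in
lemma condLaw_of_pos {m : Set ℝ} (h : 0 < E.prior m) :
    condLaw E.prior m = (E.prior m)⁻¹ • E.prior.restrict m := by
  rw [condLaw, if_neg h.ne', ProbabilityTheory.cond]

lemma condLaw_unit : condLaw E.prior (Icc 0 1) = E.prior := by
  have h1 : E.prior (Icc 0 1) = 1 := by
    have := hE.isProbabilityMeasure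
    exact prob_compl_eq_zero_iff measurableSet_Icc |>.1 hE.prior_compl
  rw [condLaw_of_pos (by rw [h1]; exact one_pos), h1]
  simp only [inv_one, one_smul]
  exact Measure.restrict_eq_self_of_ae_mem hE.ae_mem

lemma isProbabilityMeasure_condLaw {m : Set ℝ} (hm : IsCell m) :
    IsProbabilityMeasure (condLaw E.prior m) := by
  have := hE.isProbabilityMeasure
  by_cases h : E.prior m = 0
  · rw [condLaw, if_pos h]; infer_instance
  · rw [condLaw, if_neg h]; exact ProbabilityTheory.cond_isProbabilityMeasure h

lemma condLaw_compl {m : Set ℝ} (hm : IsCell m) : condLaw E.prior m mᶜ = 0 := by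
  by_cases h : E.prior m = 0
  · obtain ⟨θ, hθ⟩ := hm.nonempty
    rw [hE.eq_singleton hm h hθ, hE.condLaw_singleton]
    simp
  · rw [condLaw_of_pos (pos_iff_ne_zero.2 h)]
    simp [hm.measurableSet.compl]

lemma ae_mem_condLaw {m : Set ℝ} (hm : IsCell m) : ∀ᵐ θ ∂condLaw E.prior m, θ ∈ m :=
  hE.condLaw_compl hm

omit hE in
lemma integral_condLaw {m : Set ℝ} (h : 0 < E.prior m) (f : ℝ → ℝ) :
    ∫ θ, f θ ∂condLaw E.prior m = (E.prior m).toReal⁻¹ * ∫ θ in m, f θ ∂E.prior := by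
  rw [condLaw_of_pos h, integral_smul_measure, ENNReal.toReal_inv, smul_eq_mul]

lemma toReal_pos {m : Set ℝ} (h : 0 < E.prior m) : 0 < (E.prior m).toReal := by
  have := hE.isProbabilityMeasure
  exact ENNReal.toReal_pos h.ne' (measure_ne_top _ _)

lemma setIntegral_eq {m : Set ℝ} (h : 0 < E.prior m) (f : ℝ → ℝ) :
    ∫ θ in m, f θ ∂E.prior = (E.prior m).toReal * ∫ θ, f θ ∂condLaw E.prior m := by
  rw [integral_condLaw h, mul_inv_cancel_left₀ (hE.toReal_pos h).ne']

lemma aemeasurable_condLaw_iff {m : Set ℝ} (h : 0 < E.prior m) {f : ℝ → ℝ} :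
    AEMeasurable f (condLaw E.prior m) ↔ AEMeasurable f (E.prior.restrict m) := by
  have := hE.isProbabilityMeasure
  rw [condLaw_of_pos h]
  exact aemeasurable_smul_measure_iff (ENNReal.inv_ne_zero.2 (measure_ne_top _ _))

lemma integrable_condLaw_iff {m : Set ℝ} (h : 0 < E.prior m) {f : ℝ → ℝ} :
    Integrable f (condLaw E.prior m) ↔ IntegrableOn f m E.prior := by
  have := hE.isProbabilityMeasure
  rw [condLaw_of_pos h]
  exact integrable_smul_measure (ENNReal.inv_ne_zero.2 (measure_ne_top _ _))
    (ENNReal.inv_ne_top.2 h.ne')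

lemma condLaw_congr {m m' : Set ℝ} (hm : IsCell m) (hm' : IsCell m') (hsub : m ⊆ m')
    (h : E.prior (m' \ m) = 0) : condLaw E.prior m = condLaw E.prior m' := by
  by_cases h0 : E.prior m' = 0
  · obtain ⟨θ, hθ⟩ := hm.nonempty
    rw [hE.eq_singleton hm' h0 (hsub hθ), hE.eq_singleton hm (measure_mono_null hsub h0) hθ]
  · have hae : m =ᵐ[E.prior] m' := by
      refine (ae_le_set.2 ?_).antisymm (ae_le_set.2 h)
      rw [sdiff_eq_empty.2 hsub]; simp
    have heq : E.prior m = E.prior m' := measure_congr hae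
    rw [condLaw_of_pos (pos_iff_ne_zero.2 h0), condLaw_of_pos (heq ▸ pos_iff_ne_zero.2 h0), heq, Measure.restrict_congr_set hae]

lemma condLaw_congr_finite {m m' : Set ℝ} (hm : IsCell m) (hm' : IsCell m') (hsub : m ⊆ m')
    (h : (m' \ m).Countable) : condLaw E.prior m = condLaw E.prior m' :=
  have := hE.noAtoms
  hE.condLaw_congr hm hm' hsub (h.measure_zero _)

omit hE in
-- A point of the closure strictly between infimum and supremum already lies in the convex set, so
-- at most two endpoints are added. Hence the penal problem, posed on `closure s`, concerns the law
-- given `s`.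
lemma closure_diff_finite {m : Set ℝ} (hm : IsCell m) : (closure m \ m).Countable := by
  have hbb : BddBelow m := ⟨0, fun x hx => (hm.subset hx).1⟩
  have hba : BddAbove m := ⟨1, fun x hx => (hm.subset hx).2⟩
  refine ((Set.finite_singleton (sInf m)).insert (sSup m)).countable.mono ?_
  rintro x ⟨hx, hxm⟩
  by_contra hne
  simp only [mem_insert_iff, mem_singleton_iff, not_or] at hne
  have h1 : sInf m ≤ x := closure_minimal (fun y hy => csInf_le hbb hy) isClosed_Ici hx
  have h2 : x ≤ sSup m := closure_minimal (fun y hy => le_csSup hba hy) isClosed_Iic hx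
  obtain ⟨y, hy, hyx⟩ := (csInf_lt_iff hbb hm.nonempty).1 (lt_of_le_of_ne h1 (Ne.symm hne.2))
  obtain ⟨z, hz, hxz⟩ := (lt_csSup_iff hba hm.nonempty).1 (lt_of_le_of_ne h2 hne.1)
  exact hxm (hm.ordConnected.out hy hz ⟨hyx.le, hxz.le⟩)

lemma condLaw_closure {m : Set ℝ} (hm : IsCell m) :
    condLaw E.prior (closure m) = condLaw E.prior m :=
  (hE.condLaw_congr_finite hm hm.closure subset_closure (closure_diff_finite hm)).symm

/-- The realizations of positive probability of a monotone rule. -/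
lemma exists_positive_cells {S : Set ℝ} (hS : S ⊆ Icc 0 1) (μ : MonotoneRule S) :
    ∃ (ι : Type) (_ : Countable ι) (A : ι → Set ℝ), Pairwise (Function.onFun Disjoint A) ∧
      (∀ i, ∃ θ ∈ S, A i = μ.cell θ) ∧ (∀ i, 0 < E.prior (A i)) ∧
      (∀ θ ∈ S, 0 < E.prior (μ.cell θ) → ∃ i, A i = μ.cell θ) := by
  have := hE.isProbabilityMeasure
  let ι := {c : Set ℝ // ∃ θ ∈ S, c = μ.cell θ}
  have hmeas : ∀ i : ι, MeasurableSet i.1 := by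
    rintro ⟨c, θ, hθ, rfl⟩
    exact (μ.isCell hS hθ).measurableSet
  have hdis : Pairwise (Function.onFun Disjoint fun i : ι => i.1) := by
    rintro ⟨c, θ, hθ, rfl⟩ ⟨c', θ', hθ', rfl⟩ hne
    exact (μ.eq_or_disjoint hθ hθ').resolve_left fun h => hne (Subtype.ext h)
  have hc := Measure.countable_meas_pos_of_disjoint_iUnion (μ := E.prior) hmeas hdis
  refine ⟨{i : ι // 0 < E.prior i.1}, hc.to_subtype, fun i => i.1.1, ?_, ?_, ?_, ?_⟩
  · intro i j hij
    exact hdis (fun h => hij (Subtype.ext h))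
  · intro i
    exact i.1.2
  · intro i
    exact i.2
  · intro θ hθ h
    exact ⟨⟨⟨μ.cell θ, θ, hθ, rfl⟩, h⟩, rfl⟩

/-- An integral over `S` is nonnegative if all conditional expectations given the realizations of
a monotone rule are; and it is then positive unless almost all of them vanish. -/
lemma setIntegral_nonneg_of_cells {S : Set ℝ} (hSc : IsCell S) (μ : MonotoneRule S)
    {f : ℝ → ℝ} (hf : IntegrableOn f S E.prior)
    (h : ∀ θ ∈ S, 0 ≤ ∫ x, f x ∂condLaw E.prior (μ.cell θ)) :
    0 ≤ ∫ x in S, f x ∂E.prior ∧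
      (0 < E.prior {θ | θ ∈ S ∧ 0 < ∫ x, f x ∂condLaw E.prior (μ.cell θ)} →
        0 < ∫ x in S, f x ∂E.prior) := by
  obtain ⟨ι, _, A, hdis, hA, hpos, hex⟩ := hE.exists_positive_cells hSc.subset μ
  set C := ⋃ i, A i with hC
  have hAm : ∀ i, MeasurableSet (A i) := fun i => by
    obtain ⟨θ, hθ, h⟩ := hA i
    rw [h]; exact (μ.isCell hSc.subset hθ).measurableSet
  have hAS : ∀ i, A i ⊆ S := fun i => by
    obtain ⟨θ, hθ, h⟩ := hA i
    rw [h]; exact μ.cell_subset θ hθ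
  have hCS : C ⊆ S := iUnion_subset hAS
  have hCm : MeasurableSet C := .iUnion hAm
  -- There may be uncountably many cells. Those of positive probability are countably many, and on
  -- the rest, `S \ C`, each cell is a point, where the conditional expectation is the value of `f`.
  have hsplit : ∫ x in S, f x ∂E.prior = ∫ x in S \ C, f x ∂E.prior + ∑' i, ∫ x in A i, f x ∂E.prior := by
    rw [← integral_iUnion hAm hdis (hf.mono_set hCS), ← hC,
      ← setIntegral_union disjoint_sdiff_left hCm (hf.mono_set sdiff_subset) (hf.mono_set hCS),
      sdiff_union_of_subset hCS]
  have hsum : Summable fun i => ∫ x in A i, f x ∂E.prior :=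
    (hasSum_integral_iUnion hAm hdis (hf.mono_set hCS)).summable
  have hAnn : ∀ i, 0 ≤ ∫ x in A i, f x ∂E.prior := fun i => by
    obtain ⟨θ, hθ, hi⟩ := hA i
    rw [hE.setIntegral_eq (hpos i), hi]
    exact mul_nonneg ENNReal.toReal_nonneg (h θ hθ)
  have hsing : ∀ θ ∈ S \ C, μ.cell θ = {θ} := fun θ hθ => by
    refine hE.eq_singleton (μ.isCell hSc.subset hθ.1) ?_ (μ.mem_cell θ hθ.1)
    by_contra h0
    obtain ⟨i, hi⟩ := hex θ hθ.1 (pos_iff_ne_zero.2 h0)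
    exact hθ.2 (mem_iUnion.2 ⟨i, hi ▸ μ.mem_cell θ hθ.1⟩)
  have hval : ∀ θ ∈ S \ C, ∫ x, f x ∂condLaw E.prior (μ.cell θ) = f θ := fun θ hθ => by
    rw [hsing θ hθ, hE.condLaw_singleton, integral_dirac]
  have hnn : ∀ θ ∈ S \ C, 0 ≤ f θ := fun θ hθ => by
    have := h θ hθ.1
    rwa [hval θ hθ] at this
  have hm2 : MeasurableSet (S \ C) := hSc.measurableSet.diff hCm
  have h1 : 0 ≤ ∫ x in S \ C, f x ∂E.prior := setIntegral_nonneg hm2 hnn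
  have h2 : 0 ≤ ∑' i, ∫ x in A i, f x ∂E.prior := tsum_nonneg hAnn
  refine ⟨by rw [hsplit]; exact add_nonneg h1 h2, fun hp => ?_⟩
  rw [hsplit]
  by_contra hle
  push Not at hle
  have e1 : ∫ x in S \ C, f x ∂E.prior = 0 := by linarith
  have e2 : ∑' i, ∫ x in A i, f x ∂E.prior = 0 := by linarith
  have e3 : ∀ i, ∫ x in A i, f x ∂E.prior = 0 := by
    have := (hasSum_zero_iff_of_nonneg hAnn).1 (e2 ▸ hsum.hasSum)
    exact fun i => congrFun this i
  have e4 := (setIntegral_eq_zero_iff_of_nonneg_ae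
    ((ae_restrict_iff' hm2).2 (.of_forall hnn)) (hf.mono_set sdiff_subset)).1 e1
  have e5 : E.prior ({x | ¬ f x = 0} ∩ (S \ C)) = 0 := by
    have := e4
    rw [Filter.EventuallyEq, ae_iff, Measure.restrict_apply₀' hm2.nullMeasurableSet] at this
    exact this
  refine hp.ne' (measure_mono_null ?_ e5)
  rintro θ ⟨hθ, hlt⟩
  have hθC : θ ∉ C := fun hc => by
    obtain ⟨i, hi⟩ := mem_iUnion.1 hc
    obtain ⟨θ', hθ', hi'⟩ := hA i
    rw [hi'] at hi
    have h3 := e3 i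
    rw [hE.setIntegral_eq (hpos i), hi', ← μ.cell_eq θ' hθ' θ hi] at h3
    have hp2 : 0 < E.prior (μ.cell θ) := by rw [μ.cell_eq θ' hθ' θ hi, ← hi']; exact hpos i
    rcases mul_eq_zero.1 h3 with h4 | h4
    · exact (hE.toReal_pos hp2).ne' h4
    · exact hlt.ne' h4
  rw [hval θ ⟨hθ, hθC⟩] at hlt
  exact ⟨hlt.ne', hθ, hθC⟩

lemma integrable_condLaw_cell {S : Set ℝ} (hSc : IsCell S) (μ : MonotoneRule S)
    {f : ℝ → ℝ} (hf : IntegrableOn f S E.prior) {θ : ℝ} (hθ : θ ∈ S) :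
    Integrable f (condLaw E.prior (μ.cell θ)) := by
  by_cases h : E.prior (μ.cell θ) = 0
  · rw [hE.eq_singleton (μ.isCell hSc.subset hθ) h (μ.mem_cell θ hθ), hE.condLaw_singleton]
    exact integrable_dirac (by simp)
  · exact (hE.integrable_condLaw_iff (pos_iff_ne_zero.2 h)).2 (hf.mono_set (μ.cell_subset θ hθ))

lemma setIntegral_le_of_cells {S : Set ℝ} (hSc : IsCell S) (μ : MonotoneRule S)
    {f g : ℝ → ℝ} (hf : IntegrableOn f S E.prior) (hg : IntegrableOn g S E.prior)
    (h : ∀ θ ∈ S, ∫ x, f x ∂condLaw E.prior (μ.cell θ) ≤ ∫ x, g x ∂condLaw E.prior (μ.cell θ)) :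
    ∫ x in S, f x ∂E.prior ≤ ∫ x in S, g x ∂E.prior := by
  have := (hE.setIntegral_nonneg_of_cells hSc μ (hg.sub hf) fun θ hθ => by
    have e := integral_sub (hE.integrable_condLaw_cell hSc μ hg hθ)
      (hE.integrable_condLaw_cell hSc μ hf hθ)
    simp only [Pi.sub_apply]
    rw [e]; linarith [h θ hθ]).1
  have e := integral_sub hg hf
  simp only [Pi.sub_apply] at this
  rw [e] at this
  linarith

/-- Conditional expectations given a convex set are monotone, cell by cell of a monotone rule. -/
lemma integral_condLaw_le_of_cells {S : Set ℝ} (hSc : IsCell S) (μ : MonotoneRule S)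
    {f g : ℝ → ℝ} (hf : Integrable f (condLaw E.prior S)) (hg : Integrable g (condLaw E.prior S))
    (h : ∀ θ ∈ S, ∫ x, f x ∂condLaw E.prior (μ.cell θ) ≤ ∫ x, g x ∂condLaw E.prior (μ.cell θ)) :
    ∫ x, f x ∂condLaw E.prior S ≤ ∫ x, g x ∂condLaw E.prior S := by
  by_cases h0 : E.prior S = 0
  · obtain ⟨θ, hθ⟩ := hSc.nonempty
    have e1 := hE.eq_singleton hSc h0 hθ
    have e2 : μ.cell θ = {θ} := subset_antisymm ((μ.cell_subset θ hθ).trans e1.subset)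
      (singleton_subset_iff.2 (μ.mem_cell θ hθ))
    have := h θ hθ
    rwa [e2, ← e1] at this
  · have hp := pos_iff_ne_zero.2 h0
    rw [integral_condLaw hp, integral_condLaw hp]
    have := hE.setIntegral_le_of_cells hSc μ ((hE.integrable_condLaw_iff hp).1 hf)
      ((hE.integrable_condLaw_iff hp).1 hg) h
    exact mul_le_mul_of_nonneg_left this (inv_nonneg.2 ENNReal.toReal_nonneg)

lemma integral_prior_le_of_cells (ψ : Signal)
    {f g : ℝ → ℝ} (hf : Integrable f E.prior) (hg : Integrable g E.prior)
    (h : ∀ θ ∈ Icc (0 : ℝ) 1,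
      ∫ x, f x ∂condLaw E.prior (ψ.cell θ) ≤ ∫ x, g x ∂condLaw E.prior (ψ.cell θ)) :
    ∫ x, f x ∂E.prior ≤ ∫ x, g x ∂E.prior := by
  have := hE.integral_condLaw_le_of_cells isCell_unit ψ (f := f) (g := g)
  rw [hE.condLaw_unit] at this
  exact this hf hg h

/-- A function that is constant on the realizations of positive probability and measurable on the
rest is measurable. -/
lemma aemeasurable_of_cells {S : Set ℝ} (hSc : IsCell S) (μ : MonotoneRule S) {G g : ℝ → ℝ}
    (hg : AEMeasurable g (E.prior.restrict S))
    (hconst : ∀ θ ∈ S, 0 < E.prior (μ.cell θ) → ∃ g' : ℝ → ℝ,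
      AEMeasurable g' (E.prior.restrict (μ.cell θ)) ∧ ∀ θ' ∈ μ.cell θ, G θ' = g' θ')
    (hsing : ∀ θ ∈ S, μ.cell θ = {θ} → G θ = g θ) : AEMeasurable G (E.prior.restrict S) := by
  obtain ⟨ι, _, A, hdis, hA, hpos, hex⟩ := hE.exists_positive_cells hSc.subset μ
  set C := ⋃ i, A i with hC
  have hAm : ∀ i, MeasurableSet (A i) := fun i => by
    obtain ⟨θ, hθ, h⟩ := hA i
    rw [h]; exact (μ.isCell hSc.subset hθ).measurableSet
  have hAS : ∀ i, A i ⊆ S := fun i => by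
    obtain ⟨θ, hθ, h⟩ := hA i
    rw [h]; exact μ.cell_subset θ hθ
  have hCS : C ⊆ S := iUnion_subset hAS
  have hCm : MeasurableSet C := .iUnion hAm
  rw [← sdiff_union_of_subset hCS, aemeasurable_union_iff]
  constructor
  · refine (hg.mono_set sdiff_subset).congr ?_
    refine (ae_restrict_iff' (hSc.measurableSet.diff hCm)).2 (.of_forall fun θ hθ => ?_)
    refine (hsing θ hθ.1 ?_).symm
    refine hE.eq_singleton (μ.isCell hSc.subset hθ.1) ?_ (μ.mem_cell θ hθ.1)
    by_contra h0
    obtain ⟨i, hi⟩ := hex θ hθ.1 (pos_iff_ne_zero.2 h0)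
    exact hθ.2 (mem_iUnion.2 ⟨i, hi ▸ μ.mem_cell θ hθ.1⟩)
  · rw [hC, aemeasurable_iUnion_iff]
    intro i
    obtain ⟨θ, hθ, hi⟩ := hA i
    obtain ⟨g', hg', he⟩ := hconst θ hθ (hi ▸ hpos i)
    rw [hi]
    refine hg'.congr ?_
    exact (ae_restrict_iff' (hi ▸ hAm i)).2 (.of_forall fun x hx => (he x hx).symm)

omit hE in
lemma integrable_of_bounded {κ : Measure ℝ} [IsFiniteMeasure κ] {f : ℝ → ℝ} {C : ℝ}
    (hf : AEMeasurable f κ) (hb : ∀ᵐ x ∂κ, |f x| ≤ C) : Integrable f κ :=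
  Integrable.of_bound hf.aestronglyMeasurable C hb

/-- Averaging over the realizations of a rule. -/
lemma aemeasurable_integral_cell {S : Set ℝ} (hSc : IsCell S) (μ : MonotoneRule S) {f : ℝ → ℝ}
    (hf : AEMeasurable f (E.prior.restrict S)) :
    AEMeasurable (fun θ => ∫ x, f x ∂condLaw E.prior (μ.cell θ)) (E.prior.restrict S) := by
  refine hE.aemeasurable_of_cells hSc μ hf (fun θ hθ _ => ?_) fun θ _ h => ?_
  · exact ⟨fun _ => ∫ x, f x ∂condLaw E.prior (μ.cell θ), aemeasurable_const, fun θ' hθ' => by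
      rw [μ.cell_eq θ hθ θ' hθ']⟩
  · simp only [h, hE.condLaw_singleton, integral_dirac]

lemma restrict_unit : E.prior.restrict (Icc 0 1) = E.prior :=
  Measure.restrict_eq_self_of_ae_mem hE.ae_mem

lemma aemeasurable_u {κ : Measure ℝ} (hκ : ∀ᵐ θ ∂κ, θ ∈ Icc (0 : ℝ) 1) (i : Player) {ρ : ℝ → ℝ}
    (hρ : AEMeasurable ρ κ) : AEMeasurable (fun θ => E.u i (ρ θ) θ) κ := by
  have h := (hE.continuous_u i).measurable.comp_aemeasurable (hρ.prodMk aemeasurable_id)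
  refine h.congr ?_
  filter_upwards [hκ] with θ hθ
  simp [clampUnit_of_mem hθ]

lemma ae_unit_condLaw {m : Set ℝ} (hm : IsCell m) :
    ∀ᵐ θ ∂condLaw E.prior m, θ ∈ Icc (0 : ℝ) 1 := by
  filter_upwards [hE.ae_mem_condLaw hm] with θ hθ using hm.subset hθ

lemma integrable_u {κ : Measure ℝ} [IsFiniteMeasure κ] (hκ : ∀ᵐ θ ∂κ, θ ∈ Icc (0 : ℝ) 1)
    (i : Player) {ρ : ℝ → ℝ} (hρ : AEMeasurable ρ κ) {B : ℝ} (hB : ∀ᵐ θ ∂κ, |ρ θ| ≤ B) :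
    Integrable (fun θ => E.u i (ρ θ) θ) κ := by
  obtain ⟨C, hC⟩ := hE.bounded_u B
  refine integrable_of_bounded (C := C) (hE.aemeasurable_u hκ i hρ) ?_
  filter_upwards [hκ, hB] with θ h1 h2 using hC i _ θ h2 h1

lemma integrable_u_const {κ : Measure ℝ} [IsFiniteMeasure κ] (hκ : ∀ᵐ θ ∂κ, θ ∈ Icc (0 : ℝ) 1)
    (i : Player) (d : ℝ) : Integrable (fun θ => E.u i d θ) κ :=
  hE.integrable_u hκ i (ρ := fun _ => d) aemeasurable_const (B := |d|) (.of_forall fun _ => le_rfl)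

/-- An integral is the average of the conditional integrals. -/
lemma integral_integral_cell (ψ : Signal) {f : ℝ → ℝ} (hf : AEMeasurable f E.prior) {C : ℝ}
    (hC : ∀ θ ∈ Icc (0 : ℝ) 1, |f θ| ≤ C) :
    Integrable (fun θ => ∫ x, f x ∂condLaw E.prior (ψ.cell θ)) E.prior ∧
    ∫ θ, ∫ x, f x ∂condLaw E.prior (ψ.cell θ) ∂E.prior = ∫ θ, f θ ∂E.prior := by
  have := hE.isProbabilityMeasure
  have hm : AEMeasurable (fun θ => ∫ x, f x ∂condLaw E.prior (ψ.cell θ)) E.prior := by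
    have := hE.aemeasurable_integral_cell isCell_unit ψ (f := f) (by rwa [hE.restrict_unit])
    rwa [hE.restrict_unit] at this
  have hi1 : Integrable f E.prior := by
    refine integrable_of_bounded (C := C) hf ?_
    filter_upwards [hE.ae_mem] with θ hθ using hC θ hθ
  have hi2 : Integrable (fun θ => ∫ x, f x ∂condLaw E.prior (ψ.cell θ)) E.prior := by
    refine integrable_of_bounded (C := C) hm ?_
    filter_upwards [hE.ae_mem] with θ hθ
    have hc := ψ.isCell subset_rfl hθ
    have := hE.isProbabilityMeasure_condLaw hc
    have h3 := norm_integral_le_of_norm_le_const (μ := condLaw E.prior (ψ.cell θ)) (f := f) (C := C)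
      (by filter_upwards [hE.ae_unit_condLaw hc] with x hx using hC x hx)
    simpa using h3
  have key : ∀ θ ∈ Icc (0 : ℝ) 1,
      ∫ y, ∫ x, f x ∂condLaw E.prior (ψ.cell y) ∂condLaw E.prior (ψ.cell θ) =
        ∫ x, f x ∂condLaw E.prior (ψ.cell θ) := fun θ hθ => by
    have hc := ψ.isCell subset_rfl hθ
    have := hE.isProbabilityMeasure_condLaw hc
    rw [integral_congr_ae (g := fun _ => ∫ x, f x ∂condLaw E.prior (ψ.cell θ))]
    · simp
    · filter_upwards [hE.ae_mem_condLaw hc] with y hy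
      rw [ψ.cell_eq θ hθ y hy]
  exact ⟨hi2, le_antisymm (hE.integral_prior_le_of_cells ψ hi2 hi1 fun θ hθ => (key θ hθ).le)
    (hE.integral_prior_le_of_cells ψ hi1 hi2 fun θ hθ => (key θ hθ).ge)⟩

end Standing
end Env

/-! ## Decisions that the receiver can be induced to take -/

lemma min_le_of_concave {f : ℝ → ℝ} (hf : ConcaveOn ℝ univ f) {a b c : ℝ} (hab : a ≤ b)
    (hbc : b ≤ c) : min (f a) (f c) ≤ f b :=
  hf.min_le_of_mem_Icc (mem_univ a) (mem_univ c) ⟨hab, hbc⟩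

namespace Env

variable (E : Env)

/-- With the belief `β` the receiver gains at most `L` by deviating from `d` to a lower decision. -/
def TolBelow (L : ℝ) (β : Measure ℝ) (d : ℝ) : Prop :=
  ∀ d' ≤ d, ∫ θ, E.u .receiver d' θ ∂β - ∫ θ, E.u .receiver d θ ∂β ≤ L

/-- With the belief `β` the receiver gains at most `L` by deviating from `d` to a higher decision. -/
def TolAbove (L : ℝ) (β : Measure ℝ) (d : ℝ) : Prop :=
  ∀ d', d ≤ d' → ∫ θ, E.u .receiver d' θ ∂β - ∫ θ, E.u .receiver d θ ∂β ≤ L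

/-- With the belief `β` the receiver gains at most `L` by deviating from `d`. -/
def Tol (L : ℝ) (β : Measure ℝ) (d : ℝ) : Prop :=
  ∀ d', ∫ θ, E.u .receiver d' θ ∂β - ∫ θ, E.u .receiver d θ ∂β ≤ L

/-- The smallest decision with temptation at most `L`. -/
noncomputable def lo (L : ℝ) (m : Set ℝ) : ℝ := sInf {d | E.temptation d m ≤ L}

/-- The largest decision with temptation at most `L`. -/
noncomputable def hi (L : ℝ) (m : Set ℝ) : ℝ := sSup {d | E.temptation d m ≤ L}

variable {E}

lemma tol_iff {L : ℝ} {β : Measure ℝ} {d : ℝ} :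
    E.Tol L β d ↔ E.TolBelow L β d ∧ E.TolAbove L β d :=
  ⟨fun h => ⟨fun d' _ => h d', fun d' _ => h d'⟩, fun h d' =>
    (le_total d' d).elim (h.1 d') (h.2 d')⟩

lemma Tol.mono {L L' : ℝ} {β : Measure ℝ} {d : ℝ} (h : E.Tol L β d) (hL : L ≤ L') :
    E.Tol L' β d := fun d' => (h d').trans hL

lemma Tol.nonneg {L : ℝ} {β : Measure ℝ} {d : ℝ} (h : E.Tol L β d) : 0 ≤ L := by
  simpa using h d

namespace Standing

variable (hE : E.Standing)
include hE

lemma concaveOn_integral {β : Measure ℝ} [IsFiniteMeasure β]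
    (hβ : ∀ᵐ θ ∂β, θ ∈ Icc (0 : ℝ) 1) (i : Player) :
    ConcaveOn ℝ univ fun d => ∫ θ, E.u i d θ ∂β := by
  refine ⟨convex_univ, fun x _ y _ a b ha hb hab => ?_⟩
  have hi := fun d => hE.integrable_u_const hβ i d
  simp only [smul_eq_mul]
  rw [← integral_const_mul, ← integral_const_mul, ← integral_add ((hi x).const_mul a)
    ((hi y).const_mul b)]
  refine integral_mono_ae (((hi x).const_mul a).add ((hi y).const_mul b)) (hi _) ?_
  filter_upwards [hβ] with θ hθ
  exact (hE.concaveOn_u i hθ).2 (mem_univ x) (mem_univ y) ha hb hab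

lemma continuous_integral {β : Measure ℝ} [IsFiniteMeasure β]
    (hβ : ∀ᵐ θ ∂β, θ ∈ Icc (0 : ℝ) 1) (i : Player) :
    Continuous fun d => ∫ θ, E.u i d θ ∂β :=
  continuousOn_univ.1 ((hE.concaveOn_integral hβ i).continuousOn isOpen_univ)

/-- Increasing differences, for ordered beliefs. -/
lemma integral_sub_mono {β β' : Measure ℝ} [IsProbabilityMeasure β] [IsProbabilityMeasure β']
    {S S' : Set ℝ} (hS : S ⊆ Icc 0 1) (hS' : S' ⊆ Icc 0 1) (hβ : ∀ᵐ θ ∂β, θ ∈ S)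
    (hβ' : ∀ᵐ θ ∂β', θ ∈ S') (hle : ∀ x ∈ S, ∀ y ∈ S', x ≤ y) (i : Player) {d d' : ℝ}
    (hd : d ≤ d') :
    ∫ θ, E.u i d' θ ∂β - ∫ θ, E.u i d θ ∂β ≤ ∫ θ, E.u i d' θ ∂β' - ∫ θ, E.u i d θ ∂β' := by
  have h1 : ∀ᵐ θ ∂β, θ ∈ Icc (0 : ℝ) 1 := hβ.mono fun x hx => hS hx
  have h2 : ∀ᵐ θ ∂β', θ ∈ Icc (0 : ℝ) 1 := hβ'.mono fun x hx => hS' hx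
  have hne : S.Nonempty := by
    obtain ⟨x, hx⟩ := hβ.exists
    exact ⟨x, hx⟩
  have hne' : S'.Nonempty := by
    obtain ⟨x, hx⟩ := hβ'.exists
    exact ⟨x, hx⟩
  -- The state `sSup S` separates the two supports. The payoff differences on both sides are
  -- compared with the difference at this state.
  have hbd : BddAbove S := ⟨1, fun x hx => (hS hx).2⟩
  have hz1 : ∀ x ∈ S, x ≤ sSup S := fun x hx => le_csSup hbd hx
  have hz2 : ∀ y ∈ S', sSup S ≤ y := fun y hy => csSup_le hne fun x hx => hle x hx y hy
  have hz : sSup S ∈ Icc (0 : ℝ) 1 := by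
    obtain ⟨x, hx⟩ := hne
    obtain ⟨y, hy⟩ := hne'
    exact ⟨(hS hx).1.trans (hz1 x hx), (hz2 y hy).trans (hS' hy).2⟩
  rw [← integral_sub (hE.integrable_u_const h1 i d') (hE.integrable_u_const h1 i d),
    ← integral_sub (hE.integrable_u_const h2 i d') (hE.integrable_u_const h2 i d)]
  have a1 : ∫ θ, (E.u i d' θ - E.u i d θ) ∂β ≤ E.u i d' (sSup S) - E.u i d (sSup S) := by
    have := integral_mono_ae (μ := β)
      ((hE.integrable_u_const h1 i d').sub (hE.integrable_u_const h1 i d))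
      (integrable_const (E.u i d' (sSup S) - E.u i d (sSup S))) (by
        filter_upwards [hβ] with θ hθ
        exact hE.increasing_differences_le i hd (hS hθ) hz (hz1 θ hθ))
    simpa using this
  have a2 : E.u i d' (sSup S) - E.u i d (sSup S) ≤ ∫ θ, (E.u i d' θ - E.u i d θ) ∂β' := by
    have := integral_mono_ae (μ := β')
      (integrable_const (E.u i d' (sSup S) - E.u i d (sSup S)))
      ((hE.integrable_u_const h2 i d').sub (hE.integrable_u_const h2 i d)) (by
        filter_upwards [hβ'] with θ hθ
        exact hE.increasing_differences_le i hd hz (hS' hθ) (hz2 θ hθ))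
    simpa using this
  exact a1.trans a2

/-- By increasing differences the gain from a lower decision shrinks as states rise. This is the
reason for one-sided tolerance: each side is monotone in the belief, while `Tol` is not. -/
lemma tolBelow_mono {β β' : Measure ℝ} [IsProbabilityMeasure β] [IsProbabilityMeasure β']
    {S S' : Set ℝ} (hS : S ⊆ Icc 0 1) (hS' : S' ⊆ Icc 0 1) (hβ : ∀ᵐ θ ∂β, θ ∈ S)
    (hβ' : ∀ᵐ θ ∂β', θ ∈ S') (hle : ∀ x ∈ S, ∀ y ∈ S', x ≤ y) {L d : ℝ}
    (h : E.TolBelow L β d) : E.TolBelow L β' d := fun d' hd' => by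
  have := hE.integral_sub_mono hS hS' hβ hβ' hle .receiver hd'
  linarith [h d' hd']

lemma tolAbove_anti {β β' : Measure ℝ} [IsProbabilityMeasure β] [IsProbabilityMeasure β']
    {S S' : Set ℝ} (hS : S ⊆ Icc 0 1) (hS' : S' ⊆ Icc 0 1) (hβ : ∀ᵐ θ ∂β, θ ∈ S)
    (hβ' : ∀ᵐ θ ∂β', θ ∈ S') (hle : ∀ x ∈ S, ∀ y ∈ S', x ≤ y) {L d : ℝ}
    (h : E.TolAbove L β' d) : E.TolAbove L β d := fun d' hd' => by
  have := hE.integral_sub_mono hS hS' hβ hβ' hle .receiver hd'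
  linarith [h d' hd']

/-- By concavity the payoff at `e` is at least the smaller of those at `d'` and `d`. In the first
case moving to `d'` gains nothing, in the second it gains no more than from `d`. -/
lemma tolBelow_of_le {β : Measure ℝ} [IsFiniteMeasure β]
    (hβ : ∀ᵐ θ ∂β, θ ∈ Icc (0 : ℝ) 1) {L d e : ℝ} (hL : 0 ≤ L) (h : E.TolBelow L β d)
    (he : e ≤ d) : E.TolBelow L β e := fun d' hd' => by
  have h1 := min_le_of_concave (hE.concaveOn_integral hβ .receiver) hd' he
  have h2 := h d' (hd'.trans he)
  rcases min_le_iff.1 h1 with h3 | h3 <;> linarith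

lemma tolAbove_of_ge {β : Measure ℝ} [IsFiniteMeasure β]
    (hβ : ∀ᵐ θ ∂β, θ ∈ Icc (0 : ℝ) 1) {L d e : ℝ} (hL : 0 ≤ L) (h : E.TolAbove L β d)
    (he : d ≤ e) : E.TolAbove L β e := fun d' hd' => by
  have h1 := min_le_of_concave (hE.concaveOn_integral hβ .receiver) he hd'
  have h2 := h d' (he.trans hd')
  rcases min_le_iff.1 h1 with h3 | h3 <;> linarith

/-- A concave function cannot exceed its value at `d` by more than `L ≥ 0` on both sides of `d`. -/
lemma tolBelow_or_tolAbove {β : Measure ℝ} [IsFiniteMeasure β]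
    (hβ : ∀ᵐ θ ∂β, θ ∈ Icc (0 : ℝ) 1) {L : ℝ} (hL : 0 ≤ L) (d : ℝ) :
    E.TolBelow L β d ∨ E.TolAbove L β d := by
  by_contra h
  simp only [not_or, TolBelow, TolAbove, not_forall, not_le] at h
  obtain ⟨⟨a, ha, h1⟩, c, hc, h2⟩ := h
  have h3 := min_le_of_concave (hE.concaveOn_integral hβ .receiver) ha hc
  rcases min_le_iff.1 h3 with h3 | h3 <;> linarith

/-- A decision that maximizes the receiver's expected payoff exists. -/
lemma exists_best {β : Measure ℝ} [IsFiniteMeasure β] (hβ : ∀ᵐ θ ∂β, θ ∈ Icc (0 : ℝ) 1) :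
    ∃ d, E.Tol 0 β d := by
  obtain ⟨ρ, hρ, hmono⟩ := hE.exists_preferred
  have hle : ρ 0 ≤ ρ 1 := hmono (by simp) (by simp) zero_le_one
  obtain ⟨d, hd, hmax⟩ := isCompact_Icc.exists_isMaxOn (nonempty_Icc.2 hle)
    (hE.continuous_integral hβ .receiver).continuousOn
  have hi := fun d => hE.integrable_u_const hβ .receiver d
  refine ⟨d, fun d' => ?_⟩
  rw [sub_nonpos]
  -- Outside `[ρ 0, ρ 1]` the payoff in every state is at most that at the nearer end, so a maximum
  -- over this compact interval is global.
  rcases lt_or_ge d' (ρ 0) with h | h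
  · refine le_trans ?_ (hmax (left_mem_Icc.2 hle))
    refine integral_mono_ae (hi _) (hi _) ?_
    filter_upwards [hβ] with θ hθ
    have h1 := min_le_of_concave (hE.concaveOn_u .receiver hθ) h.le
      (hmono (by simp) hθ hθ.1)
    rcases min_le_iff.1 h1 with h2 | h2
    · exact h2
    · exact (hρ θ hθ d').trans h2
  rcases lt_or_ge (ρ 1) d' with h' | h'
  · refine le_trans ?_ (hmax (right_mem_Icc.2 hle))
    refine integral_mono_ae (hi _) (hi _) ?_
    filter_upwards [hβ] with θ hθ
    have h1 := min_le_of_concave (hE.concaveOn_u .receiver hθ) (hmono hθ (by simp) hθ.2) h'.le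
    rcases min_le_iff.1 h1 with h2 | h2
    · exact (hρ θ hθ d').trans h2
    · exact h2
  · exact hmax ⟨h, h'⟩

lemma ae_dirac {θ : ℝ} {S : Set ℝ} (h : θ ∈ S) : ∀ᵐ x ∂Measure.dirac θ, x ∈ S := by
  rw [ae_dirac_eq]; exact h

/-- Decisions with bounded temptation are bounded, uniformly in the belief. -/
lemma exists_bound (L : ℝ) : ∃ B, 0 ≤ B ∧
    (∀ (β : Measure ℝ) [IsProbabilityMeasure β], (∀ᵐ θ ∂β, θ ∈ Icc (0 : ℝ) 1) → ∀ d,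
      E.TolBelow L β d → d ≤ B) ∧
    (∀ (β : Measure ℝ) [IsProbabilityMeasure β], (∀ᵐ θ ∂β, θ ∈ Icc (0 : ℝ) 1) → ∀ d,
      E.TolAbove L β d → -B ≤ d) := by
  obtain ⟨ρ, hρ, -⟩ := hE.exists_preferred
  have m1 : (1 : ℝ) ∈ Icc (0 : ℝ) 1 := by simp
  have m0 : (0 : ℝ) ∈ Icc (0 : ℝ) 1 := by simp
  have hmid : ∀ θ ∈ Icc (0 : ℝ) 1, ∀ t : ℝ, t ≠ 0 → E.u .receiver (ρ θ + t) θ <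
      E.u .receiver (ρ θ) θ := fun θ hθ t ht => by
    refine lt_of_le_of_ne (hρ θ hθ _) fun heq => ?_
    have := (hE.strictConcaveOn_receiver hθ).2 (mem_univ (ρ θ)) (mem_univ (ρ θ + t))
      (by simpa using ht) (show (0 : ℝ) < 1 / 2 by norm_num)
      (show (0 : ℝ) < 1 / 2 by norm_num) (by norm_num)
    have h2 := hρ θ hθ ((1 / 2 : ℝ) • ρ θ + (1 / 2 : ℝ) • (ρ θ + t))
    simp only [smul_eq_mul] at this h2
    rw [heq] at this
    linarith
  -- By concavity the loss at `ρ θ + s t` is at least `t` times the loss at `ρ θ + s`. With `s = ±1`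
  -- this makes losses grow at least linearly.
  have slope : ∀ θ ∈ Icc (0 : ℝ) 1, ∀ s : ℝ, s ≠ 0 → ∀ t : ℝ, 1 ≤ t →
      E.u .receiver (ρ θ + s * t) θ ≤ E.u .receiver (ρ θ) θ -
        t * (E.u .receiver (ρ θ) θ - E.u .receiver (ρ θ + s) θ) := fun θ hθ s hs t ht => by
    have ht0 : 0 < t := by linarith
    have := (hE.concaveOn_u .receiver hθ).2 (mem_univ (ρ θ)) (mem_univ (ρ θ + s * t))
      (show (0 : ℝ) ≤ 1 - 1 / t by rw [sub_nonneg, div_le_one ht0]; exact ht)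
      (show (0 : ℝ) ≤ 1 / t by positivity) (by ring)
    have e : (1 - 1 / t) • ρ θ + (1 / t) • (ρ θ + s * t) = ρ θ + s := by
      simp only [smul_eq_mul]; field_simp; ring
    rw [e] at this
    simp only [smul_eq_mul] at this
    have h2 := mul_le_mul_of_nonneg_left this ht0.le
    have e2 : t * ((1 - 1 / t) * E.u .receiver (ρ θ) θ + 1 / t * E.u .receiver (ρ θ + s * t) θ) =
      (t - 1) * E.u .receiver (ρ θ) θ + E.u .receiver (ρ θ + s * t) θ := by field_simp
    rw [e2] at h2
    linarith
  set c1 := E.u .receiver (ρ 1) 1 - E.u .receiver (ρ 1 + 1) 1 with hc1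
  have hc1p : 0 < c1 := by have := hmid 1 m1 1 one_ne_zero; linarith
  set c0 := E.u .receiver (ρ 0) 0 - E.u .receiver (ρ 0 + -1) 0 with hc0
  have hc0p : 0 < c0 := by have := hmid 0 m0 (-1) (by norm_num); linarith
  refine ⟨max (max (ρ 1 + max 1 (L / c1)) (-(ρ 0) + max 1 (L / c0))) 0, le_max_right _ _,
    fun β _ hβ d hd => ?_, fun β _ hβ d hd => ?_⟩
  · refine le_trans ?_ ((le_max_left _ _).trans (le_max_left _ _))
    -- Shifting the belief to the highest state only weakens the temptation to decide lower. This
    -- makes the bound independent of the belief; the lower bound uses state `0` in the same way.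
    have h1 : E.TolBelow L (Measure.dirac 1) d :=
      hE.tolBelow_mono (S' := {1}) subset_rfl (singleton_subset_iff.2 m1) hβ
        (hE.ae_dirac rfl) (fun x hx y hy => by rw [mem_singleton_iff.1 hy]; exact hx.2) hd
    rcases lt_or_ge d (ρ 1 + 1) with h | h
    · exact h.le.trans (by gcongr; exact le_max_left _ _)
    have h2 := h1 (ρ 1) (by linarith)
    have h3 := slope 1 m1 1 one_ne_zero (d - ρ 1) (by linarith)
    simp only [integral_dirac] at h2
    rw [show ρ 1 + 1 * (d - ρ 1) = d by ring, ← hc1] at h3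
    have : d - ρ 1 ≤ L / c1 := by rw [le_div_iff₀ hc1p]; linarith
    linarith [le_max_right 1 (L / c1)]
  · refine neg_le.1 (le_trans ?_ ((le_max_right _ _).trans (le_max_left _ _)))
    have h1 : E.TolAbove L (Measure.dirac 0) d :=
      hE.tolAbove_anti (S := {0}) (singleton_subset_iff.2 m0) subset_rfl
        (hE.ae_dirac rfl) hβ (fun x hx y hy => by rw [mem_singleton_iff.1 hx]; exact hy.1) hd
    rcases lt_or_ge (ρ 0 - 1) d with h | h
    · linarith [le_max_left 1 (L / c0)]
    have h2 := h1 (ρ 0) (by linarith)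
    have h3 := slope 0 m0 (-1) (by norm_num) (ρ 0 - d) (by linarith)
    simp only [integral_dirac] at h2
    rw [show ρ 0 + -1 * (ρ 0 - d) = d by ring, ← hc0] at h3
    have : ρ 0 - d ≤ L / c0 := by rw [le_div_iff₀ hc0p]; linarith
    linarith [le_max_right 1 (L / c0)]

lemma exists_abs_bound (L : ℝ) : ∃ B, 0 ≤ B ∧
    ∀ (β : Measure ℝ) [IsProbabilityMeasure β], (∀ᵐ θ ∂β, θ ∈ Icc (0 : ℝ) 1) → ∀ d,
      E.Tol L β d → |d| ≤ B := by
  obtain ⟨B, h0, h1, h2⟩ := hE.exists_bound L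
  exact ⟨B, h0, fun β _ hβ d hd =>
    abs_le.2 ⟨h2 β hβ d (tol_iff.1 hd).2, h1 β hβ d (tol_iff.1 hd).1⟩⟩

lemma isClosed_tol {β : Measure ℝ} [IsFiniteMeasure β] (hβ : ∀ᵐ θ ∂β, θ ∈ Icc (0 : ℝ) 1)
    (L : ℝ) : IsClosed {d | E.Tol L β d} := by
  simp only [Tol, ofPred_forall]
  exact isClosed_iInter fun d' => isClosed_le
    (continuous_const.sub (hE.continuous_integral hβ .receiver)) continuous_const

lemma isCompact_tol {β : Measure ℝ} [IsProbabilityMeasure β] (hβ : ∀ᵐ θ ∂β, θ ∈ Icc (0 : ℝ) 1)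
    (L : ℝ) : IsCompact {d | E.Tol L β d} := by
  obtain ⟨B, -, hB⟩ := hE.exists_abs_bound L
  exact (isCompact_Icc (a := -B) (b := B)).of_isClosed_subset (hE.isClosed_tol hβ L)
    fun d hd => abs_le.1 (hB β hβ d hd)

/-- A decision that can be induced with some belief on an interval can be induced with certainty
about the state. -/
lemma exists_tol_dirac {β : Measure ℝ} [IsProbabilityMeasure β] {S : Set ℝ} (hS : IsCell S)
    (hcl : IsClosed S) (hβ : ∀ᵐ θ ∂β, θ ∈ S) {L d : ℝ} (h : E.Tol L β d) :
    ∃ θ ∈ S, E.Tol L (Measure.dirac θ) d := by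
  have hL := h.nonneg
  have hcont : ∀ d', Continuous fun θ => E.u .receiver d' (clampUnit θ) := fun d' =>
    (hE.continuous_u .receiver).comp ((continuous_const (y := d')).prodMk continuous_id)
  let A : Set ℝ := {θ | ∀ d' ≤ d, E.u .receiver d' (clampUnit θ) - E.u .receiver d (clampUnit θ) ≤ L}
  let B : Set ℝ := {θ | ∀ d', d ≤ d' → E.u .receiver d' (clampUnit θ) - E.u .receiver d (clampUnit θ) ≤ L}
  have hA : IsClosed A := by
    simp only [A, ofPred_forall]
    exact isClosed_iInter fun d' => isClosed_iInter fun _ =>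
      isClosed_le ((hcont d').sub (hcont d)) continuous_const
  have hB : IsClosed B := by
    simp only [B, ofPred_forall]
    exact isClosed_iInter fun d' => isClosed_iInter fun _ =>
      isClosed_le ((hcont d').sub (hcont d)) continuous_const
  have hAi : ∀ θ ∈ S, θ ∈ A ↔ E.TolBelow L (Measure.dirac θ) d := fun θ hθ => by
    simp [A, TolBelow, clampUnit_of_mem (hS.subset hθ)]
  have hBi : ∀ θ ∈ S, θ ∈ B ↔ E.TolAbove L (Measure.dirac θ) d := fun θ hθ => by
    simp [B, TolAbove, clampUnit_of_mem (hS.subset hθ)]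
  have hcomp : IsCompact S := isCompact_Icc.of_isClosed_subset hcl hS.subset
  obtain ⟨a, ha⟩ := hcomp.exists_isLeast hS.nonempty
  obtain ⟨b, hb⟩ := hcomp.exists_isGreatest hS.nonempty
  have hpre : IsPreconnected S := hS.ordConnected.isPreconnected
  -- The closed sets `A` and `B` cover `S` by concavity. The highest state lies in `A` and the
  -- lowest in `B`, by monotonicity in the belief, so connectedness gives a state in both.
  obtain ⟨θ, hθ, h1, h2⟩ := isPreconnected_closed_iff.1 hpre A B hA hB (fun θ hθ => by
      rw [mem_union, hAi θ hθ, hBi θ hθ]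
      exact hE.tolBelow_or_tolAbove (hE.ae_dirac (hS.subset hθ)) hL d)
    ⟨b, hb.1, (hAi b hb.1).2 (hE.tolBelow_mono (S' := {b}) hS.subset
      (singleton_subset_iff.2 (hS.subset hb.1)) hβ (hE.ae_dirac rfl)
      (fun x hx y hy => by rw [mem_singleton_iff.1 hy]; exact hb.2 hx) (tol_iff.1 h).1)⟩
    ⟨a, ha.1, (hBi a ha.1).2 (hE.tolAbove_anti (S := {a})
      (singleton_subset_iff.2 (hS.subset ha.1)) hS.subset (hE.ae_dirac rfl) hβ
      (fun x hx y hy => by rw [mem_singleton_iff.1 hx]; exact ha.2 hy) (tol_iff.1 h).2)⟩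
  exact ⟨θ, hθ, tol_iff.2 ⟨(hAi θ hθ).1 h1, (hBi θ hθ).1 h2⟩⟩

/-! ### The interval of tolerable decisions given a realization -/

section Cell

variable {m : Set ℝ} (hm : IsCell m)
include hm

lemma temptation_le_iff {L d : ℝ} : E.temptation d m ≤ L ↔ E.Tol L (condLaw E.prior m) d := by
  have := hE.isProbabilityMeasure_condLaw hm
  obtain ⟨d0, h0⟩ := hE.exists_best (hE.ae_unit_condLaw hm)
  have hbdd : BddAbove (range fun d' => E.mean .receiver d' m) := by
    refine ⟨E.mean .receiver d0 m, ?_⟩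
    rintro _ ⟨d', rfl⟩
    exact sub_nonpos.1 (h0 d')
  constructor
  · intro h d'
    have := le_ciSup hbdd d'
    simp only [temptation] at h
    change E.mean .receiver d' m - E.mean .receiver d m ≤ L
    linarith
  · intro h
    rw [temptation, sub_le_iff_le_add]
    exact ciSup_le fun d' => sub_le_iff_le_add.1 (h d')

lemma setOf_temptation (L : ℝ) :
    {d | E.temptation d m ≤ L} = {d | E.Tol L (condLaw E.prior m) d} := by
  ext d; exact hE.temptation_le_iff hm

lemma isLeast_lo {L : ℝ} (hL : 0 ≤ L) : IsLeast {d | E.temptation d m ≤ L} (E.lo L m) := by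
  have := hE.isProbabilityMeasure_condLaw hm
  rw [lo, hE.setOf_temptation hm]
  obtain ⟨d0, h0⟩ := hE.exists_best (hE.ae_unit_condLaw hm)
  exact (hE.isCompact_tol (hE.ae_unit_condLaw hm) L).isLeast_sInf ⟨d0, h0.mono hL⟩

lemma isGreatest_hi {L : ℝ} (hL : 0 ≤ L) : IsGreatest {d | E.temptation d m ≤ L} (E.hi L m) := by
  have := hE.isProbabilityMeasure_condLaw hm
  rw [hi, hE.setOf_temptation hm]
  obtain ⟨d0, h0⟩ := hE.exists_best (hE.ae_unit_condLaw hm)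
  exact (hE.isCompact_tol (hE.ae_unit_condLaw hm) L).isGreatest_sSup ⟨d0, h0.mono hL⟩

lemma tol_lo {L : ℝ} (hL : 0 ≤ L) : E.Tol L (condLaw E.prior m) (E.lo L m) :=
  (hE.temptation_le_iff hm).1 (hE.isLeast_lo hm hL).1

lemma tol_hi {L : ℝ} (hL : 0 ≤ L) : E.Tol L (condLaw E.prior m) (E.hi L m) :=
  (hE.temptation_le_iff hm).1 (hE.isGreatest_hi hm hL).1

/-- Above a best decision upward deviations never tempt by more than `L`, so only downward ones
limit `d`. Below a best decision, which itself is at most `hi`, both sides hold. -/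
lemma tolBelow_iff_le_hi {L : ℝ} (hL : 0 ≤ L) {d : ℝ} :
    E.TolBelow L (condLaw E.prior m) d ↔ d ≤ E.hi L m := by
  have := hE.isProbabilityMeasure_condLaw hm
  have hβ := hE.ae_unit_condLaw hm
  constructor
  · intro h
    obtain ⟨d0, h0⟩ := hE.exists_best hβ
    have hd0 : d0 ≤ E.hi L m := (hE.isGreatest_hi hm hL).2
      ((hE.temptation_le_iff hm).2 (h0.mono hL))
    rcases le_total d d0 with hd | hd
    · exact hd.trans hd0
    · refine (hE.isGreatest_hi hm hL).2 ((hE.temptation_le_iff hm).2 (tol_iff.2 ⟨h, ?_⟩))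
      exact hE.tolAbove_of_ge hβ hL (tol_iff.1 (h0.mono hL)).2 hd
  · intro h
    exact hE.tolBelow_of_le hβ hL (tol_iff.1 (hE.tol_hi hm hL)).1 h

lemma tolAbove_iff_lo_le {L : ℝ} (hL : 0 ≤ L) {d : ℝ} :
    E.TolAbove L (condLaw E.prior m) d ↔ E.lo L m ≤ d := by
  have := hE.isProbabilityMeasure_condLaw hm
  have hβ := hE.ae_unit_condLaw hm
  constructor
  · intro h
    obtain ⟨d0, h0⟩ := hE.exists_best hβ
    have hd0 : E.lo L m ≤ d0 := (hE.isLeast_lo hm hL).2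
      ((hE.temptation_le_iff hm).2 (h0.mono hL))
    rcases le_total d d0 with hd | hd
    · refine (hE.isLeast_lo hm hL).2 ((hE.temptation_le_iff hm).2 (tol_iff.2 ⟨?_, h⟩))
      exact hE.tolBelow_of_le hβ hL (tol_iff.1 (h0.mono hL)).1 hd
    · exact hd0.trans hd
  · intro h
    exact hE.tolAbove_of_ge hβ hL (tol_iff.1 (hE.tol_lo hm hL)).2 h

lemma tol_condLaw_iff {L : ℝ} (hL : 0 ≤ L) {d : ℝ} :
    E.Tol L (condLaw E.prior m) d ↔ E.lo L m ≤ d ∧ d ≤ E.hi L m := by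
  rw [tol_iff, hE.tolBelow_iff_le_hi hm hL, hE.tolAbove_iff_lo_le hm hL, and_comm]

lemma hi_mono {m' : Set ℝ} (hm' : IsCell m') (hle : ∀ x ∈ m, ∀ y ∈ m', x ≤ y) {L : ℝ}
    (hL : 0 ≤ L) : E.hi L m ≤ E.hi L m' := by
  have := hE.isProbabilityMeasure_condLaw hm
  have := hE.isProbabilityMeasure_condLaw hm'
  rw [← hE.tolBelow_iff_le_hi hm' hL]
  exact hE.tolBelow_mono hm.subset hm'.subset (hE.ae_mem_condLaw hm) (hE.ae_mem_condLaw hm') hle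
    ((hE.tolBelow_iff_le_hi hm hL).2 le_rfl)

lemma lo_mono {m' : Set ℝ} (hm' : IsCell m') (hle : ∀ x ∈ m, ∀ y ∈ m', x ≤ y) {L : ℝ}
    (hL : 0 ≤ L) : E.lo L m ≤ E.lo L m' := by
  have := hE.isProbabilityMeasure_condLaw hm
  have := hE.isProbabilityMeasure_condLaw hm'
  rw [← hE.tolAbove_iff_lo_le hm hL]
  exact hE.tolAbove_anti hm.subset hm'.subset (hE.ae_mem_condLaw hm) (hE.ae_mem_condLaw hm') hle
    ((hE.tolAbove_iff_lo_le hm' hL).2 le_rfl)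

/-- The gain from a fixed deviation given `m` is the average of the gains given the cells. This is
what allows messages with a common tolerable decision to be merged. -/
lemma tolBelow_of_cells (μ : MonotoneRule m) {L d : ℝ}
    (h : ∀ θ ∈ m, E.TolBelow L (condLaw E.prior (μ.cell θ)) d) :
    E.TolBelow L (condLaw E.prior m) d := fun d' hd' => by
  have := hE.isProbabilityMeasure_condLaw hm
  have hi := fun d => hE.integrable_u_const (hE.ae_unit_condLaw hm) .receiver d
  rw [← integral_sub (hi d') (hi d)]
  have := hE.integral_condLaw_le_of_cells hm μ (f := fun θ => E.u .receiver d' θ - E.u .receiver d θ)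
    (g := fun _ => L) ((hi d').sub (hi d)) (integrable_const _) fun θ hθ => by
      have hc := μ.isCell hm.subset hθ
      have := hE.isProbabilityMeasure_condLaw hc
      have hi := fun d => hE.integrable_u_const (hE.ae_unit_condLaw hc) .receiver d
      rw [integral_sub (hi d') (hi d)]
      simpa using h θ hθ d' hd'
  simpa using this

lemma tolAbove_of_cells (μ : MonotoneRule m) {L d : ℝ}
    (h : ∀ θ ∈ m, E.TolAbove L (condLaw E.prior (μ.cell θ)) d) :
    E.TolAbove L (condLaw E.prior m) d := fun d' hd' => by
  have := hE.isProbabilityMeasure_condLaw hm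
  have hi := fun d => hE.integrable_u_const (hE.ae_unit_condLaw hm) .receiver d
  rw [← integral_sub (hi d') (hi d)]
  have := hE.integral_condLaw_le_of_cells hm μ (f := fun θ => E.u .receiver d' θ - E.u .receiver d θ)
    (g := fun _ => L) ((hi d').sub (hi d)) (integrable_const _) fun θ hθ => by
      have hc := μ.isCell hm.subset hθ
      have := hE.isProbabilityMeasure_condLaw hc
      have hi := fun d => hE.integrable_u_const (hE.ae_unit_condLaw hc) .receiver d
      rw [integral_sub (hi d') (hi d)]
      simpa using h θ hθ d' hd'
  simpa using this

lemma tol_of_cells (μ : MonotoneRule m) {L d : ℝ}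
    (h : ∀ θ ∈ m, E.Tol L (condLaw E.prior (μ.cell θ)) d) :
    E.Tol L (condLaw E.prior m) d :=
  tol_iff.2 ⟨hE.tolBelow_of_cells hm μ fun θ hθ => (tol_iff.1 (h θ hθ)).1,
    hE.tolAbove_of_cells hm μ fun θ hθ => (tol_iff.1 (h θ hθ)).2⟩

end Cell

end Standing
end Env

/-! ## Payoffs of bounded profiles -/

/-- The total amount of a transfer choice. -/
noncomputable def Transfer.size (p : Transfer) : ℝ := p.1 + p.2

lemma Transfer.size_nonneg (p : Transfer) : 0 ≤ Transfer.size p := by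
  unfold Transfer.size; positivity

lemma TransferLE.size_le {p : Transfer} {B : ℝ≥0} (h : TransferLE p B) :
    Transfer.size p ≤ 2 * B := by
  have h1 : (p.1 : ℝ) ≤ B := h.1
  have h2 : (p.2 : ℝ) ≤ B := h.2
  unfold Transfer.size; linarith

lemma abs_netTransfer_le (p q : Transfer) :
    |netTransfer p q| ≤ Transfer.size p + Transfer.size q := by
  have h1 := p.1.2
  have h2 := p.2.2
  have h3 := q.1.2
  have h4 := q.2.2
  simp only [netTransfer, Transfer.size]
  rw [abs_le]
  constructor <;> simp only [NNReal.val_eq_coe] at * <;> linarith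

namespace Profile

variable {σ : Profile}

lemma exists_bound_afterOpening (hS : σ.S.Bounded) (hR : σ.R.Bounded) :
    ∃ B, 0 ≤ B ∧ ∀ h x θ, |(σ.afterOpening h x θ).dec| ≤ B ∧ ∀ i,
      |(σ.afterOpening h x θ).net i| ≤ B + Transfer.size x.exS + Transfer.size x.exR := by
  obtain ⟨B1, -, hS2, hS3⟩ := hS
  obtain ⟨B2, -, hR2, hR3, hR4⟩ := hR
  refine ⟨B2 + 4 * B1 + 4 * B2, by positivity, fun h x θ => ⟨(hR3 _ _).trans ?_, fun i => ?_⟩⟩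
  · have := B1.2; have := B2.2
    simp only [NNReal.val_eq_coe] at *; linarith
  · set r := σ.afterOpening h x θ with hr
    have e1 : Transfer.size r.inS ≤ 2 * B1 := (hS2 h x θ).size_le
    have e2 : Transfer.size r.postS ≤ 2 * B1 := (hS3 h _).size_le
    have e3 : Transfer.size r.inR ≤ 2 * B2 := (hR2 h _).size_le
    have e4 : Transfer.size r.postR ≤ 2 * B2 := (hR4 h _).size_le
    have e5 : r.exS = x.exS := rfl
    have e6 : r.exR = x.exR := rfl
    have e7 := B2.2
    simp only [NNReal.val_eq_coe] at e7
    cases i <;> simp only [Record.net] <;> refine (abs_add_three _ _ _).trans ?_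
    · have a1 := abs_netTransfer_le r.exS r.exR
      have a2 := abs_netTransfer_le r.inS r.inR
      have a3 := abs_netTransfer_le r.postS r.postR
      rw [e5, e6] at *; linarith
    · have a1 := abs_netTransfer_le r.exR r.exS
      have a2 := abs_netTransfer_le r.inR r.inS
      have a3 := abs_netTransfer_le r.postR r.postS
      rw [e5, e6] at *; linarith

lemma exists_bound_afterSignal (hS : σ.S.Bounded) (hR : σ.R.Bounded) :
    ∃ B, 0 ≤ B ∧ ∀ h s θ, |(σ.afterSignal h s θ).dec| ≤ B ∧ ∀ i,
      |(σ.afterSignal h s θ).net i| ≤ B := by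
  obtain ⟨B, hB0, hB⟩ := exists_bound_afterOpening hS hR
  obtain ⟨B1, hS1, -⟩ := hS
  obtain ⟨B2, hR1, -⟩ := hR
  refine ⟨B + 2 * B1 + 2 * B2, by positivity, fun h s θ => ?_⟩
  have h1 := (hS1 h s).size_le
  have h2 := (hR1 h s (σ.S.exAnte h s)).size_le
  have e := hB h ⟨s, σ.S.exAnte h s, σ.R.exAnte h s (σ.S.exAnte h s)⟩ θ
  have p1 := B1.2
  have p2 := B2.2
  simp only [NNReal.val_eq_coe] at p1 p2
  exact ⟨e.1.trans (by linarith), fun i => (e.2 i).trans (by linarith)⟩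

end Profile

/-! ### Recursion for payoffs, and the contraction behind one-shot deviations -/

namespace Env
namespace Standing

variable {E : Env} (hE : E.Standing)
include hE

lemma exists_stage_bound (B : ℝ) : ∃ C, 0 ≤ C ∧ ∀ i θ (r : Record), θ ∈ Icc (0 : ℝ) 1 →
    |r.dec| ≤ B → |r.net i| ≤ B → |E.stage i θ r| ≤ C := by
  obtain ⟨C, hC⟩ := hE.bounded_u B
  refine ⟨|C + B|, abs_nonneg _, fun i θ r hθ h1 h2 => ?_⟩
  have := hC i r.dec θ h1 hθ
  exact (abs_sub _ _).trans ((add_le_add this h2).trans (le_abs_self _))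

lemma exists_ahead_bound (ψ : Signal) {σ : Profile} (hS : σ.S.Bounded) (hR : σ.R.Bounded) :
    ∃ C, 0 ≤ C ∧ ∀ i k h, |E.ahead ψ σ i k h| ≤ C := by
  have := hE.isProbabilityMeasure
  obtain ⟨B, -, hB⟩ := Profile.exists_bound_afterSignal hS hR
  obtain ⟨C, hC0, hC⟩ := hE.exists_stage_bound B
  refine ⟨C, hC0, fun i k => ?_⟩
  induction k with
  | zero =>
    intro h
    have := norm_integral_le_of_norm_le_const (μ := E.prior) (C := C)
      (f := fun θ => E.stage i θ (σ.play h ψ θ)) (by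
        filter_upwards [hE.ae_mem] with θ hθ
        exact hC i θ _ hθ (hB h _ θ).1 ((hB h _ θ).2 i))
    simpa [ahead] using this
  | succ k ih =>
    intro h
    have := norm_integral_le_of_norm_le_const (μ := E.prior) (C := C)
      (f := fun θ => E.ahead ψ σ i k (h ++ [σ.play h ψ θ])) (.of_forall fun θ => ih _)
    simpa [ahead] using this

lemma summable_ahead {ψ : Signal} {σ : Profile} {C : ℝ} {i : Player} {h : History}
    (hC : ∀ k, |E.ahead ψ σ i k h| ≤ C) : Summable fun k => E.δ ^ k * E.ahead ψ σ i k h := by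
  refine Summable.of_norm_bounded
    ((summable_geometric_of_lt_one hE.delta_nonneg hE.delta_lt_one).mul_right C) fun k => ?_
  rw [norm_mul, norm_pow, Real.norm_of_nonneg hE.delta_nonneg]
  exact mul_le_mul_of_nonneg_left (hC k) (pow_nonneg hE.delta_nonneg k)

lemma abs_value_le {ψ : Signal} {σ : Profile} {C : ℝ} {i : Player} {h : History}
    (hC : ∀ k, |E.ahead ψ σ i k h| ≤ C) : |E.value ψ σ i h| ≤ C := by
  have h1 : 0 < 1 - E.δ := sub_pos.2 hE.delta_lt_one
  rw [value, abs_mul, abs_of_pos h1]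
  have := tsum_of_norm_bounded (f := fun k => E.δ ^ k * E.ahead ψ σ i k h)
    ((hasSum_geometric_of_lt_one hE.delta_nonneg hE.delta_lt_one).mul_right C) fun k => by
      rw [norm_mul, norm_pow, Real.norm_of_nonneg hE.delta_nonneg]
      exact mul_le_mul_of_nonneg_left (hC k) (pow_nonneg hE.delta_nonneg k)
  rw [Real.norm_eq_abs] at this
  calc _ ≤ (1 - E.δ) * ((1 - E.δ)⁻¹ * C) := mul_le_mul_of_nonneg_left this h1.le
    _ = C := mul_inv_cancel_left₀ h1.ne' C

lemma exists_value_bound (ψ : Signal) {σ : Profile} (hS : σ.S.Bounded) (hR : σ.R.Bounded) :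
    ∃ C, 0 ≤ C ∧ ∀ i h, |E.value ψ σ i h| ≤ C := by
  obtain ⟨C, h0, hC⟩ := hE.exists_ahead_bound ψ hS hR
  exact ⟨C, h0, fun i h => hE.abs_value_le fun k => hC i k h⟩

section Measurable

variable {ψ : Signal} {σ : Profile} {κ : Measure ℝ} {h : History} {r : ℝ → Record}

lemma aemeasurable_stage (hκ : ∀ᵐ θ ∂κ, θ ∈ Icc (0 : ℝ) 1)
    (hr : E.MeasurableOutcome ψ σ κ h r) (i : Player) :
    AEMeasurable (fun θ => E.stage i θ (r θ)) κ :=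
  (hE.aemeasurable_u hκ i hr.1).sub (hr.2.1 i)

lemma aemeasurable_value (hS : σ.S.Bounded) (hR : σ.R.Bounded)
    (hr : E.MeasurableOutcome ψ σ κ h r) (i : Player) :
    AEMeasurable (fun θ => E.value ψ σ i (h ++ [r θ])) κ := by
  obtain ⟨C, h0, hC⟩ := hE.exists_ahead_bound ψ hS hR
  unfold value
  refine AEMeasurable.const_mul ?_ _
  refine aemeasurable_of_tendsto_metrizable_ae Filter.atTop
    (f := fun n θ => ∑ k ∈ Finset.range n, E.δ ^ k * E.ahead ψ σ i k (h ++ [r θ])) (fun n => ?_) ?_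
  · exact Finset.aemeasurable_fun_sum _ fun k _ => (hr.2.2 i k).const_mul _
  · exact .of_forall fun θ => (hE.summable_ahead fun k => hC i k _).hasSum.tendsto_sum_nat

lemma aemeasurable_total (hS : σ.S.Bounded) (hR : σ.R.Bounded)
    (hκ : ∀ᵐ θ ∂κ, θ ∈ Icc (0 : ℝ) 1)
    (hr : E.MeasurableOutcome ψ σ κ h r) (i : Player) :
    AEMeasurable (fun θ => E.total ψ σ i h θ (r θ)) κ :=
  ((hE.aemeasurable_stage hκ hr i).const_mul _).add
    ((hE.aemeasurable_value hS hR hr i).const_mul _)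

lemma integrable_total [IsFiniteMeasure κ] (hS : σ.S.Bounded) (hR : σ.R.Bounded)
    (hκ : ∀ᵐ θ ∂κ, θ ∈ Icc (0 : ℝ) 1)
    (hr : E.MeasurableOutcome ψ σ κ h r) {B : ℝ}
    (hB : ∀ᵐ θ ∂κ, |(r θ).dec| ≤ B ∧ ∀ i, |(r θ).net i| ≤ B) (i : Player) :
    Integrable (fun θ => E.total ψ σ i h θ (r θ)) κ := by
  obtain ⟨C, h0, hC⟩ := hE.exists_value_bound ψ hS hR
  obtain ⟨C', h0', hC'⟩ := hE.exists_stage_bound B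
  refine integrable_of_bounded (C := (1 - E.δ) * C' + E.δ * C)
    (hE.aemeasurable_total hS hR hκ hr i) ?_
  filter_upwards [hκ, hB] with θ hθ hb
  have h1 : 0 < 1 - E.δ := sub_pos.2 hE.delta_lt_one
  refine (abs_add_le _ _).trans (add_le_add ?_ ?_)
  · rw [abs_mul, abs_of_pos h1]
    exact mul_le_mul_of_nonneg_left (hC' i θ _ hθ hb.1 (hb.2 i)) h1.le
  · rw [abs_mul, abs_of_nonneg hE.delta_nonneg]
    exact mul_le_mul_of_nonneg_left (hC i _) hE.delta_nonneg

end Measurable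

/-- The recursive formula for payoffs. -/
lemma value_eq_integral {ψ : Signal} {σ : Profile} (hS : σ.S.Bounded) (hR : σ.R.Bounded)
    {h : History} (hm : E.MeasurableOutcome ψ σ E.prior h (σ.play h ψ)) (i : Player) :
    E.value ψ σ i h = ∫ θ, E.total ψ σ i h θ (σ.play h ψ θ) ∂E.prior := by
  have := hE.isProbabilityMeasure
  obtain ⟨C, h0, hC⟩ := hE.exists_ahead_bound ψ hS hR
  obtain ⟨Cv, h0v, hCv⟩ := hE.exists_value_bound ψ hS hR
  obtain ⟨B, -, hB⟩ := Profile.exists_bound_afterSignal hS hR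
  obtain ⟨C', hC0', hC'⟩ := hE.exists_stage_bound B
  have i1 : Integrable (fun θ => E.stage i θ (σ.play h ψ θ)) E.prior := by
    refine integrable_of_bounded (C := C') (hE.aemeasurable_stage hE.ae_mem hm i) ?_
    filter_upwards [hE.ae_mem] with θ hθ using hC' i θ _ hθ (hB h _ θ).1 ((hB h _ θ).2 i)
  have i2 : Integrable (fun θ => E.value ψ σ i (h ++ [σ.play h ψ θ])) E.prior :=
    integrable_of_bounded (C := Cv) (hE.aemeasurable_value hS hR hm i) (.of_forall fun θ => hCv i _)
  have hsum := hE.summable_ahead (fun k => hC i k h)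
  have e1 : ∫ θ, E.value ψ σ i (h ++ [σ.play h ψ θ]) ∂E.prior =
      (1 - E.δ) * ∑' k, E.δ ^ k * E.ahead ψ σ i (k + 1) h := by
    unfold value
    rw [integral_const_mul]
    congr 1
    rw [← integral_tsum_of_summable_integral_norm]
    · simp only [integral_const_mul]; rfl
    · intro k
      exact (integrable_of_bounded (C := C) (hm.2.2 i k) (.of_forall fun θ => hC i k _)).const_mul _
    · refine Summable.of_nonneg_of_le (fun k => by positivity) (fun k => ?_)
        ((summable_geometric_of_lt_one hE.delta_nonneg hE.delta_lt_one).mul_right C)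
      have : ∀ θ, ‖E.δ ^ k * E.ahead ψ σ i k (h ++ [σ.play h ψ θ])‖ ≤ E.δ ^ k * C := fun θ => by
        rw [norm_mul, norm_pow, Real.norm_of_nonneg hE.delta_nonneg]
        exact mul_le_mul_of_nonneg_left (hC i k _) (pow_nonneg hE.delta_nonneg k)
      calc _ ≤ ∫ θ, E.δ ^ k * C ∂E.prior :=
            integral_mono_of_nonneg (.of_forall fun θ => norm_nonneg _) (integrable_const _)
              (.of_forall this)
        _ = _ := by simp
  unfold total
  rw [integral_add (i1.const_mul _) (i2.const_mul _), integral_const_mul, integral_const_mul, e1,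
    value, hsum.tsum_eq_zero_add]
  simp only [pow_zero, one_mul, pow_succ']
  have : ∑' k, E.δ * E.δ ^ k * E.ahead ψ σ i (k + 1) h =
      E.δ * ∑' k, E.δ ^ k * E.ahead ψ σ i (k + 1) h := by
    rw [← tsum_mul_left]; congr 1; ext k; ring
  rw [this]
  simp only [ahead]
  ring

/-- If no deviation followed by at most a gain of `D` gains more than `δ D`, no deviation gains. -/
lemma value_le_of_contraction {ψ : Signal} {σ σ' : Profile} (hS : σ.S.Bounded)
    (hR : σ.R.Bounded) (hS' : σ'.S.Bounded) (hR' : σ'.R.Bounded) (i : Player) (h₀ : History)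
    (hstep : ∀ h, h₀ <+: h → ∀ D, 0 ≤ D →
      (∀ h', h₀ <+: h' → E.value ψ σ' i h' ≤ E.value ψ σ i h' + D) →
        E.value ψ σ' i h ≤ E.value ψ σ i h + E.δ * D) :
    ∀ h, h₀ <+: h → E.value ψ σ' i h ≤ E.value ψ σ i h := by
  obtain ⟨C, h0, hC⟩ := hE.exists_value_bound ψ hS hR
  obtain ⟨C', h0', hC'⟩ := hE.exists_value_bound ψ hS' hR'
  -- Payoffs are bounded by `C` and `C'`, so the gain is at most `C + C'` to begin with. Every
  -- application of `hstep` multiplies the bound by `δ`.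
  have key : ∀ n : ℕ, ∀ h, h₀ <+: h →
      E.value ψ σ' i h ≤ E.value ψ σ i h + E.δ ^ n * (C + C') := fun n => by
    induction n with
    | zero =>
      intro h _
      have a := abs_le.1 (hC i h)
      have b := abs_le.1 (hC' i h)
      simp only [pow_zero, one_mul]
      linarith
    | succ n ih =>
      intro h hh
      have := hstep h hh _ (mul_nonneg (pow_nonneg hE.delta_nonneg n) (add_nonneg h0 h0')) ih
      rwa [pow_succ', mul_assoc]
  intro h hh
  have ht : Filter.Tendsto (fun n : ℕ => E.value ψ σ i h + E.δ ^ n * (C + C')) Filter.atTop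
      (nhds (E.value ψ σ i h + 0 * (C + C'))) :=
    ((tendsto_pow_atTop_nhds_zero_of_lt_one hE.delta_nonneg hE.delta_lt_one).mul_const _).const_add _
  rw [zero_mul, add_zero] at ht
  exact ge_of_tendsto' ht fun n => key n h hh

end Standing
end Env

/-! ## Continuation play -/

/-- The strategy from the history `g` on. -/
def SenderStrategy.shift (S : SenderStrategy) (g : History) : SenderStrategy where
  exAnte h := S.exAnte (g ++ h)
  report h := S.report (g ++ h)
  exPost h := S.exPost (g ++ h)

/-- The strategy from the history `g` on. -/
def ReceiverStrategy.shift (R : ReceiverStrategy) (g : History) : ReceiverStrategy where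
  exAnte h := R.exAnte (g ++ h)
  interim h := R.interim (g ++ h)
  decide h := R.decide (g ++ h)
  exPost h := R.exPost (g ++ h)

/-- The continuation of a profile from the history `g` on. -/
def Profile.shift (σ : Profile) (g : History) : Profile := ⟨σ.S.shift g, σ.R.shift g⟩

open Classical in
/-- Follow `S`, but `S'` from the history `g` on. -/
noncomputable def SenderStrategy.graft (S : SenderStrategy) (g : History) (S' : SenderStrategy) :
    SenderStrategy where
  exAnte h := if g <+: h then S'.exAnte (h.drop g.length) else S.exAnte h
  report h := if g <+: h then S'.report (h.drop g.length) else S.report h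
  exPost h := if g <+: h then S'.exPost (h.drop g.length) else S.exPost h

open Classical in
/-- Follow `R`, but `R'` from the history `g` on. -/
noncomputable def ReceiverStrategy.graft (R : ReceiverStrategy) (g : History)
    (R' : ReceiverStrategy) : ReceiverStrategy where
  exAnte h := if g <+: h then R'.exAnte (h.drop g.length) else R.exAnte h
  interim h := if g <+: h then R'.interim (h.drop g.length) else R.interim h
  decide h := if g <+: h then R'.decide (h.drop g.length) else R.decide h
  exPost h := if g <+: h then R'.exPost (h.drop g.length) else R.exPost h

lemma SenderStrategy.shift_graft (S S' : SenderStrategy) (g : History) :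
    (S.graft g S').shift g = S' := by
  simp [shift, graft]

lemma ReceiverStrategy.shift_graft (R R' : ReceiverStrategy) (g : History) :
    (R.graft g R').shift g = R' := by
  simp [shift, graft]

lemma TransferLE.mono {p : Transfer} {B B' : ℝ≥0} (h : TransferLE p B) (hB : B ≤ B') :
    TransferLE p B' := ⟨h.1.trans hB, h.2.trans hB⟩

lemma SenderStrategy.Bounded.shift {S : SenderStrategy} (h : S.Bounded) (g : History) :
    (S.shift g).Bounded := by
  obtain ⟨B, h1, h2, h3⟩ := h
  exact ⟨B, fun h => h1 _, fun h => h2 _, fun h => h3 _⟩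

lemma ReceiverStrategy.Bounded.shift {R : ReceiverStrategy} (h : R.Bounded) (g : History) :
    (R.shift g).Bounded := by
  obtain ⟨B, h1, h2, h3, h4⟩ := h
  exact ⟨B, fun h => h1 _, fun h => h2 _, fun h => h3 _, fun h => h4 _⟩

lemma SenderStrategy.Bounded.graft {S S' : SenderStrategy} (h : S.Bounded) (h' : S'.Bounded)
    (g : History) : (S.graft g S').Bounded := by
  obtain ⟨B, h1, h2, h3⟩ := h
  obtain ⟨B', h1', h2', h3'⟩ := h'
  refine ⟨max B B', fun h s => ?_, fun h x θ => ?_, fun h x => ?_⟩ <;>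
    simp only [SenderStrategy.graft] <;> split_ifs
  · exact (h1' _ _).mono (le_max_right _ _)
  · exact (h1 _ _).mono (le_max_left _ _)
  · exact (h2' _ _ _).mono (le_max_right _ _)
  · exact (h2 _ _ _).mono (le_max_left _ _)
  · exact (h3' _ _).mono (le_max_right _ _)
  · exact (h3 _ _).mono (le_max_left _ _)

lemma ReceiverStrategy.Bounded.graft {R R' : ReceiverStrategy} (h : R.Bounded) (h' : R'.Bounded)
    (g : History) : (R.graft g R').Bounded := by
  obtain ⟨B, h1, h2, h3, h4⟩ := h
  obtain ⟨B', h1', h2', h3', h4'⟩ := h'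
  have e : (B : ℝ) ≤ (max B B' : ℝ≥0) := by exact_mod_cast le_max_left B B'
  have e' : (B' : ℝ) ≤ (max B B' : ℝ≥0) := by exact_mod_cast le_max_right B B'
  refine ⟨max B B', fun h s p => ?_, fun h x => ?_, fun h x => ?_, fun h x => ?_⟩ <;>
    simp only [ReceiverStrategy.graft] <;> split_ifs
  · exact (h1' _ _ _).mono (le_max_right _ _)
  · exact (h1 _ _ _).mono (le_max_left _ _)
  · exact (h2' _ _).mono (le_max_right _ _)
  · exact (h2 _ _).mono (le_max_left _ _)
  · exact (h3' _ _).trans e'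
  · exact (h3 _ _).trans e
  · exact (h4' _ _).mono (le_max_right _ _)
  · exact (h4 _ _).mono (le_max_left _ _)

namespace Env

variable {E : Env} {ψ : Signal}

lemma ahead_shift (σ : Profile) (g : History) (i : Player) (k : ℕ) (h : History) :
    E.ahead ψ (σ.shift g) i k h = E.ahead ψ σ i k (g ++ h) := by
  induction k generalizing h with
  | zero => rfl
  | succ k ih =>
    simp only [ahead, ih, ← List.append_assoc]
    rfl

lemma value_shift (σ : Profile) (g : History) (i : Player) (h : History) :
    E.value ψ (σ.shift g) i h = E.value ψ σ i (g ++ h) := by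
  simp only [value, ahead_shift]

lemma total_shift (σ : Profile) (g : History) (i : Player) (h : History) (θ : ℝ) (r : Record) :
    E.total ψ (σ.shift g) i h θ r = E.total ψ σ i (g ++ h) θ r := by
  simp only [total, value_shift, List.append_assoc]

lemma measurableOutcome_shift (σ : Profile) (g : History) (κ : Measure ℝ) (h : History)
    (r : ℝ → Record) :
    E.MeasurableOutcome ψ (σ.shift g) κ h r ↔ E.MeasurableOutcome ψ σ κ (g ++ h) r := by
  simp only [MeasurableOutcome, ahead_shift, List.append_assoc]

lemma measurableFrom_shift (σ : Profile) (g h₀ : History) :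
    E.MeasurableFrom ψ (σ.shift g) h₀ ↔ E.MeasurableFrom ψ σ (g ++ h₀) := by
  constructor
  · rintro H h ⟨t, rfl⟩
    obtain ⟨H1, H2⟩ := H (h₀ ++ t) (List.prefix_append _ _)
    rw [List.append_assoc]
    refine ⟨(measurableOutcome_shift _ _ _ _ _).1 H1, fun θ hθ p q => ⟨(H2 θ hθ p q).1, ?_⟩⟩
    exact (measurableOutcome_shift _ _ _ _ _).1 (H2 θ hθ p q).2
  · rintro H h ⟨t, rfl⟩
    obtain ⟨H1, H2⟩ := H (g ++ (h₀ ++ t)) (by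
      rw [← List.append_assoc]; exact List.prefix_append _ _)
    refine ⟨(measurableOutcome_shift _ _ _ _ _).2 H1, fun θ hθ p q => ⟨(H2 θ hθ p q).1, ?_⟩⟩
    exact (measurableOutcome_shift _ _ _ _ _).2 (H2 θ hθ p q).2

/-- Continuation play in an equilibrium is an equilibrium. -/
lemma IsEquilibrium.shift {σ : Profile} {β : History → Reported → Measure ℝ}
    (H : E.IsEquilibrium ψ σ β) (g : History) :
    E.IsEquilibrium ψ (σ.shift g) fun h => β (g ++ h) where
  sender_bounded := H.sender_bounded.shift g
  receiver_bounded := H.receiver_bounded.shift g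
  measurable := (measurableFrom_shift σ g []).2 fun h _ => H.measurable h List.nil_prefix
  consistent h := H.consistent (g ++ h)
  sender_rational := by
    intro h S' hb hm
    have e : (⟨σ.S.graft g S', σ.R⟩ : Profile).shift g = ⟨S', (σ.shift g).R⟩ := by
      simp only [Profile.shift, SenderStrategy.shift_graft]
    have hm' : E.MeasurableFrom ψ ⟨σ.S.graft g S', σ.R⟩ (g ++ h) := by
      rw [← measurableFrom_shift, e]; exact hm
    have key := H.sender_rational (g ++ h) (σ.S.graft g S') (H.sender_bounded.graft hb g) hm'
    simp only [← total_shift] at key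
    simp only [e] at key
    intro σ' θ₀ hθ₀
    obtain ⟨k1, k2, k3⟩ := key θ₀ hθ₀
    have f1 : ∀ s, (⟨σ.S.graft g S', σ.R⟩ : Profile).afterSignal (g ++ h) s = σ'.afterSignal h s :=
      fun s => by
        change ((⟨σ.S.graft g S', σ.R⟩ : Profile).shift g).afterSignal h s = _
        rw [e]
    have f2 : (⟨σ.S.graft g S', σ.R⟩ : Profile).afterOpening (g ++ h) = σ'.afterOpening h := by
        change ((⟨σ.S.graft g S', σ.R⟩ : Profile).shift g).afterOpening h = _
        rw [e]
    have f3 : (⟨σ.S.graft g S', σ.R⟩ : Profile).afterDecided (g ++ h) = σ'.afterDecided h := by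
        change ((⟨σ.S.graft g S', σ.R⟩ : Profile).shift g).afterDecided h = _
        rw [e]
    simp only [f1] at k1
    simp only [f2] at k2
    simp only [f3] at k3
    exact ⟨k1, k2, k3⟩
  receiver_rational := by
    intro h R' hb hm
    have e : (⟨σ.S, σ.R.graft g R'⟩ : Profile).shift g = ⟨(σ.shift g).S, R'⟩ := by
      simp only [Profile.shift, ReceiverStrategy.shift_graft]
    have hm' : E.MeasurableFrom ψ ⟨σ.S, σ.R.graft g R'⟩ (g ++ h) := by
      rw [← measurableFrom_shift, e]; exact hm
    have key := H.receiver_rational (g ++ h) (σ.R.graft g R') (H.receiver_bounded.graft hb g) hm'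
    simp only [← total_shift] at key
    simp only [e] at key
    intro σ' θ₀ hθ₀
    obtain ⟨k1, k2, k3, k4⟩ := key θ₀ hθ₀
    have f1 : (⟨σ.S, σ.R.graft g R'⟩ : Profile).afterSenderExAnte (g ++ h) =
        σ'.afterSenderExAnte h := by
      change ((⟨σ.S, σ.R.graft g R'⟩ : Profile).shift g).afterSenderExAnte h = _
      rw [e]
    have f2 : (⟨σ.S, σ.R.graft g R'⟩ : Profile).afterReported (g ++ h) = σ'.afterReported h := by
      change ((⟨σ.S, σ.R.graft g R'⟩ : Profile).shift g).afterReported h = _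
      rw [e]
    have f3 : (⟨σ.S, σ.R.graft g R'⟩ : Profile).afterPaid (g ++ h) = σ'.afterPaid h := by
      change ((⟨σ.S, σ.R.graft g R'⟩ : Profile).shift g).afterPaid h = _
      rw [e]
    have f4 : (⟨σ.S, σ.R.graft g R'⟩ : Profile).afterSettling (g ++ h) = σ'.afterSettling h := by
      change ((⟨σ.S, σ.R.graft g R'⟩ : Profile).shift g).afterSettling h = _
      rw [e]
    simp only [f1] at k1
    simp only [f2] at k2
    simp only [f3] at k3
    simp only [f4] at k4
    exact ⟨k1, k2, k3, k4⟩

lemma IsEquilibrium.value_mem {σ : Profile} {β : History → Reported → Measure ℝ}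
    (H : E.IsEquilibrium ψ σ β) (h : History) :
    (E.value ψ σ .sender h, E.value ψ σ .receiver h) ∈ E.equilibriumPayoffs ψ := by
  refine ⟨_, _, H.shift h, ?_⟩
  simp only [value_shift, List.append_nil]

end Env

/-! ## Deviations at a single point of a period -/

open Classical in
/-- Pay nothing ex post in the period that starts at `h`, after the report `X`. -/
noncomputable def SenderStrategy.stopPaying (S : SenderStrategy) (h : History) (X : Reported) :
    SenderStrategy where
  exAnte := S.exAnte
  report := S.report
  exPost h' D := if h' = h ∧ D.toReported = X then 0 else S.exPost h' D

open Classical in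
/-- In the period that starts at `h`, after the report `X`, decide `d` and pay nothing. -/
noncomputable def ReceiverStrategy.deviate (R : ReceiverStrategy) (h : History) (X : Reported)
    (d : ℝ) : ReceiverStrategy where
  exAnte := R.exAnte
  interim h' X' := if h' = h ∧ X' = X then 0 else R.interim h' X'
  decide h' Y := if h' = h ∧ Y.toReported = X then d else R.decide h' Y
  exPost h' Z := if h' = h ∧ Z.toReported = X then 0 else R.exPost h' Z

open Classical in
/-- In state `θ`, report `y` in the period that starts at `h` with the opening `x`. -/
noncomputable def SenderStrategy.misreport (S : SenderStrategy) (h : History) (x : Opening)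
    (θ : ℝ) (y : Set ℝ × Transfer) : SenderStrategy where
  exAnte := S.exAnte
  report h' x' θ' := if h' = h ∧ x' = x ∧ θ' = θ then y else S.report h' x' θ'
  exPost := S.exPost

open Classical in
/-- Pay nothing ex ante in the period that starts at `h`, after the signal `s`. -/
noncomputable def SenderStrategy.skipExAnte (S : SenderStrategy) (h : History) (s : Set ℝ) :
    SenderStrategy where
  exAnte h' s' := if h' = h ∧ s' = s then 0 else S.exAnte h' s'
  report := S.report
  exPost := S.exPost

open Classical in
/-- Pay nothing ex ante in the period that starts at `h`, after the signal `s`. -/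
noncomputable def ReceiverStrategy.skipExAnte (R : ReceiverStrategy) (h : History) (s : Set ℝ) :
    ReceiverStrategy where
  exAnte h' s' p' := if h' = h ∧ s' = s then 0 else R.exAnte h' s' p'
  interim := R.interim
  decide := R.decide
  exPost := R.exPost

lemma transferLE_zero (B : ℝ≥0) : TransferLE 0 B := ⟨zero_le, zero_le⟩

lemma SenderStrategy.Bounded.stopPaying {S : SenderStrategy} (hS : S.Bounded) (h : History)
    (X : Reported) : (S.stopPaying h X).Bounded := by
  obtain ⟨B, h1, h2, h3⟩ := hS
  refine ⟨B, h1, h2, fun h x => ?_⟩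
  simp only [SenderStrategy.stopPaying]
  split_ifs
  · exact transferLE_zero B
  · exact h3 _ _

lemma SenderStrategy.Bounded.skipExAnte {S : SenderStrategy} (hS : S.Bounded) (h : History)
    (s : Set ℝ) : (S.skipExAnte h s).Bounded := by
  obtain ⟨B, h1, h2, h3⟩ := hS
  refine ⟨B, fun h x => ?_, h2, h3⟩
  simp only [SenderStrategy.skipExAnte]
  split_ifs
  · exact transferLE_zero B
  · exact h1 _ _

lemma SenderStrategy.Bounded.misreport {S : SenderStrategy} (hS : S.Bounded) (h : History)
    (x : Opening) (θ : ℝ) (y : Set ℝ × Transfer) : (S.misreport h x θ y).Bounded := by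
  obtain ⟨B, h1, h2, h3⟩ := hS
  refine ⟨max B (max y.2.1 y.2.2), fun h s => (h1 h s).mono (le_max_left _ _), fun h x θ => ?_,
    fun h x => (h3 h x).mono (le_max_left _ _)⟩
  simp only [SenderStrategy.misreport]
  split_ifs
  · exact ⟨(le_max_left _ _).trans (le_max_right _ _), (le_max_right _ _).trans (le_max_right _ _)⟩
  · exact (h2 _ _ _).mono (le_max_left _ _)

lemma ReceiverStrategy.Bounded.skipExAnte {R : ReceiverStrategy} (hR : R.Bounded) (h : History)
    (s : Set ℝ) : (R.skipExAnte h s).Bounded := by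
  obtain ⟨B, h1, h2, h3, h4⟩ := hR
  refine ⟨B, fun h s p => ?_, h2, h3, h4⟩
  simp only [ReceiverStrategy.skipExAnte]
  split_ifs
  · exact transferLE_zero B
  · exact h1 _ _ _

lemma ReceiverStrategy.Bounded.deviate {R : ReceiverStrategy} (hR : R.Bounded) (h : History)
    (X : Reported) (d : ℝ) : (R.deviate h X d).Bounded := by
  obtain ⟨B, h1, h2, h3, h4⟩ := hR
  have e : (B : ℝ) ≤ (max B ‖d‖₊ : ℝ≥0) := by exact_mod_cast le_max_left B ‖d‖₊
  have e' : |d| ≤ (max B ‖d‖₊ : ℝ≥0) := by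
    rw [← Real.norm_eq_abs, ← coe_nnnorm]
    exact_mod_cast le_max_right B ‖d‖₊
  refine ⟨max B ‖d‖₊, fun h s p => (h1 h s p).mono (le_max_left _ _), fun h x => ?_, fun h x => ?_,
    fun h x => ?_⟩ <;> simp only [ReceiverStrategy.deviate] <;> split_ifs
  · exact transferLE_zero _
  · exact (h2 _ _).mono (le_max_left _ _)
  · exact e'
  · exact (h3 _ _).trans e
  · exact transferLE_zero _
  · exact (h4 _ _).mono (le_max_left _ _)

namespace Env

variable {E : Env} {ψ : Signal} {σ σ' : Profile} {h : History}

/-- The profiles prescribe the same play after the period that starts at `h`. -/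
def AgreeAfter (h : History) (σ σ' : Profile) : Prop :=
  ∀ h', h.length < h'.length → σ'.S.report h' = σ.S.report h' ∧
    σ'.afterOpening h' = σ.afterOpening h' ∧ σ'.afterSignal h' = σ.afterSignal h'

lemma AgreeAfter.ahead_eq (hag : AgreeAfter h σ σ') (i : Player) (k : ℕ) (h' : History)
    (hl : h.length < h'.length) : E.ahead ψ σ' i k h' = E.ahead ψ σ i k h' := by
  induction k generalizing h' with
  | zero => simp only [ahead, Profile.play, (hag h' hl).2.2]
  | succ k ih =>
    simp only [ahead, Profile.play, (hag h' hl).2.2]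
    congr 1; ext θ
    exact ih _ (by simp; omega)

lemma AgreeAfter.value_eq (hag : AgreeAfter h σ σ') (i : Player) (h' : History)
    (hl : h.length < h'.length) : E.value ψ σ' i h' = E.value ψ σ i h' := by
  simp only [value, hag.ahead_eq i _ h' hl]

lemma AgreeAfter.total_eq (hag : AgreeAfter h σ σ') (i : Player) (θ : ℝ) (r : Record) :
    E.total ψ σ' i h θ r = E.total ψ σ i h θ r := by
  simp only [total, hag.value_eq i (h ++ [r]) (by simp)]

lemma AgreeAfter.measurableFrom (hag : AgreeAfter h σ σ') (H : E.MeasurableFrom ψ σ h)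
    (h1 : E.MeasurableOutcome ψ σ E.prior h (σ'.play h ψ))
    (h2 : ∀ θ₀ ∈ Icc (0 : ℝ) 1, ∀ p q : Transfer,
      (∀ y, MeasurableSet {θ | θ ∈ ψ.cell θ₀ ∧ σ'.S.report h ⟨ψ.cell θ₀, p, q⟩ θ = y}) ∧
      E.MeasurableOutcome ψ σ (condLaw E.prior (ψ.cell θ₀)) h
        (σ'.afterOpening h ⟨ψ.cell θ₀, p, q⟩)) : E.MeasurableFrom ψ σ' h := by
  have hout : ∀ h', h <+: h' → ∀ κ r, E.MeasurableOutcome ψ σ κ h' r →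
      E.MeasurableOutcome ψ σ' κ h' r := fun h' hp κ r hr => by
    refine ⟨hr.1, hr.2.1, fun i k => ?_⟩
    have := hr.2.2 i k
    refine this.congr (.of_forall fun θ => ?_)
    exact (hag.ahead_eq i k _ (by have := hp.length_le; simp; omega)).symm
  intro h' hp
  by_cases he : h' = h
  · subst he
    exact ⟨hout h' hp _ _ h1, fun θ₀ hθ p q => ⟨(h2 θ₀ hθ p q).1, hout h' hp _ _ (h2 θ₀ hθ p q).2⟩⟩
  · have hl : h.length < h'.length := lt_of_le_of_ne hp.length_le
      fun hle => he (hp.eq_of_length hle).symm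
    obtain ⟨a1, a2, a3⟩ := hag h' hl
    obtain ⟨b1, b2⟩ := H h' hp
    refine ⟨hout h' hp _ _ ?_, fun θ₀ hθ p q => ⟨?_, hout h' hp _ _ ?_⟩⟩
    · have : σ'.play h' ψ = σ.play h' ψ := by ext1 θ; simp only [Profile.play, a3]
      rw [this]; exact b1
    · rw [a1]; exact (b2 θ₀ hθ p q).1
    · rw [a2]; exact (b2 θ₀ hθ p q).2

lemma MeasurableOutcome.of_forall {κ : Measure ℝ} {r : ℝ → Record}
    (H : ∀ g : Record → ℝ, AEMeasurable (fun θ => g (r θ)) κ) :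
    E.MeasurableOutcome ψ σ κ h r :=
  ⟨H fun r => r.dec, fun i => H fun r => r.net i, fun i k => H fun r => E.ahead ψ σ i k (h ++ [r])⟩

lemma MeasurableOutcome.const {κ : Measure ℝ} (r : Record) :
    E.MeasurableOutcome ψ σ κ h fun _ => r := .of_forall fun g => aemeasurable_const

lemma aemeasurable_of_pieces {κ : Measure ℝ} {Q : Set ℝ} (hQ : MeasurableSet Q)
    {f f1 f2 : ℝ → ℝ} (h1 : AEMeasurable f1 (κ.restrict Q)) (h2 : AEMeasurable f2 κ)
    (e1 : ∀ᵐ θ ∂κ, θ ∈ Q → f θ = f1 θ) (e2 : ∀ᵐ θ ∂κ, θ ∉ Q → f θ = f2 θ) : AEMeasurable f κ := by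
  have : AEMeasurable f (κ.restrict (Q ∪ Qᶜ)) := by
    rw [aemeasurable_union_iff]
    refine ⟨h1.congr ?_, h2.restrict.congr ?_⟩
    · refine (ae_restrict_iff' hQ).2 ?_
      filter_upwards [e1] with θ h hθ using (h hθ).symm
    · refine (ae_restrict_iff' hQ.compl).2 ?_
      filter_upwards [e2] with θ h hθ using (h hθ).symm
  rwa [union_compl_self, Measure.restrict_univ] at this

lemma MeasurableOutcome.of_pieces {κ : Measure ℝ} {Q : Set ℝ} (hQ : MeasurableSet Q)
    {r r1 r2 : ℝ → Record} (h1 : E.MeasurableOutcome ψ σ (κ.restrict Q) h r1)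
    (h2 : E.MeasurableOutcome ψ σ κ h r2)
    (e1 : ∀ᵐ θ ∂κ, θ ∈ Q → r θ = r1 θ) (e2 : ∀ᵐ θ ∂κ, θ ∉ Q → r θ = r2 θ) :
    E.MeasurableOutcome ψ σ κ h r := by
  refine ⟨aemeasurable_of_pieces hQ h1.1 h2.1 (e1.mono fun θ h hθ => by rw [h hθ])
    (e2.mono fun θ h hθ => by rw [h hθ]),
    fun i => aemeasurable_of_pieces hQ (h1.2.1 i) (h2.2.1 i) (e1.mono fun θ h hθ => by rw [h hθ])
      (e2.mono fun θ h hθ => by rw [h hθ]),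
    fun i k => aemeasurable_of_pieces hQ (h1.2.2 i k) (h2.2.2 i k)
      (e1.mono fun θ h hθ => by rw [h hθ]) (e2.mono fun θ h hθ => by rw [h hθ])⟩

namespace Standing

variable (hE : E.Standing)
include hE

lemma measurableOutcome_restrict {m : Set ℝ} (hm : IsCell m) {r : ℝ → Record}
    (H : E.MeasurableOutcome ψ σ (condLaw E.prior m) h r) :
    E.MeasurableOutcome ψ σ (E.prior.restrict m) h r := by
  by_cases h0 : E.prior m = 0
  · rw [Measure.restrict_eq_zero.2 h0]
    exact .of_forall fun g => aemeasurable_zero_measure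
  · have hp := pos_iff_ne_zero.2 h0
    exact ⟨(hE.aemeasurable_condLaw_iff hp).1 H.1,
      fun i => (hE.aemeasurable_condLaw_iff hp).1 (H.2.1 i),
      fun i k => (hE.aemeasurable_condLaw_iff hp).1 (H.2.2 i k)⟩

/-- Changing play after a single report keeps a profile measurable. -/
lemma measurableFrom_of_single_report {X : Reported} {θ₁ : ℝ} (hθ₁ : θ₁ ∈ Icc (0 : ℝ) 1)
    (hX : X.signal = ψ.cell θ₁)
    (hr : σ'.S.report = σ.S.report) (hS : σ'.S.exAnte = σ.S.exAnte)
    (hR : σ'.R.exAnte = σ.R.exAnte)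
    (hoff : ∀ h' X', ¬ (h' = h ∧ X' = X) → σ'.afterReported h' X' = σ.afterReported h' X')
    (H : E.MeasurableFrom ψ σ h) : AgreeAfter h σ σ' ∧ E.MeasurableFrom ψ σ' h := by
  have hag : AgreeAfter h σ σ' := by
    intro h' hl
    have hne : h' ≠ h := fun he => by simp [he] at hl
    have e : σ'.afterOpening h' = σ.afterOpening h' := by
      funext x θ
      simp only [Profile.afterOpening, hr]
      exact hoff _ _ fun hh => hne hh.1
    refine ⟨by rw [hr], e, ?_⟩
    funext s θ
    simp only [Profile.afterSignal, Profile.afterSenderExAnte, e, hS, hR]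
  refine ⟨hag, hag.measurableFrom H ?_ fun θ₀ hθ₀ p q => ⟨?_, ?_⟩⟩
  · have hmeas := ((H h List.prefix_rfl).2 θ₁ hθ₁ X.exS X.exR).1 (X.msg, X.inS)
    -- If the transfers in `X` are not the prescribed ones, `X` is not reached in this period and
    -- the record of play is unchanged. Otherwise the states that lead to `X` form a measurable set,
    -- on which the new record is constant.
    by_cases hop : X.exS = σ.S.exAnte h X.signal ∧
      X.exR = σ.R.exAnte h X.signal (σ.S.exAnte h X.signal)
    · refine MeasurableOutcome.of_pieces hmeas (.const (σ'.afterReported h X))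
        (H h List.prefix_rfl).1 (.of_forall fun θ hθ => ?_) ?_
      · obtain ⟨h1, h2⟩ := hθ
        have ho : (⟨ψ.cell θ, σ.S.exAnte h (ψ.cell θ),
            σ.R.exAnte h (ψ.cell θ) (σ.S.exAnte h (ψ.cell θ))⟩ : Opening) =
            ⟨ψ.cell θ₁, X.exS, X.exR⟩ := by
          rw [ψ.cell_eq θ₁ hθ₁ θ h1, ← hX, hop.2, hop.1]
        simp only [Profile.play, Profile.afterSignal, Profile.afterSenderExAnte,
          Profile.afterOpening, hr, hS, hR]
        rw [ho, h2, ← hX]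
      · filter_upwards [hE.ae_mem] with θ hθu hθ
        simp only [Profile.play, Profile.afterSignal, Profile.afterSenderExAnte,
          Profile.afterOpening, hr, hS, hR]
        refine hoff _ _ fun hh => hθ ?_
        have h3 := hh.2
        have ho : (⟨ψ.cell θ, σ.S.exAnte h (ψ.cell θ),
            σ.R.exAnte h (ψ.cell θ) (σ.S.exAnte h (ψ.cell θ))⟩ : Opening) =
            ⟨ψ.cell θ₁, X.exS, X.exR⟩ := by
          rw [← hX, ← h3]
        have e1 : ψ.cell θ = X.signal := by rw [← h3]
        refine ⟨by rw [← hX, ← e1]; exact ψ.mem_cell θ hθu, ?_⟩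
        rw [← ho, ← h3]
    · have : σ'.play h ψ = σ.play h ψ := by
        funext θ
        simp only [Profile.play, Profile.afterSignal, Profile.afterSenderExAnte,
          Profile.afterOpening, hr, hS, hR]
        refine hoff _ _ fun hh => hop ?_
        rw [← hh.2]
        exact ⟨rfl, rfl⟩
      rw [this]
      exact (H h List.prefix_rfl).1
  · rw [hr]; exact ((H h List.prefix_rfl).2 θ₀ hθ₀ p q).1
  · have hmeas := ((H h List.prefix_rfl).2 θ₀ hθ₀ p q).1 (X.msg, X.inS)
    by_cases hop : X.toOpening = ⟨ψ.cell θ₀, p, q⟩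
    · refine MeasurableOutcome.of_pieces hmeas (.const (σ'.afterReported h X))
        ((H h List.prefix_rfl).2 θ₀ hθ₀ p q).2 (.of_forall fun θ hθ => ?_) ?_
      · obtain ⟨h1, h2⟩ := hθ
        simp only [Profile.afterOpening, hr, ← hop] at h2 ⊢
        rw [h2]
      · filter_upwards [hE.ae_mem_condLaw (ψ.isCell subset_rfl hθ₀)] with θ hθm hθ
        simp only [Profile.afterOpening, hr]
        refine hoff _ _ fun hh => hθ ⟨hθm, ?_⟩
        rw [← hh.2]
    · have : σ'.afterOpening h ⟨ψ.cell θ₀, p, q⟩ = σ.afterOpening h ⟨ψ.cell θ₀, p, q⟩ := by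
        funext θ
        simp only [Profile.afterOpening, hr]
        refine hoff _ _ fun hh => hop ?_
        rw [← hh.2]
      rw [this]
      exact ((H h List.prefix_rfl).2 θ₀ hθ₀ p q).2

lemma stopPaying_measurable {X : Reported} {θ₁ : ℝ} (hθ₁ : θ₁ ∈ Icc (0 : ℝ) 1)
    (hX : X.signal = ψ.cell θ₁) (H : E.MeasurableFrom ψ σ h) :
    AgreeAfter h σ ⟨σ.S.stopPaying h X, σ.R⟩ ∧
      E.MeasurableFrom ψ ⟨σ.S.stopPaying h X, σ.R⟩ h := by
  refine hE.measurableFrom_of_single_report (X := X) hθ₁ hX rfl rfl rfl (fun h' X' hne => ?_) H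
  simp only [Profile.afterReported, Profile.afterPaid, Profile.afterDecided,
    SenderStrategy.stopPaying, if_neg hne]
  rfl

lemma deviate_measurable {X : Reported} {θ₁ : ℝ} (hθ₁ : θ₁ ∈ Icc (0 : ℝ) 1)
    (hX : X.signal = ψ.cell θ₁) (d : ℝ) (H : E.MeasurableFrom ψ σ h) :
    AgreeAfter h σ ⟨σ.S, σ.R.deviate h X d⟩ ∧
      E.MeasurableFrom ψ ⟨σ.S, σ.R.deviate h X d⟩ h := by
  refine hE.measurableFrom_of_single_report (X := X) hθ₁ hX rfl rfl rfl (fun h' X' hne => ?_) H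
  simp only [Profile.afterReported, Profile.afterPaid, Profile.afterDecided,
    Profile.afterSettling, ReceiverStrategy.deviate, if_neg hne]

/-- Play in this period changes in one state only, and a single state is measurable. Constraints of
individual types therefore follow from `SenderRational`, although it admits only measurable
deviations. -/
lemma misreport_measurable (x : Opening) (θ : ℝ) (y : Set ℝ × Transfer)
    (H : E.MeasurableFrom ψ σ h) :
    AgreeAfter h σ ⟨σ.S.misreport h x θ y, σ.R⟩ ∧
      E.MeasurableFrom ψ ⟨σ.S.misreport h x θ y, σ.R⟩ h := by
  have hrep : ∀ h' x' θ', ¬ (h' = h ∧ x' = x ∧ θ' = θ) →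
      (σ.S.misreport h x θ y).report h' x' θ' = σ.S.report h' x' θ' := fun h' x' θ' hne => by
    simp only [SenderStrategy.misreport, if_neg hne]
  have hrec : ∀ h' x' θ', ¬ (h' = h ∧ x' = x ∧ θ' = θ) →
      (⟨σ.S.misreport h x θ y, σ.R⟩ : Profile).afterOpening h' x' θ' = σ.afterOpening h' x' θ' :=
    fun h' x' θ' hne => by
      simp only [Profile.afterOpening, hrep h' x' θ' hne]; rfl
  have hag : AgreeAfter h σ ⟨σ.S.misreport h x θ y, σ.R⟩ := by
    intro h' hl
    have hne : h' ≠ h := fun he => by simp [he] at hl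
    refine ⟨?_, ?_, ?_⟩
    · funext x' θ'; exact hrep _ _ _ fun hh => hne hh.1
    · funext x' θ'; exact hrec _ _ _ fun hh => hne hh.1
    · funext s θ'; exact hrec _ _ _ fun hh => hne hh.1
  have hsing : E.prior {θ} = 0 := hE.prior_singleton θ
  refine ⟨hag, hag.measurableFrom H ?_ fun θ₀ hθ₀ p q => ⟨fun z => ?_, ?_⟩⟩
  · refine MeasurableOutcome.of_pieces (measurableSet_singleton θ) (.const
      ((⟨σ.S.misreport h x θ y, σ.R⟩ : Profile).play h ψ θ)) (H h List.prefix_rfl).1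
      (.of_forall fun θ' hθ' => ?_) (.of_forall fun θ' hθ' => ?_)
    · rw [mem_singleton_iff.1 hθ']
    · exact hrec _ _ _ fun hh => hθ' hh.2.2
  · have hm := ((H h List.prefix_rfl).2 θ₀ hθ₀ p q).1 z
    by_cases hz : θ ∈ ψ.cell θ₀ ∧ (σ.S.misreport h x θ y).report h ⟨ψ.cell θ₀, p, q⟩ θ = z
    · convert hm.union (measurableSet_singleton θ) using 1
      ext θ'
      simp only [mem_ofPred_eq, mem_union, mem_singleton_iff]
      by_cases he : θ' = θ
      · subst he; simp [hz]
      · rw [hrep _ _ _ fun hh => he hh.2.2]; simp [he]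
    · convert hm.diff (measurableSet_singleton θ) using 1
      ext θ'
      simp only [mem_ofPred_eq, mem_sdiff, mem_singleton_iff]
      by_cases he : θ' = θ
      · subst he; simp [hz]
      · rw [hrep _ _ _ fun hh => he hh.2.2]; simp [he]
  · refine MeasurableOutcome.of_pieces (measurableSet_singleton θ) (.const
      ((⟨σ.S.misreport h x θ y, σ.R⟩ : Profile).afterOpening h ⟨ψ.cell θ₀, p, q⟩ θ))
      ((H h List.prefix_rfl).2 θ₀ hθ₀ p q).2
      (.of_forall fun θ' hθ' => ?_) (.of_forall fun θ' hθ' => ?_)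
    · rw [mem_singleton_iff.1 hθ']
    · exact hrec _ _ _ fun hh => hθ' hh.2.2

lemma senderSkipExAnte_measurable {θ₁ : ℝ} (hθ₁ : θ₁ ∈ Icc (0 : ℝ) 1)
    (H : E.MeasurableFrom ψ σ h) :
    AgreeAfter h σ ⟨σ.S.skipExAnte h (ψ.cell θ₁), σ.R⟩ ∧
      E.MeasurableFrom ψ ⟨σ.S.skipExAnte h (ψ.cell θ₁), σ.R⟩ h := by
  have hc := ψ.isCell subset_rfl hθ₁
  have hsig : ∀ h' s θ, ¬ (h' = h ∧ s = ψ.cell θ₁) →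
      (⟨σ.S.skipExAnte h (ψ.cell θ₁), σ.R⟩ : Profile).afterSignal h' s θ = σ.afterSignal h' s θ :=
    fun h' s θ hne => by
      simp only [Profile.afterSignal, SenderStrategy.skipExAnte, if_neg hne]; rfl
  have hag : AgreeAfter h σ ⟨σ.S.skipExAnte h (ψ.cell θ₁), σ.R⟩ := by
    intro h' hl
    have hne : h' ≠ h := fun he => by simp [he] at hl
    exact ⟨rfl, rfl, by funext s θ; exact hsig _ _ _ fun hh => hne hh.1⟩
  refine ⟨hag, hag.measurableFrom H ?_ fun θ₀ hθ₀ p q => (H h List.prefix_rfl).2 θ₀ hθ₀ p q⟩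
  refine MeasurableOutcome.of_pieces hc.measurableSet
    (hE.measurableOutcome_restrict hc ((H h List.prefix_rfl).2 θ₁ hθ₁ 0
      (σ.R.exAnte h (ψ.cell θ₁) 0)).2) (H h List.prefix_rfl).1
      (.of_forall fun θ hθ => ?_) ?_
  · simp only [Profile.play, ψ.cell_eq θ₁ hθ₁ θ hθ, Profile.afterSignal,
      Profile.afterSenderExAnte, SenderStrategy.skipExAnte, and_self, if_true]
    rfl
  · filter_upwards [hE.ae_mem] with θ hθu hθ
    refine hsig _ _ _ fun hh => hθ ?_
    rw [← hh.2]; exact ψ.mem_cell θ hθu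

lemma receiverSkipExAnte_measurable {θ₁ : ℝ} (hθ₁ : θ₁ ∈ Icc (0 : ℝ) 1)
    (H : E.MeasurableFrom ψ σ h) :
    AgreeAfter h σ ⟨σ.S, σ.R.skipExAnte h (ψ.cell θ₁)⟩ ∧
      E.MeasurableFrom ψ ⟨σ.S, σ.R.skipExAnte h (ψ.cell θ₁)⟩ h := by
  have hc := ψ.isCell subset_rfl hθ₁
  have hsig : ∀ h' s θ, ¬ (h' = h ∧ s = ψ.cell θ₁) →
      (⟨σ.S, σ.R.skipExAnte h (ψ.cell θ₁)⟩ : Profile).afterSignal h' s θ = σ.afterSignal h' s θ :=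
    fun h' s θ hne => by
      simp only [Profile.afterSignal, Profile.afterSenderExAnte, ReceiverStrategy.skipExAnte,
        if_neg hne]; rfl
  have hag : AgreeAfter h σ ⟨σ.S, σ.R.skipExAnte h (ψ.cell θ₁)⟩ := by
    intro h' hl
    have hne : h' ≠ h := fun he => by simp [he] at hl
    exact ⟨rfl, rfl, by funext s θ; exact hsig _ _ _ fun hh => hne hh.1⟩
  refine ⟨hag, hag.measurableFrom H ?_ fun θ₀ hθ₀ p q => (H h List.prefix_rfl).2 θ₀ hθ₀ p q⟩
  refine MeasurableOutcome.of_pieces hc.measurableSet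
    (hE.measurableOutcome_restrict hc ((H h List.prefix_rfl).2 θ₁ hθ₁
      (σ.S.exAnte h (ψ.cell θ₁)) 0).2) (H h List.prefix_rfl).1
      (.of_forall fun θ hθ => ?_) ?_
  · simp only [Profile.play, ψ.cell_eq θ₁ hθ₁ θ hθ, Profile.afterSignal,
      Profile.afterSenderExAnte, ReceiverStrategy.skipExAnte, and_self, if_true]
    rfl
  · filter_upwards [hE.ae_mem] with θ hθu hθ
    refine hsig _ _ _ fun hh => hθ ?_
    rw [← hh.2]; exact ψ.mem_cell θ hθu

end Standing
end Env

/-! ## Necessary conditions for equilibrium -/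

/-- Averaging a family of laws that disintegrates `κ`. -/
lemma lintegral_disintegration {κ : Measure ℝ} {b : ℝ → Measure ℝ}
    (hb : ∀ A, MeasurableSet A → AEMeasurable (fun θ => b θ A) κ ∧ ∫⁻ θ, b θ A ∂κ = κ A)
    {f : ℝ → ENNReal} (hf : Measurable f) :
    AEMeasurable (fun θ => ∫⁻ x, f x ∂b θ) κ ∧ ∫⁻ θ, ∫⁻ x, f x ∂b θ ∂κ = ∫⁻ x, f x ∂κ := by
  refine Measurable.ennreal_induction (motive := fun f =>
    AEMeasurable (fun θ => ∫⁻ x, f x ∂b θ) κ ∧ ∫⁻ θ, ∫⁻ x, f x ∂b θ ∂κ = ∫⁻ x, f x ∂κ)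
    ?_ ?_ ?_ hf
  · intro c s hs
    simp only [lintegral_indicator hs, lintegral_const, Measure.restrict_apply MeasurableSet.univ,
      univ_inter]
    exact ⟨(hb s hs).1.const_mul c, by rw [lintegral_const_mul'' _ (hb s hs).1, (hb s hs).2]⟩
  · intro f g _ hf hg h1 h2
    simp only [Pi.add_apply, lintegral_add_left hf]
    exact ⟨h1.1.add h2.1, by rw [lintegral_add_left' h1.1, h1.2, h2.2]⟩
  · intro f hf hmono h
    simp only [lintegral_iSup hf hmono]
    refine ⟨AEMeasurable.iSup fun n => (h n).1, ?_⟩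
    rw [lintegral_iSup' (fun n => (h n).1) (.of_forall fun θ n m hnm =>
      lintegral_mono (hmono hnm))]
    simp only [(h _).2]

/-- An integral inequality that holds for each law of a disintegration holds on average. -/
lemma integral_le_of_disintegration {κ : Measure ℝ} [IsProbabilityMeasure κ] {b : ℝ → Measure ℝ}
    (hb1 : ∀ᵐ θ ∂κ, b θ univ = 1)
    (hb : ∀ A, MeasurableSet A → AEMeasurable (fun θ => b θ A) κ ∧ ∫⁻ θ, b θ A ∂κ = κ A)
    {F H : ℝ → ℝ} (hF : Integrable F κ) (hH : Integrable H κ) {C : ℝ}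
    (hC : ∀ᵐ θ ∂κ, |F θ - H θ| ≤ C)
    (hle : ∀ᵐ θ ∂κ, 0 ≤ ∫ x, (F x - H x) ∂b θ) :
    ∫ x, H x ∂κ ≤ ∫ x, F x ∂κ := by
  have hC0 : 0 ≤ C := by
    obtain ⟨θ, h⟩ := hC.exists
    exact (abs_nonneg _).trans h
  have hG := (hF.sub hH).aestronglyMeasurable.aemeasurable
  -- `G` is a bounded Borel version of `F - H`. The two agree almost surely under `κ`, hence under
  -- almost every `b θ`, because `b` disintegrates `κ`.
  set G0 := hG.mk with hG0
  set G := fun θ => max (-C) (min C (G0 θ)) with hGdef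
  have hGm : Measurable G := measurable_const.max (measurable_const.min hG.measurable_mk)
  have hGC : ∀ θ, |G θ| ≤ C := fun θ => abs_le.2
    ⟨le_max_left _ _, max_le (by linarith) (min_le_left _ _)⟩
  have hae : ∀ᵐ θ ∂κ, F θ - H θ = G θ := by
    filter_upwards [hG.ae_eq_mk, hC] with θ h1 h2
    simp only [Pi.sub_apply] at h1
    have h3 : G0 θ = F θ - H θ := h1.symm
    rw [hGdef]
    simp only
    rw [h3, min_eq_right (abs_le.1 h2).2, max_eq_right (abs_le.1 h2).1]
  have hae2 : ∀ᵐ θ ∂κ, ∀ᵐ x ∂b θ, F x - H x = G x := by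
    obtain ⟨N, hN, hNm, hN0⟩ := exists_measurable_superset_of_null (ae_iff.1 hae)
    have h1 := hb N hNm
    rw [hN0] at h1
    have h2 := (lintegral_eq_zero_iff' h1.1).1 h1.2
    filter_upwards [h2] with θ h3
    exact measure_mono_null hN h3
  -- Adding `C` makes the integrand nonnegative, so that the disintegration of the lower Lebesgue
  -- integral applies.
  have key := (lintegral_disintegration hb
    (f := fun x => ENNReal.ofReal (G x + C)) (hGm.add_const C).ennreal_ofReal).2
  have hGint : ∀ (m : Measure ℝ) [IsFiniteMeasure m], Integrable G m := fun m _ =>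
    Env.Standing.integrable_of_bounded hGm.aemeasurable (.of_forall hGC)
  have hGi : ∀ (m : Measure ℝ) [IsFiniteMeasure m], Integrable (fun x => G x + C) m := fun m _ =>
    (hGint m).add (integrable_const C)
  have hnn : ∀ x, 0 ≤ G x + C := fun x => by linarith [(abs_le.1 (hGC x)).1]
  have h1 : ∀ᵐ θ ∂κ, ENNReal.ofReal C ≤ ∫⁻ x, ENNReal.ofReal (G x + C) ∂b θ := by
    filter_upwards [hb1, hle, hae2] with θ h1 h2 h3
    have : IsProbabilityMeasure (b θ) := ⟨h1⟩
    rw [← ofReal_integral_eq_lintegral_ofReal (hGi _)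
      (.of_forall hnn), integral_add (hGint _) (integrable_const C)]
    refine ENNReal.ofReal_le_ofReal ?_
    rw [integral_congr_ae h3] at h2
    simpa using h2
  have h2 : ENNReal.ofReal C ≤ ∫⁻ x, ENNReal.ofReal (G x + C) ∂κ := by
    rw [← key]
    calc ENNReal.ofReal C = ∫⁻ θ, ENNReal.ofReal C ∂κ := by simp
      _ ≤ _ := lintegral_mono_ae h1
  rw [← ofReal_integral_eq_lintegral_ofReal (hGi _)
    (.of_forall hnn), integral_add (hGint _) (integrable_const C),
    ENNReal.ofReal_le_ofReal_iff (by
      rw [← integral_add (hGint _) (integrable_const C)]; exact integral_nonneg hnn)] at h2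
  have h3 : 0 ≤ ∫ x, G x ∂κ := by simpa using h2
  rw [← integral_congr_ae hae, integral_sub hF hH] at h3
  linarith

namespace Env

/-- Bounds for the equilibrium payoffs. -/
def PayoffBounds (E : Env) (ψ : Signal) (vS vR vbar : ℝ) : Prop :=
  ∀ v ∈ E.equilibriumPayoffs ψ, vS ≤ v.1 ∧ vR ≤ v.2 ∧ v.1 + v.2 ≤ vbar

variable {E : Env} {ψ : Signal} {σ : Profile} {β : History → Reported → Measure ℝ}

namespace IsEquilibrium

variable (H : E.IsEquilibrium ψ σ β)
include H

lemma measurableFrom (h : History) : E.MeasurableFrom ψ σ h := fun h' _ =>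
  H.measurable h' List.nil_prefix

lemma belief {θ₀ : ℝ} (hθ₀ : θ₀ ∈ Icc (0 : ℝ) 1) (h : History) {X : Reported}
    (hX : X.signal = ψ.cell θ₀) :
    IsProbabilityMeasure (β h X) ∧ ∀ᵐ θ ∂β h X, θ ∈ closure (ψ.cell θ₀) := by
  have := (H.consistent h θ₀ hθ₀ X.toOpening hX).1 X.msg X.inS
  exact ⟨⟨this.1⟩, by rw [← hX]; exact this.2⟩

lemma ae_belief_unit {θ₀ : ℝ} (hθ₀ : θ₀ ∈ Icc (0 : ℝ) 1) (h : History) {X : Reported}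
    (hX : X.signal = ψ.cell θ₀) : ∀ᵐ θ ∂β h X, θ ∈ Icc (0 : ℝ) 1 :=
  (H.belief hθ₀ h hX).2.mono fun θ hθ => (ψ.isCell subset_rfl hθ₀).closure.subset hθ

end IsEquilibrium

namespace Standing

variable (hE : E.Standing)
include hE

lemma integral_total_const {κ : Measure ℝ} [IsProbabilityMeasure κ]
    (hκ : ∀ᵐ θ ∂κ, θ ∈ Icc (0 : ℝ) 1) (ψ : Signal) (σ : Profile) (i : Player) (h : History)
    (r : Record) : ∫ θ, E.total ψ σ i h θ r ∂κ =
      (1 - E.δ) * (∫ θ, E.u i r.dec θ ∂κ - r.net i) + E.δ * E.value ψ σ i (h ++ [r]) := by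
  have h1 := hE.integrable_u_const hκ i r.dec
  have h2 : Integrable (fun θ => E.u i r.dec θ - r.net i) κ := h1.sub (integrable_const _)
  simp only [total, stage]
  rw [integral_add (h2.const_mul _) (integrable_const _),
    integral_const_mul, integral_sub h1 (integrable_const _)]
  simp

variable (H : E.IsEquilibrium ψ σ β)
include H

/-- After the decision the sender may stop paying. His net transfer in the last round is then at
most zero, and what follows is an equilibrium payoff, hence at least `vS`. -/
lemma sender_expost {vS vR vbar : ℝ} (hb : E.PayoffBounds ψ vS vR vbar) {θ₀ : ℝ}
    (hθ₀ : θ₀ ∈ Icc (0 : ℝ) 1) (h : History) {D : Decided} (hD : D.signal = ψ.cell θ₀) {θ : ℝ}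
    (hθ : θ ∈ ψ.cell θ₀) :
    (1 - E.δ) * (E.u .sender D.dec θ - (netTransfer D.exS D.exR + netTransfer D.inS D.inR)) +
      E.δ * vS ≤ E.total ψ σ .sender h θ (σ.afterDecided h D) := by
  have hδ : 0 < 1 - E.δ := sub_pos.2 hE.delta_lt_one
  obtain ⟨hag, hm⟩ := hE.stopPaying_measurable (X := D.toReported) hθ₀ hD (H.measurableFrom h)
  have key := (H.sender_rational h _ (H.sender_bounded.stopPaying h D.toReported) hm θ₀ hθ₀).2.2
    D hD θ (hD ▸ hθ)
  rw [hag.total_eq] at key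
  refine le_trans ?_ key
  set r := (⟨σ.S.stopPaying h D.toReported, σ.R⟩ : Profile).afterDecided h D with hr
  have e : r.postS = 0 := by
    simp [hr, Profile.afterDecided, Profile.afterSettling, SenderStrategy.stopPaying]
  have e1 : r.net .sender ≤ netTransfer D.exS D.exR + netTransfer D.inS D.inR := by
    simp only [Record.net, e]
    have : netTransfer 0 r.postR ≤ 0 := by simp [netTransfer]
    have e5 : r.exS = D.exS := rfl
    have e6 : r.exR = D.exR := rfl
    have e7 : r.inS = D.inS := rfl
    have e8 : r.inR = D.inR := rfl
    rw [e5, e6, e7, e8]; linarith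
  have e2 : r.dec = D.dec := rfl
  have e3 := (hb _ (H.value_mem (h ++ [r]))).1
  simp only [total, stage, e2]
  simp only at e3
  gcongr
  exact hE.delta_nonneg

/-- In equilibrium the receiver's temptation is at most the discounted surplus. -/
lemma tol_of_equilibrium {vS vR vbar : ℝ} (hb : E.PayoffBounds ψ vS vR vbar) {θ₀ : ℝ}
    (hθ₀ : θ₀ ∈ Icc (0 : ℝ) 1) (h : History) {X : Reported} (hX : X.signal = ψ.cell θ₀) :
    E.Tol (E.δ / (1 - E.δ) * (vbar - vS - vR)) (β h X) (σ.afterReported h X).dec := by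
  have hδ : 0 < 1 - E.δ := sub_pos.2 hE.delta_lt_one
  intro d'
  obtain ⟨_, -⟩ := H.belief hθ₀ h hX
  have hβ := H.ae_belief_unit hθ₀ h hX
  obtain ⟨hag, hm⟩ := hE.deviate_measurable (X := X) hθ₀ hX d' (H.measurableFrom h)
  have key := (H.receiver_rational h _ (H.receiver_bounded.deviate h X d') hm θ₀ hθ₀).2.2.1
    ⟨X, σ.R.interim h X⟩ hX
  simp only [hag.total_eq] at key
  rw [hE.integral_total_const hβ, hE.integral_total_const hβ] at key
  set r := σ.afterPaid h ⟨X, σ.R.interim h X⟩ with hr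
  have hr2 : σ.afterReported h X = r := rfl
  set r' := (⟨σ.S, σ.R.deviate h X d'⟩ : Profile).afterPaid h ⟨X, σ.R.interim h X⟩ with hr'
  have hd : r'.dec = d' := by
    simp [hr', Profile.afterPaid, Profile.afterDecided, Profile.afterSettling,
      ReceiverStrategy.deviate]
  have hp : r'.postR = 0 := by
    simp [hr', Profile.afterPaid, Profile.afterDecided, Profile.afterSettling,
      ReceiverStrategy.deviate]
  have b1 := hb _ (H.value_mem (h ++ [r]))
  have b2 := hb _ (H.value_mem (h ++ [r']))
  -- Adding the sender's ex-post constraint to the receiver's cancels the transfers between them,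
  -- and burned money only helps. The joint continuation payoff is at most `vbar`, while the
  -- deviations leave at least `vS` and `vR`. The sender's own payoff cancels, so any type in the
  -- realization serves.
  have s1 := hE.sender_expost H hb hθ₀ h (D := ⟨⟨X, σ.R.interim h X⟩, r.dec⟩) hX
    (ψ.mem_cell θ₀ hθ₀)
  have hs : σ.afterDecided h ⟨⟨X, σ.R.interim h X⟩, r.dec⟩ = r := rfl
  rw [hs] at s1
  simp only [total, stage] at s1
  rw [hr2]
  rw [hd] at key
  have n1 : r.net .sender + r.net .receiver ≥ netTransfer X.exS X.exR +
      netTransfer X.inS r.inR + netTransfer X.exR X.exS + netTransfer r.inR X.inS := by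
    have p1 := r.postS.2.2
    have p2 := r.postR.2.2
    have e5 : r.exS = X.exS := rfl
    have e6 : r.exR = X.exR := rfl
    have e7 : r.inS = X.inS := rfl
    simp only [Record.net, netTransfer, e5, e6, e7]
    simp only [NNReal.val_eq_coe] at p1 p2
    linarith
  have n2 : r'.net .receiver ≤ netTransfer X.exR X.exS + netTransfer r.inR X.inS := by
    have e5 : r'.exS = X.exS := rfl
    have e6 : r'.exR = X.exR := rfl
    have e7 : r'.inS = X.inS := rfl
    have e8 : r'.inR = r.inR := rfl
    have p1 := r'.postS.1.2
    simp only [NNReal.val_eq_coe] at p1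
    simp only [Record.net, e5, e6, e7, e8, hp, netTransfer]
    simp only [Prod.fst_zero, Prod.snd_zero, NNReal.coe_zero]
    linarith
  have n3 := mul_le_mul_of_nonneg_left n1 hδ.le
  have n4 := mul_le_mul_of_nonneg_left n2 hδ.le
  have n5 := mul_le_mul_of_nonneg_left b2.2.1 hE.delta_nonneg
  have n6 := mul_le_mul_of_nonneg_left b1.2.2 hE.delta_nonneg
  simp only at n5 n6 s1
  have e9 : (⟨X, σ.R.interim h X⟩ : Paid).inR = r.inR := rfl
  rw [div_mul_eq_mul_div, le_div_iff₀ hδ]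
  change (1 - E.δ) * (E.u .sender r.dec θ₀ - (netTransfer X.exS X.exR +
    netTransfer X.inS r.inR)) + E.δ * vS ≤ _ at s1
  linarith

/-- No type of the sender gains by another report. -/
lemma sender_report {θ₀ : ℝ} (hθ₀ : θ₀ ∈ Icc (0 : ℝ) 1) (h : History) {x : Opening}
    (hx : x.signal = ψ.cell θ₀) {θ : ℝ} (hθ : θ ∈ ψ.cell θ₀) (y : Set ℝ × Transfer) :
    E.total ψ σ .sender h θ (σ.afterReported h ⟨x, y.1, y.2⟩) ≤
      E.total ψ σ .sender h θ (σ.afterOpening h x θ) := by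
  obtain ⟨hag, hm⟩ := hE.misreport_measurable (σ := σ) (ψ := ψ) (h := h) x θ y (H.measurableFrom h)
  have key := (H.sender_rational h _ (H.sender_bounded.misreport h x θ y) hm θ₀ hθ₀).2.1
    x hx θ (hx ▸ hθ)
  rw [hag.total_eq] at key
  convert key using 2
  simp only [Profile.afterOpening, SenderStrategy.misreport, and_self, if_true]
  rfl

/-- After paying nothing ex ante, a type of the sender can report without paying. -/
lemma sender_free_report {vS vR vbar : ℝ} (hb : E.PayoffBounds ψ vS vR vbar) {θ₀ : ℝ}
    (hθ₀ : θ₀ ∈ Icc (0 : ℝ) 1) (h : History) {x : Opening}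
    (hx : x.signal = ψ.cell θ₀) (hx0 : x.exS = 0) {θ : ℝ} (hθ : θ ∈ ψ.cell θ₀) :
    (1 - E.δ) * E.u .sender (σ.afterReported h ⟨x, ∅, 0⟩).dec θ + E.δ * vS ≤
      E.total ψ σ .sender h θ (σ.afterOpening h x θ) := by
  have hδ : 0 < 1 - E.δ := sub_pos.2 hE.delta_lt_one
  refine le_trans ?_ (hE.sender_report H hθ₀ h hx hθ (∅, 0))
  set r := σ.afterReported h ⟨x, ∅, 0⟩ with hr
  have := hE.sender_expost H hb hθ₀ h (D := ⟨⟨⟨x, ∅, 0⟩, r.inR⟩, r.dec⟩) hx hθ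
  refine le_trans ?_ this
  have e : netTransfer x.exS x.exR + netTransfer 0 r.inR ≤ 0 := by
    have p1 := r.inR.1.2
    have p2 := x.exR.1.2
    simp only [NNReal.val_eq_coe] at p1 p2
    rw [hx0]
    simp only [netTransfer, Prod.fst_zero, Prod.snd_zero, NNReal.coe_zero]
    linarith
  have e2 := mul_le_mul_of_nonneg_left e hδ.le
  change _ ≤ (1 - E.δ) * (E.u .sender r.dec θ - (netTransfer x.exS x.exR +
    netTransfer 0 r.inR)) + E.δ * vS
  linarith

/-- The law of the state given the signal is at least as good for a function as the beliefs. -/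
lemma integral_le_of_beliefs {θ₀ : ℝ} (hθ₀ : θ₀ ∈ Icc (0 : ℝ) 1) (h : History) {x : Opening}
    (hx : x.signal = ψ.cell θ₀) {F G : ℝ → ℝ}
    (hF : Integrable F (condLaw E.prior (ψ.cell θ₀)))
    (hG : Integrable G (condLaw E.prior (ψ.cell θ₀))) {C : ℝ}
    (hC : ∀ θ ∈ ψ.cell θ₀, |F θ - G θ| ≤ C)
    (hle : ∀ θ ∈ ψ.cell θ₀, 0 ≤ ∫ x', (F x' - G x')
      ∂β h ⟨x, (σ.S.report h x θ).1, (σ.S.report h x θ).2⟩) :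
    ∫ θ, G θ ∂condLaw E.prior (ψ.cell θ₀) ≤ ∫ θ, F θ ∂condLaw E.prior (ψ.cell θ₀) := by
  have hc := ψ.isCell subset_rfl hθ₀
  have := hE.isProbabilityMeasure_condLaw hc
  obtain ⟨h1, h2, h3⟩ := H.consistent h θ₀ hθ₀ x hx
  rw [hx] at h3
  refine integral_le_of_disintegration (.of_forall fun θ => (h1 _ _).1) h3 hF hG (C := C) ?_ ?_
  · filter_upwards [hE.ae_mem_condLaw hc] with θ hθ using hC θ hθ
  · filter_upwards [hE.ae_mem_condLaw hc] with θ hθ using hle θ hθ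

/-- The belief after a report of the sender is concentrated on the states with this report. -/
lemma ae_belief_class {θ₀ : ℝ} (hθ₀ : θ₀ ∈ Icc (0 : ℝ) 1) (h : History) {x : Opening}
    (hx : x.signal = ψ.cell θ₀) {θ : ℝ} (hθ : θ ∈ ψ.cell θ₀) :
    ∀ᵐ θ' ∂β h ⟨x, (σ.S.report h x θ).1, (σ.S.report h x θ).2⟩,
      θ' ∈ ψ.cell θ₀ ∧ σ.S.report h x θ' = σ.S.report h x θ := by
  obtain ⟨h1, h2, h3⟩ := H.consistent h θ₀ hθ₀ x hx
  have := h2 θ (hx ▸ hθ)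
  rw [hx] at this
  exact this

lemma integrable_total_opening {θ₀ : ℝ} (hθ₀ : θ₀ ∈ Icc (0 : ℝ) 1) (h : History) (p q : Transfer)
    (i : Player) :
    Integrable (fun θ => E.total ψ σ i h θ (σ.afterOpening h ⟨ψ.cell θ₀, p, q⟩ θ))
      (condLaw E.prior (ψ.cell θ₀)) ∧
    ∃ C, ∀ θ ∈ ψ.cell θ₀, |E.total ψ σ i h θ (σ.afterOpening h ⟨ψ.cell θ₀, p, q⟩ θ)| ≤ C := by
  have hc := ψ.isCell subset_rfl hθ₀
  have := hE.isProbabilityMeasure_condLaw hc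
  have hδ : 0 < 1 - E.δ := sub_pos.2 hE.delta_lt_one
  obtain ⟨B, hB0, hB⟩ := Profile.exists_bound_afterOpening H.sender_bounded H.receiver_bounded
  have hB' : ∀ θ, |(σ.afterOpening h ⟨ψ.cell θ₀, p, q⟩ θ).dec| ≤
      B + Transfer.size p + Transfer.size q ∧ ∀ i,
      |(σ.afterOpening h ⟨ψ.cell θ₀, p, q⟩ θ).net i| ≤ B + Transfer.size p + Transfer.size q :=
    fun θ => ⟨(hB _ _ _).1.trans (by linarith [p.size_nonneg, q.size_nonneg]), (hB _ _ _).2⟩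
  refine ⟨hE.integrable_total H.sender_bounded H.receiver_bounded (hE.ae_unit_condLaw hc)
    ((H.measurable h List.nil_prefix).2 θ₀ hθ₀ p q).2 (.of_forall hB') i, ?_⟩
  obtain ⟨C, -, hC⟩ := hE.exists_value_bound ψ H.sender_bounded H.receiver_bounded
  obtain ⟨C', -, hC'⟩ := hE.exists_stage_bound (B + Transfer.size p + Transfer.size q)
  refine ⟨(1 - E.δ) * C' + E.δ * C, fun θ hθ => (abs_add_le _ _).trans (add_le_add ?_ ?_)⟩
  · rw [abs_mul, abs_of_pos hδ]
    exact mul_le_mul_of_nonneg_left (hC' i θ _ (hc.subset hθ) (hB' θ).1 ((hB' θ).2 i)) hδ.le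
  · rw [abs_mul, abs_of_nonneg hE.delta_nonneg]
    exact mul_le_mul_of_nonneg_left (hC i _) hE.delta_nonneg

/-- The receiver can ignore the reports and pay nothing. -/
lemma receiver_lower {vS vR vbar : ℝ} (hb : E.PayoffBounds ψ vS vR vbar) {θ₀ : ℝ}
    (hθ₀ : θ₀ ∈ Icc (0 : ℝ) 1) (h : History) (d : ℝ) :
    (1 - E.δ) * ∫ θ, E.u .receiver d θ ∂condLaw E.prior (ψ.cell θ₀) + E.δ * vR ≤
      ∫ θ, E.total ψ σ .receiver h θ (σ.afterSignal h (ψ.cell θ₀) θ)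
        ∂condLaw E.prior (ψ.cell θ₀) := by
  have hδ : 0 < 1 - E.δ := sub_pos.2 hE.delta_lt_one
  have hc := ψ.isCell subset_rfl hθ₀
  have := hE.isProbabilityMeasure_condLaw hc
  have hκ := hE.ae_unit_condLaw hc
  set s := ψ.cell θ₀ with hs
  set p := σ.S.exAnte h s with hp
  obtain ⟨hag, hm⟩ := hE.receiverSkipExAnte_measurable (σ := σ) (ψ := ψ) (h := h) hθ₀
    (H.measurableFrom h)
  have key := (H.receiver_rational h _ (H.receiver_bounded.skipExAnte h s) hm θ₀ hθ₀).1 p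
  refine le_trans ?_ key
  have hrec : ∀ θ, (⟨σ.S, σ.R.skipExAnte h s⟩ : Profile).afterSenderExAnte h s p θ =
      σ.afterOpening h ⟨s, p, 0⟩ θ := fun θ => by
    simp only [Profile.afterSenderExAnte, ReceiverStrategy.skipExAnte, and_self, if_true]
    rfl
  have hrec' : ∫ θ, E.total ψ σ .receiver h θ
      ((⟨σ.S, σ.R.skipExAnte h s⟩ : Profile).afterSenderExAnte h s p θ) ∂condLaw E.prior s =
      ∫ θ, E.total ψ σ .receiver h θ (σ.afterOpening h ⟨s, p, 0⟩ θ) ∂condLaw E.prior s :=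
    integral_congr_ae (.of_forall fun θ => by simp only [hrec])
  refine le_of_le_of_eq ?_ (hrec'.symm.trans
    (integral_congr_ae (.of_forall fun θ => (hag.total_eq .receiver θ _).symm)))
  obtain ⟨hint, C, hC⟩ := hE.integrable_total_opening H hθ₀ h p 0 .receiver
  have hu := hE.integrable_u_const hκ .receiver d
  have hG : Integrable (fun θ => (1 - E.δ) * E.u .receiver d θ + E.δ * vR)
      (condLaw E.prior s) := (hu.const_mul _).add (integrable_const _)
  have e0 : (1 - E.δ) * ∫ θ, E.u .receiver d θ ∂condLaw E.prior s + E.δ * vR =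
      ∫ θ, ((1 - E.δ) * E.u .receiver d θ + E.δ * vR) ∂condLaw E.prior s := by
    rw [integral_add (hu.const_mul _) (integrable_const _), integral_const_mul]
    simp
  rw [e0]
  obtain ⟨Cu, hCu⟩ := hE.bounded_u |d|
  -- After each report the receiver could decide `d` and pay nothing, with at least `vR` to follow.
  -- By consistency her beliefs average to the law given the signal.
  refine hE.integral_le_of_beliefs H hθ₀ h (x := ⟨s, p, 0⟩) rfl hint hG
    (C := C + ((1 - E.δ) * Cu + |E.δ * vR|)) (fun θ hθ => ?_) fun θ hθ => ?_
  · refine (abs_sub _ _).trans (add_le_add (hC θ hθ) ((abs_add_le _ _).trans ?_))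
    rw [abs_mul, abs_of_pos hδ]
    gcongr
    exact hCu _ _ _ le_rfl (hc.subset hθ)
  · set X : Reported := ⟨⟨s, p, 0⟩, (σ.S.report h ⟨s, p, 0⟩ θ).1, (σ.S.report h ⟨s, p, 0⟩ θ).2⟩
      with hX
    obtain ⟨_, -⟩ := H.belief hθ₀ h (X := X) rfl
    have hβ := H.ae_belief_unit hθ₀ h (X := X) rfl
    have hcl := hE.ae_belief_class H hθ₀ h (x := ⟨s, p, 0⟩) rfl hθ
    have hF : ∀ᵐ θ' ∂β h X, E.total ψ σ .receiver h θ' (σ.afterOpening h ⟨s, p, 0⟩ θ') =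
        E.total ψ σ .receiver h θ' (σ.afterReported h X) := by
      filter_upwards [hcl] with θ' hθ'
      simp only [Profile.afterOpening, hθ'.2]
      rfl
    have hu' := hE.integrable_u_const hβ .receiver
    have hFi : Integrable (fun θ' => E.total ψ σ .receiver h θ' (σ.afterReported h X)) (β h X) := by
      simp only [total, stage]
      exact (((hu' _).sub (integrable_const _)).const_mul _).add (integrable_const _)
    have hGi : Integrable (fun θ' => (1 - E.δ) * E.u .receiver d θ' + E.δ * vR) (β h X) :=
      ((hu' d).const_mul _).add (integrable_const _)
    rw [integral_congr_ae (g := fun θ' => E.total ψ σ .receiver h θ' (σ.afterReported h X) -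
      ((1 - E.δ) * E.u .receiver d θ' + E.δ * vR)) (by
        filter_upwards [hF] with θ' h1; rw [h1]),
      integral_sub hFi hGi, sub_nonneg,
      integral_add ((hu' d).const_mul _) (integrable_const _), integral_const_mul]
    obtain ⟨hag', hm'⟩ := hE.deviate_measurable (X := X) hθ₀ rfl d (H.measurableFrom h)
    have key2 := (H.receiver_rational h _ (H.receiver_bounded.deviate h X d) hm' θ₀ hθ₀).2.1 X rfl
    simp only [hag'.total_eq] at key2
    refine le_trans ?_ key2
    rw [hE.integral_total_const hβ]
    set r := (⟨σ.S, σ.R.deviate h X d⟩ : Profile).afterReported h X with hr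
    have hd : r.dec = d := by
      simp [hr, Profile.afterReported, Profile.afterPaid, Profile.afterDecided,
        Profile.afterSettling, ReceiverStrategy.deviate]
    have hp : r.postR = 0 := by
      simp [hr, Profile.afterReported, Profile.afterPaid, Profile.afterDecided,
        Profile.afterSettling, ReceiverStrategy.deviate]
    have hi : r.inR = 0 := by
      simp [hr, Profile.afterReported, Profile.afterPaid, Profile.afterDecided,
        Profile.afterSettling, ReceiverStrategy.deviate]
    have hx : r.exR = 0 := rfl
    have hn : r.net .receiver ≤ 0 := by
      simp only [Record.net, hp, hi, hx]
      have : ∀ q : Transfer, netTransfer 0 q ≤ 0 := fun q => by simp [netTransfer]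
      have a1 := this r.exS
      have a2 := this r.inS
      have a3 := this r.postS
      linarith
    have b := (hb _ (H.value_mem (h ++ [r]))).2.1
    simp only at b
    rw [hd]
    have b1 := mul_le_mul_of_nonneg_left b hE.delta_nonneg
    have b2 := mul_le_mul_of_nonneg_left hn hδ.le
    simp only [integral_const, probReal_univ, one_smul]
    linarith

end Standing
end Env

/-! ## The envelope formula -/

namespace Env.Standing

variable {E : Env} (hE : E.Standing)
include hE

lemma aemeasurable_partialTheta {κ : Measure ℝ} (hκ : ∀ᵐ θ ∂κ, θ ∈ Icc (0 : ℝ) 1) (i : Player)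
    {ρ : ℝ → ℝ} (hρ : AEMeasurable ρ κ) :
    AEMeasurable (fun θ => partialTheta (E.u i) (ρ θ) θ) κ := by
  have h := (hE.continuous_partialTheta i).measurable.comp_aemeasurable (hρ.prodMk aemeasurable_id)
  refine h.congr ?_
  filter_upwards [hκ] with θ hθ
  simp [clampUnit_of_mem hθ]

variable {S : Set ℝ} (hS : S.OrdConnected) (hsub : S ⊆ Icc 0 1)
include hS hsub

lemma intervalIntegrable_partialTheta (i : Player) {ρ : ℝ → ℝ} (hρ : MonotoneOn ρ S) {a b : ℝ}
    (ha : a ∈ S) (hb : b ∈ S) :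
    IntervalIntegrable (fun x => partialTheta (E.u i) (ρ x) x) volume a b := by
  have hab : uIcc a b ⊆ S := hS.uIcc_subset ha hb
  have hIoc : uIoc a b ⊆ S := uIoc_subset_uIcc.trans hab
  obtain ⟨C, hC⟩ := hE.bounded_partialTheta i (max |ρ (min a b)| |ρ (max a b)|)
  rw [intervalIntegrable_iff]
  have hκ : ∀ᵐ x ∂volume.restrict (uIoc a b), x ∈ uIoc a b := ae_restrict_mem measurableSet_uIoc
  have : IsFiniteMeasure (volume.restrict (uIoc a b)) := ⟨by simp [uIoc]⟩
  refine integrable_of_bounded (C := C) ?_ ?_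
  · refine hE.aemeasurable_partialTheta (hκ.mono fun x hx => hsub (hIoc hx)) i ?_
    exact aemeasurable_restrict_of_monotoneOn measurableSet_uIoc (hρ.mono hIoc)
  · filter_upwards [hκ] with x hx
    have hx' := uIoc_subset_uIcc hx
    refine hC _ _ ?_ (hsub (hIoc hx))
    have h1 := hρ (hab ⟨le_rfl, min_le_max⟩) (hab hx') hx'.1
    have h2 := hρ (hab hx') (hab ⟨min_le_max, le_rfl⟩) hx'.2
    rw [max_comm]
    exact abs_le_max_abs_abs h1 h2 |>.trans (by rw [max_comm])

lemma integral_partialTheta_mono (i : Player) {ρ ρ' : ℝ → ℝ} (hρ : MonotoneOn ρ S)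
    (hρ' : MonotoneOn ρ' S) {a b : ℝ} (ha : a ∈ S) (hb : b ∈ S) (hab : a ≤ b)
    (h : ∀ x ∈ Icc a b, ρ x ≤ ρ' x) :
    ∫ x in a..b, partialTheta (E.u i) (ρ x) x ≤ ∫ x in a..b, partialTheta (E.u i) (ρ' x) x :=
  intervalIntegral.integral_mono_on hab (hE.intervalIntegrable_partialTheta hS hsub i hρ ha hb)
    (hE.intervalIntegrable_partialTheta hS hsub i hρ' ha hb) fun x hx =>
      (hE.strictMono_partialTheta i (hsub (hS.out ha hb hx))).monotone (h x hx)

lemma integral_partialTheta_adjacent (i : Player) {ρ : ℝ → ℝ} (hρ : MonotoneOn ρ S) {a b c : ℝ}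
    (ha : a ∈ S) (hb : b ∈ S) (hc : c ∈ S) :
    (∫ x in a..b, partialTheta (E.u i) (ρ x) x) + (∫ x in b..c, partialTheta (E.u i) (ρ x) x) =
      ∫ x in a..c, partialTheta (E.u i) (ρ x) x :=
  intervalIntegral.integral_add_adjacent_intervals
    (hE.intervalIntegrable_partialTheta hS hsub i hρ ha hb)
    (hE.intervalIntegrable_partialTheta hS hsub i hρ hb hc)

lemma lipschitz_integral_partialTheta (i : Player) {ρ : ℝ → ℝ} (hρ : MonotoneOn ρ S) {B : ℝ}
    (hB : ∀ θ ∈ S, |ρ θ| ≤ B) : ∃ C, 0 ≤ C ∧ ∀ a ∈ S, ∀ b ∈ S,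
      |∫ x in a..b, partialTheta (E.u i) (ρ x) x| ≤ C * |b - a| := by
  obtain ⟨C, hC⟩ := hE.bounded_partialTheta i B
  refine ⟨max C 0, le_max_right _ _, fun a ha b hb => ?_⟩
  rw [← Real.norm_eq_abs]
  refine intervalIntegral.norm_integral_le_of_norm_le_const fun x hx => ?_
  have hx' := hS.uIcc_subset ha hb (uIoc_subset_uIcc hx)
  exact (hC _ _ (hB x hx') (hsub hx')).trans (le_max_left _ _)

lemma continuousOn_integral_partialTheta (i : Player) {ρ : ℝ → ℝ} (hρ : MonotoneOn ρ S) {B : ℝ}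
    (hB : ∀ θ ∈ S, |ρ θ| ≤ B) {t : ℝ} (ht : t ∈ S) :
    ContinuousOn (fun θ => ∫ x in t..θ, partialTheta (E.u i) (ρ x) x) S := by
  obtain ⟨C, hC0, hC⟩ := hE.lipschitz_integral_partialTheta hS hsub i hρ hB
  refine (LipschitzOnWith.of_dist_le_mul (K := C.toNNReal) fun a ha b hb => ?_).continuousOn
  rw [Real.dist_eq, Real.dist_eq, abs_sub_comm, Real.coe_toNNReal _ hC0,
    ← hE.integral_partialTheta_adjacent hS hsub i hρ ht ha hb, add_sub_cancel_left, abs_sub_comm]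
  exact hC a ha b hb

/-- A rent that satisfies the envelope formula with monotone decisions deters imitation. -/
lemma deter_of_envelope (i : Player) {ρ W : ℝ → ℝ} (hρ : MonotoneOn ρ S)
    (hW : ∀ θ ∈ S, ∀ θ' ∈ S, W θ' - W θ = ∫ x in θ..θ', partialTheta (E.u i) (ρ x) x) {θ θ' : ℝ}
    (hθ : θ ∈ S) (hθ' : θ' ∈ S) :
    W θ + (E.u i (ρ θ) θ' - E.u i (ρ θ) θ) ≤ W θ' := by
  have hc : MonotoneOn (fun _ => ρ θ) S := monotoneOn_const
  rcases le_total θ θ' with h | h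
  · have := hE.integral_partialTheta_mono hS hsub i hc hρ hθ hθ' h fun x hx =>
      hρ hθ (hS.out hθ hθ' hx) hx.1
    rw [hE.integral_partialTheta i _ (hsub hθ) (hsub hθ'), ← hW θ hθ θ' hθ'] at this
    linarith
  · have := hE.integral_partialTheta_mono hS hsub i hρ hc hθ' hθ h fun x hx =>
      hρ (hS.out hθ' hθ hx) hθ hx.2
    rw [hE.integral_partialTheta i _ (hsub hθ') (hsub hθ), ← hW θ' hθ' θ hθ] at this
    linarith

/-- Add the constraints of two states against each other. With a lower decision in the higher state
the sum would contradict increasing differences. -/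
lemma monotoneOn_of_deter (i : Player) {ρ W : ℝ → ℝ}
    (hW : ∀ θ ∈ S, ∀ θ' ∈ S, W θ + (E.u i (ρ θ) θ' - E.u i (ρ θ) θ) ≤ W θ') :
    MonotoneOn ρ S := by
  intro θ hθ θ' hθ' h
  by_contra hlt
  push Not at hlt
  have hne : θ < θ' := h.lt_of_ne fun e => by rw [e] at hlt; exact lt_irrefl _ hlt
  have h1 := hE.increasing_differences i hlt (hsub hθ) (hsub hθ') hne
  linarith [hW θ hθ θ' hθ', hW θ' hθ' θ hθ]

/-- The two constraints of a pair of states sandwich the increment of `W` between increments of `u`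
at the two decisions. So `W` is Lipschitz and has the expected derivative wherever `ρ` is
continuous. Being monotone, `ρ` is discontinuous at countably many states only. -/
lemma envelope (i : Player) {ρ W : ℝ → ℝ} {B : ℝ} (hB : ∀ θ ∈ S, |ρ θ| ≤ B)
    (hW : ∀ θ ∈ S, ∀ θ' ∈ S, W θ + (E.u i (ρ θ) θ' - E.u i (ρ θ) θ) ≤ W θ') {a b : ℝ}
    (ha : a ∈ S) (hb : b ∈ S) :
    W b - W a = ∫ x in a..b, partialTheta (E.u i) (ρ x) x := by
  have hρ := hE.monotoneOn_of_deter hS hsub i hW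
  obtain ⟨C, hC⟩ := hE.bounded_partialTheta i B
  have hab : uIcc a b ⊆ S := hS.uIcc_subset ha hb
  have hdiff : ∀ d c, ∀ x ∈ S, ∀ y ∈ S, ∀ ε, (∀ z ∈ uIcc x y,
      |partialTheta (E.u i) d z - c| ≤ ε) → |E.u i d y - E.u i d x - (y - x) * c| ≤ ε * |y - x| := by
    intro d c x hx y hy ε hε
    have hi : IntervalIntegrable (fun z => partialTheta (E.u i) d z) volume x y :=
      hE.intervalIntegrable_partialTheta hS hsub i (ρ := fun _ => d) monotoneOn_const hx hy
    rw [← hE.integral_partialTheta i d (hsub hx) (hsub hy), ← smul_eq_mul (y - x) c,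
      ← intervalIntegral.integral_const, ← intervalIntegral.integral_sub hi (by simp),
      ← Real.norm_eq_abs]
    exact intervalIntegral.norm_integral_le_of_norm_le_const fun z hz =>
      hε z (uIoc_subset_uIcc hz)
  have hsand : ∀ c, ∀ x ∈ S, ∀ y ∈ S, ∀ ε, (∀ z ∈ uIcc x y,
      |partialTheta (E.u i) (ρ x) z - c| ≤ ε ∧ |partialTheta (E.u i) (ρ y) z - c| ≤ ε) →
      |W y - W x - (y - x) * c| ≤ ε * |y - x| := by
    intro c x hx y hy ε hε
    have h1 := abs_le.1 (hdiff (ρ x) c x hx y hy ε fun z hz => (hε z hz).1)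
    have h2 := abs_le.1 (hdiff (ρ y) c x hx y hy ε fun z hz => (hε z hz).2)
    rw [abs_le]
    constructor <;> linarith [hW x hx y hy, hW y hy x hx]
  symm
  refine MeasureTheory.integral_eq_of_hasDerivAt_off_countable W _
    hρ.countable_not_continuousWithinAt ?_ ?_
    (hE.intervalIntegrable_partialTheta hS hsub i hρ ha hb)
  · have hC0 : 0 ≤ C := (abs_nonneg _).trans (hC _ _ (hB a ha) (hsub ha))
    refine (LipschitzOnWith.of_dist_le_mul (K := C.toNNReal) fun y hy x hx => ?_).continuousOn
    have := hsand 0 x (hab hx) y (hab hy) C fun z hz => by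
      have hz' := hsub (hS.uIcc_subset (hab hx) (hab hy) hz)
      simp only [sub_zero]
      exact ⟨hC _ _ (hB x (hab hx)) hz', hC _ _ (hB y (hab hy)) hz'⟩
    simpa [Real.dist_eq, hC0] using this
  · rintro θ ⟨hθ, hcont⟩
    have hθS : θ ∈ S := hab ⟨hθ.1.le, hθ.2.le⟩
    have hnhds : S ∈ nhds θ := Filter.mem_of_superset (Icc_mem_nhds hθ.1 hθ.2) hab
    have hcont : ContinuousAt ρ θ := by
      simp only [mem_ofPred_eq, not_and, not_not] at hcont
      exact (hcont hθS).continuousAt hnhds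
    rw [hasDerivAt_iff_isLittleO, Asymptotics.isLittleO_iff]
    intro ε hε
    have hcc := (hE.continuous_partialTheta i).continuousAt (x := (ρ θ, θ))
    rw [Metric.continuousAt_iff] at hcc
    obtain ⟨η, hη, hcc⟩ := hcc ε hε
    rw [Metric.continuousAt_iff] at hcont
    obtain ⟨η', hη', hcont⟩ := hcont η hη
    have hev : ∀ᶠ y in nhds θ, y ∈ S ∧ dist y θ < min η η' :=
      (Filter.eventually_of_mem hnhds fun _ h => h).and (Metric.ball_mem_nhds _ (lt_min hη hη'))
    filter_upwards [hev] with y hy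
    have := hsand (partialTheta (E.u i) (ρ θ) θ) θ hθS y hy.1 ε fun z hz => by
      have hzS := hS.uIcc_subset hθS hy.1 hz
      have hzd : dist z θ < η := lt_of_le_of_lt (by
        rw [Real.dist_eq, Real.dist_eq]
        rw [abs_sub_comm, abs_sub_comm y]
        rw [uIcc_comm] at hz
        exact abs_sub_right_of_mem_uIcc hz) (hy.2.trans_le (min_le_left _ _))
      have key : ∀ d, dist d (ρ θ) < η →
          |partialTheta (E.u i) d z - partialTheta (E.u i) (ρ θ) θ| ≤ ε := fun d hd => by
        have := hcc (x := (d, z)) (by rw [Prod.dist_eq]; exact max_lt hd hzd)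
        simp only [clampUnit_of_mem (hsub hzS), clampUnit_of_mem (hsub hθS)] at this
        exact this.le
      exact ⟨key _ (by simpa using hη), key _ (hcont (hy.2.trans_le (min_le_right _ _)))⟩
    simpa [Real.norm_eq_abs, smul_eq_mul] using this

end Env.Standing

/-! ## Decision outcomes and rents that equilibria induce -/

namespace Env

/-- Decisions on the set `s` of states that are monotone and that, pooled on any union of messages,
tempt the receiver by at most `L` in either direction. -/
structure Poolable (E : Env) (L : ℝ) (s : Set ℝ) (ρ : ℝ → ℝ) : Prop where
  bounded : ∃ B, ∀ θ ∈ s, |ρ θ| ≤ B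
  monotone : MonotoneOn ρ s
  -- The last condition on `g` makes it a union of sets with a common decision, hence of sets with a
  -- common report. Beliefs after these reports then average to the law given `g`.
  below : ∀ g, IsCell g → g ⊆ s → (∀ θ ∈ g, ∀ θ' ∈ s, ρ θ' = ρ θ → θ' ∈ g) →
    ∀ e, (∀ θ ∈ g, e ≤ ρ θ) → E.TolBelow L (condLaw E.prior g) e
  above : ∀ g, IsCell g → g ⊆ s → (∀ θ ∈ g, ∀ θ' ∈ s, ρ θ' = ρ θ → θ' ∈ g) →
    ∀ e, (∀ θ ∈ g, ρ θ ≤ e) → E.TolAbove L (condLaw E.prior g) e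

/-- `W` is a rent of the sender that deters him from imitating other states, and that is at least
what he gets when he sends an unexpected message without paying. -/
structure Rent (E : Env) (L : ℝ) (s : Set ℝ) (ρ W : ℝ → ℝ) : Prop where
  deter : ∀ θ ∈ s, ∀ θ' ∈ s, W θ + (E.u .sender (ρ θ) θ' - E.u .sender (ρ θ) θ) ≤ W θ'
  outside : ∃ d, (∃ θ ∈ closure s, E.Tol L (Measure.dirac θ) d) ∧ ∀ θ ∈ s, E.u .sender d θ ≤ W θ

namespace Standing

variable {E : Env} {ψ : Signal} {σ : Profile} {β : History → Reported → Measure ℝ}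
variable (hE : E.Standing)
include hE

lemma setIntegral_indicator_sub {s g : Set ℝ} (hs : IsCell s) (hg : IsCell g) (hgs : g ⊆ s)
    (hpos : 0 < E.prior g) {F : ℝ → ℝ}
    (h : 0 ≤ ∫ θ, g.indicator F θ ∂condLaw E.prior s) : 0 ≤ ∫ θ, F θ ∂condLaw E.prior g := by
  have hspos : 0 < E.prior s := hpos.trans_le (measure_mono hgs)
  rw [integral_condLaw hspos] at h
  rw [integral_condLaw hpos]
  have h2 := nonneg_of_mul_nonneg_right h (inv_pos.2 (hE.toReal_pos hspos))
  rw [integral_indicator hg.measurableSet, Measure.restrict_restrict hg.measurableSet,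
    inter_eq_left.2 hgs] at h2
  exact mul_nonneg (inv_nonneg.2 ENNReal.toReal_nonneg) h2

variable (H : E.IsEquilibrium ψ σ β)
include H

/-- An inequality that holds for the beliefs after the messages from `g` holds on average. -/
lemma integral_pool {θ₀ : ℝ} (hθ₀ : θ₀ ∈ Icc (0 : ℝ) 1) (h : History) {x : Opening}
    (hx : x.signal = ψ.cell θ₀) {g : Set ℝ} (hg : IsCell g) (hgs : g ⊆ ψ.cell θ₀)
    (hsat : ∀ θ ∈ g, ∀ θ' ∈ ψ.cell θ₀, (σ.afterOpening h x θ').dec = (σ.afterOpening h x θ).dec →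
      θ' ∈ g)
    {F : ℝ → ℝ} (hF : AEMeasurable F (condLaw E.prior (ψ.cell θ₀))) {C : ℝ}
    (hC : ∀ θ ∈ ψ.cell θ₀, |F θ| ≤ C)
    (hb : ∀ θ ∈ g, 0 ≤ ∫ x', F x' ∂β h ⟨x, (σ.S.report h x θ).1, (σ.S.report h x θ).2⟩) :
    0 ≤ ∫ θ, F θ ∂condLaw E.prior g := by
  have hs := ψ.isCell subset_rfl hθ₀
  have := hE.isProbabilityMeasure_condLaw hs
  have hclass := fun θ hθ => hE.ae_belief_class H hθ₀ h hx (θ := θ) hθ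
  have hrep : ∀ θ θ', σ.S.report h x θ' = σ.S.report h x θ →
      (σ.afterOpening h x θ').dec = (σ.afterOpening h x θ).dec := fun θ θ' e => by
    simp only [Profile.afterOpening, e]
  -- A null `g` is a point, on which the belief after its report is concentrated by saturation.
  -- Otherwise the indicator of `g` times `F` is averaged over the signal realization; saturation
  -- makes the indicator constant under each belief.
  by_cases hpos : E.prior g = 0
  · obtain ⟨θ, hθ⟩ := hg.nonempty
    have e := hE.eq_singleton hg hpos hθ
    have h2 : ∀ᵐ x' ∂β h ⟨x, (σ.S.report h x θ).1, (σ.S.report h x θ).2⟩, F x' = F θ := by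
      filter_upwards [hclass θ (hgs hθ)] with x' hx'
      have : x' ∈ g := hsat θ hθ x' hx'.1 (hrep _ _ hx'.2)
      rw [e] at this
      rw [mem_singleton_iff.1 this]
    have h1 := hb θ hθ
    obtain ⟨_, -⟩ := H.belief hθ₀ h
      (X := ⟨x, (σ.S.report h x θ).1, (σ.S.report h x θ).2⟩) hx
    rw [integral_congr_ae h2] at h1
    rw [e, hE.condLaw_singleton, integral_dirac]
    simpa using h1
  · refine hE.setIntegral_indicator_sub hs hg hgs (pos_iff_ne_zero.2 hpos) ?_
    have hC0 : 0 ≤ C := (abs_nonneg _).trans (hC θ₀ (ψ.mem_cell θ₀ hθ₀))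
    have hbd : ∀ θ ∈ ψ.cell θ₀, |g.indicator F θ| ≤ C := fun θ hθ => by
      by_cases hm : θ ∈ g
      · rw [indicator_of_mem hm]; exact hC θ hθ
      · rw [indicator_of_notMem hm]; simpa using hC0
    have hint : Integrable (g.indicator F) (condLaw E.prior (ψ.cell θ₀)) := by
      refine integrable_of_bounded (C := C) (hF.indicator hg.measurableSet) ?_
      filter_upwards [hE.ae_mem_condLaw hs] with θ hθ using hbd θ hθ
    have := hE.integral_le_of_beliefs H hθ₀ h hx hint (integrable_zero ℝ ℝ _) (C := C)
      (fun θ hθ => by simpa using hbd θ hθ) fun θ hθ => ?_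
    · simpa using this
    · simp only [Pi.zero_apply, sub_zero]
      by_cases hm : θ ∈ g
      · rw [integral_congr_ae (g := F)]
        · exact hb θ hm
        · filter_upwards [hclass θ hθ] with x' hx'
          exact indicator_of_mem (hsat θ hm x' hx'.1 (hrep _ _ hx'.2)) _
      · rw [integral_congr_ae (g := fun _ => 0)]
        · simp
        · filter_upwards [hclass θ hθ] with x' hx'
          refine indicator_of_notMem (fun hm' => hm ?_) _
          exact hsat x' hm' θ hθ (hrep _ _ hx'.2).symm

/-- Imitating `θ` reproduces the public record of `θ`, so transfers and continuation agree and only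
the current payoff from the decision depends on the true state. -/
lemma deter_of_equilibrium {θ₀ : ℝ} (hθ₀ : θ₀ ∈ Icc (0 : ℝ) 1) (h : History) {x : Opening}
    (hx : x.signal = ψ.cell θ₀) {θ θ' : ℝ} (hθ : θ ∈ ψ.cell θ₀) (hθ' : θ' ∈ ψ.cell θ₀) :
    E.total ψ σ .sender h θ (σ.afterOpening h x θ) + (1 - E.δ) *
      (E.u .sender (σ.afterOpening h x θ).dec θ' - E.u .sender (σ.afterOpening h x θ).dec θ) ≤
      E.total ψ σ .sender h θ' (σ.afterOpening h x θ') := by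
  refine le_trans (le_of_eq ?_) (hE.sender_report H hθ₀ h hx hθ' (σ.S.report h x θ))
  have e : σ.afterReported h ⟨x, (σ.S.report h x θ).1, (σ.S.report h x θ).2⟩ =
    σ.afterOpening h x θ := rfl
  rw [e]
  simp only [total, stage]
  ring

/-- For fixed `e` and `d'` the receiver's gain is linear in the belief, so a bound that holds after
every report from `g` holds given `g`. Each equilibrium decision is first replaced by the common
bound `e`, to which one-sided tolerance extends. -/
lemma poolable_of_equilibrium {vS vR vbar : ℝ} (hb : E.PayoffBounds ψ vS vR vbar) {θ₀ : ℝ}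
    (hθ₀ : θ₀ ∈ Icc (0 : ℝ) 1) (h : History) {x : Opening} (hx : x.signal = ψ.cell θ₀) :
    E.Poolable (E.δ / (1 - E.δ) * (vbar - vS - vR)) (ψ.cell θ₀)
      fun θ => (σ.afterOpening h x θ).dec := by
  have hδ : 0 < 1 - E.δ := sub_pos.2 hE.delta_lt_one
  have hs := ψ.isCell subset_rfl hθ₀
  have := hE.isProbabilityMeasure_condLaw hs
  obtain ⟨B, -, hB⟩ := Profile.exists_bound_afterOpening H.sender_bounded H.receiver_bounded
  set L := E.δ / (1 - E.δ) * (vbar - vS - vR) with hL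
  have hbelief := fun θ => H.belief hθ₀ h
    (X := ⟨x, (σ.S.report h x θ).1, (σ.S.report h x θ).2⟩) hx
  have hunit := fun θ => H.ae_belief_unit hθ₀ h
    (X := ⟨x, (σ.S.report h x θ).1, (σ.S.report h x θ).2⟩) hx
  have htol : ∀ θ, E.Tol L (β h ⟨x, (σ.S.report h x θ).1, (σ.S.report h x θ).2⟩)
    (σ.afterOpening h x θ).dec := fun θ => hE.tol_of_equilibrium H hb hθ₀ h hx
  have key : ∀ g, IsCell g → g ⊆ ψ.cell θ₀ → (∀ θ ∈ g, ∀ θ' ∈ ψ.cell θ₀,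
      (σ.afterOpening h x θ').dec = (σ.afterOpening h x θ).dec → θ' ∈ g) → ∀ e d',
      (∀ θ ∈ g, ∫ x', E.u .receiver d' x'
          ∂β h ⟨x, (σ.S.report h x θ).1, (σ.S.report h x θ).2⟩ -
        ∫ x', E.u .receiver e x' ∂β h ⟨x, (σ.S.report h x θ).1, (σ.S.report h x θ).2⟩ ≤ L) →
      ∫ x', E.u .receiver d' x' ∂condLaw E.prior g -
        ∫ x', E.u .receiver e x' ∂condLaw E.prior g ≤ L := by
    intro g hg hgs hsat e d' hle
    obtain ⟨C, hC⟩ := hE.bounded_u (max |e| |d'|)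
    have hi : ∀ (m : Measure ℝ) [IsProbabilityMeasure m], (∀ᵐ θ ∂m, θ ∈ Icc (0 : ℝ) 1) →
        Integrable (fun θ => E.u .receiver e θ - E.u .receiver d' θ) m ∧
        ∫ θ, (L + (E.u .receiver e θ - E.u .receiver d' θ)) ∂m =
          L + (∫ θ, E.u .receiver e θ ∂m - ∫ θ, E.u .receiver d' θ ∂m) := fun m _ hm => by
      have h1 := hE.integrable_u_const hm .receiver
      have h2 : Integrable (fun θ => E.u .receiver e θ - E.u .receiver d' θ) m :=
        (h1 e).sub (h1 d')
      refine ⟨h2, ?_⟩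
      rw [integral_add (integrable_const _) h2, integral_sub (h1 e) (h1 d')]
      simp
    have hκ := hE.ae_unit_condLaw hs
    have := hE.isProbabilityMeasure_condLaw hg
    have h3 := hE.integral_pool H hθ₀ h hx hg hgs hsat
      (F := fun θ => L + (E.u .receiver e θ - E.u .receiver d' θ))
      ((integrable_const L).add (hi _ hκ).1).aestronglyMeasurable.aemeasurable
      (C := |L| + (C + C)) (fun θ hθ => ?_) fun θ hθ => ?_
    · rw [(hi _ (hE.ae_unit_condLaw hg)).2] at h3
      linarith
    · have hθ' := hs.subset hθ
      exact (abs_add_le _ _).trans (add_le_add le_rfl ((abs_sub _ _).trans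
        (add_le_add (hC _ _ _ (le_max_left _ _) hθ') (hC _ _ _ (le_max_right _ _) hθ'))))
    · have := (hbelief θ).1
      rw [(hi _ (hunit θ)).2]
      linarith [hle θ hθ]
  refine ⟨⟨_, fun θ _ => (hB h x θ).1⟩, ?_, ?_, ?_⟩
  · refine hE.monotoneOn_of_deter hs.ordConnected hs.subset .sender
      (W := fun θ => (1 - E.δ)⁻¹ * E.total ψ σ .sender h θ (σ.afterOpening h x θ))
      fun θ hθ θ' hθ' => ?_
    have := mul_le_mul_of_nonneg_left (hE.deter_of_equilibrium H hθ₀ h hx hθ hθ')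
      (inv_nonneg.2 hδ.le)
    rwa [mul_add, inv_mul_cancel_left₀ hδ.ne'] at this
  · intro g hg hgs hsat e he d' hd'
    refine key g hg hgs hsat e d' fun θ hθ => ?_
    have := (hbelief θ).1
    exact hE.tolBelow_of_le (hunit θ) (htol θ).nonneg (tol_iff.1 (htol θ)).1 (he θ hθ) d' hd'
  · intro g hg hgs hsat e he d' hd'
    refine key g hg hgs hsat e d' fun θ hθ => ?_
    have := (hbelief θ).1
    exact hE.tolAbove_of_ge (hunit θ) (htol θ).nonneg (tol_iff.1 (htol θ)).2 (he θ hθ) d' hd'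

/-- A lower bound for the sender's equilibrium payoff given the signal. -/
lemma exists_rent {vS vR vbar : ℝ} (hb : E.PayoffBounds ψ vS vR vbar) {θ₀ : ℝ}
    (hθ₀ : θ₀ ∈ Icc (0 : ℝ) 1) (h : History) :
    ∃ ρ W : ℝ → ℝ, E.Poolable (E.δ / (1 - E.δ) * (vbar - vS - vR)) (ψ.cell θ₀) ρ ∧
      E.Rent (E.δ / (1 - E.δ) * (vbar - vS - vR)) (ψ.cell θ₀) ρ W ∧
      (1 - E.δ) * ∫ θ, W θ ∂condLaw E.prior (ψ.cell θ₀) + E.δ * vS ≤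
        ∫ θ, E.total ψ σ .sender h θ (σ.afterSignal h (ψ.cell θ₀) θ)
          ∂condLaw E.prior (ψ.cell θ₀) := by
  have hδ : 0 < 1 - E.δ := sub_pos.2 hE.delta_lt_one
  have hs := ψ.isCell subset_rfl hθ₀
  have := hE.isProbabilityMeasure_condLaw hs
  set s := ψ.cell θ₀ with hsdef
  set q := σ.R.exAnte h s 0 with hq
  set x : Opening := ⟨s, 0, q⟩ with hx
  set ρ := fun θ => (σ.afterOpening h x θ).dec with hρ
  set U := fun θ => E.total ψ σ .sender h θ (σ.afterOpening h x θ) with hU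
  have hpool := hE.poolable_of_equilibrium H hb hθ₀ h (x := x) rfl
  have hmul : ∀ y, (1 - E.δ) * ((1 - E.δ)⁻¹ * y) = y := fun y => mul_inv_cancel_left₀ hδ.ne' y
  -- The rent is the payoff of each type after no ex-ante transfer by the sender, net of the worst
  -- continuation payoff and expressed in units of the stage payoff.
  refine ⟨ρ, fun θ => (1 - E.δ)⁻¹ * (U θ - E.δ * vS), hpool, ⟨?_, ?_⟩, ?_⟩
  · intro θ hθ θ' hθ'
    refine le_of_mul_le_mul_left ?_ hδ
    rw [mul_add, hmul, hmul]
    have := hE.deter_of_equilibrium H hθ₀ h (x := x) rfl hθ hθ'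
    simp only [hU, hρ]
    linarith
  -- The report `∅` without payment is the outside option. The decision after it is tolerable under
  -- the belief held there, hence under some point belief.
  · refine ⟨(σ.afterReported h ⟨x, ∅, 0⟩).dec, ?_, fun θ hθ => ?_⟩
    · obtain ⟨_, h2⟩ := H.belief hθ₀ h (X := ⟨x, ∅, 0⟩) rfl
      exact hE.exists_tol_dirac hs.closure isClosed_closure h2
        (hE.tol_of_equilibrium H hb hθ₀ h (X := ⟨x, ∅, 0⟩) rfl)
    · refine le_of_mul_le_mul_left ?_ hδ
      rw [hmul]
      have := hE.sender_free_report H hb hθ₀ h (x := x) rfl rfl hθ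
      simp only [hU]
      linarith
  · obtain ⟨hag, hm⟩ := hE.senderSkipExAnte_measurable (σ := σ) (ψ := ψ) (h := h) hθ₀
      (H.measurableFrom h)
    have key := (H.sender_rational h _ (H.sender_bounded.skipExAnte h s) hm θ₀ hθ₀).1
    refine le_trans (le_of_eq ?_) key
    have hrec : ∀ θ, (⟨σ.S.skipExAnte h s, σ.R⟩ : Profile).afterSignal h s θ =
        σ.afterOpening h x θ := fun θ => by
      simp only [Profile.afterSignal, Profile.afterSenderExAnte, SenderStrategy.skipExAnte,
        and_self, if_true]
      rfl
    have e1 : ∫ θ, E.total ψ (⟨σ.S.skipExAnte h s, σ.R⟩ : Profile) .sender h θ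
        ((⟨σ.S.skipExAnte h s, σ.R⟩ : Profile).afterSignal h s θ) ∂condLaw E.prior s =
        ∫ θ, U θ ∂condLaw E.prior s := integral_congr_ae (.of_forall fun θ => by
      simp only [hrec, hU]
      exact hag.total_eq .sender θ _)
    refine Eq.trans ?_ e1.symm
    have hint : Integrable U (condLaw E.prior s) :=
      (hE.integrable_total_opening H hθ₀ h 0 q .sender).1
    rw [integral_const_mul, hmul, integral_sub hint (integrable_const _)]
    simp

end Standing
end Env

/-! ## Decisions that are extreme except on one message -/

/-- The states of `S` with the same label as `θ`. -/
def level {α : Type*} (S : Set ℝ) (g : ℝ → α) (θ : ℝ) : Set ℝ := {x | x ∈ S ∧ g x = g θ}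

section Level

variable {α : Type*} [LinearOrder α] {S : Set ℝ} {g : ℝ → α}

lemma ordConnected_level (hS : S.OrdConnected) (hg : MonotoneOn g S) (θ : ℝ) :
    (level S g θ).OrdConnected := by
  refine ⟨fun x hx y hy z hz => ?_⟩
  have hzS := hS.out hx.1 hy.1 hz
  exact ⟨hzS, le_antisymm ((hg hzS hy.1 hz.2).trans hy.2.le) (hx.2.ge.trans (hg hx.1 hzS hz.1))⟩

lemma isCell_level (hS : IsCell S) (hg : MonotoneOn g S) {θ : ℝ} (hθ : θ ∈ S) :
    IsCell (level S g θ) :=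
  ⟨⟨θ, hθ, rfl⟩, fun _ hx => hS.subset hx.1, ordConnected_level hS.ordConnected hg θ⟩

lemma level_eq {θ θ' : ℝ} (h : g θ = g θ') : level S g θ = level S g θ' := by
  simp only [level, h]

lemma level_lt (hg : MonotoneOn g S) {θ θ' : ℝ} (h : g θ < g θ') :
    ∀ x ∈ level S g θ, ∀ y ∈ level S g θ', x < y := fun x hx y hy => by
  by_contra hxy
  have := hg hy.1 hx.1 (not_lt.1 hxy)
  rw [hx.2, hy.2] at this
  exact absurd h (not_lt.2 this)

/-- The rule that reports a monotone label. -/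
def levelRule (hS : S.OrdConnected) (hg : MonotoneOn g S) : MonotoneRule S where
  cell := level S g
  mem_cell := fun _ hθ => ⟨hθ, rfl⟩
  cell_subset := fun _ _ _ hx => hx.1
  cell_eq := fun _ _ _ hθ' => level_eq hθ'.2
  ordConnected := fun θ _ => ordConnected_level hS hg θ

end Level

/-- On the way from `t` to `θ` the set `Z` is left once and for all, at `y`. It is applied with `Z`
the states of label zero; adding `t` to the set covers the case that no state on the way lies in
`Z`. -/
lemma exists_split {Z : Set ℝ} {t θ : ℝ}
    (hZ : ∀ x ∈ uIcc t θ, x ∈ Z → ∀ z ∈ uIoo t x, z ∈ Z) :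
    ∃ y ∈ uIcc t θ, (∀ z ∈ uIoo t y, z ∈ Z) ∧ ∀ z ∈ uIoo y θ, z ∉ Z := by
  rcases le_total t θ with h | h
  · set A := insert t (Icc t θ ∩ Z)
    have hA : ∀ x ∈ A, x ∈ Icc t θ := by
      rintro x (rfl | hx)
      exacts [⟨le_rfl, h⟩, hx.1]
    have hbdd : BddAbove A := ⟨θ, fun x hx => (hA x hx).2⟩
    have ht : t ≤ sSup A := le_csSup hbdd (mem_insert _ _)
    have hθ : sSup A ≤ θ := csSup_le ⟨t, mem_insert _ _⟩ fun x hx => (hA x hx).2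
    refine ⟨sSup A, by rw [uIcc_of_le h]; exact ⟨ht, hθ⟩, fun z hz => ?_, fun z hz hzZ => ?_⟩
    · rw [uIoo_of_le ht] at hz
      obtain ⟨x, hx, hzx⟩ := exists_lt_of_lt_csSup ⟨t, mem_insert _ _⟩ hz.2
      rcases hx with rfl | hx
      · exact absurd hz.1 hzx.not_gt
      · refine hZ x (by rw [uIcc_of_le h]; exact hx.1) hx.2 z ?_
        rw [uIoo_of_le hx.1.1]; exact ⟨hz.1, hzx⟩
    · rw [uIoo_of_le hθ] at hz
      exact hz.1.not_ge (le_csSup hbdd (.inr ⟨⟨ht.trans hz.1.le, hz.2.le⟩, hzZ⟩))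
  · set A := insert t (Icc θ t ∩ Z)
    have hA : ∀ x ∈ A, x ∈ Icc θ t := by
      rintro x (rfl | hx)
      exacts [⟨h, le_rfl⟩, hx.1]
    have hbdd : BddBelow A := ⟨θ, fun x hx => (hA x hx).1⟩
    have ht : sInf A ≤ t := csInf_le hbdd (mem_insert _ _)
    have hθ : θ ≤ sInf A := le_csInf ⟨t, mem_insert _ _⟩ fun x hx => (hA x hx).1
    refine ⟨sInf A, by rw [uIcc_of_ge h]; exact ⟨hθ, ht⟩, fun z hz => ?_, fun z hz hzZ => ?_⟩
    · rw [uIoo_of_ge ht] at hz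
      obtain ⟨x, hx, hzx⟩ := exists_lt_of_csInf_lt ⟨t, mem_insert _ _⟩ hz.1
      rcases hx with rfl | hx
      · exact absurd hz.2 hzx.not_gt
      · refine hZ x (by rw [uIcc_of_ge h]; exact hx.1) hx.2 z ?_
        rw [uIoo_of_ge hx.1.2]; exact ⟨hzx, hz.2⟩
    · rw [uIoo_of_ge hθ] at hz
      exact hz.2.not_ge (csInf_le hbdd (.inr ⟨⟨hz.1.le, hz.2.le.trans ht⟩, hzZ⟩))

/-! ### Step decisions and their values -/

namespace Env

/-- The decision is the largest tolerable one for negative labels, the smallest tolerable one for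
positive labels, and `c` for the label zero. -/
noncomputable def stepDec (E : Env) (L : ℝ) (S : Set ℝ) (g : ℝ → ℤ) (c θ : ℝ) : ℝ :=
  if g θ < 0 then E.hi L (level S g θ) else if 0 < g θ then E.lo L (level S g θ) else c

/-- Labels and a middle decision that fit together. -/
structure Step (E : Env) (L : ℝ) (S : Set ℝ) (g : ℝ → ℤ) (c : ℝ) : Prop where
  mono : MonotoneOn g S
  -- Finiteness makes the binding labels exist in `exists_ends`, and the number of labels serves as
  -- the induction variable later.
  finite : (g '' S).Finite
  neg : ∀ θ ∈ S, g θ < 0 → E.hi L (level S g θ) ≤ c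
  pos : ∀ θ ∈ S, 0 < g θ → c ≤ E.lo L (level S g θ)
  middle : ∀ θ ∈ S, g θ = 0 → E.Tol L (condLaw E.prior (level S g θ)) c
  exists_nonpos : ∃ θ ∈ S, g θ ≤ 0
  exists_nonneg : ∃ θ ∈ S, 0 ≤ g θ

/-- The state `t` separates negative from positive labels. -/
def Separates (S : Set ℝ) (g : ℝ → ℤ) (t : ℝ) : Prop :=
  (∀ x ∈ S, x < t → g x ≤ 0) ∧ ∀ x ∈ S, t < x → 0 ≤ g x

/-- The sender's payoff when `t` is the punishment state. -/
noncomputable def stepValue (E : Env) (L : ℝ) (S : Set ℝ) (g : ℝ → ℤ) (t c : ℝ) : ℝ :=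
  E.u .sender c t + ∫ θ, (∫ x in t..θ, partialTheta (E.u .sender) (E.stepDec L S g c x) x)
    ∂condLaw E.prior S

lemma stepDec_of_neg {E : Env} {L : ℝ} {S : Set ℝ} {g : ℝ → ℤ} {c θ : ℝ} (h : g θ < 0) :
    E.stepDec L S g c θ = E.hi L (level S g θ) := if_pos h

lemma stepDec_of_pos {E : Env} {L : ℝ} {S : Set ℝ} {g : ℝ → ℤ} {c θ : ℝ} (h : 0 < g θ) :
    E.stepDec L S g c θ = E.lo L (level S g θ) := by
  rw [stepDec, if_neg h.not_gt, if_pos h]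

lemma stepDec_of_zero {E : Env} {L : ℝ} {S : Set ℝ} {g : ℝ → ℤ} {c θ : ℝ} (h : g θ = 0) :
    E.stepDec L S g c θ = c := by
  simp [stepDec, h]

lemma stepDec_congr {E : Env} {L : ℝ} {S : Set ℝ} {g : ℝ → ℤ} {c θ θ' : ℝ} (h : g θ = g θ') :
    E.stepDec L S g c θ = E.stepDec L S g c θ' := by
  simp only [stepDec, level_eq (S := S) h, h]

namespace Standing

variable {E : Env} (hE : E.Standing) {L : ℝ} (hL : 0 ≤ L) {S : Set ℝ} (hS : IsCell S)
include hE hL hS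

section

variable {g : ℝ → ℤ} {c : ℝ} (h : E.Step L S g c)
include h

lemma monotoneOn_stepDec : MonotoneOn (E.stepDec L S g c) S := by
  intro x hx y hy hxy
  rcases (h.mono hx hy hxy).eq_or_lt with e | hlt
  · exact (stepDec_congr e).le
  have hcx := isCell_level hS h.mono hx
  have hcy := isCell_level hS h.mono hy
  have hle : ∀ z ∈ level S g x, ∀ w ∈ level S g y, z ≤ w := fun z hz w hw =>
    (level_lt h.mono hlt z hz w hw).le
  rcases lt_trichotomy (g x) 0 with h1 | h1 | h1
  · rw [stepDec_of_neg h1]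
    rcases lt_trichotomy (g y) 0 with h2 | h2 | h2
    · rw [stepDec_of_neg h2]; exact hE.hi_mono hcx hcy hle hL
    · rw [stepDec_of_zero h2]; exact h.neg x hx h1
    · rw [stepDec_of_pos h2]; exact (h.neg x hx h1).trans (h.pos y hy h2)
  · rw [stepDec_of_zero h1, stepDec_of_pos (h1 ▸ hlt)]; exact h.pos y hy (h1 ▸ hlt)
  · rw [stepDec_of_pos h1, stepDec_of_pos (h1.trans hlt)]; exact hE.lo_mono hcx hcy hle hL

lemma tol_stepDec {θ : ℝ} (hθ : θ ∈ S) :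
    E.Tol L (condLaw E.prior (level S g θ)) (E.stepDec L S g c θ) := by
  have hc := isCell_level hS h.mono hθ
  rcases lt_trichotomy (g θ) 0 with h1 | h1 | h1
  · rw [stepDec_of_neg h1]; exact hE.tol_hi hc hL
  · rw [stepDec_of_zero h1]; exact h.middle θ hθ h1
  · rw [stepDec_of_pos h1]; exact hE.tol_lo hc hL

lemma exists_bound_stepDec : ∃ B, ∀ θ ∈ S, |E.stepDec L S g c θ| ≤ B := by
  obtain ⟨B, -, hB⟩ := hE.exists_abs_bound L
  refine ⟨B, fun θ hθ => ?_⟩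
  have hc := isCell_level hS h.mono hθ
  have := hE.isProbabilityMeasure_condLaw hc
  exact hB _ (hE.ae_unit_condLaw hc) _ (hE.tol_stepDec hL hS h hθ)

lemma integrable_stepValue {t : ℝ} (ht : t ∈ S) :
    Integrable (fun θ => ∫ x in t..θ, partialTheta (E.u .sender) (E.stepDec L S g c x) x)
      (condLaw E.prior S) := by
  have := hE.isProbabilityMeasure_condLaw hS
  obtain ⟨B, hB⟩ := hE.exists_bound_stepDec hL hS h
  have hm := hE.monotoneOn_stepDec hL hS h
  obtain ⟨C, hC0, hC⟩ := hE.lipschitz_integral_partialTheta hS.ordConnected hS.subset .sender hm hB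
  have hcont := hE.continuousOn_integral_partialTheta hS.ordConnected hS.subset .sender hm hB ht
  refine integrable_of_bounded (C := C) ?_ ?_
  · have h1 := hcont.aemeasurable (μ := condLaw E.prior S) hS.measurableSet
    rwa [Measure.restrict_eq_self_of_ae_mem (hE.ae_mem_condLaw hS)] at h1
  · filter_upwards [hE.ae_mem_condLaw hS] with θ hθ
    refine (hC t ht θ hθ).trans (mul_le_of_le_one_right hC0 (abs_le.2 ?_))
    have h1 := hS.subset hθ
    have h2 := hS.subset ht
    constructor <;> linarith [h1.1, h1.2, h2.1, h2.2]

lemma stepValue_eq {t : ℝ} (ht : t ∈ S) : E.stepValue L S g t c =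
    ∫ θ, (E.u .sender c t + ∫ x in t..θ, partialTheta (E.u .sender) (E.stepDec L S g c x) x)
      ∂condLaw E.prior S := by
  have := hE.isProbabilityMeasure_condLaw hS
  rw [integral_add (integrable_const _) (hE.integrable_stepValue hL hS h ht), stepValue]
  simp

/-- The value does not depend on the choice of the punishment state. -/
lemma stepValue_congr {t t' : ℝ} (ht : t ∈ S) (ht' : t' ∈ S) (hs : Separates S g t)
    (hs' : Separates S g t') : E.stepValue L S g t c = E.stepValue L S g t' c := by
  rw [hE.stepValue_eq hL hS h ht, hE.stepValue_eq hL hS h ht']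
  refine integral_congr_ae ?_
  filter_upwards [hE.ae_mem_condLaw hS] with θ hθ
  have hm := hE.monotoneOn_stepDec hL hS h
  rw [← hE.integral_partialTheta_adjacent hS.ordConnected hS.subset .sender hm ht ht' hθ]
  -- Between two separating states every label is zero. There the decision is `c`, and the integral
  -- is the change of `u_S` at `c`.
  have e : ∫ x in t..t', partialTheta (E.u .sender) (E.stepDec L S g c x) x =
      ∫ x in t..t', partialTheta (E.u .sender) c x := by
    refine intervalIntegral.integral_congr_uIoo fun x hx => ?_
    have hxS : x ∈ S := hS.ordConnected.uIcc_subset ht ht' ⟨hx.1.le, hx.2.le⟩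
    have : g x = 0 := by
      rcases le_total t t' with hle | hle
      · rw [uIoo_of_le hle] at hx
        exact le_antisymm (hs'.1 x hxS hx.2) (hs.2 x hxS hx.1)
      · rw [uIoo_of_ge hle] at hx
        exact le_antisymm (hs.1 x hxS hx.2) (hs'.2 x hxS hx.1)
    simp only [stepDec_of_zero this]
  rw [e, hE.integral_partialTheta .sender c (hS.subset ht) (hS.subset ht')]
  ring

end

/-- The value is concave in the middle decision. -/
lemma min_stepValue_le {g : ℝ → ℤ} {t c₁ c₂ c : ℝ} (ht : t ∈ S) (hs : Separates S g t)
    (h₁ : E.Step L S g c₁) (h₂ : E.Step L S g c₂) (h : E.Step L S g c) (hc₁ : c₁ ≤ c)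
    (hc₂ : c ≤ c₂) :
    E.stepValue L S g t c₁ ≤ E.stepValue L S g t c ∨
      E.stepValue L S g t c₂ ≤ E.stepValue L S g t c := by
  have := hE.isProbabilityMeasure_condLaw hS
  obtain ⟨a, b, ha, hb, hab, rfl⟩ : ∃ a b : ℝ, 0 ≤ a ∧ 0 ≤ b ∧ a + b = 1 ∧ a * c₁ + b * c₂ = c := by
    have := (segment_eq_Icc (hc₁.trans hc₂)).symm.subset (⟨hc₁, hc₂⟩ : c ∈ Icc c₁ c₂)
    simpa [segment] using this
  set c := a * c₁ + b * c₂ with hc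
  set F := fun c θ => E.u .sender c t +
    ∫ x in t..θ, partialTheta (E.u .sender) (E.stepDec L S g c x) x with hF
  have hint : ∀ c, E.Step L S g c → Integrable (F c) (condLaw E.prior S) := fun c h =>
    (integrable_const _).add (hE.integrable_stepValue hL hS h ht)
  have hpt : ∀ θ ∈ S, a * F c₁ θ + b * F c₂ θ ≤ F c θ := by
    intro θ hθ
    -- From `t` towards `θ` the middle decision applies up to `y` and not after, and `y` does not
    -- depend on `c`. So the payoff in `θ` is `u_S(c, y)` plus a term without `c`, and concavity of
    -- `u_S` in the decision gives the claim.
    obtain ⟨y, hy, hy1, hy2⟩ := exists_split (Z := {x | g x = 0}) (t := t) (θ := θ) (by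
      intro x hx hx0 z hz
      have hxS : x ∈ S := hS.ordConnected.uIcc_subset ht hθ hx
      have hzS : z ∈ S := hS.ordConnected.uIcc_subset ht hxS ⟨hz.1.le, hz.2.le⟩
      rcases le_total t x with hle | hle
      · rw [uIoo_of_le hle] at hz
        exact le_antisymm ((h.mono hzS hxS hz.2.le).trans hx0.le) (hs.2 z hzS hz.1)
      · rw [uIoo_of_ge hle] at hz
        exact le_antisymm (hs.1 z hzS hz.2) (hx0.ge.trans (h.mono hxS hzS hz.1.le)))
    have hyS : y ∈ S := hS.ordConnected.uIcc_subset ht hθ hy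
    have key : ∀ c', E.Step L S g c' → F c' θ = E.u .sender c' y +
        ∫ x in y..θ, partialTheta (E.u .sender) (E.stepDec L S g c x) x := by
      intro c' h'
      have hm := hE.monotoneOn_stepDec hL hS h'
      have e1 : ∫ x in t..y, partialTheta (E.u .sender) (E.stepDec L S g c' x) x =
          ∫ x in t..y, partialTheta (E.u .sender) c' x := by
        refine intervalIntegral.integral_congr_uIoo fun x hx => ?_
        simp only [stepDec_of_zero (show g x = 0 from hy1 x hx)]
      have e2 : ∫ x in y..θ, partialTheta (E.u .sender) (E.stepDec L S g c' x) x =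
          ∫ x in y..θ, partialTheta (E.u .sender) (E.stepDec L S g c x) x := by
        refine intervalIntegral.integral_congr_uIoo fun x hx => ?_
        have hne : g x ≠ 0 := hy2 x hx
        rcases hne.lt_or_gt with h1 | h1
        · simp only [stepDec_of_neg h1]
        · simp only [stepDec_of_pos h1]
      simp only [hF]
      rw [← hE.integral_partialTheta_adjacent hS.ordConnected hS.subset .sender hm ht hyS hθ, e1,
        e2, hE.integral_partialTheta .sender c' (hS.subset ht) (hS.subset hyS)]
      ring
    rw [key c₁ h₁, key c₂ h₂, key c h]
    have := (hE.concaveOn_u .sender (hS.subset hyS)).2 (mem_univ c₁) (mem_univ c₂) ha hb hab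
    simp only [smul_eq_mul] at this
    set K := ∫ x in y..θ, partialTheta (E.u .sender) (E.stepDec L S g c x) x
    have e : a * K + b * K = K := by rw [← add_mul, hab, one_mul]
    linarith
  have hle : a * E.stepValue L S g t c₁ + b * E.stepValue L S g t c₂ ≤ E.stepValue L S g t c := by
    rw [hE.stepValue_eq hL hS h₁ ht, hE.stepValue_eq hL hS h₂ ht, hE.stepValue_eq hL hS h ht,
      ← integral_const_mul, ← integral_const_mul,
      ← integral_add ((hint _ h₁).const_mul a) ((hint _ h₂).const_mul b)]
    refine integral_mono_ae (((hint _ h₁).const_mul a).add ((hint _ h₂).const_mul b)) (hint _ h) ?_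
    filter_upwards [hE.ae_mem_condLaw hS] with θ hθ using hpt θ hθ
  by_contra hcon
  push Not at hcon
  rcases ha.eq_or_lt with rfl | ha'
  · have : b = 1 := by linarith
    subst this; linarith [hcon.2]
  · have h3 := mul_lt_mul_of_pos_left hcon.1 ha'
    have h4 := mul_le_mul_of_nonneg_left hcon.2.le hb
    have h5 : a * E.stepValue L S g t c + b * E.stepValue L S g t c = E.stepValue L S g t c := by
      rw [← add_mul, hab, one_mul]
    linarith

end Standing
end Env

/-! ### From step decisions to penal rules -/

namespace Env.Standing

variable {E : Env} (hE : E.Standing) {L : ℝ} (hL : 0 ≤ L) {S : Set ℝ} (hS : IsCell S)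
include hE hL hS

/-- A middle decision that is itself extreme gives penal rules. -/
lemma exists_penalRules_of_extreme {g : ℝ → ℤ} {c t : ℝ} (h : E.Step L S g c) (ht : t ∈ S)
    (ht0 : g t = 0) (hc : c = E.lo L (level S g t) ∨ c = E.hi L (level S g t)) :
    ∃ r : PenalRules S, E.PenalFeasible L r ∧ E.penalValue r = E.stepValue L S g t c := by
  classical
  -- Decisions must be a function of the message. A state of the message is chosen to evaluate them;
  -- its choice is immaterial, as step decisions depend only on the label.
  let dec : Set ℝ → ℝ := fun m =>
    if hm : ∃ θ ∈ S, level S g θ = m then E.stepDec L S g c hm.choose else 0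
  have hdec : ∀ θ ∈ S, dec (level S g θ) = E.stepDec L S g c θ := fun θ hθ => by
    have hm : ∃ θ' ∈ S, level S g θ' = level S g θ := ⟨θ, hθ, rfl⟩
    simp only [dec, dif_pos hm]
    refine stepDec_congr ?_
    have h1 : hm.choose ∈ level S g hm.choose := ⟨hm.choose_spec.1, rfl⟩
    rw [hm.choose_spec.2] at h1
    exact h1.2
  let r : PenalRules S := ⟨levelRule hS.ordConnected h.mono, dec, t⟩
  have hout : ∀ θ ∈ S, r.outcome θ = E.stepDec L S g c θ := hdec
  have hlab : ∀ θ ∈ S, ∀ θ' ∈ S, Below (level S g θ) (level S g θ') → g θ < g θ' :=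
    fun θ hθ θ' hθ' hb => by
      by_contra hle
      rcases (not_lt.1 hle).eq_or_lt with e | hlt
      · exact lt_irrefl _ (hb θ ⟨hθ, rfl⟩ θ ⟨hθ, e.symm⟩)
      · exact lt_asymm (hb θ ⟨hθ, rfl⟩ θ' ⟨hθ', rfl⟩)
          (level_lt h.mono hlt θ' ⟨hθ', rfl⟩ θ ⟨hθ, rfl⟩)
  refine ⟨r, ⟨ht, ?_, ?_, ?_, ?_⟩, ?_⟩
  · exact (hE.monotoneOn_stepDec hL hS h).congr fun θ hθ => (hout θ hθ).symm
  · intro θ hθ hb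
    have hpos : 0 < g θ := ht0 ▸ hlab t ht θ hθ hb
    rw [hout θ hθ, stepDec_of_pos hpos]
    exact hE.isLeast_lo (isCell_level hS h.mono hθ) hL
  · have e : r.outcome r.pt = c := (hout t ht).trans (stepDec_of_zero ht0)
    rw [e]
    rcases hc with hc | hc
    · exact .inl (by rw [hc]; exact hE.isLeast_lo (isCell_level hS h.mono ht) hL)
    · exact .inr (by rw [hc]; exact hE.isGreatest_hi (isCell_level hS h.mono ht) hL)
  · intro θ hθ hb
    have hneg : g θ < 0 := ht0 ▸ hlab θ hθ t ht hb
    rw [hout θ hθ, stepDec_of_neg hneg]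
    exact hE.isGreatest_hi (isCell_level hS h.mono hθ) hL
  · rw [penalValue, stepValue]
    have e : r.outcome r.pt = c := (hout t ht).trans (stepDec_of_zero ht0)
    rw [e]
    congr 1
    refine integral_congr_ae ?_
    filter_upwards [hE.ae_mem_condLaw hS] with θ hθ
    refine intervalIntegral.integral_congr fun x hx => ?_
    simp only [hout x (hS.ordConnected.uIcc_subset ht hθ hx)]

/-- The middle decision can be moved to an end of the admissible interval. -/
lemma exists_ends {g : ℝ → ℤ} {c : ℝ} (h : E.Step L S g c) : ∃ c₁ c₂, c₁ ≤ c ∧ c ≤ c₂ ∧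
    E.Step L S g c₁ ∧ E.Step L S g c₂ ∧
    (∃ θ ∈ S, (g θ = 0 ∧ c₁ = E.lo L (level S g θ)) ∨ g θ ≠ 0 ∧ c₁ = E.stepDec L S g c₁ θ) ∧
    ∃ θ ∈ S, (g θ = 0 ∧ c₂ = E.hi L (level S g θ)) ∨ g θ ≠ 0 ∧ c₂ = E.stepDec L S g c₂ θ := by
  have htol : ∀ θ ∈ S, g θ = 0 → E.lo L (level S g θ) ≤ c ∧ c ≤ E.hi L (level S g θ) :=
    fun θ hθ h0 => (hE.tol_condLaw_iff (isCell_level hS h.mono hθ) hL).1 (h.middle θ hθ h0)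
  -- A middle decision is admissible exactly if it is at least `F k` for all labels `k ≤ 0` and at
  -- most `G k` for all labels `k ≥ 0`. The ends are the largest value of `F` and the smallest of
  -- `G`; each comes from the middle message or from an extreme decision on another one.
  set F : ℤ → ℝ := fun k => if k < 0 then E.hi L {x | x ∈ S ∧ g x = k}
    else E.lo L {x | x ∈ S ∧ g x = k} with hF
  set G : ℤ → ℝ := fun k => if 0 < k then E.lo L {x | x ∈ S ∧ g x = k}
    else E.hi L {x | x ∈ S ∧ g x = k} with hG
  have hFle : ∀ θ ∈ S, g θ ≤ 0 → F (g θ) ≤ c := fun θ hθ hle => by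
    simp only [hF]
    split_ifs with h1
    · exact h.neg θ hθ h1
    · exact (htol θ hθ (le_antisymm hle (not_lt.1 h1))).1
  have hGge : ∀ θ ∈ S, 0 ≤ g θ → c ≤ G (g θ) := fun θ hθ hle => by
    simp only [hG]
    split_ifs with h1
    · exact h.pos θ hθ h1
    · exact (htol θ hθ (le_antisymm (not_lt.1 h1) hle)).2
  have hfin1 : (F '' (g '' S ∩ {k | k ≤ 0})).Finite := (h.finite.inter_of_left _).image F
  have hfin2 : (G '' (g '' S ∩ {k | 0 ≤ k})).Finite := (h.finite.inter_of_left _).image G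
  obtain ⟨θ₁, hθ₁, hn⟩ := h.exists_nonpos
  obtain ⟨θ₂, hθ₂, hp⟩ := h.exists_nonneg
  obtain ⟨c₁, ⟨k₁, ⟨⟨a₁, ha₁, rfl⟩, hk₁⟩, rfl⟩, hmax⟩ := hfin1.isCompact.exists_isGreatest
    ⟨_, mem_image_of_mem F ⟨mem_image_of_mem g hθ₁, hn⟩⟩
  obtain ⟨c₂, ⟨k₂, ⟨⟨a₂, ha₂, rfl⟩, hk₂⟩, rfl⟩, hmin⟩ := hfin2.isCompact.exists_isLeast
    ⟨_, mem_image_of_mem G ⟨mem_image_of_mem g hθ₂, hp⟩⟩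
  have hmax' : ∀ θ ∈ S, g θ ≤ 0 → F (g θ) ≤ F (g a₁) := fun θ hθ hle =>
    hmax (mem_image_of_mem F ⟨mem_image_of_mem g hθ, hle⟩)
  have hmin' : ∀ θ ∈ S, 0 ≤ g θ → G (g a₂) ≤ G (g θ) := fun θ hθ hle =>
    hmin (mem_image_of_mem G ⟨mem_image_of_mem g hθ, hle⟩)
  have hle₁ := hFle a₁ ha₁ hk₁
  have hle₂ := hGge a₂ ha₂ hk₂
  refine ⟨F (g a₁), G (g a₂), hle₁, hle₂, ?_, ?_, ⟨a₁, ha₁, ?_⟩, ⟨a₂, ha₂, ?_⟩⟩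
  · refine ⟨h.mono, h.finite, fun θ hθ hneg => ?_, fun θ hθ hpos => hle₁.trans (h.pos θ hθ hpos),
      fun θ hθ h0 => ?_, h.exists_nonpos, h.exists_nonneg⟩
    · have := hmax' θ hθ hneg.le
      refine le_trans (le_of_eq ?_) this
      simp only [hF, if_pos hneg, level]
    · rw [hE.tol_condLaw_iff (isCell_level hS h.mono hθ) hL]
      have := hmax' θ hθ h0.le
      refine ⟨le_trans (le_of_eq ?_) this, hle₁.trans (htol θ hθ h0).2⟩
      simp only [hF, if_neg h0.not_lt, level]
  · refine ⟨h.mono, h.finite, fun θ hθ hneg => (h.neg θ hθ hneg).trans hle₂, fun θ hθ hpos => ?_,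
      fun θ hθ h0 => ?_, h.exists_nonpos, h.exists_nonneg⟩
    · have := hmin' θ hθ hpos.le
      simp only [hG, if_pos hpos] at this ⊢
      exact this
    · rw [hE.tol_condLaw_iff (isCell_level hS h.mono hθ) hL]
      have := hmin' θ hθ h0.ge
      refine ⟨(htol θ hθ h0).1.trans hle₂, this.trans (le_of_eq ?_)⟩
      simp only [hG, if_neg h0.not_gt, level]
  · rcases (show g a₁ ≤ 0 from hk₁).eq_or_lt with h0 | h0
    · exact .inl ⟨h0, by simp only [hF, if_neg h0.not_lt, level]⟩
    · refine .inr ⟨h0.ne, ?_⟩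
      rw [stepDec_of_neg h0]
      simp only [hF, if_pos h0, level]
  · rcases (show 0 ≤ g a₂ from hk₂).eq_or_lt with h0 | h0
    · exact .inl ⟨h0.symm, by simp only [hG, if_neg h0.symm.not_gt, level]⟩
    · refine .inr ⟨h0.ne', ?_⟩
      rw [stepDec_of_pos h0]
      simp only [hG, if_pos h0, level]

/-- Messages with the middle decision can be merged. -/
lemma absorb {g : ℝ → ℤ} {c : ℝ} (h : E.Step L S g c) {θ : ℝ} (hθ : θ ∈ S) (h0 : g θ ≠ 0)
    (hc : c = E.stepDec L S g c θ) :
    ∃ g' : ℝ → ℤ, E.Step L S g' c ∧ (g' '' S \ {0}).ncard < (g '' S \ {0}).ncard ∧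
      (∀ t, Separates S g t → Separates S g' t) ∧
      ∀ x ∈ S, E.stepDec L S g' c x = E.stepDec L S g c x := by
  classical
  set φ := E.stepDec L S g c with hφ
  have hm : MonotoneOn φ S := hE.monotoneOn_stepDec hL hS h
  -- All messages with decision `c` get label zero. At least the label `g θ` disappears, while
  -- decisions and the other messages stay the same.
  set g' : ℝ → ℤ := fun x => if φ x = c then 0 else g x with hg'
  have hnonpos : ∀ x ∈ S, g x ≤ 0 → φ x ≤ c := fun x hx hle => by
    rcases hle.eq_or_lt with e | e
    · exact (stepDec_of_zero e).le
    · rw [hφ, stepDec_of_neg e]; exact h.neg x hx e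
  have hnonneg : ∀ x ∈ S, 0 ≤ g x → c ≤ φ x := fun x hx hle => by
    rcases hle.eq_or_lt with e | e
    · exact (stepDec_of_zero e.symm).ge
    · rw [hφ, stepDec_of_pos e]; exact h.pos x hx e
  have hlt : ∀ x ∈ S, φ x < c → g x < 0 ∧ g' x = g x := fun x hx hl =>
    ⟨not_le.1 fun hle => (hnonneg x hx hle).not_gt hl, if_neg hl.ne⟩
  have hgt : ∀ x ∈ S, c < φ x → 0 < g x ∧ g' x = g x := fun x hx hl =>
    ⟨not_le.1 fun hle => (hnonpos x hx hle).not_gt hl, if_neg hl.ne'⟩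
  have heq : ∀ x, φ x = c → g' x = 0 := fun x hx => if_pos hx
  have hzero : ∀ x ∈ S, g' x = 0 → φ x = c := fun x hx h1 => by
    rcases lt_trichotomy (φ x) c with hl | hl | hl
    · exact absurd ((hlt x hx hl).2 ▸ h1) (hlt x hx hl).1.ne
    · exact hl
    · exact absurd ((hgt x hx hl).2 ▸ h1) (hgt x hx hl).1.ne'
  have hmono : MonotoneOn g' S := by
    intro x hx y hy hxy
    have hle := hm hx hy hxy
    rcases lt_trichotomy (φ x) c with hx1 | hx1 | hx1
    · rcases lt_trichotomy (φ y) c with hy1 | hy1 | hy1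
      · rw [(hlt x hx hx1).2, (hlt y hy hy1).2]; exact h.mono hx hy hxy
      · rw [(hlt x hx hx1).2, heq y hy1]; exact (hlt x hx hx1).1.le
      · rw [(hlt x hx hx1).2, (hgt y hy hy1).2]; exact h.mono hx hy hxy
    · rcases (hx1 ▸ hle).eq_or_lt with hy1 | hy1
      · rw [heq x hx1, heq y hy1.symm]
      · rw [heq x hx1, (hgt y hy hy1).2]; exact (hgt y hy hy1).1.le
    · rw [(hgt x hx hx1).2, (hgt y hy (hx1.trans_le hle)).2]; exact h.mono hx hy hxy
  have hcell : ∀ x ∈ S, g' x ≠ 0 → level S g' x = level S g x := fun x hx hne => by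
    have hx1 : φ x ≠ c := fun e => hne (heq x e)
    have hgx : g' x = g x := if_neg hx1
    ext y
    refine and_congr_right fun hy => ?_
    rw [hgx]
    constructor
    · intro e
      have : φ y ≠ c := fun e1 => hne (by rw [hgx, ← e, heq y e1])
      simp only [hg', if_neg this] at e
      exact e
    · intro e
      have : φ y ≠ c := fun e1 => hx1 (by rw [← e1]; exact stepDec_congr e.symm)
      simp only [hg', if_neg this, e]
  have hstep : ∀ x ∈ S, E.stepDec L S g' c x = φ x := fun x hx => by
    rcases lt_trichotomy (φ x) c with hl | hl | hl
    · obtain ⟨h1, h2⟩ := hlt x hx hl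
      rw [stepDec_of_neg (h2.symm ▸ h1), hcell x hx (by rw [h2]; exact h1.ne), hφ,
        stepDec_of_neg h1]
    · rw [stepDec_of_zero (heq x hl), hl]
    · obtain ⟨h1, h2⟩ := hgt x hx hl
      rw [stepDec_of_pos (h2.symm ▸ h1), hcell x hx (by rw [h2]; exact h1.ne'), hφ,
        stepDec_of_pos h1]
  have himg : g' '' S \ {0} ⊂ g '' S \ {0} := by
    refine ⟨?_, fun hsub => ?_⟩
    · rintro _ ⟨⟨x, hx, rfl⟩, hne⟩
      have hx1 : φ x ≠ c := fun e => hne (heq x e)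
      have e : g' x = g x := if_neg hx1
      exact ⟨e ▸ mem_image_of_mem g hx, hne⟩
    · obtain ⟨⟨x, hx, e⟩, -⟩ := hsub ⟨mem_image_of_mem g hθ, h0⟩
      by_cases hx1 : φ x = c
      · exact h0 (by rw [← e, heq x hx1])
      · have e2 : g x = g θ := by rw [← e, hg']; exact (if_neg hx1).symm
        exact hx1 ((stepDec_congr e2).trans hc.symm)
  have hfin : (g '' S \ {0}).Finite := h.finite.sdiff
  refine ⟨g', ⟨hmono, ?_, ?_, ?_, ?_, ?_, ?_⟩, ncard_lt_ncard himg hfin, ?_, hstep⟩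
  · refine (h.finite.insert 0).subset ?_
    rintro _ ⟨x, hx, rfl⟩
    by_cases hx1 : φ x = c
    · exact .inl (heq x hx1)
    · exact .inr ⟨x, hx, (if_neg hx1).symm⟩
  · intro x hx hneg
    rw [← stepDec_of_neg (c := c) hneg, hstep x hx]
    by_contra hcon
    obtain ⟨h1, h2⟩ := hgt x hx (not_le.1 hcon)
    omega
  · intro x hx hpos
    rw [← stepDec_of_pos (c := c) hpos, hstep x hx]
    by_contra hcon
    obtain ⟨h1, h2⟩ := hlt x hx (not_le.1 hcon)
    omega
  · intro x hx hx0
    have hM := isCell_level hS hmono hx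
    have hsubS : level S g' x ⊆ S := fun y hy => hy.1
    -- The new middle message is a union of old messages on each of which `c` is tolerable.
    refine hE.tol_of_cells hM (levelRule hM.ordConnected (h.mono.mono hsubS)) fun y hy => ?_
    have hy1 : φ y = c := hzero y hy.1 (hy.2.trans hx0)
    have e : level (level S g' x) g y = level S g y := by
      ext z
      refine ⟨fun hz => ⟨hz.1.1, hz.2⟩, fun hz => ⟨⟨hz.1, ?_⟩, hz.2⟩⟩
      rw [hx0, heq z ((stepDec_congr hz.2).trans hy1)]
    have := hE.tol_stepDec hL hS h hy.1
    rw [← hφ, hy1] at this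
    change E.Tol L (condLaw E.prior (level (level S g' x) g y)) c
    rwa [e]
  · exact ⟨θ, hθ, (heq θ hc.symm).le⟩
  · exact ⟨θ, hθ, (heq θ hc.symm).ge⟩
  · intro t ht
    refine ⟨fun x hx hlt' => ?_, fun x hx hlt' => ?_⟩
    · simp only [hg']; split_ifs
      exacts [le_rfl, ht.1 x hx hlt']
    · simp only [hg']; split_ifs
      exacts [le_rfl, ht.2 x hx hlt']

/-- Penal rules do at least as well as any step decisions. -/
lemma exists_penalRules_of_step {g : ℝ → ℤ} {c t : ℝ} (h : E.Step L S g c) (ht : t ∈ S)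
    (hs : Separates S g t) :
    ∃ r : PenalRules S, E.PenalFeasible L r ∧ E.penalValue r ≤ E.stepValue L S g t c := by
  -- Induction on the number of nonzero labels. By concavity one end of the admissible interval does
  -- not raise the value. If the end is extreme on the middle message the rules are penal; otherwise
  -- it equals the decision on another message, which is absorbed.
  induction hn : (g '' S \ {0}).ncard using Nat.strong_induction_on generalizing g c with
  | _ n ih =>
  have key : ∀ e, E.Step L S g e → (∃ θ ∈ S, (g θ = 0 ∧ (e = E.lo L (level S g θ) ∨
      e = E.hi L (level S g θ))) ∨ g θ ≠ 0 ∧ e = E.stepDec L S g e θ) →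
      ∃ r : PenalRules S, E.PenalFeasible L r ∧ E.penalValue r ≤ E.stepValue L S g t e := by
    rintro e he ⟨θ, hθ, ⟨h0, hext⟩ | ⟨h0, hext⟩⟩
    · obtain ⟨r, hr, hv⟩ := hE.exists_penalRules_of_extreme hL hS he hθ h0 hext
      refine ⟨r, hr, hv.le.trans (hE.stepValue_congr hL hS he hθ ht ⟨?_, ?_⟩ hs).le⟩
      · exact fun x hx hlt => h0 ▸ h.mono hx hθ hlt.le
      · exact fun x hx hlt => h0 ▸ h.mono hθ hx hlt.le
    · obtain ⟨g', hg', hcard, hsep, hdec⟩ := hE.absorb hL hS he hθ h0 hext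
      obtain ⟨r, hr, hv⟩ := ih _ (hn ▸ hcard) hg' (hsep t hs) rfl
      refine ⟨r, hr, hv.trans (le_of_eq ?_)⟩
      rw [stepValue, stepValue]
      congr 1
      refine integral_congr_ae ?_
      filter_upwards [hE.ae_mem_condLaw hS] with x hx
      refine intervalIntegral.integral_congr fun y hy => ?_
      simp only [hdec y (hS.ordConnected.uIcc_subset ht hx hy)]
  obtain ⟨c₁, c₂, hc₁, hc₂, h₁, h₂, ⟨a₁, ha₁, e₁⟩, a₂, ha₂, e₂⟩ := hE.exists_ends hL hS h
  rcases hE.min_stepValue_le hL hS ht hs h₁ h₂ h hc₁ hc₂ with hle | hle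
  · obtain ⟨r, hr, hv⟩ := key c₁ h₁ ⟨a₁, ha₁, e₁.imp_left fun e => ⟨e.1, .inl e.2⟩⟩
    exact ⟨r, hr, hv.trans hle⟩
  · obtain ⟨r, hr, hv⟩ := key c₂ h₂ ⟨a₂, ha₂, e₂.imp_left fun e => ⟨e.1, .inr e.2⟩⟩
    exact ⟨r, hr, hv.trans hle⟩

end Env.Standing

/-- The label of the bin of width `ε` around `d` in which `r` lies. -/
noncomputable def binLabel (d ε r : ℝ) : ℤ := if r < d then ⌊(r - d) / ε⌋ else ⌈(r - d) / ε⌉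

/-! ### Sorting decisions into bins -/

section BinLabel

variable {d ε : ℝ} (hε : 0 < ε)
include hε

lemma monotone_binLabel : Monotone (binLabel d ε) := by
  intro x y hxy
  have hq : (x - d) / ε ≤ (y - d) / ε := by gcongr
  unfold binLabel
  split_ifs with h1 h2 h2
  · exact Int.floor_le_floor hq
  · exact (Int.floor_le_ceil _).trans (Int.ceil_le_ceil hq)
  · exact absurd (hxy.trans_lt h2) h1
  · exact Int.ceil_le_ceil hq

/-- Labels are rounded away from zero: seen from `d`, the bin value `d + k ε` lies weakly beyond the
decisions of the bin, by at most `ε`. Label zero means `r = d`. -/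
lemma binLabel_nonpos {r : ℝ} (h : binLabel d ε r ≤ 0) :
    r ≤ d ∧ d + binLabel d ε r * ε ≤ r ∧ r ≤ d + binLabel d ε r * ε + ε := by
  have hq : (r - d) / ε * ε = r - d := div_mul_cancel₀ _ hε.ne'
  unfold binLabel at h ⊢
  split_ifs at h ⊢ with h1
  · have h2 := mul_le_mul_of_nonneg_right (Int.floor_le ((r - d) / ε)) hε.le
    have h3 := mul_le_mul_of_nonneg_right (Int.lt_floor_add_one ((r - d) / ε)).le hε.le
    exact ⟨h1.le, by linarith, by linarith⟩
  · have h2 : (r - d) / ε ≤ 0 := by simpa using Int.ceil_le.1 h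
    have h3 : r - d ≤ 0 := by rw [← hq]; exact mul_nonpos_of_nonpos_of_nonneg h2 hε.le
    have h4 : r = d := by linarith [not_lt.1 h1]
    simp [h4, hε.le]

lemma binLabel_nonneg {r : ℝ} (h : 0 ≤ binLabel d ε r) :
    d ≤ r ∧ r ≤ d + binLabel d ε r * ε ∧ d + binLabel d ε r * ε ≤ r + ε := by
  have hq : (r - d) / ε * ε = r - d := div_mul_cancel₀ _ hε.ne'
  unfold binLabel at h ⊢
  split_ifs at h ⊢ with h1
  · have h2 : 0 ≤ (r - d) / ε := by simpa using Int.le_floor.1 h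
    have : 0 ≤ r - d := by rw [← hq]; positivity
    linarith
  · have h2 := mul_le_mul_of_nonneg_right (Int.le_ceil ((r - d) / ε)) hε.le
    have h3 := mul_le_mul_of_nonneg_right (Int.ceil_lt_add_one ((r - d) / ε)).le hε.le
    exact ⟨not_lt.1 h1, by linarith, by linarith⟩

lemma abs_binLabel_le {r Q : ℝ} (h : |r - d| ≤ Q) : |binLabel d ε r| ≤ ⌈Q / ε⌉ := by
  have h1 : (r - d) / ε ≤ Q / ε := by gcongr; exact (abs_le.1 h).2
  have h2 : -(Q / ε) ≤ (r - d) / ε := by rw [← neg_div]; gcongr; exact (abs_le.1 h).1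
  have h3 : -⌈Q / ε⌉ ≤ ⌊(r - d) / ε⌋ := by rw [← Int.floor_neg]; exact Int.floor_le_floor h2
  have h4 := Int.ceil_le_ceil h1
  have h5 := Int.floor_le_ceil ((r - d) / ε)
  rw [abs_le]
  unfold binLabel
  split_ifs <;> constructor <;> omega

end BinLabel

/-! ### Step decisions from bins -/

namespace Env.Standing

variable {E : Env} (hE : E.Standing) {L : ℝ} (hL : 0 ≤ L)
include hE hL

/-- Bins in which `c` is tolerable from the side of zero give step decisions. -/
lemma exists_step_of_bins {S : Set ℝ} (hS : IsCell S) {κ : ℝ → ℤ} {c : ℝ} (hκ : MonotoneOn κ S)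
    (hfin : (κ '' S).Finite)
    (hneg : ∀ θ ∈ S, κ θ ≤ 0 → E.TolAbove L (condLaw E.prior (level S κ θ)) c)
    (hpos : ∀ θ ∈ S, 0 ≤ κ θ → E.TolBelow L (condLaw E.prior (level S κ θ)) c)
    (h1 : ∃ θ ∈ S, κ θ ≤ 0) (h2 : ∃ θ ∈ S, 0 ≤ κ θ) :
    ∃ g : ℝ → ℤ, E.Step L S g c ∧ (∀ θ, κ θ ≤ 0 → g θ ≤ 0) ∧ (∀ θ, 0 ≤ κ θ → 0 ≤ g θ) ∧
      (∀ θ ∈ S, κ θ ≤ 0 → ∀ e ≤ c, E.TolBelow L (condLaw E.prior (level S κ θ)) e →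
        e ≤ E.stepDec L S g c θ) ∧
      ∀ θ ∈ S, 0 ≤ κ θ → ∀ e, c ≤ e → E.TolAbove L (condLaw E.prior (level S κ θ)) e →
        E.stepDec L S g c θ ≤ e := by
  classical
  have hcellκ : ∀ θ ∈ S, IsCell (level S κ θ) := fun θ hθ => isCell_level hS hκ hθ
  have hlo : ∀ θ ∈ S, κ θ ≤ 0 → E.lo L (level S κ θ) ≤ c := fun θ hθ h =>
    (hE.tolAbove_iff_lo_le (hcellκ θ hθ) hL).1 (hneg θ hθ h)
  have hhi : ∀ θ ∈ S, 0 ≤ κ θ → c ≤ E.hi L (level S κ θ) := fun θ hθ h =>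
    (hE.tolBelow_iff_le_hi (hcellκ θ hθ) hL).1 (hpos θ hθ h)
  -- On a negative bin with `c < hi` the decision `c` is itself tolerable, since `lo ≤ c` there, so
  -- the bin joins the middle message. On the other negative bins `hi ≤ c`, as step decisions
  -- require. Positive bins are treated symmetrically.
  set A : ℝ → Prop := fun x => (κ x < 0 ∧ c < E.hi L (level S κ x)) ∨
    (0 < κ x ∧ E.lo L (level S κ x) < c) with hA
  set g : ℝ → ℤ := fun x => if A x then 0 else κ x with hg
  have hAg : ∀ x, A x → g x = 0 := fun x h => if_pos h
  have hnAg : ∀ x, ¬ A x → g x = κ x := fun x h => if_neg h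
  have hAcongr : ∀ x y, κ x = κ y → (A x ↔ A y) := fun x y e => by
    simp only [hA, level_eq (S := S) e, e]
  have hmono : MonotoneOn g S := by
    intro x hx y hy hxy
    rcases (hκ hx hy hxy).eq_or_lt with e | hlt
    · simp only [hg, hAcongr x y e, e]; exact le_rfl
    have hle : ∀ z ∈ level S κ x, ∀ w ∈ level S κ y, z ≤ w := fun z hz w hw =>
      (level_lt hκ hlt z hz w hw).le
    have e1 := hE.hi_mono (hcellκ x hx) (hcellκ y hy) hle hL
    have e2 := hE.lo_mono (hcellκ x hx) (hcellκ y hy) hle hL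
    by_cases hx1 : A x <;> by_cases hy1 : A y
    · rw [hAg x hx1, hAg y hy1]
    · rw [hAg x hx1, hnAg y hy1]
      rcases hx1 with hx1 | hx1
      · by_contra hcon
        exact hy1 (.inl ⟨not_le.1 hcon, hx1.2.trans_le e1⟩)
      · exact (hx1.1.trans hlt).le
    · rw [hnAg x hx1, hAg y hy1]
      rcases hy1 with hy1 | hy1
      · exact (hlt.trans hy1.1).le
      · by_contra hcon
        exact hx1 (.inr ⟨not_le.1 hcon, e2.trans_lt hy1.2⟩)
    · rw [hnAg x hx1, hnAg y hy1]; exact hlt.le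
  have hcell : ∀ θ, g θ ≠ 0 → ¬ A θ ∧ level S g θ = level S κ θ := fun θ hne => by
    have h : ¬ A θ := fun h => hne (hAg θ h)
    refine ⟨h, ?_⟩
    ext y
    refine and_congr_right fun hy => ?_
    rw [hnAg θ h]
    constructor
    · intro e
      have : ¬ A y := fun h' => hne (by rw [hnAg θ h, ← e, hAg y h'])
      rwa [hnAg y this] at e
    · intro e
      rw [hnAg y fun h' => h ((hAcongr y θ e).1 h'), e]
  have hle0 : ∀ θ, κ θ ≤ 0 → g θ ≤ 0 := fun θ h => by
    simp only [hg]; split_ifs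
    exacts [le_rfl, h]
  have hge0 : ∀ θ, 0 ≤ κ θ → 0 ≤ g θ := fun θ h => by
    simp only [hg]; split_ifs
    exacts [le_rfl, h]
  have hstep : E.Step L S g c := by
    refine ⟨hmono, ?_, fun θ hθ hlt => ?_, fun θ hθ hlt => ?_, fun θ hθ h0 => ?_, ?_, ?_⟩
    · refine (hfin.insert 0).subset ?_
      rintro _ ⟨x, hx, rfl⟩
      by_cases hx1 : A x
      · exact .inl (hAg x hx1)
      · exact .inr ⟨x, hx, (hnAg x hx1).symm⟩
    · obtain ⟨h3, h4⟩ := hcell θ hlt.ne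
      rw [h4]
      by_contra hcon
      exact h3 (.inl ⟨hnAg θ h3 ▸ hlt, not_le.1 hcon⟩)
    · obtain ⟨h3, h4⟩ := hcell θ hlt.ne'
      rw [h4]
      by_contra hcon
      exact h3 (.inr ⟨hnAg θ h3 ▸ hlt, not_le.1 hcon⟩)
    · have hM := isCell_level hS hmono hθ
      have hsubS : level S g θ ⊆ S := fun y hy => hy.1
      refine hE.tol_of_cells hM (levelRule hM.ordConnected (hκ.mono hsubS)) fun y hy => ?_
      have hy0 : g y = 0 := hy.2.trans h0
      have e : level (level S g θ) κ y = level S κ y := by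
        ext z
        refine ⟨fun hz => ⟨hz.1.1, hz.2⟩, fun hz => ⟨⟨hz.1, ?_⟩, hz.2⟩⟩
        rw [h0, ← hy0]
        simp only [hg, hAcongr z y hz.2, hz.2]
      change E.Tol L (condLaw E.prior (level (level S g θ) κ y)) c
      rw [e, hE.tol_condLaw_iff (hcellκ y hy.1) hL]
      by_cases hy1 : A y
      · rcases hy1 with hy1 | hy1
        · exact ⟨hlo y hy.1 hy1.1.le, hy1.2.le⟩
        · exact ⟨hy1.2.le, hhi y hy.1 hy1.1.le⟩
      · rw [hnAg y hy1] at hy0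
        exact ⟨hlo y hy.1 hy0.le, hhi y hy.1 hy0.ge⟩
    · exact h1.imp fun θ h => ⟨h.1, hle0 θ h.2⟩
    · exact h2.imp fun θ h => ⟨h.1, hge0 θ h.2⟩
  refine ⟨g, hstep, hle0, hge0, fun θ hθ h e he htol => ?_, fun θ hθ h e he htol => ?_⟩
  · rcases (hle0 θ h).eq_or_lt with h0 | h0
    · rwa [stepDec_of_zero h0]
    · rw [stepDec_of_neg h0, (hcell θ h0.ne).2]
      exact (hE.tolBelow_iff_le_hi (hcellκ θ hθ) hL).1 htol
  · rcases (hge0 θ h).eq_or_lt with h0 | h0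
    · rwa [stepDec_of_zero h0.symm]
    · rw [stepDec_of_pos h0, (hcell θ h0.ne').2]
      exact (hE.tolAbove_iff_lo_le (hcellκ θ hθ) hL).1 htol

omit hL in
lemma uniform_partialTheta (i : Player) (B : ℝ) {η : ℝ} (hη : 0 < η) : ∃ ε, 0 < ε ∧
    ∀ d, |d| ≤ B → ∀ x ∈ Icc (0 : ℝ) 1, partialTheta (E.u i) (d + ε) x ≤
      partialTheta (E.u i) d x + η ∧ partialTheta (E.u i) d x - η ≤ partialTheta (E.u i) (d - ε) x := by
  have huc := (isCompact_Icc.prod isCompact_Icc : IsCompact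
    (Icc (-(B + 1)) (B + 1) ×ˢ Icc (0 : ℝ) 1)).uniformContinuousOn_of_continuous
      (hE.continuous_partialTheta i).continuousOn
  rw [Metric.uniformContinuousOn_iff] at huc
  obtain ⟨η', hη', huc⟩ := huc η hη
  refine ⟨min 1 (η' / 2), lt_min one_pos (half_pos hη'), fun d hd x hx => ?_⟩
  set ε := min 1 (η' / 2) with hε
  have h0 : 0 < ε := lt_min one_pos (half_pos hη')
  have h1 : ε ≤ 1 := min_le_left _ _
  have h2 : ε < η' := (min_le_right _ _).trans_lt (half_lt_self hη')
  obtain ⟨hd1, hd2⟩ := abs_le.1 hd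
  have key : ∀ e, |e - d| ≤ ε → |partialTheta (E.u i) e x - partialTheta (E.u i) d x| < η :=
    fun e he => by
      obtain ⟨he1, he2⟩ := abs_le.1 he
      have := huc (e, x) ⟨⟨by linarith, by linarith⟩, hx⟩ (d, x) ⟨⟨by linarith, by linarith⟩, hx⟩
        (by rw [Prod.dist_eq, dist_self, Real.dist_eq]; exact max_lt (he.trans_lt h2) hη')
      simpa [Real.dist_eq, clampUnit_of_mem hx] using this
  have k1 := abs_lt.1 (key (d + ε) (by simp [abs_of_pos h0]))
  have k2 := abs_lt.1 (key (d - ε) (by simp [abs_of_pos h0]))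
  constructor <;> linarith [k1.1, k1.2, k2.1, k2.2]

omit hL in
lemma integrable_rent {s : Set ℝ} (hs : IsCell s) {ρ W : ℝ → ℝ} (hpool : E.Poolable L s ρ)
    (hrent : E.Rent L s ρ W) : Integrable W (condLaw E.prior s) := by
  have := hE.isProbabilityMeasure_condLaw hs
  obtain ⟨B, hB⟩ := hpool.bounded
  obtain ⟨C, hC0, hC⟩ := hE.lipschitz_integral_partialTheta hs.ordConnected hs.subset .sender
    hpool.monotone hB
  obtain ⟨t, ht⟩ := hs.nonempty
  have henv := fun θ hθ => hE.envelope hs.ordConnected hs.subset .sender hB hrent.deter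
    (a := t) (b := θ) ht hθ
  have hcont : ContinuousOn W s := by
    refine ((hE.continuousOn_integral_partialTheta hs.ordConnected hs.subset .sender
      hpool.monotone hB ht).const_add (W t)).congr fun θ hθ => ?_
    linarith [henv θ hθ]
  refine integrable_of_bounded (C := |W t| + C) ?_ ?_
  · have h1 := hcont.aemeasurable (μ := condLaw E.prior s) hs.measurableSet
    rwa [Measure.restrict_eq_self_of_ae_mem (hE.ae_mem_condLaw hs)] at h1
  · filter_upwards [hE.ae_mem_condLaw hs] with θ hθ
    have e : W θ = W t + ∫ x in t..θ, partialTheta (E.u .sender) (ρ x) x := by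
      linarith [henv θ hθ]
    rw [e]
    refine (abs_add_le _ _).trans (add_le_add le_rfl ((hC t ht θ hθ).trans
      (mul_le_of_le_one_right hC0 (abs_le.2 ?_))))
    have h1 := hs.subset hθ
    have h2 := hs.subset ht
    constructor <;> linarith [h1.1, h1.2, h2.1, h2.2]

end Env.Standing

/-- A convex set of states contains the states strictly between the ends of its closure. -/
lemma exists_closure_eq_Icc {s : Set ℝ} (hs : IsCell s) :
    ∃ a b, a ≤ b ∧ closure s = Icc a b ∧ Ioo a b ⊆ s := by
  have hcl := hs.closure
  have hc : IsCompact (closure s) := isCompact_Icc.of_isClosed_subset isClosed_closure hcl.subset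
  obtain ⟨a, ha⟩ := hc.exists_isLeast hcl.nonempty
  obtain ⟨b, hb⟩ := hc.exists_isGreatest hcl.nonempty
  refine ⟨a, b, ha.2 hb.1, subset_antisymm (fun x hx => ⟨ha.2 hx, hb.2 hx⟩)
    (hcl.ordConnected.out ha.1 hb.1), fun x hx => ?_⟩
  obtain ⟨y, hy1, hy⟩ := mem_closure_iff.1 ha.1 (Iio x) isOpen_Iio hx.1
  obtain ⟨z, hz1, hz⟩ := mem_closure_iff.1 hb.1 (Ioi x) isOpen_Ioi hx.2
  exact hs.ordConnected.out hy hz ⟨(mem_Iio.1 hy1).le, (mem_Ioi.1 hz1).le⟩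

/-- The crossing state is the supremum of the states with decisions below `d`; `a` is added in case
there are none. -/
lemma exists_crossing {s : Set ℝ} {a b : ℝ} (hab : a ≤ b) (hs : s ⊆ Icc a b) {ρ : ℝ → ℝ}
    (hρ : MonotoneOn ρ s) (d : ℝ) :
    ∃ t ∈ Icc a b, (∀ x ∈ s, x < t → ρ x ≤ d) ∧ ∀ x ∈ s, t < x → d ≤ ρ x := by
  set A := insert a {x | x ∈ s ∧ ρ x < d}
  have hA : ∀ x ∈ A, x ∈ Icc a b := by
    rintro x (rfl | hx)
    exacts [⟨le_rfl, hab⟩, hs hx.1]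
  have hbdd : BddAbove A := ⟨b, fun x hx => (hA x hx).2⟩
  refine ⟨sSup A, ⟨le_csSup hbdd (mem_insert _ _), csSup_le ⟨a, mem_insert _ _⟩ fun x hx =>
    (hA x hx).2⟩, fun x hx hlt => ?_, fun x hx hlt => ?_⟩
  · obtain ⟨y, hy, hxy⟩ := exists_lt_of_lt_csSup ⟨a, mem_insert _ _⟩ hlt
    rcases hy with rfl | hy
    · exact absurd (hs hx).1 hxy.not_ge
    · exact (hρ hx hy.1 hxy.le).trans hy.2.le
  · by_contra hcon
    exact hlt.not_ge (le_csSup hbdd (.inr ⟨hx, not_le.1 hcon⟩))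

/-! ### The penal value bounds the sender's rents -/

namespace Env.Standing

variable {E : Env} (hE : E.Standing) {L : ℝ} (hL : 0 ≤ L)
include hE hL

/-- A rent is at least the payoff from the outside option, transported by the envelope formula. -/
lemma outside_le_rent {s : Set ℝ} (hs : IsCell s) {ρ W : ℝ → ℝ} (hpool : E.Poolable L s ρ)
    (hrent : E.Rent L s ρ W) {ρ' : ℝ → ℝ} (hρ' : MonotoneOn ρ' (closure s))
    (heq : ∀ x ∈ s, ρ' x = ρ x) {d : ℝ} (hd : ∀ θ ∈ s, E.u .sender d θ ≤ W θ) {t θ : ℝ}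
    (ht : t ∈ closure s) (hθ : θ ∈ s) :
    E.u .sender d t + ∫ x in t..θ, partialTheta (E.u .sender) (ρ' x) x ≤ W θ := by
  obtain ⟨B, hB⟩ := hpool.bounded
  have hcl := hs.closure
  have hθ' := subset_closure hθ
  have hclB : ∃ B', ∀ x ∈ closure s, |ρ' x| ≤ B' := by
    obtain ⟨a, b, hab, e, -⟩ := exists_closure_eq_Icc hs
    refine ⟨max |ρ' a| |ρ' b|, fun x hx => ?_⟩
    have ha : a ∈ closure s := e ▸ ⟨le_rfl, hab⟩
    have hb : b ∈ closure s := e ▸ ⟨hab, le_rfl⟩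
    have hx' : x ∈ Icc a b := e ▸ hx
    exact abs_le_max_abs_abs (hρ' ha hx hx'.1) (hρ' hx hb hx'.2)
  obtain ⟨B', hB'⟩ := hclB
  -- The state `t` may be an endpoint that `s` lacks. For states of `s` the inequality follows from
  -- the envelope formula, and continuity carries it to the closure.
  have hcont : ContinuousOn (fun y => E.u .sender d y -
      ∫ x in θ..y, partialTheta (E.u .sender) (ρ' x) x) (closure s) := by
    refine ContinuousOn.sub ?_ (hE.continuousOn_integral_partialTheta hcl.ordConnected hcl.subset
      .sender hρ' hB' hθ')
    have h1 := (hE.continuous_u .sender).comp ((continuous_const (y := d)).prodMk continuous_id)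
    refine h1.continuousOn.congr fun x hx => ?_
    simp [clampUnit_of_mem (hcl.subset hx)]
  have hclosed := isClosed_closure.isClosed_le hcont (continuousOn_const (c := W θ))
  have hsub : s ⊆ {x | x ∈ closure s ∧ E.u .sender d x -
      ∫ x in θ..x, partialTheta (E.u .sender) (ρ' x) x ≤ W θ} := fun y hy => by
    refine ⟨subset_closure hy, ?_⟩
    have henv := hE.envelope hs.ordConnected hs.subset .sender hB hrent.deter hθ hy
    have e : ∫ x in θ..y, partialTheta (E.u .sender) (ρ' x) x =
        ∫ x in θ..y, partialTheta (E.u .sender) (ρ x) x :=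
      intervalIntegral.integral_congr fun x hx => by
        simp only [heq x (hs.ordConnected.uIcc_subset hθ hy hx)]
    rw [e, ← henv]
    linarith [hd y hy]
  have := (closure_minimal hsub hclosed ht).2
  rw [intervalIntegral.integral_symm]
  linarith

/-- Let `d` be the outside decision and `t` a state where the decisions cross it. The rent is at
least `u_S(d, t)` continued by the envelope formula. Bins of width `ε` around `d` give step
decisions with middle decision `d` that are at least `ρ - ε` to the left of `t` and at most `ρ + ε`
to the right. Up to `η` these have no larger value, and penal rules do at least as well. -/
lemma exists_penalRules_le {s : Set ℝ} (hs : IsCell s) {ρ W : ℝ → ℝ} (hpool : E.Poolable L s ρ)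
    (hrent : E.Rent L s ρ W) {η : ℝ} (hη : 0 < η) :
    ∃ r : PenalRules (closure s), E.PenalFeasible L r ∧
      E.penalValue r ≤ ∫ θ, W θ ∂condLaw E.prior s + η := by
  have hcl := hs.closure
  obtain ⟨d, ⟨θd, hθd, htol⟩, hout⟩ := hrent.outside
  obtain ⟨a, b, hab, hS, hIoo⟩ := exists_closure_eq_Icc hs
  obtain ⟨B, hB⟩ := hpool.bounded
  have hsS : s ⊆ Icc a b := hS ▸ subset_closure
  obtain ⟨t, ht, ht1, ht2⟩ := exists_crossing hab hsS hpool.monotone d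
  obtain ⟨ε, hε, huni⟩ := hE.uniform_partialTheta .sender B hη
  have haS : a ∈ closure s := hS ▸ ⟨le_rfl, hab⟩
  have hbS : b ∈ closure s := hS ▸ ⟨hab, le_rfl⟩
  have htS : t ∈ closure s := hS ▸ ht
  -- Since `d` is tolerable in some state of the closure, in the lowest state `a` it tempts at most
  -- `L` upwards and in the highest state `b` at most `L` downwards.
  have hdira : E.TolAbove L (Measure.dirac a) d :=
    hE.tolAbove_anti (S := {a}) (S' := {θd}) (by simpa using hcl.subset haS)
      (by simpa using hcl.subset hθd) (hE.ae_dirac rfl) (hE.ae_dirac rfl)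
      (by simpa using (hS ▸ hθd : θd ∈ Icc a b).1) (tol_iff.1 htol).2
  have hdirb : E.TolBelow L (Measure.dirac b) d :=
    hE.tolBelow_mono (S := {θd}) (S' := {b}) (by simpa using hcl.subset hθd)
      (by simpa using hcl.subset hbS) (hE.ae_dirac rfl) (hE.ae_dirac rfl)
      (by simpa using (hS ▸ hθd : θd ∈ Icc a b).2) (tol_iff.1 htol).1
  set k : ℝ → ℤ := fun x => binLabel d ε (ρ x) with hk
  -- A label larger in absolute value than all bin labels; `-N` and `N` are reserved for the
  -- endpoints of the closure.
  set N : ℤ := ⌈(B + |d|) / ε⌉ + 1 with hN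
  have hkN : ∀ x ∈ s, |k x| < N := fun x hx => by
    have := abs_binLabel_le hε (r := ρ x) (d := d) (Q := B + |d|)
      ((abs_sub _ _).trans (add_le_add (hB x hx) le_rfl))
    simp only [hk, hN]; omega
  have hN0 : 0 < N := by
    obtain ⟨x, hx⟩ := hs.nonempty
    exact (abs_nonneg _).trans_lt (hkN x hx)
  have hself : binLabel d ε d = 0 := by simp [binLabel]
  have hkle : ∀ x, ρ x ≤ d → k x ≤ 0 := fun x h => hself ▸ monotone_binLabel hε h
  have hkge : ∀ x, d ≤ ρ x → 0 ≤ k x := fun x h => hself ▸ monotone_binLabel hε h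
  have hkmono : MonotoneOn k s := fun x hx y hy hxy =>
    monotone_binLabel hε (hpool.monotone hx hy hxy)
  -- The endpoints form messages of their own, whether or not `s` contains them. If `a < b` they
  -- carry no probability, but they ensure that labels of both signs occur. If `a = b` the single
  -- state gets label zero.
  obtain ⟨κ, hκ1, hκ2, hκa, hκb⟩ : ∃ κ : ℝ → ℤ, (∀ x ∈ Ioo a b, κ x = k x) ∧
      (a < b → κ a = -N ∧ κ b = N) ∧ (a = b → κ a = 0) ∧ ∀ x, |κ x| ≤ N ∨ x ∉ Icc a b := by
    classical
    refine ⟨fun x => if x ∈ Ioo a b then k x else if a < b then if x = a then -N else N else 0,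
      fun x hx => if_pos hx, fun h => ?_, fun h => ?_, fun x => ?_⟩
    · simp [h, h.ne']
    · simp [h]
    · by_cases hx : x ∈ Ioo a b
      · simp only [if_pos hx]; exact .inl (hkN x (hIoo hx)).le
      · simp only [if_neg hx]; left
        split_ifs <;> simp [abs_of_pos hN0, hN0.le]
  have hcase : ∀ x ∈ closure s, x = a ∨ x ∈ Ioo a b ∨ (a < b ∧ x = b) := fun x hx => by
    have hx' : x ∈ Icc a b := hS ▸ hx
    rcases hx'.1.eq_or_lt with e | e
    · exact .inl e.symm
    · rcases hx'.2.eq_or_lt with e' | e'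
      · exact .inr (.inr ⟨e' ▸ e, e'⟩)
      · exact .inr (.inl ⟨e, e'⟩)
  have hκmono : MonotoneOn κ (closure s) := by
    intro x hx y hy hxy
    rcases hcase x hx with rfl | hx1 | ⟨hlt, rfl⟩
    · rcases hcase y hy with rfl | hy1 | ⟨hlt, rfl⟩
      · exact le_rfl
      · rw [(hκ2 (hy1.1.trans hy1.2)).1, hκ1 y hy1]
        exact (abs_lt.1 (hkN y (hIoo hy1))).1.le
      · rw [(hκ2 hlt).1, (hκ2 hlt).2]; omega
    · rcases hcase y hy with rfl | hy1 | ⟨hlt, rfl⟩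
      · exact absurd hx1.1 hxy.not_gt
      · rw [hκ1 x hx1, hκ1 y hy1]; exact hkmono (hIoo hx1) (hIoo hy1) hxy
      · rw [(hκ2 hlt).2, hκ1 x hx1]
        exact (abs_lt.1 (hkN x (hIoo hx1))).2.le
    · rw [le_antisymm (hS ▸ hy : y ∈ Icc a x).2 hxy]
  -- The bins of `κ` in the closure and of `k` in `s` differ by endpoints at most, so pooling in `s`
  -- controls the former as well.
  have hlev : ∀ x ∈ Ioo a b, condLaw E.prior (level (closure s) κ x) =
      condLaw E.prior (level s k x) ∧ IsCell (level s k x) := fun x hx => by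
    have h1 := isCell_level hcl hκmono (subset_closure (hIoo hx))
    have h2 := isCell_level hs hkmono (hIoo hx)
    have hlt := hκ2 (hx.1.trans hx.2)
    have hkx := abs_lt.1 (hkN x (hIoo hx))
    refine ⟨hE.condLaw_congr_finite h1 h2 (fun y hy => ?_) ?_, h2⟩
    · rw [level, mem_ofPred_eq, hκ1 x hx] at hy
      rcases hcase y hy.1 with rfl | hy1 | ⟨_, rfl⟩
      · have := hy.2; omega
      · exact ⟨hIoo hy1, by rw [← hκ1 y hy1]; exact hy.2⟩
      · have := hy.2; omega
    · refine ((Set.finite_singleton b).insert a).countable.mono fun y hy => ?_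
      rcases hcase y (subset_closure hy.1.1) with rfl | hy1 | ⟨_, rfl⟩
      · simp
      · exact absurd ⟨subset_closure hy.1.1, by rw [hκ1 y hy1, hκ1 x hx]; exact hy.1.2⟩ hy.2
      · simp
  have hend : ∀ x ∈ closure s, x ∉ Ioo a b → level (closure s) κ x = {x} := fun x hx hxn => by
    refine subset_antisymm (fun y hy => ?_) (singleton_subset_iff.2 ⟨hx, rfl⟩)
    have hy2 := hy.2
    rcases hcase x hx with rfl | hx1 | ⟨hlt, rfl⟩
    · rcases hcase y hy.1 with rfl | hy1 | ⟨hlt, rfl⟩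
      · rfl
      · rw [(hκ2 (hy1.1.trans hy1.2)).1, hκ1 y hy1] at hy2
        have := abs_lt.1 (hkN y (hIoo hy1)); omega
      · rw [(hκ2 hlt).1, (hκ2 hlt).2] at hy2; omega
    · exact absurd hx1 hxn
    · rcases hcase y hy.1 with rfl | hy1 | ⟨hlt, rfl⟩
      · rw [(hκ2 hlt).1, (hκ2 hlt).2] at hy2; omega
      · rw [(hκ2 hlt).2, hκ1 y hy1] at hy2
        have := abs_lt.1 (hkN y (hIoo hy1)); omega
      · rfl
  have hsat : ∀ x, ∀ θ ∈ level s k x, ∀ θ' ∈ s, ρ θ' = ρ θ → θ' ∈ level s k x :=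
    fun x θ hθ θ' hθ' e => ⟨hθ', by rw [← hθ.2]; simp only [hk, e]⟩
  have hbelow : ∀ x ∈ Ioo a b, ∀ e, (∀ θ ∈ level s k x, e ≤ ρ θ) →
      E.TolBelow L (condLaw E.prior (level (closure s) κ x)) e := fun x hx e he => by
    rw [(hlev x hx).1]
    exact hpool.below _ (hlev x hx).2 (fun y hy => hy.1) (hsat x) e he
  have habove : ∀ x ∈ Ioo a b, ∀ e, (∀ θ ∈ level s k x, ρ θ ≤ e) →
      E.TolAbove L (condLaw E.prior (level (closure s) κ x)) e := fun x hx e he => by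
    rw [(hlev x hx).1]
    exact hpool.above _ (hlev x hx).2 (fun y hy => hy.1) (hsat x) e he
  obtain ⟨g, hstep, hg1, hg2, hg3, hg4⟩ := hE.exists_step_of_bins hL hcl (c := d) hκmono
    (by
      refine (Set.finite_Icc (-N) N).subset ?_
      rintro _ ⟨x, hx, rfl⟩
      exact abs_le.1 ((hκb x).resolve_right (by rw [← hS]; exact not_not.2 hx)))
    (fun x hx hle => by
      by_cases hx1 : x ∈ Ioo a b
      · refine habove x hx1 d fun θ hθ => ?_
        rw [hκ1 x hx1] at hle
        exact (binLabel_nonpos hε (hθ.2.le.trans hle)).1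
      · rw [hend x hx hx1, hE.condLaw_singleton]
        rcases hcase x hx with rfl | hx2 | ⟨hlt, rfl⟩
        · exact hdira
        · exact absurd hx2 hx1
        · rw [(hκ2 hlt).2] at hle; omega)
    (fun x hx hle => by
      by_cases hx1 : x ∈ Ioo a b
      · refine hbelow x hx1 d fun θ hθ => ?_
        rw [hκ1 x hx1] at hle
        exact (binLabel_nonneg hε (hle.trans hθ.2.ge)).1
      · rw [hend x hx hx1, hE.condLaw_singleton]
        rcases hcase x hx with rfl | hx2 | ⟨hlt, rfl⟩
        · rcases hab.eq_or_lt with e | e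
          · rw [e]; exact hdirb
          · rw [(hκ2 e).1] at hle; omega
        · exact absurd hx2 hx1
        · exact hdirb)
    (by
      refine ⟨a, haS, ?_⟩
      rcases hab.eq_or_lt with e | e
      · exact (hκa e).le
      · rw [(hκ2 e).1]; omega)
    (by
      refine ⟨b, hbS, ?_⟩
      rcases hab.eq_or_lt with e | e
      · rw [← e]; exact (hκa e).ge
      · rw [(hκ2 e).2]; omega)
  have hleft : ∀ x ∈ Ioo a b, x < t → ρ x - ε ≤ E.stepDec L (closure s) g d x := by
    intro x hx hlt
    have hxs := hIoo hx
    have hk0 : k x ≤ 0 := hkle x (ht1 x hxs hlt)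
    obtain ⟨h1, h2, h3⟩ := binLabel_nonpos hε hk0
    -- The bin value `d + k ε` bounds the decisions of the bin from below, so it is tolerable on the
    -- bin against lower decisions, and the step decision is no smaller.
    refine le_trans (by linarith) (hg3 x (subset_closure hxs) (by rw [hκ1 x hx]; exact hk0)
      (d + k x * ε) ?_ (hbelow x hx _ fun θ hθ => ?_))
    · have : (k x : ℝ) ≤ 0 := by exact_mod_cast hk0
      nlinarith
    · rw [← hθ.2]
      exact (binLabel_nonpos hε (hθ.2.le.trans hk0)).2.1
  have hright : ∀ x ∈ Ioo a b, t < x → E.stepDec L (closure s) g d x ≤ ρ x + ε := by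
    intro x hx hlt
    have hxs := hIoo hx
    have hk0 : 0 ≤ k x := hkge x (ht2 x hxs hlt)
    obtain ⟨h1, h2, h3⟩ := binLabel_nonneg hε hk0
    refine le_trans (hg4 x (subset_closure hxs) (by rw [hκ1 x hx]; exact hk0)
      (d + k x * ε) ?_ (habove x hx _ fun θ hθ => ?_)) h3
    · have : (0 : ℝ) ≤ k x := by exact_mod_cast hk0
      nlinarith
    · rw [← hθ.2]
      exact (binLabel_nonneg hε (hk0.trans hθ.2.ge)).2.1
  have hsep : Separates (closure s) g t := by
    refine ⟨fun x hx hlt => hg1 x ?_, fun x hx hlt => hg2 x ?_⟩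
    · rcases hcase x hx with rfl | hx1 | ⟨_, rfl⟩
      · rcases hab.eq_or_lt with e | e
        · exact (hκa e).le
        · rw [(hκ2 e).1]; omega
      · rw [hκ1 x hx1]
        exact hkle x (ht1 x (hIoo hx1) hlt)
      · exact absurd ht.2 hlt.not_ge
    · rcases hcase x hx with rfl | hx1 | ⟨hlt', rfl⟩
      · exact absurd ht.1 hlt.not_ge
      · rw [hκ1 x hx1]
        exact hkge x (ht2 x (hIoo hx1) hlt)
      · rw [(hκ2 hlt').2]; omega
  obtain ⟨r, hr, hval⟩ := hE.exists_penalRules_of_step hL hcl hstep htS hsep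
  refine ⟨r, hr, hval.trans ?_⟩
  have := hE.isProbabilityMeasure_condLaw hs
  have hW := hE.integrable_rent hs hpool hrent
  have := hE.isProbabilityMeasure_condLaw hcl
  have hint := (integrable_const (E.u .sender d t)).add (hE.integrable_stepValue hL hcl hstep htS)
  rw [hE.stepValue_eq hL hcl hstep htS, hE.condLaw_closure hs]
  rw [hE.condLaw_closure hs] at hint
  have e1 : ∫ θ, W θ ∂condLaw E.prior s + η = ∫ θ, (W θ + η) ∂condLaw E.prior s := by
    rw [integral_add hW (integrable_const _)]; simp
  rw [e1]
  refine integral_mono_ae hint (hW.add (integrable_const _)) ?_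
  filter_upwards [hE.ae_mem_condLaw hs] with θ hθ
  -- The decisions are extended monotonically to missing endpoints by the values `-B` and `B`.
  obtain ⟨ρ', hρ', heq⟩ : ∃ ρ' : ℝ → ℝ, MonotoneOn ρ' (closure s) ∧ ∀ x ∈ s, ρ' x = ρ x := by
    classical
    refine ⟨fun x => if x ∈ s then ρ x else if x = a then -B else B, fun x hx y hy hxy => ?_,
      fun x hx => if_pos hx⟩
    have hB0 : 0 ≤ B := (abs_nonneg _).trans (hB θ hθ)
    by_cases hx1 : x ∈ s <;> by_cases hy1 : y ∈ s
    · simp only [if_pos hx1, if_pos hy1]; exact hpool.monotone hx1 hy1 hxy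
    · simp only [if_pos hx1, if_neg hy1]
      rcases hcase y hy with rfl | h | ⟨_, rfl⟩
      · exact absurd (le_antisymm hxy (hsS hx1).1 ▸ hx1) hy1
      · exact absurd (hIoo h) hy1
      · split_ifs with h
        · have e : x = y := le_antisymm hxy (by rw [h]; exact (hsS hx1).1)
          exact absurd (e ▸ hx1) hy1
        · exact (abs_le.1 (hB x hx1)).2
    · simp only [if_neg hx1, if_pos hy1]
      rcases hcase x hx with rfl | h | ⟨_, rfl⟩
      · simp only [if_true]; exact (abs_le.1 (hB y hy1)).1
      · exact absurd (hIoo h) hx1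
      · exact absurd (le_antisymm (hsS hy1).2 hxy ▸ hy1) hx1
    · simp only [if_neg hx1, if_neg hy1]
      split_ifs with h1 h2 h2
      · exact le_rfl
      · linarith
      · exact absurd (le_antisymm (h2 ▸ hxy) (hS ▸ hx : x ∈ Icc a b).1) h1
      · exact le_rfl
  have hle := hE.outside_le_rent hL hs hpool hrent hρ' heq hout htS hθ
  have hm := hE.monotoneOn_stepDec hL hcl hstep
  have hθS := subset_closure hθ
  have hθ1 := hcl.subset hθS
  have ht1 := hcl.subset htS
  have hi1 := fun {y z : ℝ} => hE.intervalIntegrable_partialTheta hcl.ordConnected hcl.subset .sender hm (a := y) (b := z)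
  have hi2 := fun {y z : ℝ} => hE.intervalIntegrable_partialTheta hcl.ordConnected hcl.subset .sender hρ'
    (a := y) (b := z)
  refine le_trans (?_ : _ ≤ E.u .sender d t +
    (∫ x in t..θ, partialTheta (E.u .sender) (ρ' x) x) + η) (by simpa using hle)
  rw [add_assoc]
  refine add_le_add le_rfl ?_
  -- The path of integration has length at most one, so the errors `η` add up to at most `η`.
  have hconst : ∀ x y : ℝ, ∫ _ in x..y, η = (y - x) * η := fun x y => by simp
  rcases le_total t θ with h | h
  · have h3 : ∫ x in t..θ, partialTheta (E.u .sender) (E.stepDec L (closure s) g d x) x ≤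
        ∫ x in t..θ, (partialTheta (E.u .sender) (ρ' x) x + η) := by
      refine intervalIntegral.integral_mono_on_of_le_Ioo h (hi1 htS hθS)
        ((hi2 htS hθS).add intervalIntegrable_const) fun x hx => ?_
      have hx1 : x ∈ Ioo a b := ⟨ht.1.trans_lt hx.1, hx.2.trans_le (hsS hθ).2⟩
      have hx2 := hs.subset (hIoo hx1)
      refine ((hE.strictMono_partialTheta .sender hx2).monotone (hright x hx1 hx.1)).trans ?_
      rw [heq x (hIoo hx1)]
      exact (huni (ρ x) (hB x (hIoo hx1)) x hx2).1
    rw [intervalIntegral.integral_add (hi2 htS hθS) intervalIntegrable_const, hconst] at h3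
    nlinarith [hθ1.2, ht1.1]
  · have h3 : ∫ x in θ..t, (partialTheta (E.u .sender) (ρ' x) x - η) ≤
        ∫ x in θ..t, partialTheta (E.u .sender) (E.stepDec L (closure s) g d x) x := by
      refine intervalIntegral.integral_mono_on_of_le_Ioo h
        ((hi2 hθS htS).sub intervalIntegrable_const) (hi1 hθS htS) fun x hx => ?_
      have hx1 : x ∈ Ioo a b := ⟨(hsS hθ).1.trans_lt hx.1, hx.2.trans_le ht.2⟩
      have hx2 := hs.subset (hIoo hx1)
      refine le_trans ?_ ((hE.strictMono_partialTheta .sender hx2).monotone (hleft x hx1 hx.2))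
      rw [heq x (hIoo hx1)]
      exact (huni (ρ x) (hB x (hIoo hx1)) x hx2).2
    rw [intervalIntegral.integral_sub (hi2 hθS htS) intervalIntegrable_const, hconst] at h3
    rw [intervalIntegral.integral_symm θ t, intervalIntegral.integral_symm θ t]
    nlinarith [hθ1.1, ht1.2]

/-- The solution of the penal problem is a lower bound for the sender's rents. -/
lemma penalValue_le_rent {s : Set ℝ} (hs : IsCell s) {ρ W : ℝ → ℝ} (hpool : E.Poolable L s ρ)
    (hrent : E.Rent L s ρ W) {r : PenalRules (closure s)} (hr : E.SolvesPenal L r) :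
    E.penalValue r ≤ ∫ θ, W θ ∂condLaw E.prior s := by
  refine le_of_forall_pos_le_add fun η hη => ?_
  obtain ⟨r', hr', hle⟩ := hE.exists_penalRules_le hL hs hpool hrent hη
  exact (hr.2 r' hr').trans hle

end Env.Standing

/-! ## Play within a period -/

/-- A rule that refines a realization, seen as a rule on this realization. -/
def MonotoneRule.restrict {S T : Set ℝ} (μ : MonotoneRule S) (hT : T ⊆ S)
    (h : ∀ θ ∈ T, μ.cell θ ⊆ T) : MonotoneRule T where
  cell := μ.cell
  mem_cell := fun θ hθ => μ.mem_cell θ (hT hθ)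
  cell_subset := h
  cell_eq := fun θ hθ => μ.cell_eq θ (hT hθ)
  ordConnected := fun θ hθ => μ.ordConnected θ (hT hθ)

namespace Env

/-- How a period is played after the ex-ante transfers: a message rule, the decision and the
sender's interim payment as functions of the state, and the receiver's decision and belief after
an unexpected report. -/
structure Mode (ψ : Signal) where
  msg : Signal
  dec : ℝ → ℝ
  pay : ℝ → ℝ≥0
  offDec : Set ℝ → ℝ
  offState : Set ℝ → ℝ
  refines : ∀ θ ∈ Icc (0 : ℝ) 1, msg.cell θ ⊆ ψ.cell θ
  dec_eq : ∀ θ ∈ Icc (0 : ℝ) 1, ∀ θ' ∈ msg.cell θ, dec θ' = dec θ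
  pay_eq : ∀ θ ∈ Icc (0 : ℝ) 1, ∀ θ' ∈ msg.cell θ, pay θ' = pay θ
  off_mem : ∀ θ ∈ Icc (0 : ℝ) 1, offState (ψ.cell θ) ∈ closure (ψ.cell θ)

/-- The sender's payoff in a mode. -/
noncomputable def Mode.uS (E : Env) {ψ : Signal} (M : Mode ψ) (θ : ℝ) : ℝ :=
  E.u .sender (M.dec θ) θ - M.pay θ

/-- The receiver's payoff in a mode. -/
noncomputable def Mode.uR (E : Env) {ψ : Signal} (M : Mode ψ) (θ : ℝ) : ℝ :=
  E.u .receiver (M.dec θ) θ + M.pay θ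

/-- A mode with bounded and measurable choices in which the sender reports truthfully, and in
which the receiver's temptation is at most `L`. -/
structure Mode.Valid (E : Env) {ψ : Signal} (M : Mode ψ) (L : ℝ) : Prop where
  bounded : ∃ B : ℝ≥0, (∀ θ, |M.dec θ| ≤ B) ∧ (∀ θ, M.pay θ ≤ B) ∧ ∀ s, |M.offDec s| ≤ B
  aemeasurable_dec : AEMeasurable M.dec E.prior
  aemeasurable_pay : AEMeasurable (fun θ => (M.pay θ : ℝ)) E.prior
  tol : ∀ θ ∈ Icc (0 : ℝ) 1, E.Tol L (condLaw E.prior (M.msg.cell θ)) (M.dec θ)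
  off_tol : ∀ θ ∈ Icc (0 : ℝ) 1,
    E.Tol L (Measure.dirac (M.offState (ψ.cell θ))) (M.offDec (ψ.cell θ))
  ic : ∀ θ ∈ Icc (0 : ℝ) 1, ∀ θ' ∈ ψ.cell θ,
    E.u .sender (M.dec θ') θ - M.pay θ' ≤ M.uS E θ
  off_ic : ∀ θ ∈ Icc (0 : ℝ) 1, E.u .sender (M.offDec (ψ.cell θ)) θ ≤ M.uS E θ

namespace Mode

variable {ψ : Signal} (M : Mode ψ)

/-- The sender's report. -/
def report (θ : ℝ) : Set ℝ × Transfer := (M.msg.cell θ, (M.pay θ, 0))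

open Classical in
/-- The receiver's decision. -/
noncomputable def reply (s m : Set ℝ) (p : Transfer) : ℝ :=
  if h : ∃ θ ∈ s, M.report θ = (m, p) then M.dec h.choose else M.offDec s

open Classical in
/-- The receiver's belief. -/
noncomputable def belief (P : Measure ℝ) (s m : Set ℝ) (p : Transfer) : Measure ℝ :=
  if ∃ θ ∈ s, M.report θ = (m, p) then condLaw P m else Measure.dirac (M.offState s)

variable {θ₀ : ℝ} (hθ₀ : θ₀ ∈ Icc (0 : ℝ) 1)
include hθ₀

lemma mem_unit {θ : ℝ} (hθ : θ ∈ ψ.cell θ₀) : θ ∈ Icc (0 : ℝ) 1 := ψ.cell_subset θ₀ hθ₀ hθ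

lemma report_eq_iff {θ θ' : ℝ} (hθ : θ ∈ ψ.cell θ₀) (hθ' : θ' ∈ ψ.cell θ₀) :
    M.report θ' = M.report θ ↔ θ' ∈ M.msg.cell θ := by
  have h1 := mem_unit hθ₀ hθ
  have h2 := mem_unit hθ₀ hθ'
  constructor
  · intro e
    have := congrArg Prod.fst e
    simp only [report] at this
    exact this ▸ M.msg.mem_cell θ' h2
  · intro h
    simp only [report, M.msg.cell_eq θ h1 θ' h, M.pay_eq θ h1 θ' h]

lemma reply_report {θ : ℝ} (hθ : θ ∈ ψ.cell θ₀) :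
    M.reply (ψ.cell θ₀) (M.report θ).1 (M.report θ).2 = M.dec θ := by
  have h : ∃ θ' ∈ ψ.cell θ₀, M.report θ' = M.report θ := ⟨θ, hθ, rfl⟩
  rw [reply, dif_pos h]
  exact M.dec_eq θ (mem_unit hθ₀ hθ) _ ((M.report_eq_iff hθ₀ hθ h.choose_spec.1).1 h.choose_spec.2)

lemma belief_report (P : Measure ℝ) {θ : ℝ} (hθ : θ ∈ ψ.cell θ₀) :
    M.belief P (ψ.cell θ₀) (M.report θ).1 (M.report θ).2 = condLaw P (M.msg.cell θ) := by
  have h : ∃ θ' ∈ ψ.cell θ₀, M.report θ' = M.report θ := ⟨θ, hθ, rfl⟩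
  rw [belief, if_pos h]; rfl

lemma msg_subset {θ : ℝ} (hθ : θ ∈ ψ.cell θ₀) : M.msg.cell θ ⊆ ψ.cell θ₀ :=
  (M.refines θ (mem_unit hθ₀ hθ)).trans (ψ.cell_eq θ₀ hθ₀ θ hθ).subset

/-- The message rule on a signal realization. -/
def rule : MonotoneRule (ψ.cell θ₀) :=
  M.msg.restrict (ψ.cell_subset θ₀ hθ₀) fun _ hθ => M.msg_subset hθ₀ hθ

lemma measurableSet_report (y : Set ℝ × Transfer) :
    MeasurableSet {θ | θ ∈ ψ.cell θ₀ ∧ M.report θ = y} := by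
  by_cases h : ∃ θ ∈ ψ.cell θ₀, M.report θ = y
  · obtain ⟨θ, hθ, rfl⟩ := h
    have : {θ' | θ' ∈ ψ.cell θ₀ ∧ M.report θ' = M.report θ} = M.msg.cell θ := by
      ext θ'
      refine ⟨fun h => (M.report_eq_iff hθ₀ hθ h.1).1 h.2, fun h => ?_⟩
      have h' := M.msg_subset hθ₀ hθ h
      exact ⟨h', (M.report_eq_iff hθ₀ hθ h').2 h⟩
    rw [this]
    exact (M.msg.isCell subset_rfl (mem_unit hθ₀ hθ)).measurableSet
  · convert MeasurableSet.empty
    ext θ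
    simp only [mem_ofPred_eq, mem_empty_iff_false, iff_false]
    exact fun h' => h ⟨θ, h'⟩

end Mode

/-! ### Incentives within a mode -/

namespace Standing

variable {E : Env} (hE : E.Standing) {ψ : Signal}
include hE

lemma aemeasurable_condLaw_of_restrict {m : Set ℝ} (hm : IsCell m) {f : ℝ → ℝ}
    (hf : AEMeasurable f (E.prior.restrict m)) : AEMeasurable f (condLaw E.prior m) := by
  by_cases h0 : E.prior m = 0
  · obtain ⟨θ, hθ⟩ := hm.nonempty
    rw [hE.eq_singleton hm h0 hθ, hE.condLaw_singleton]
    refine (aemeasurable_const (b := f θ)).congr ?_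
    rw [Filter.EventuallyEq, ae_dirac_eq]
    exact rfl
  · exact (hE.aemeasurable_condLaw_iff (pos_iff_ne_zero.2 h0)).2 hf

lemma aemeasurable_condLaw {m : Set ℝ} (hm : IsCell m) {f : ℝ → ℝ}
    (hf : AEMeasurable f E.prior) : AEMeasurable f (condLaw E.prior m) :=
  hE.aemeasurable_condLaw_of_restrict hm hf.restrict

/-- The conditional laws given the realization of a rule disintegrate the law of the state. -/
lemma disintegration {S : Set ℝ} (hS : IsCell S) (μ : MonotoneRule S) {A : Set ℝ}
    (hA : MeasurableSet A) :
    AEMeasurable (fun θ => condLaw E.prior (μ.cell θ) A) (condLaw E.prior S) ∧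
      ∫⁻ θ, condLaw E.prior (μ.cell θ) A ∂condLaw E.prior S = condLaw E.prior S A := by
  have := hE.isProbabilityMeasure_condLaw hS
  set f : ℝ → ℝ := A.indicator fun _ => 1 with hf
  have hfm : Measurable f := measurable_const.indicator hA
  have hf01 : ∀ x, 0 ≤ f x ∧ f x ≤ 1 := fun x => by
    simp only [hf, indicator]; split_ifs <;> simp
  have hfi : ∀ (m : Measure ℝ) [IsProbabilityMeasure m], Integrable f m := fun m _ =>
    integrable_of_bounded (C := 1) hfm.aemeasurable (.of_forall fun x =>
      abs_le.2 ⟨by linarith [(hf01 x).1], (hf01 x).2⟩)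
  have hint : ∀ (m : Measure ℝ) [IsProbabilityMeasure m], ∫ x, f x ∂m = m.real A := fun m _ => by
    rw [hf, integral_indicator hA]; simp
  set F : ℝ → ℝ := fun θ => ∫ x, f x ∂condLaw E.prior (μ.cell θ) with hF
  have hcell := fun θ (hθ : θ ∈ S) => hE.isProbabilityMeasure_condLaw (μ.isCell hS.subset hθ)
  have hFm : AEMeasurable F (condLaw E.prior S) := hE.aemeasurable_condLaw_of_restrict hS
    (hE.aemeasurable_integral_cell hS μ hfm.aemeasurable)
  have hF01 : ∀ θ ∈ S, 0 ≤ F θ ∧ F θ ≤ 1 := fun θ hθ => by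
    have := hcell θ hθ
    simp only [hF, hint]
    exact ⟨measureReal_nonneg, measureReal_le_one⟩
  have hFi : Integrable F (condLaw E.prior S) := by
    refine integrable_of_bounded (C := 1) hFm ?_
    filter_upwards [hE.ae_mem_condLaw hS] with θ hθ
    exact abs_le.2 ⟨by linarith [(hF01 θ hθ).1], (hF01 θ hθ).2⟩
  have key : ∀ θ ∈ S, ∫ y, F y ∂condLaw E.prior (μ.cell θ) =
      ∫ x, f x ∂condLaw E.prior (μ.cell θ) := fun θ hθ => by
    have := hcell θ hθ
    rw [integral_congr_ae (g := fun _ => F θ)]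
    · simp [hF]
    · filter_upwards [hE.ae_mem_condLaw (μ.isCell hS.subset hθ)] with y hy
      simp only [hF, μ.cell_eq θ hθ y hy]
  have heq : ∫ θ, F θ ∂condLaw E.prior S = ∫ x, f x ∂condLaw E.prior S := le_antisymm
    (hE.integral_condLaw_le_of_cells hS μ hFi (hfi _) fun θ hθ => (key θ hθ).le)
    (hE.integral_condLaw_le_of_cells hS μ (hfi _) hFi fun θ hθ => (key θ hθ).ge)
  have hconv : ∀ θ ∈ S, condLaw E.prior (μ.cell θ) A = ENNReal.ofReal (F θ) := fun θ hθ => by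
    have := hcell θ hθ
    simp only [hF, hint]
    exact (ENNReal.ofReal_toReal (measure_ne_top _ _)).symm
  have hae : (fun θ => ENNReal.ofReal (F θ)) =ᵐ[condLaw E.prior S]
      fun θ => condLaw E.prior (μ.cell θ) A := by
    filter_upwards [hE.ae_mem_condLaw hS] with θ hθ using (hconv θ hθ).symm
  refine ⟨hFm.ennreal_ofReal.congr hae, ?_⟩
  rw [← lintegral_congr_ae hae, ← ofReal_integral_eq_lintegral_ofReal hFi, heq, hint,
    ofReal_measureReal]
  filter_upwards [hE.ae_mem_condLaw hS] with θ hθ using (hF01 θ hθ).1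

variable {M : Mode ψ} {L : ℝ} (hM : M.Valid E L) {θ₀ : ℝ} (hθ₀ : θ₀ ∈ Icc (0 : ℝ) 1)
include hM

omit hM in
lemma isProbabilityMeasure_belief (hθ₀ : θ₀ ∈ Icc (0 : ℝ) 1) (m : Set ℝ) (p : Transfer) :
    IsProbabilityMeasure (M.belief E.prior (ψ.cell θ₀) m p) ∧
      ∀ᵐ θ ∂M.belief E.prior (ψ.cell θ₀) m p, θ ∈ closure (ψ.cell θ₀) := by
  by_cases h : ∃ θ ∈ ψ.cell θ₀, M.report θ = (m, p)
  · obtain ⟨θ, hθ, e⟩ := h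
    have hc := M.msg.isCell subset_rfl (Mode.mem_unit hθ₀ hθ)
    have e2 := M.belief_report hθ₀ E.prior hθ
    rw [e] at e2
    rw [e2]
    refine ⟨hE.isProbabilityMeasure_condLaw hc, ?_⟩
    filter_upwards [hE.ae_mem_condLaw hc] with x hx
    exact subset_closure (M.msg_subset hθ₀ hθ hx)
  · rw [Mode.belief, if_neg h]
    exact ⟨inferInstance, hE.ae_dirac (M.off_mem θ₀ hθ₀)⟩

lemma tol_reply (hθ₀ : θ₀ ∈ Icc (0 : ℝ) 1) (m : Set ℝ) (p : Transfer) :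
    E.Tol L (M.belief E.prior (ψ.cell θ₀) m p) (M.reply (ψ.cell θ₀) m p) := by
  by_cases h : ∃ θ ∈ ψ.cell θ₀, M.report θ = (m, p)
  · obtain ⟨θ, hθ, e⟩ := h
    have e2 := M.belief_report hθ₀ E.prior hθ
    have e3 := M.reply_report hθ₀ hθ
    rw [e] at e2 e3
    rw [e2, e3]
    exact hM.tol θ (Mode.mem_unit hθ₀ hθ)
  · rw [Mode.belief, if_neg h, Mode.reply, dif_neg h]
    exact hM.off_tol θ₀ hθ₀

/-- A report that some type makes is covered by `ic`, including its payment. Any other report is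
covered by `off_ic`, and paying along with it only costs. -/
lemma reply_le (hθ₀ : θ₀ ∈ Icc (0 : ℝ) 1) {θ : ℝ} (hθ : θ ∈ ψ.cell θ₀) (m : Set ℝ)
    (p : Transfer) :
    E.u .sender (M.reply (ψ.cell θ₀) m p) θ - Transfer.size p ≤ M.uS E θ := by
  have hθ1 := Mode.mem_unit hθ₀ hθ
  have hc := ψ.cell_eq θ₀ hθ₀ θ hθ
  by_cases h : ∃ θ ∈ ψ.cell θ₀, M.report θ = (m, p)
  · obtain ⟨θ', hθ', e⟩ := h
    have e3 := M.reply_report hθ₀ hθ'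
    rw [e] at e3
    rw [e3]
    have e4 : p = (M.pay θ', 0) := (congrArg Prod.snd e).symm
    have := hM.ic θ hθ1 θ' (hc ▸ hθ')
    simpa [Transfer.size, e4] using this
  · rw [Mode.reply, dif_neg h]
    have := hM.off_ic θ hθ1
    rw [hc] at this
    linarith [p.size_nonneg]

lemma integrable_mode {κ : Measure ℝ} [IsProbabilityMeasure κ]
    (hκ : ∀ᵐ θ ∂κ, θ ∈ Icc (0 : ℝ) 1) (hd : AEMeasurable M.dec κ)
    (hp : AEMeasurable (fun θ => (M.pay θ : ℝ)) κ) :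
    Integrable (M.uS E) κ ∧ Integrable (M.uR E) κ ∧ (∀ i, Integrable (fun θ => E.u i (M.dec θ) θ) κ)
      ∧ Integrable (fun θ => (M.pay θ : ℝ)) κ := by
  obtain ⟨B, h1, h2, -⟩ := hM.bounded
  have hi := fun i => hE.integrable_u hκ i hd (B := B) (.of_forall h1)
  have hp' : Integrable (fun θ => (M.pay θ : ℝ)) κ := integrable_of_bounded (C := B) hp
    (.of_forall fun θ => by rw [NNReal.abs_eq]; exact_mod_cast h2 θ)
  exact ⟨(hi _).sub hp', (hi _).add hp', hi, hp'⟩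

lemma integrable_mode_cell {m : Set ℝ} (hm : IsCell m) :
    Integrable (M.uS E) (condLaw E.prior m) ∧ Integrable (M.uR E) (condLaw E.prior m) ∧
      (∀ i, Integrable (fun θ => E.u i (M.dec θ) θ) (condLaw E.prior m)) ∧
      Integrable (fun θ => (M.pay θ : ℝ)) (condLaw E.prior m) := by
  have := hE.isProbabilityMeasure_condLaw hm
  exact hE.integrable_mode hM (hE.ae_unit_condLaw hm)
    (hE.aemeasurable_condLaw hm hM.aemeasurable_dec)
    (hE.aemeasurable_condLaw hm hM.aemeasurable_pay)

lemma exists_bound_mode : ∃ C, ∀ θ ∈ Icc (0 : ℝ) 1, |M.uS E θ| ≤ C ∧ |M.uR E θ| ≤ C := by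
  obtain ⟨B, h1, h2, -⟩ := hM.bounded
  obtain ⟨C, hC⟩ := hE.bounded_u B
  have hp : ∀ θ, |(M.pay θ : ℝ)| ≤ B := fun θ => by
    rw [NNReal.abs_eq]; exact_mod_cast h2 θ
  exact ⟨C + B, fun θ hθ => ⟨(abs_sub _ _).trans (add_le_add (hC _ _ _ (h1 θ) hθ) (hp θ)),
    (abs_add_le _ _).trans (add_le_add (hC _ _ _ (h1 θ) hθ) (hp θ))⟩⟩

/-- By ignoring the messages the receiver gains at most `L`. -/
lemma integral_const_le_mode (hθ₀ : θ₀ ∈ Icc (0 : ℝ) 1) (d : ℝ) :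
    ∫ θ, E.u .receiver d θ ∂condLaw E.prior (ψ.cell θ₀) ≤
      ∫ θ, M.uR E θ ∂condLaw E.prior (ψ.cell θ₀) + L := by
  have hc := ψ.isCell subset_rfl hθ₀
  have := hE.isProbabilityMeasure_condLaw hc
  obtain ⟨-, hR, -, -⟩ := hE.integrable_mode_cell hM hc
  have e : ∫ θ, M.uR E θ ∂condLaw E.prior (ψ.cell θ₀) + L =
      ∫ θ, (M.uR E θ + L) ∂condLaw E.prior (ψ.cell θ₀) := by
    rw [integral_add hR (integrable_const _)]; simp
  rw [e]
  refine hE.integral_condLaw_le_of_cells hc (M.rule hθ₀)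
    (hE.integrable_u_const (hE.ae_unit_condLaw hc) _ _) (hR.add (integrable_const _))
    fun θ hθ => ?_
  have hθ1 := Mode.mem_unit hθ₀ hθ
  have hm := M.msg.isCell subset_rfl hθ1
  have := hE.isProbabilityMeasure_condLaw hm
  obtain ⟨-, hR', hu', -⟩ := hE.integrable_mode_cell hM hm
  change ∫ x, E.u .receiver d x ∂condLaw E.prior (M.msg.cell θ) ≤
    ∫ x, (M.uR E x + L) ∂condLaw E.prior (M.msg.cell θ)
  rw [integral_add hR' (integrable_const _)]
  have h1 := hM.tol θ hθ1 d
  have h2 : ∫ x, E.u .receiver (M.dec θ) x ∂condLaw E.prior (M.msg.cell θ) ≤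
      ∫ x, M.uR E x ∂condLaw E.prior (M.msg.cell θ) := by
    refine integral_mono_ae (hE.integrable_u_const (hE.ae_unit_condLaw hm) _ _) hR' ?_
    filter_upwards [hE.ae_mem_condLaw hm] with x hx
    rw [Mode.uR, M.dec_eq θ hθ1 x hx]
    exact le_add_of_nonneg_right (M.pay x).2
  simp only [integral_const, probReal_univ, one_smul]
  linarith

end Standing
end Env

/-! ## Equilibrium schemes -/

namespace Env

variable {ψ : Signal}

/-- A player's payoff in a mode. -/
noncomputable def Mode.payoff (E : Env) (M : Mode ψ) : Player → ℝ → ℝ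
  | .sender => M.uS E
  | .receiver => M.uR E

/-- A player's net transfer in the ex-ante round. -/
noncomputable def exNet (p q : Transfer) : Player → ℝ
  | .sender => netTransfer p q
  | .receiver => netTransfer q p

/-- A scheme: the mode `K` on the path of play, the mode `P` after the sender has not made the
prescribed ex-ante transfer, and the mode `B` once the receiver has deviated.  The ex-ante
transfers depend on whether it is the first period. -/
structure Scheme (ψ : Signal) where
  K : Mode ψ
  P : Mode ψ
  B : Mode ψ
  exS : Bool → Set ℝ → Transfer
  exR : Bool → Set ℝ → ℝ≥0

namespace Scheme

variable (A : Scheme ψ)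

open Classical in
/-- The ex-ante transfer required of the receiver. -/
noncomputable def due (b : Bool) (s : Set ℝ) (p : Transfer) : Transfer :=
  if p = A.exS b s then (A.exR b s, 0) else 0

open Classical in
/-- The mode played if the receiver has not deviated. -/
noncomputable def mode (b : Bool) (x : Opening) : Mode ψ :=
  if x.exS = A.exS b x.signal then A.K else A.P

/-- The receiver has complied in a period. -/
def Comply (b : Bool) (r : Record) : Prop :=
  r.exR = A.due b r.signal r.exS ∧ r.dec = (A.mode b r.toOpening).reply r.signal r.msg r.inS

/-- The receiver has always complied. -/
def Good : History → Prop
  | [] => True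
  | r :: t => A.Comply true r ∧ ∀ r' ∈ t, A.Comply false r'

lemma good_append (h : History) (r : Record) :
    A.Good (h ++ [r]) ↔ A.Good h ∧ A.Comply h.isEmpty r := by
  cases h with
  | nil => simp [Good]
  | cons a t =>
    simp only [List.cons_append, Good, List.mem_append, List.mem_singleton, List.isEmpty_cons,
      and_assoc]
    refine and_congr_right fun _ => ⟨fun H => ⟨fun r' hr' => H r' (.inl hr'), H r (.inr rfl)⟩, ?_⟩
    rintro ⟨H1, H2⟩ r' (hr' | rfl)
    exacts [H1 r' hr', H2]

/-- The receiver has complied so far, including the ex-ante round. -/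
def Ok (h : History) (x : Opening) : Prop :=
  A.Good h ∧ x.exR = A.due h.isEmpty x.signal x.exS

open Classical in
/-- The mode played after the ex-ante round. -/
noncomputable def modeAt (h : History) (x : Opening) : Mode ψ :=
  if A.Ok h x then A.mode h.isEmpty x else A.B

open Classical in
/-- The profile of a scheme. -/
noncomputable def profile : Profile where
  S := { exAnte := fun h s => if A.Good h then A.exS h.isEmpty s else 0
         report := fun h x => (A.modeAt h x).report
         exPost := fun _ _ => 0 }
  R := { exAnte := fun h s p => if A.Good h then A.due h.isEmpty s p else 0
         interim := fun _ _ => 0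
         decide := fun h x => (A.modeAt h x.toOpening).reply x.signal x.msg x.inS
         exPost := fun _ _ => 0 }

/-- The beliefs of a scheme. -/
noncomputable def belief (P : Measure ℝ) (h : History) (x : Reported) : Measure ℝ :=
  (A.modeAt h x.toOpening).belief P x.signal x.msg x.inS

/-- With the prescribed decision, standing after the period is decided by the earlier history and
the ex-ante round. Reports and later transfers do not matter. -/
lemma good_of_reply {h : History} {r : Record}
    (hr : r.dec = (A.modeAt h r.toOpening).reply r.signal r.msg r.inS) :
    A.Good (h ++ [r]) ↔ A.Ok h r.toOpening := by
  rw [good_append]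
  constructor
  · rintro ⟨h1, h2, -⟩
    exact ⟨h1, h2⟩
  · intro hok
    refine ⟨hok.1, hok.2, ?_⟩
    rw [hr, modeAt, if_pos hok]

lemma good_imp_ok {h : History} {r : Record} (H : A.Good (h ++ [r])) : A.Ok h r.toOpening :=
  have H := (A.good_append h r).1 H
  ⟨H.1, H.2.1⟩

/-- The expected payoff of a period in which the scheme is followed. -/
noncomputable def flow (E : Env) (b : Bool) (i : Player) : ℝ :=
  ∫ θ, (A.K.payoff E i θ - exNet (A.exS b (ψ.cell θ)) (A.exR b (ψ.cell θ), 0) i) ∂E.prior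

/-- The expected payoff of a period after the receiver has deviated. -/
noncomputable def badFlow (E : Env) (i : Player) : ℝ := ∫ θ, A.B.payoff E i θ ∂E.prior

open Classical in
/-- The continuation payoffs. -/
noncomputable def next (E : Env) (i : Player) (g : Prop) : ℝ :=
  if g then A.flow E false i else A.badFlow E i

/-- The conditions under which a scheme is an equilibrium, `L` being the receiver's discounted
loss from losing her good standing. -/
structure Valid (E : Env) (L : ℝ) : Prop where
  K_valid : A.K.Valid E L
  P_valid : A.P.Valid E L
  -- Once in bad standing the receiver has nothing more to lose, so her decisions must be myopically
  -- best.
  B_valid : A.B.Valid E 0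
  bounded : ∃ C : ℝ≥0, ∀ b s, TransferLE (A.exS b s) C ∧ A.exR b s ≤ C
  aemeasurable_gift : ∀ b, AEMeasurable (fun θ => ((A.exS b (ψ.cell θ)).1 : ℝ)) E.prior
  aemeasurable_burn : ∀ b, AEMeasurable (fun θ => ((A.exS b (ψ.cell θ)).2 : ℝ)) E.prior
  aemeasurable_reward : ∀ b, AEMeasurable (fun θ => (A.exR b (ψ.cell θ) : ℝ)) E.prior
  -- If the sender departs from the prescribed transfer, the receiver pays nothing and `P` is
  -- played. His continuation payoff is the same, so one period decides.
  sender_comply : ∀ b, ∀ θ ∈ Icc (0 : ℝ) 1,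
    ∫ x, A.P.uS E x ∂condLaw E.prior (ψ.cell θ) ≤
      (∫ x, A.K.uS E x ∂condLaw E.prior (ψ.cell θ)) -
        netTransfer (A.exS b (ψ.cell θ)) (A.exR b (ψ.cell θ), 0)
  receiver_comply : ∀ b, ∀ θ ∈ Icc (0 : ℝ) 1,
    ∫ x, A.B.uR E x ∂condLaw E.prior (ψ.cell θ) ≤
      (∫ x, A.K.uR E x ∂condLaw E.prior (ψ.cell θ)) - A.exR b (ψ.cell θ) + L
  receiver_penal : ∀ θ ∈ Icc (0 : ℝ) 1,
    ∫ x, A.B.uR E x ∂condLaw E.prior (ψ.cell θ) ≤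
      (∫ x, A.P.uR E x ∂condLaw E.prior (ψ.cell θ)) + L
  -- Losing good standing replaces the flow by the bad flow in all later periods; `L` is this loss
  -- in units of the current stage payoff.
  surplus : (1 - E.δ) * L = E.δ * (A.flow E false .receiver - A.badFlow E .receiver)

variable {A} {E : Env} {L : ℝ}

lemma Valid.mode_valid (hA : A.Valid E L) (b : Bool) (x : Opening) : (A.mode b x).Valid E L := by
  unfold mode; split_ifs
  exacts [hA.K_valid, hA.P_valid]

lemma Valid.exists_bound_modes (hA : A.Valid E L) : ∃ C : ℝ≥0, ∀ h x,
    (∀ s m p, |(A.modeAt h x).reply s m p| ≤ C) ∧ ∀ θ, (A.modeAt h x).pay θ ≤ C := by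
  obtain ⟨K1, K2, K3, K4⟩ := hA.K_valid.bounded
  obtain ⟨P1, P2, P3, P4⟩ := hA.P_valid.bounded
  obtain ⟨B1, B2, B3, B4⟩ := hA.B_valid.bounded
  have l1 : K1 ≤ K1 + P1 + B1 := by rw [add_assoc]; exact le_self_add
  have l2 : P1 ≤ K1 + P1 + B1 := le_add_self.trans le_self_add
  have l3 : B1 ≤ K1 + P1 + B1 := le_add_self
  have hr : ∀ (M : Mode ψ) (C C' : ℝ≥0), C ≤ C' → (∀ θ, |M.dec θ| ≤ C) → (∀ s, |M.offDec s| ≤ C) →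
      ∀ s m p, |M.reply s m p| ≤ C' := fun M C C' hC h1 h2 s m p => by
    unfold Mode.reply
    split_ifs
    exacts [(h1 _).trans (by exact_mod_cast hC), (h2 _).trans (by exact_mod_cast hC)]
  refine ⟨K1 + P1 + B1, fun h x => ?_⟩
  have : A.modeAt h x = A.K ∨ A.modeAt h x = A.P ∨ A.modeAt h x = A.B := by
    unfold modeAt mode; split_ifs <;> simp
  rcases this with e | e | e <;> rw [e]
  exacts [⟨hr _ _ _ l1 K2 K4, fun θ => (K3 θ).trans l1⟩, ⟨hr _ _ _ l2 P2 P4, fun θ => (P3 θ).trans l2⟩,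
    ⟨hr _ _ _ l3 B2 B4, fun θ => (B3 θ).trans l3⟩]

lemma Valid.bounded_profile (hA : A.Valid E L) :
    A.profile.S.Bounded ∧ A.profile.R.Bounded := by
  obtain ⟨C, hC⟩ := hA.exists_bound_modes
  obtain ⟨C', hC'⟩ := hA.bounded
  have l1 : C ≤ C + C' := le_self_add
  have l2 : C' ≤ C + C' := le_add_self
  refine ⟨⟨C + C', fun h s => ?_, fun h x θ => ⟨((hC h x).2 θ).trans l1, zero_le⟩,
    fun _ _ => transferLE_zero _⟩, ⟨C + C', fun h s p => ?_, fun _ _ => transferLE_zero _,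
    fun h x => ((hC h _).1 _ _ _).trans (by exact_mod_cast l1), fun _ _ => transferLE_zero _⟩⟩
  · simp only [profile]
    split_ifs
    exacts [(hC' _ _).1.mono l2, transferLE_zero _]
  · simp only [profile, due]
    split_ifs
    exacts [⟨(hC' _ _).2.trans l2, zero_le⟩, transferLE_zero _, transferLE_zero _]

/-- The payoff of the current period after the ex-ante round. -/
lemma stage_afterOpening {θ₀ : ℝ} (hθ₀ : θ₀ ∈ Icc (0 : ℝ) 1) {x : Opening}
    (hx : x.signal = ψ.cell θ₀) {θ : ℝ} (hθ : θ ∈ ψ.cell θ₀) (h : History) (i : Player) :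
    E.stage i θ (A.profile.afterOpening h x θ) =
      (A.modeAt h x).payoff E i θ - exNet x.exS x.exR i := by
  have hd : (A.profile.afterOpening h x θ).dec = (A.modeAt h x).dec θ := by
    have := (A.modeAt h x).reply_report hθ₀ hθ
    rw [← hx] at this
    exact this
  cases i
  · simp only [stage, hd, Mode.payoff, Mode.uS, exNet]
    simp only [Record.net, netTransfer, Profile.afterOpening, Profile.afterReported,
      Profile.afterPaid, Profile.afterDecided, Profile.afterSettling, profile, Mode.report]
    simp; ring
  · simp only [stage, hd, Mode.payoff, Mode.uR, exNet]
    simp only [Record.net, netTransfer, Profile.afterOpening, Profile.afterReported,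
      Profile.afterPaid, Profile.afterDecided, Profile.afterSettling, profile, Mode.report]
    simp; ring

lemma good_afterReported (h : History) (X : Reported) :
    A.Good (h ++ [A.profile.afterReported h X]) ↔ A.Ok h X.toOpening :=
  A.good_of_reply rfl

lemma good_afterOpening (h : History) (x : Opening) (θ : ℝ) :
    A.Good (h ++ [A.profile.afterOpening h x θ]) ↔ A.Ok h x :=
  A.good_of_reply rfl

lemma good_play (h : History) (θ : ℝ) : A.Good (h ++ [A.profile.play h ψ θ]) ↔ A.Good h := by
  refine (A.good_afterOpening h _ θ).trans ⟨fun H => H.1, fun H => ⟨H, ?_⟩⟩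
  simp only [profile, if_pos H]

/-- The opening of a period in which the scheme is followed. -/
lemma modeAt_play (h : History) (s : Set ℝ) : A.modeAt h
    ⟨s, A.profile.S.exAnte h s, A.profile.R.exAnte h s (A.profile.S.exAnte h s)⟩ =
      open Classical in if A.Good h then A.K else A.B := by
  by_cases hg : A.Good h
  · simp [modeAt, profile, Ok, hg, mode]
  · simp [modeAt, Ok, hg]

open Classical in
lemma stage_play (h : History) {θ : ℝ} (hθ : θ ∈ Icc (0 : ℝ) 1) (i : Player) :
    E.stage i θ (A.profile.play h ψ θ) = if A.Good h then A.K.payoff E i θ -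
      exNet (A.exS h.isEmpty (ψ.cell θ)) (A.exR h.isEmpty (ψ.cell θ), 0) i
      else A.B.payoff E i θ := by
  refine (stage_afterOpening hθ rfl (ψ.mem_cell θ hθ) h i).trans ?_
  rw [modeAt_play]
  by_cases hg : A.Good h
  · simp [profile, hg, due]
  · simp only [profile, if_neg hg]
    cases i <;> simp [exNet, netTransfer]

variable (hE : E.Standing)
include hE

open Classical in
lemma ahead_zero (i : Player) (h : History) : E.ahead ψ A.profile i 0 h =
    if A.Good h then A.flow E h.isEmpty i else A.badFlow E i := by
  rw [ahead, integral_congr_ae (hE.ae_mem.mono fun θ hθ => A.stage_play h hθ i)]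
  split_ifs <;> rfl

/-- Play according to the profile preserves the standing, so expected payoffs are stationary from
the second period on. The first period is excluded because its ex-ante transfers differ. -/
lemma ahead_eq_next (i : Player) (k : ℕ) (h : History) (hk : k ≠ 0 ∨ h ≠ []) :
    E.ahead ψ A.profile i k h = A.next E i (A.Good h) := by
  have := hE.isProbabilityMeasure
  induction k generalizing h with
  | zero =>
    have : h.isEmpty = false := by simpa using hk
    rw [ahead_zero hE, this]; rfl
  | succ k ih =>
    rw [ahead]
    simp only [ih _ (.inr (List.append_ne_nil_of_right_ne_nil _ (List.cons_ne_nil _ _))), good_play]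
    simp

lemma value_eq_next (i : Player) {h : History} (hh : h ≠ []) :
    E.value ψ A.profile i h = A.next E i (A.Good h) := by
  simp only [value, ahead_eq_next hE i _ h (.inr hh), tsum_mul_right,
    tsum_geometric_of_lt_one hE.delta_nonneg hE.delta_lt_one]
  rw [mul_inv_cancel_left₀ (sub_pos.2 hE.delta_lt_one).ne']

lemma value_append (i : Player) (h : History) (r : Record) :
    E.value ψ A.profile i (h ++ [r]) = A.next E i (A.Good (h ++ [r])) :=
  value_eq_next hE i (by simp)

/-- The payoffs of a scheme. -/
lemma value_nil (i : Player) : E.value ψ A.profile i [] =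
    (1 - E.δ) * A.flow E true i + E.δ * A.flow E false i := by
  have h1 := (sub_pos.2 hE.delta_lt_one).ne'
  have hs : Summable fun k => E.δ ^ k * E.ahead ψ A.profile i k [] := by
    rw [← summable_nat_add_iff 1]
    simp only [ahead_eq_next hE i _ [] (.inl (Nat.succ_ne_zero _))]
    exact (((summable_nat_add_iff 1).2
      (summable_geometric_of_lt_one hE.delta_nonneg hE.delta_lt_one)).mul_right _)
  rw [value, hs.tsum_eq_zero_add]
  simp only [ahead_eq_next hE i _ [] (.inl (Nat.succ_ne_zero _)), ahead_zero hE, tsum_mul_right,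
    pow_succ, tsum_geometric_of_lt_one hE.delta_nonneg hE.delta_lt_one]
  have hg : A.Good [] := trivial
  rw [next, if_pos hg, if_pos hg, List.isEmpty_nil]
  field_simp

lemma total_afterOpening {θ₀ : ℝ} (hθ₀ : θ₀ ∈ Icc (0 : ℝ) 1) {x : Opening}
    (hx : x.signal = ψ.cell θ₀) {θ : ℝ} (hθ : θ ∈ ψ.cell θ₀) (h : History) (i : Player) :
    E.total ψ A.profile i h θ (A.profile.afterOpening h x θ) =
      (1 - E.δ) * ((A.modeAt h x).payoff E i θ - exNet x.exS x.exR i) +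
        E.δ * A.next E i (A.Ok h x) := by
  rw [total, stage_afterOpening hθ₀ hx hθ, value_append hE, good_afterOpening]

end Scheme
end Env

namespace Env
namespace Scheme

variable {ψ : Signal} {A : Scheme ψ} {E : Env} {L : ℝ}

/-! ## Schemes are consistent and measurable -/

lemma dec_afterOpening {θ₀ : ℝ} (hθ₀ : θ₀ ∈ Icc (0 : ℝ) 1) {x : Opening}
    (hx : x.signal = ψ.cell θ₀) {θ : ℝ} (hθ : θ ∈ ψ.cell θ₀) (h : History) :
    (A.profile.afterOpening h x θ).dec = (A.modeAt h x).dec θ := by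
  have := (A.modeAt h x).reply_report hθ₀ hθ
  rw [← hx] at this
  exact this

lemma net_afterOpening_sender (h : History) (x : Opening) (θ : ℝ) :
    (A.profile.afterOpening h x θ).net .sender =
      netTransfer x.exS x.exR + (A.modeAt h x).pay θ := by
  simp only [Record.net, netTransfer, Profile.afterOpening, Profile.afterReported,
    Profile.afterPaid, Profile.afterDecided, Profile.afterSettling, profile, Mode.report]
  simp

lemma net_afterOpening_receiver (h : History) (x : Opening) (θ : ℝ) :
    (A.profile.afterOpening h x θ).net .receiver =
      netTransfer x.exR x.exS - (A.modeAt h x).pay θ := by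
  simp only [Record.net, netTransfer, Profile.afterOpening, Profile.afterReported,
    Profile.afterPaid, Profile.afterDecided, Profile.afterSettling, profile, Mode.report]
  simp; ring

lemma Valid.exists_valid (hA : A.Valid E L) (h : History) (x : Opening) :
    ∃ L', (A.modeAt h x).Valid E L' := by
  unfold modeAt
  split_ifs
  exacts [⟨L, hA.mode_valid _ _⟩, ⟨0, hA.B_valid⟩]

variable (hE : E.Standing)
include hE

lemma Valid.measurableFrom (hA : A.Valid E L) (h₀ : History) :
    E.MeasurableFrom ψ A.profile h₀ := by
  intro h _
  refine ⟨⟨?_, fun i => ?_, fun i k => ?_⟩, fun θ₀ hθ₀ p q => ⟨fun y => ?_, ?_, fun i => ?_, fun i k => ?_⟩⟩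
  · classical
    have h1 : AEMeasurable (if A.Good h then A.K else A.B).dec E.prior := by
      split_ifs
      exacts [hA.K_valid.aemeasurable_dec, hA.B_valid.aemeasurable_dec]
    refine h1.congr (hE.ae_mem.mono fun θ hθ => ?_)
    refine Eq.trans ?_ (dec_afterOpening hθ rfl (ψ.mem_cell θ hθ) h).symm
    rw [modeAt_play]
  · classical
    have h1 : AEMeasurable (fun θ => ((if A.Good h then A.K else A.B).pay θ : ℝ)) E.prior := by
      split_ifs
      exacts [hA.K_valid.aemeasurable_pay, hA.B_valid.aemeasurable_pay]
    have h2 : AEMeasurable (fun θ => ((A.profile.S.exAnte h (ψ.cell θ)).1 : ℝ)) E.prior := by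
      simp only [profile]
      split_ifs
      exacts [hA.aemeasurable_gift _, aemeasurable_const]
    have h3 : AEMeasurable (fun θ => ((A.profile.S.exAnte h (ψ.cell θ)).2 : ℝ)) E.prior := by
      simp only [profile]
      split_ifs
      exacts [hA.aemeasurable_burn _, aemeasurable_const]
    have e : ∀ s, A.profile.R.exAnte h s (A.profile.S.exAnte h s) =
        if A.Good h then (A.exR h.isEmpty s, 0) else 0 := fun s => by
      by_cases hg : A.Good h <;> simp [profile, hg, due]
    have h4 : AEMeasurable (fun θ => ((if A.Good h then ((A.exR h.isEmpty (ψ.cell θ), 0) : Transfer)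
        else 0).1 : ℝ)) E.prior := by
      split_ifs
      exacts [hA.aemeasurable_reward _, aemeasurable_const]
    have h5 : AEMeasurable (fun θ => ((if A.Good h then ((A.exR h.isEmpty (ψ.cell θ), 0) : Transfer)
        else 0).2 : ℝ)) E.prior := by
      split_ifs <;> exact aemeasurable_const
    cases i
    · refine (((h2.sub h4).add h3).add h1).congr (.of_forall fun θ => ?_)
      refine Eq.trans ?_ (net_afterOpening_sender h _ θ).symm
      rw [modeAt_play, e]
      simp only [netTransfer, Pi.add_apply, Pi.sub_apply]
    · refine (((h4.sub h2).add h5).sub h1).congr (.of_forall fun θ => ?_)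
      refine Eq.trans ?_ (net_afterOpening_receiver h _ θ).symm
      rw [modeAt_play, e]
      simp only [netTransfer, Pi.add_apply, Pi.sub_apply]
  · simp only [ahead_eq_next hE i k _ (.inr (List.append_ne_nil_of_right_ne_nil _ (List.cons_ne_nil _ _))),
      good_play]
    exact aemeasurable_const
  · exact (A.modeAt h _).measurableSet_report hθ₀ y
  · have hc := ψ.isCell subset_rfl hθ₀
    obtain ⟨L', hM⟩ := hA.exists_valid h ⟨ψ.cell θ₀, p, q⟩
    refine (hE.aemeasurable_condLaw hc hM.aemeasurable_dec).congr
      ((hE.ae_mem_condLaw hc).mono fun θ hθ => (dec_afterOpening hθ₀ rfl hθ h).symm)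
  · have hc := ψ.isCell subset_rfl hθ₀
    obtain ⟨L', hM⟩ := hA.exists_valid h ⟨ψ.cell θ₀, p, q⟩
    have := hE.aemeasurable_condLaw hc hM.aemeasurable_pay
    cases i
    · simp only [net_afterOpening_sender]
      exact this.const_add _
    · simp only [net_afterOpening_receiver]
      exact this.const_sub _
  · simp only [ahead_eq_next hE i k _ (.inr (List.append_ne_nil_of_right_ne_nil _ (List.cons_ne_nil _ _))),
      good_afterOpening]
    exact aemeasurable_const

lemma Valid.consistent (hA : A.Valid E L) :
    E.Consistent ψ A.profile (A.belief E.prior) := by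
  intro h θ₀ hθ₀ x hx
  have hc := ψ.isCell subset_rfl hθ₀
  set M := A.modeAt h x with hM
  have hb : ∀ θ ∈ ψ.cell θ₀, A.belief E.prior h ⟨x, (A.profile.S.report h x θ).1,
      (A.profile.S.report h x θ).2⟩ = condLaw E.prior (M.msg.cell θ) := fun θ hθ => by
    have := M.belief_report hθ₀ E.prior hθ
    rw [← hx] at this
    exact this
  refine ⟨fun m p => ?_, fun θ hθ => ?_, fun S hS => ?_⟩
  · obtain ⟨h1, h2⟩ := hE.isProbabilityMeasure_belief (M := M) hθ₀ m p
    rw [← hx] at h1 h2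
    exact ⟨h1.1, h2⟩
  · rw [hx] at hθ ⊢
    dsimp only
    rw [hb θ hθ]
    have hm := M.msg.isCell subset_rfl (Mode.mem_unit hθ₀ hθ)
    refine measure_mono_null (compl_subset_compl.2 fun θ' h' => ?_) (hE.ae_mem_condLaw hm)
    have h'' := M.msg_subset hθ₀ hθ h'
    exact ⟨h'', (M.report_eq_iff hθ₀ hθ h'').2 h'⟩
  · rw [hx]
    dsimp only
    obtain ⟨d1, d2⟩ := hE.disintegration hc (M.rule hθ₀) hS
    have hae : (fun θ => condLaw E.prior ((M.rule hθ₀).cell θ) S) =ᵐ[condLaw E.prior (ψ.cell θ₀)]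
        fun θ => A.belief E.prior h ⟨x, (A.profile.S.report h x θ).1,
          (A.profile.S.report h x θ).2⟩ S :=
      (hE.ae_mem_condLaw hc).mono fun θ hθ => by simp only [hb θ hθ]; rfl
    exact ⟨d1.congr hae, (lintegral_congr_ae hae).symm.trans d2⟩

end Scheme

namespace Standing

variable {E : Env} (hE : E.Standing) {ψ : Signal} {σ σ' : Profile}
include hE

/-- The one-shot deviation principle, period by period. -/
lemma value_le_of_signal (hS : σ.S.Bounded) (hR : σ.R.Bounded) (hS' : σ'.S.Bounded)
    (hR' : σ'.R.Bounded) (i : Player) (h₀ : History) (hm : E.MeasurableFrom ψ σ h₀)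
    (hm' : E.MeasurableFrom ψ σ' h₀)
    (hstep : ∀ h, h₀ <+: h → ∀ D, 0 ≤ D →
      (∀ h', h₀ <+: h' → E.value ψ σ' i h' ≤ E.value ψ σ i h' + D) →
      ∀ θ₀ ∈ Icc (0 : ℝ) 1,
        ∫ θ, E.total ψ σ' i h θ (σ'.afterSignal h (ψ.cell θ₀) θ) ∂condLaw E.prior (ψ.cell θ₀) ≤
          (∫ θ, E.total ψ σ i h θ (σ.afterSignal h (ψ.cell θ₀) θ) ∂condLaw E.prior (ψ.cell θ₀)) +
            E.δ * D) :
    ∀ h, h₀ <+: h → E.value ψ σ' i h ≤ E.value ψ σ i h := by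
  refine hE.value_le_of_contraction hS hR hS' hR' i h₀ fun h hh D hD H => ?_
  have := hE.isProbabilityMeasure
  rw [hE.value_eq_integral hS hR (hm h hh).1, hE.value_eq_integral hS' hR' (hm' h hh).1]
  obtain ⟨B, -, hB⟩ := Profile.exists_bound_afterSignal hS hR
  obtain ⟨B', -, hB'⟩ := Profile.exists_bound_afterSignal hS' hR'
  have i1 := hE.integrable_total hS hR hE.ae_mem (hm h hh).1 (.of_forall fun θ => hB h _ θ) i
  have i2 := hE.integrable_total hS' hR' hE.ae_mem (hm' h hh).1 (.of_forall fun θ => hB' h _ θ) i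
  have e : (∫ θ, E.total ψ σ i h θ (σ.play h ψ θ) ∂E.prior) + E.δ * D =
      ∫ θ, (E.total ψ σ i h θ (σ.play h ψ θ) + E.δ * D) ∂E.prior := by
    rw [integral_add i1 (integrable_const _)]; simp
  rw [e]
  refine hE.integral_prior_le_of_cells ψ i2 (i1.add (integrable_const _)) fun θ₀ hθ₀ => ?_
  have hc := ψ.isCell subset_rfl hθ₀
  have := hE.isProbabilityMeasure_condLaw hc
  have key := hstep h hh D hD H θ₀ hθ₀
  have cong : ∀ τ : Profile, ∫ θ, E.total ψ τ i h θ (τ.play h ψ θ) ∂condLaw E.prior (ψ.cell θ₀) =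
      ∫ θ, E.total ψ τ i h θ (τ.afterSignal h (ψ.cell θ₀) θ) ∂condLaw E.prior (ψ.cell θ₀) :=
    fun τ => integral_congr_ae ((hE.ae_mem_condLaw hc).mono fun θ hθ => by
      simp only [Profile.play, ψ.cell_eq θ₀ hθ₀ θ hθ])
  rw [cong]
  refine key.trans_eq ?_
  have hoc := ((hm h hh).2 θ₀ hθ₀ (σ.S.exAnte h (ψ.cell θ₀))
    (σ.R.exAnte h (ψ.cell θ₀) (σ.S.exAnte h (ψ.cell θ₀)))).2
  have i3 : Integrable (fun θ => E.total ψ σ i h θ (σ.afterSignal h (ψ.cell θ₀) θ))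
      (condLaw E.prior (ψ.cell θ₀)) :=
    hE.integrable_total hS hR (hE.ae_unit_condLaw hc) hoc (.of_forall fun θ => hB h _ θ) i
  rw [← cong σ]
  have i4 : Integrable (fun θ => E.total ψ σ i h θ (σ.play h ψ θ)) (condLaw E.prior (ψ.cell θ₀)) :=
    i3.congr ((hE.ae_mem_condLaw hc).mono fun θ hθ => by
      simp only [Profile.play, ψ.cell_eq θ₀ hθ₀ θ hθ])
  rw [integral_add i4 (integrable_const _)]; simp

/-- The payoffs after the ex-ante round are integrable. -/
lemma integrable_afterOpening (hS : σ.S.Bounded) (hR : σ.R.Bounded) {h : History}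
    (hm : E.MeasurableFrom ψ σ h) {θ₀ : ℝ} (hθ₀ : θ₀ ∈ Icc (0 : ℝ) 1) (p q : Transfer)
    (i : Player) : Integrable (fun θ => E.total ψ σ i h θ (σ.afterOpening h ⟨ψ.cell θ₀, p, q⟩ θ))
      (condLaw E.prior (ψ.cell θ₀)) := by
  have hc := ψ.isCell subset_rfl hθ₀
  have := hE.isProbabilityMeasure_condLaw hc
  obtain ⟨B, -, hB⟩ := Profile.exists_bound_afterOpening hS hR
  refine hE.integrable_total (B := B + p.size + q.size) hS hR (hE.ae_unit_condLaw hc)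
    ((hm h (List.prefix_refl h)).2 θ₀ hθ₀ p q).2 (.of_forall fun θ => ⟨?_, (hB h _ θ).2⟩) i
  linarith [(hB h ⟨ψ.cell θ₀, p, q⟩ θ).1, p.size_nonneg, q.size_nonneg]

end Standing
end Env

namespace Env
namespace Scheme

variable {ψ : Signal} {A : Scheme ψ} {E : Env} {L : ℝ} (hE : E.Standing) (hA : A.Valid E L)
include hE hA

/-! ## The sender's incentives in a scheme -/

omit hE hA in
lemma modeAt_of_ok {h : History} {x : Opening} (hok : A.Ok h x) :
    A.modeAt h x = A.mode h.isEmpty x := if_pos hok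

omit hE hA in
lemma modeAt_of_not_ok {h : History} {x : Opening} (hok : ¬ A.Ok h x) :
    A.modeAt h x = A.B := if_neg hok

lemma integral_total_afterOpening {θ₀ : ℝ} (hθ₀ : θ₀ ∈ Icc (0 : ℝ) 1) {x : Opening}
    (hx : x.signal = ψ.cell θ₀) (h : History) (i : Player) :
    ∫ θ, E.total ψ A.profile i h θ (A.profile.afterOpening h x θ) ∂condLaw E.prior (ψ.cell θ₀) =
      (1 - E.δ) * ((∫ θ, (A.modeAt h x).payoff E i θ ∂condLaw E.prior (ψ.cell θ₀)) -
        exNet x.exS x.exR i) + E.δ * A.next E i (A.Ok h x) := by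
  have hc := ψ.isCell subset_rfl hθ₀
  have := hE.isProbabilityMeasure_condLaw hc
  obtain ⟨L', hM⟩ := hA.exists_valid h x
  obtain ⟨i1, i2, -⟩ := hE.integrable_mode_cell hM hc
  have hi : Integrable ((A.modeAt h x).payoff E i) (condLaw E.prior (ψ.cell θ₀)) := by
    cases i
    exacts [i1, i2]
  have hi' : Integrable (fun θ => (A.modeAt h x).payoff E i θ - exNet x.exS x.exR i)
    (condLaw E.prior (ψ.cell θ₀)) := hi.sub (integrable_const _)
  rw [integral_congr_ae ((hE.ae_mem_condLaw hc).mono fun θ hθ => total_afterOpening hE hθ₀ hx hθ h i),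
    integral_add (hi'.const_mul _) (integrable_const _), integral_const_mul,
    integral_sub hi (integrable_const _)]
  simp

omit hE hA in
lemma exS_signal {h : History} {S' : SenderStrategy} (x : Opening) (θ : ℝ) :
    A.Good (h ++ [(⟨S', A.profile.R⟩ : Profile).afterOpening h x θ]) ↔ A.Ok h x :=
  A.good_of_reply rfl

variable {S' : SenderStrategy} {D : ℝ}

/-- Standing depends on the receiver alone, so no report changes the continuation of the scheme. In
the current period the mode makes truthful reports optimal; later deviations add at most `D`. -/
lemma sender_opening {h : History} {θ₀ : ℝ} (hθ₀ : θ₀ ∈ Icc (0 : ℝ) 1) {x : Opening}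
    (hD : ∀ r, E.value ψ ⟨S', A.profile.R⟩ .sender (h ++ [r]) ≤
      E.value ψ A.profile .sender (h ++ [r]) + D)
    (hx : x.signal = ψ.cell θ₀) {θ : ℝ} (hθ : θ ∈ ψ.cell θ₀) :
    E.total ψ ⟨S', A.profile.R⟩ .sender h θ ((⟨S', A.profile.R⟩ : Profile).afterOpening h x θ) ≤
      E.total ψ A.profile .sender h θ (A.profile.afterOpening h x θ) + E.δ * D := by
  have hδ : 0 < 1 - E.δ := sub_pos.2 hE.delta_lt_one
  rw [total_afterOpening hE hθ₀ hx hθ, total]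
  set r := (⟨S', A.profile.R⟩ : Profile).afterOpening h x θ with hr
  have h1 := hD r
  rw [value_append hE, exS_signal] at h1
  obtain ⟨L', hM⟩ := hA.exists_valid h x
  have h2 := hE.reply_le hM hθ₀ hθ r.msg r.inS
  have h3 : r.dec = (A.modeAt h x).reply (ψ.cell θ₀) r.msg r.inS := by rw [← hx]; rfl
  have h4 : r.net .sender = netTransfer x.exS x.exR + Transfer.size r.inS +
      Transfer.size r.postS := by
    have e1 : r.inR = 0 := rfl
    have e2 : r.postR = 0 := rfl
    have e3 : r.exS = x.exS := rfl
    have e4 : r.exR = x.exR := rfl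
    simp only [Record.net, netTransfer, Transfer.size, e1, e2, e3, e4]
    simp
  have h5 := Transfer.size_nonneg r.postS
  have h6 : E.stage .sender θ r ≤ (A.modeAt h x).payoff E .sender θ - exNet x.exS x.exR .sender := by
    rw [stage, h3, h4]
    simp only [Mode.payoff, exNet]
    linarith
  have h7 := mul_le_mul_of_nonneg_left h1 hE.delta_nonneg
  have h8 := mul_le_mul_of_nonneg_left h6 hδ.le
  linarith

/-- By `sender_opening` only the ex-ante transfer remains to be compared. In good standing a wrong
transfer triggers `P` and forfeits the receiver's payment, which `sender_comply` makes unprofitable.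
In bad standing no transfer changes play, so paying is a waste. -/
lemma sender_signal (hS' : S'.Bounded) {h : History}
    (hm : E.MeasurableFrom ψ ⟨S', A.profile.R⟩ h) {θ₀ : ℝ} (hθ₀ : θ₀ ∈ Icc (0 : ℝ) 1)
    (hD : ∀ r, E.value ψ ⟨S', A.profile.R⟩ .sender (h ++ [r]) ≤
      E.value ψ A.profile .sender (h ++ [r]) + D) :
    ∫ θ, E.total ψ ⟨S', A.profile.R⟩ .sender h θ
        ((⟨S', A.profile.R⟩ : Profile).afterSignal h (ψ.cell θ₀) θ) ∂condLaw E.prior (ψ.cell θ₀) ≤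
      (∫ θ, E.total ψ A.profile .sender h θ (A.profile.afterSignal h (ψ.cell θ₀) θ)
        ∂condLaw E.prior (ψ.cell θ₀)) + E.δ * D := by
  have hδ : 0 < 1 - E.δ := sub_pos.2 hE.delta_lt_one
  have hc := ψ.isCell subset_rfl hθ₀
  have := hE.isProbabilityMeasure_condLaw hc
  obtain ⟨hbS, hbR⟩ := hA.bounded_profile
  set s := ψ.cell θ₀ with hs
  set p := S'.exAnte h s with hp
  set q := A.profile.R.exAnte h s p with hq
  set x : Opening := ⟨s, p, q⟩ with hx
  have i1 : Integrable (fun θ => E.total ψ ⟨S', A.profile.R⟩ .sender h θ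
      ((⟨S', A.profile.R⟩ : Profile).afterSignal h s θ)) (condLaw E.prior s) :=
    hE.integrable_afterOpening (σ := ⟨S', A.profile.R⟩) hS' hbR hm hθ₀ p q .sender
  have i2 : Integrable (fun θ => E.total ψ A.profile .sender h θ (A.profile.afterOpening h x θ))
      (condLaw E.prior s) :=
    hE.integrable_afterOpening hbS hbR (hA.measurableFrom hE h) hθ₀ p q .sender
  have h1 : ∫ θ, E.total ψ ⟨S', A.profile.R⟩ .sender h θ
      ((⟨S', A.profile.R⟩ : Profile).afterSignal h s θ) ∂condLaw E.prior s ≤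
      (∫ θ, E.total ψ A.profile .sender h θ (A.profile.afterOpening h x θ) ∂condLaw E.prior s) +
        E.δ * D := by
    have e : (∫ θ, E.total ψ A.profile .sender h θ (A.profile.afterOpening h x θ)
        ∂condLaw E.prior s) + E.δ * D = ∫ θ, (E.total ψ A.profile .sender h θ
          (A.profile.afterOpening h x θ) + E.δ * D) ∂condLaw E.prior s := by
      rw [integral_add i2 (integrable_const _)]; simp
    rw [e]
    exact integral_mono_ae i1 (i2.add (integrable_const _)) ((hE.ae_mem_condLaw hc).mono
      fun θ hθ => sender_opening hE hA hθ₀ hD rfl hθ)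
  refine h1.trans (add_le_add_left ?_ _)
  set x' : Opening := ⟨s, A.profile.S.exAnte h s, A.profile.R.exAnte h s (A.profile.S.exAnte h s)⟩
    with hx'
  change _ ≤ ∫ θ, E.total ψ A.profile .sender h θ (A.profile.afterOpening h x' θ) ∂condLaw E.prior s
  rw [integral_total_afterOpening hE hA hθ₀ rfl, integral_total_afterOpening hE hA hθ₀ rfl]
  by_cases hg : A.Good h
  · have hq' : q = A.due h.isEmpty s p := by rw [hq]; simp [profile, hg]
    have ok : A.Ok h x := ⟨hg, hq'⟩
    have ok' : A.Ok h x' := by refine ⟨hg, ?_⟩; simp [hx', profile, hg]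
    have e1 : A.next E .sender (A.Ok h x) = A.next E .sender (A.Ok h x') := by
      simp only [ok, ok']
    rw [e1]
    refine add_le_add_left (mul_le_mul_of_nonneg_left ?_ hδ.le) _
    have e2 : x'.exS = A.exS h.isEmpty s := by simp [hx', profile, hg]
    have e3 : x'.exR = (A.exR h.isEmpty s, 0) := by simp [hx', profile, hg, due]
    have e4 : A.modeAt h x' = A.K := by
      rw [modeAt_of_ok ok', mode, if_pos e2]
    have key := hA.sender_comply h.isEmpty θ₀ hθ₀
    rw [e4, e2, e3]
    by_cases hpp : p = A.exS h.isEmpty s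
    · have e5 : A.modeAt h x = A.K := by rw [modeAt_of_ok ok, mode, if_pos hpp]
      have e6 : q = (A.exR h.isEmpty s, 0) := by rw [hq', due, if_pos hpp]
      rw [e5]
      simp only [hx, hpp, e6, le_refl]
    · have e5 : A.modeAt h x = A.P := by rw [modeAt_of_ok ok, mode, if_neg hpp]
      have e6 : q = 0 := by rw [hq', due, if_neg hpp]
      rw [e5]
      have : 0 ≤ exNet p q .sender := by
        rw [e6]
        simp only [exNet, netTransfer]
        have := p.1.2
        have := p.2.2
        simp
        positivity
      exact (sub_le_self _ this).trans key
  · have ok : ¬ A.Ok h x := fun H => hg H.1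
    have ok' : ¬ A.Ok h x' := fun H => hg H.1
    have e1 : A.next E .sender (A.Ok h x) = A.next E .sender (A.Ok h x') := by
      simp only [ok, ok']
    rw [e1, modeAt_of_not_ok ok, modeAt_of_not_ok ok']
    refine add_le_add_left (mul_le_mul_of_nonneg_left (sub_le_sub_left ?_ _) hδ.le) _
    simp only [hx, hx', hq, profile, if_neg hg, exNet, netTransfer]
    have := p.1.2
    have := p.2.2
    simp
    positivity

theorem Valid.sender_rational : E.SenderRational ψ A.profile := by
  intro h₀ S' hS' hm σ' θ₀ hθ₀
  have hδ : 0 < 1 - E.δ := sub_pos.2 hE.delta_lt_one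
  obtain ⟨hbS, hbR⟩ := hA.bounded_profile
  have hm2 : ∀ h, h₀ <+: h → E.MeasurableFrom ψ σ' h := fun h hh h' hh' => hm h' (hh.trans hh')
  have key := hE.value_le_of_signal (σ' := σ') hbS hbR hS' hbR .sender h₀
    (hA.measurableFrom hE h₀) hm fun h hh D hD H θ₀ hθ₀ =>
      sender_signal hE hA hS' (hm2 h hh) hθ₀ fun r => H _ (hh.trans (List.prefix_append _ _))
  have hD : ∀ r, E.value ψ σ' .sender (h₀ ++ [r]) ≤ E.value ψ A.profile .sender (h₀ ++ [r]) + 0 :=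
    fun r => by rw [add_zero]; exact key _ (List.prefix_append _ _)
  refine ⟨?_, fun x hx θ hθ => ?_, fun x hx θ hθ => ?_⟩
  · simpa using sender_signal hE hA hS' hm hθ₀ hD
  · simpa using sender_opening hE hA hθ₀ hD hx (hx ▸ hθ)
  · have h1 := hD (σ'.afterDecided h₀ x)
    have e : A.Good (h₀ ++ [σ'.afterDecided h₀ x]) ↔
        A.Good (h₀ ++ [A.profile.afterDecided h₀ x]) := by
      rw [good_append, good_append]; rfl
    rw [add_zero, value_append hE .sender, e, ← value_append hE .sender] at h1
    have h2 : E.stage .sender θ (σ'.afterDecided h₀ x) ≤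
        E.stage .sender θ (A.profile.afterDecided h₀ x) := by
      simp only [stage, Record.net, netTransfer, σ', Profile.afterDecided, Profile.afterSettling,
        profile]
      have := (S'.exPost h₀ x).1.2
      have := (S'.exPost h₀ x).2.2
      simp at *
      linarith
    exact add_le_add (mul_le_mul_of_nonneg_left h2 hδ.le)
      (mul_le_mul_of_nonneg_left h1 hE.delta_nonneg)

end Scheme
end Env

namespace Env
namespace Scheme

variable {ψ : Signal} {A : Scheme ψ} {E : Env} {L : ℝ} (hE : E.Standing) (hA : A.Valid E L)
include hE hA

/-! ## The receiver's incentives in a scheme -/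

variable {R' : ReceiverStrategy} {D : ℝ}

/-- A decision, compared with the prescribed one. -/
lemma receiver_record {h : History} {θ₀ : ℝ} (hθ₀ : θ₀ ∈ Icc (0 : ℝ) 1) {x : Paid}
    (hx : x.signal = ψ.cell θ₀) (hD : ∀ r, E.value ψ ⟨A.profile.S, R'⟩ .receiver (h ++ [r]) ≤
      E.value ψ A.profile .receiver (h ++ [r]) + D) (d : ℝ) (q : Transfer) :
    ∫ θ, E.total ψ ⟨A.profile.S, R'⟩ .receiver h θ ⟨⟨⟨x, d⟩, 0⟩, q⟩
        ∂A.belief E.prior h x.toReported ≤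
      (∫ θ, E.total ψ A.profile .receiver h θ (A.profile.afterPaid h x)
        ∂A.belief E.prior h x.toReported) + E.δ * D := by
  have hδ : 0 < 1 - E.δ := sub_pos.2 hE.delta_lt_one
  obtain ⟨b1, b2⟩ := hE.isProbabilityMeasure_belief (M := A.modeAt h x.toOpening) hθ₀ x.msg x.inS
  rw [← hx] at b1 b2
  have b3 : ∀ᵐ θ ∂A.belief E.prior h x.toReported, θ ∈ Icc (0 : ℝ) 1 := by
    rw [hx] at b2
    have := b2.mono fun θ hθ => (ψ.isCell subset_rfl hθ₀).closure.subset hθ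
    rw [← hx] at this
    exact this
  have b1' : IsProbabilityMeasure (A.belief E.prior h x.toReported) := b1
  rw [hE.integral_total_const b3, hE.integral_total_const b3]
  set r : Record := ⟨⟨⟨x, d⟩, 0⟩, q⟩ with hr
  set r0 := A.profile.afterPaid h x with hr0
  have h1 := hD r
  have n1 : r.net .receiver = r0.net .receiver + Transfer.size q := by
    simp only [Record.net, netTransfer, hr, hr0, Profile.afterPaid, Profile.afterDecided,
      Profile.afterSettling, profile, Transfer.size]
    simp
  have hq := Transfer.size_nonneg q
  have hg0 : A.Good (h ++ [r0]) ↔ A.Ok h x.toOpening := A.good_of_reply rfl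
  have hd0 : r0.dec = (A.modeAt h x.toOpening).reply x.signal x.msg x.inS := rfl
  rw [value_append hE] at h1
  rw [value_append hE, hg0, n1]
  have htol : ∀ L', (A.modeAt h x.toOpening).Valid E L' →
      ∫ θ, E.u .receiver d θ ∂A.belief E.prior h x.toReported ≤
        (∫ θ, E.u .receiver r0.dec θ ∂A.belief E.prior h x.toReported) + L' := fun L' hM => by
    have := hE.tol_reply hM hθ₀ x.msg x.inS d
    rw [← hx] at this
    have e : A.belief E.prior h x.toReported =
      (A.modeAt h x.toOpening).belief E.prior x.signal x.msg x.inS := rfl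
    rw [e, hd0]
    linarith
  have fin : ∀ (u u0 n s V V1 V0 : ℝ), 0 ≤ s → V ≤ V1 + D →
      (1 - E.δ) * u + E.δ * V1 ≤ (1 - E.δ) * u0 + E.δ * V0 →
      (1 - E.δ) * (u - (n + s)) + E.δ * V ≤ (1 - E.δ) * (u0 - n) + E.δ * V0 + E.δ * D :=
    fun u u0 n s V V1 V0 hs hV H => by
      have := mul_le_mul_of_nonneg_left hV hE.delta_nonneg
      have := mul_nonneg hδ.le hs
      linarith
  refine fin _ _ _ _ _ _ _ hq h1 ?_
  -- In good standing another decision gains at most `L` now and loses the standing, which is worth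
  -- `L` by `surplus`. In bad standing the prescribed decision is already a best one.
  by_cases ok : A.Ok h x.toOpening
  · by_cases hd : d = r0.dec
    · have : A.Good (h ++ [r]) ↔ A.Ok h x.toOpening := A.good_of_reply (hd.trans hd0)
      rw [this, show r.dec = r0.dec from hd]
    · have hgr : ¬ A.Good (h ++ [r]) := fun H => by
        have := ((A.good_append h r).1 H).2.2
        rw [modeAt_of_ok ok] at hd0
        exact hd (this.trans hd0.symm)
      have hM : (A.modeAt h x.toOpening).Valid E L := by
        rw [modeAt_of_ok ok]; exact hA.mode_valid _ _
      have h2 := mul_le_mul_of_nonneg_left (htol L hM) hδ.le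
      have h3 := hA.surplus
      simp only [next, if_neg hgr, if_pos ok]
      linarith
  · have hgr : ¬ A.Good (h ++ [r]) := fun H => ok (A.good_imp_ok H)
    have hM : (A.modeAt h x.toOpening).Valid E 0 := by
      rw [modeAt_of_not_ok ok]; exact hA.B_valid
    have h2 := mul_le_mul_of_nonneg_left (htol 0 hM) hδ.le
    simp only [next, if_neg hgr, if_neg ok]
    linarith

/-- An interim transfer of the receiver influences neither decisions nor standing, so it is lost
money. -/
lemma receiver_paid {h : History} {θ₀ : ℝ} (hθ₀ : θ₀ ∈ Icc (0 : ℝ) 1) {x : Reported}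
    (hx : x.signal = ψ.cell θ₀) (q : Transfer) :
    ∫ θ, E.total ψ A.profile .receiver h θ (A.profile.afterPaid h ⟨x, q⟩)
        ∂A.belief E.prior h x ≤
      ∫ θ, E.total ψ A.profile .receiver h θ (A.profile.afterReported h x)
        ∂A.belief E.prior h x := by
  have hδ : 0 < 1 - E.δ := sub_pos.2 hE.delta_lt_one
  obtain ⟨b1, b2⟩ := hE.isProbabilityMeasure_belief (M := A.modeAt h x.toOpening) hθ₀ x.msg x.inS
  rw [← hx] at b1 b2
  have b3 : ∀ᵐ θ ∂A.belief E.prior h x, θ ∈ Icc (0 : ℝ) 1 := by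
    rw [hx] at b2
    have := b2.mono fun θ hθ => (ψ.isCell subset_rfl hθ₀).closure.subset hθ
    rw [← hx] at this
    exact this
  have b1' : IsProbabilityMeasure (A.belief E.prior h x) := b1
  rw [hE.integral_total_const b3, hE.integral_total_const b3, value_append hE, value_append hE]
  have g1 : A.Good (h ++ [A.profile.afterPaid h ⟨x, q⟩]) ↔ A.Ok h x.toOpening :=
    A.good_of_reply rfl
  rw [g1, good_afterReported]
  refine add_le_add_left (mul_le_mul_of_nonneg_left ?_ hδ.le) _
  have n1 : (A.profile.afterPaid h ⟨x, q⟩).net .receiver =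
      (A.profile.afterReported h x).net .receiver + Transfer.size q := by
    simp only [Record.net, netTransfer, Profile.afterReported, Profile.afterPaid,
      Profile.afterDecided, Profile.afterSettling, profile, Transfer.size]
    simp; ring
  have hq := Transfer.size_nonneg q
  rw [n1]
  have : (A.profile.afterPaid h ⟨x, q⟩).dec = (A.profile.afterReported h x).dec := rfl
  rw [this]
  linarith

lemma receiver_reported {h : History} {θ₀ : ℝ} (hθ₀ : θ₀ ∈ Icc (0 : ℝ) 1) {x : Reported}
    (hx : x.signal = ψ.cell θ₀) (hD : ∀ r, E.value ψ ⟨A.profile.S, R'⟩ .receiver (h ++ [r]) ≤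
      E.value ψ A.profile .receiver (h ++ [r]) + D) :
    ∫ θ, E.total ψ ⟨A.profile.S, R'⟩ .receiver h θ
        ((⟨A.profile.S, R'⟩ : Profile).afterReported h x) ∂A.belief E.prior h x ≤
      (∫ θ, E.total ψ A.profile .receiver h θ (A.profile.afterReported h x)
        ∂A.belief E.prior h x) + E.δ * D :=
  (receiver_record hE hA hθ₀ (x := ⟨x, R'.interim h x⟩) hx hD _ _).trans
    (add_le_add_left (receiver_paid hE hA hθ₀ hx _) _)

/-- Averaging over the sender's reports. -/
lemma receiver_opening (hR' : R'.Bounded) {h : History}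
    (hm : E.MeasurableFrom ψ ⟨A.profile.S, R'⟩ h) {θ₀ : ℝ} (hθ₀ : θ₀ ∈ Icc (0 : ℝ) 1)
    (hD : ∀ r, E.value ψ ⟨A.profile.S, R'⟩ .receiver (h ++ [r]) ≤
      E.value ψ A.profile .receiver (h ++ [r]) + D) (p q : Transfer) :
    ∫ θ, E.total ψ ⟨A.profile.S, R'⟩ .receiver h θ
        ((⟨A.profile.S, R'⟩ : Profile).afterOpening h ⟨ψ.cell θ₀, p, q⟩ θ)
          ∂condLaw E.prior (ψ.cell θ₀) ≤
      (∫ θ, E.total ψ A.profile .receiver h θ (A.profile.afterOpening h ⟨ψ.cell θ₀, p, q⟩ θ)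
        ∂condLaw E.prior (ψ.cell θ₀)) + E.δ * D := by
  have hc := ψ.isCell subset_rfl hθ₀
  have := hE.isProbabilityMeasure_condLaw hc
  obtain ⟨hbS, hbR⟩ := hA.bounded_profile
  set x : Opening := ⟨ψ.cell θ₀, p, q⟩ with hx
  set M := A.modeAt h x with hM
  have i1 : Integrable (fun θ => E.total ψ ⟨A.profile.S, R'⟩ .receiver h θ
      ((⟨A.profile.S, R'⟩ : Profile).afterOpening h x θ)) (condLaw E.prior (ψ.cell θ₀)) :=
    hE.integrable_afterOpening (σ := ⟨A.profile.S, R'⟩) hbS hR' hm hθ₀ p q .receiver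
  have i2 : Integrable (fun θ => E.total ψ A.profile .receiver h θ (A.profile.afterOpening h x θ))
      (condLaw E.prior (ψ.cell θ₀)) :=
    hE.integrable_afterOpening hbS hbR (hA.measurableFrom hE h) hθ₀ p q .receiver
  have e : (∫ θ, E.total ψ A.profile .receiver h θ (A.profile.afterOpening h x θ)
      ∂condLaw E.prior (ψ.cell θ₀)) + E.δ * D = ∫ θ, (E.total ψ A.profile .receiver h θ
        (A.profile.afterOpening h x θ) + E.δ * D) ∂condLaw E.prior (ψ.cell θ₀) := by
    rw [integral_add i2 (integrable_const _)]; simp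
  rw [e]
  refine hE.integral_condLaw_le_of_cells hc (M.rule hθ₀) i1 (i2.add (integrable_const _))
    fun θ hθ => ?_
  have hθ1 := Mode.mem_unit hθ₀ hθ
  have hmc := M.msg.isCell subset_rfl hθ1
  have := hE.isProbabilityMeasure_condLaw hmc
  set X : Reported := ⟨x, (M.report θ).1, (M.report θ).2⟩ with hX
  have hrep : ∀ y ∈ M.msg.cell θ, M.report y = M.report θ := fun y hy =>
    (M.report_eq_iff hθ₀ hθ (M.msg_subset hθ₀ hθ hy)).2 hy
  have f : ∀ τ : Profile, τ.S = A.profile.S → ∀ y ∈ M.msg.cell θ,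
      τ.afterOpening h x y = τ.afterReported h X := fun τ hτ y hy => by
    have : τ.S.report h x y = M.report θ := by rw [hτ]; exact hrep y hy
    simp only [Profile.afterOpening, this, hX]
  have key := receiver_reported hE hA hθ₀ (x := X) rfl hD
  have hb : A.belief E.prior h X = condLaw E.prior (M.msg.cell θ) :=
    M.belief_report hθ₀ E.prior hθ
  rw [hb] at key
  change ∫ y, _ ∂condLaw E.prior (M.msg.cell θ) ≤ ∫ y, _ ∂condLaw E.prior (M.msg.cell θ)
  rw [integral_congr_ae ((hE.ae_mem_condLaw hmc).mono fun y hy => by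
    rw [f ⟨A.profile.S, R'⟩ rfl y hy])]
  refine key.trans_eq ?_
  have g : ∀ᵐ y ∂condLaw E.prior (M.msg.cell θ),
      E.total ψ A.profile .receiver h y (A.profile.afterReported h X) + E.δ * D =
        E.total ψ A.profile .receiver h y (A.profile.afterOpening h x y) + E.δ * D :=
    (hE.ae_mem_condLaw hmc).mono fun y hy => by rw [f A.profile rfl y hy]
  rw [← integral_congr_ae g, integral_add ?_ (integrable_const _)]
  · simp
  · exact ((hE.integrable_u_const (hE.ae_unit_condLaw hmc) .receiver _).sub
      (integrable_const _)).const_mul _ |>.add (integrable_const _)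

/-- A wrong ex-ante transfer moves play to `B` at once and for good. By `receiver_comply` and
`receiver_penal` this gains at most `L` in the current period, the worth of the standing that is
lost. -/
lemma receiver_exAnte (hR' : R'.Bounded) {h : History}
    (hm : E.MeasurableFrom ψ ⟨A.profile.S, R'⟩ h) {θ₀ : ℝ} (hθ₀ : θ₀ ∈ Icc (0 : ℝ) 1)
    (hD : ∀ r, E.value ψ ⟨A.profile.S, R'⟩ .receiver (h ++ [r]) ≤
      E.value ψ A.profile .receiver (h ++ [r]) + D) (p : Transfer) :
    ∫ θ, E.total ψ ⟨A.profile.S, R'⟩ .receiver h θ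
        ((⟨A.profile.S, R'⟩ : Profile).afterSenderExAnte h (ψ.cell θ₀) p θ)
          ∂condLaw E.prior (ψ.cell θ₀) ≤
      (∫ θ, E.total ψ A.profile .receiver h θ (A.profile.afterSenderExAnte h (ψ.cell θ₀) p θ)
        ∂condLaw E.prior (ψ.cell θ₀)) + E.δ * D := by
  have hδ : 0 < 1 - E.δ := sub_pos.2 hE.delta_lt_one
  refine (receiver_opening hE hA hR' hm hθ₀ hD p (R'.exAnte h (ψ.cell θ₀) p)).trans
    (add_le_add_left ?_ _)
  set s := ψ.cell θ₀ with hs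
  set q := R'.exAnte h s p with hq
  set x : Opening := ⟨s, p, q⟩ with hx
  set x' : Opening := ⟨s, p, A.profile.R.exAnte h s p⟩ with hx'
  change _ ≤ ∫ θ, E.total ψ A.profile .receiver h θ (A.profile.afterOpening h x' θ)
    ∂condLaw E.prior s
  rw [integral_total_afterOpening hE hA hθ₀ rfl, integral_total_afterOpening hE hA hθ₀ rfl]
  have q1 := q.1.2
  have q2 := q.2.2
  simp only [NNReal.val_eq_coe] at q1 q2
  by_cases hg : A.Good h
  · have hd : x'.exR = A.due h.isEmpty s p := by simp [hx', profile, hg]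
    have ok' : A.Ok h x' := ⟨hg, hd⟩
    by_cases hqd : q = A.due h.isEmpty s p
    · have : x = x' := by
        simp only [hx, hx', Opening.mk.injEq, true_and]
        exact hqd.trans hd.symm
      rw [this]
    · have ok : ¬ A.Ok h x := fun H => hqd H.2
      rw [modeAt_of_not_ok ok, modeAt_of_ok ok']
      have h3 := hA.surplus
      simp only [next, if_neg ok, if_pos ok']
      have h4 : (∫ θ, A.B.payoff E .receiver θ ∂condLaw E.prior s) - exNet p q .receiver ≤
          (∫ θ, (A.mode h.isEmpty x').payoff E .receiver θ ∂condLaw E.prior s) -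
            exNet p x'.exR .receiver + L := by
        simp only [Mode.payoff, exNet, netTransfer]
        by_cases hpp : p = A.exS h.isEmpty s
        · have := hA.receiver_comply h.isEmpty θ₀ hθ₀
          have e1 : A.mode h.isEmpty x' = A.K := by rw [mode, if_pos hpp]
          have e2 : x'.exR = (A.exR h.isEmpty s, 0) := by rw [hd, due, if_pos hpp]
          rw [e1, e2]
          simp only [NNReal.coe_zero]
          linarith
        · have := hA.receiver_penal θ₀ hθ₀
          have e1 : A.mode h.isEmpty x' = A.P := by rw [mode, if_neg hpp]
          have e2 : x'.exR = 0 := by rw [hd, due, if_neg hpp]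
          rw [e1, e2]
          simp only [Prod.fst_zero, Prod.snd_zero, NNReal.coe_zero]
          linarith
      have := mul_le_mul_of_nonneg_left h4 hδ.le
      linarith
  · have ok : ¬ A.Ok h x := fun H => hg H.1
    have ok' : ¬ A.Ok h x' := fun H => hg H.1
    have e1 : A.next E .receiver (A.Ok h x) = A.next E .receiver (A.Ok h x') := by
      simp only [ok, ok']
    rw [e1, modeAt_of_not_ok ok, modeAt_of_not_ok ok']
    refine add_le_add_left (mul_le_mul_of_nonneg_left (sub_le_sub_left ?_ _) hδ.le) _
    simp only [hx, hx', profile, if_neg hg, exNet, netTransfer]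
    simp
    linarith

theorem Valid.receiver_rational :
    E.ReceiverRational ψ A.profile (A.belief E.prior) := by
  intro h₀ R' hR' hm σ' θ₀ hθ₀
  have hδ : 0 < 1 - E.δ := sub_pos.2 hE.delta_lt_one
  obtain ⟨hbS, hbR⟩ := hA.bounded_profile
  have hm2 : ∀ h, h₀ <+: h → E.MeasurableFrom ψ σ' h := fun h hh h' hh' => hm h' (hh.trans hh')
  have key := hE.value_le_of_signal (σ' := σ') hbS hbR hbS hR' .receiver h₀
    (hA.measurableFrom hE h₀) hm fun h hh D hD H θ₀ hθ₀ =>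
      receiver_exAnte hE hA hR' (hm2 h hh) hθ₀
        (fun r => H _ (hh.trans (List.prefix_append _ _))) (A.profile.S.exAnte h (ψ.cell θ₀))
  have hD : ∀ r, E.value ψ σ' .receiver (h₀ ++ [r]) ≤
      E.value ψ A.profile .receiver (h₀ ++ [r]) + 0 :=
    fun r => by rw [add_zero]; exact key _ (List.prefix_append _ _)
  refine ⟨fun p => ?_, fun x hx => ?_, fun x hx => ?_, fun x hx => ?_⟩
  · simpa using receiver_exAnte hE hA hR' hm hθ₀ hD p
  · simpa using receiver_reported hE hA hθ₀ hx hD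
  · have := receiver_record hE hA hθ₀ hx hD (R'.decide h₀ x)
      (R'.exPost h₀ ⟨⟨x, R'.decide h₀ x⟩, 0⟩)
    rw [mul_zero, add_zero] at this
    exact this
  · obtain ⟨b1, b2⟩ := hE.isProbabilityMeasure_belief (M := A.modeAt h₀ x.toOpening) hθ₀ x.msg x.inS
    rw [← hx] at b1 b2
    have b3 : ∀ᵐ θ ∂A.belief E.prior h₀ x.toReported, θ ∈ Icc (0 : ℝ) 1 := by
      rw [hx] at b2
      have := b2.mono fun θ hθ => (ψ.isCell subset_rfl hθ₀).closure.subset hθ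
      rw [← hx] at this
      exact this
    have b1' : IsProbabilityMeasure (A.belief E.prior h₀ x.toReported) := b1
    rw [hE.integral_total_const b3, hE.integral_total_const b3]
    have h1 := hD (σ'.afterSettling h₀ x)
    have e : A.Good (h₀ ++ [σ'.afterSettling h₀ x]) ↔
        A.Good (h₀ ++ [A.profile.afterSettling h₀ x]) := by
      rw [good_append, good_append]; rfl
    rw [add_zero, value_append hE .receiver, e, ← value_append hE .receiver] at h1
    have h2 : (A.profile.afterSettling h₀ x).net .receiver ≤
        (σ'.afterSettling h₀ x).net .receiver := by
      simp only [Record.net, netTransfer, σ', Profile.afterSettling, profile]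
      have := (R'.exPost h₀ x).1.2
      have := (R'.exPost h₀ x).2.2
      simp at *
      linarith
    exact add_le_add (mul_le_mul_of_nonneg_left (sub_le_sub_left h2 _) hδ.le)
      (mul_le_mul_of_nonneg_left h1 hE.delta_nonneg)

/-- A scheme is an equilibrium. -/
theorem Valid.isEquilibrium :
    E.IsEquilibrium ψ A.profile (A.belief E.prior) where
  sender_bounded := hA.bounded_profile.1
  receiver_bounded := hA.bounded_profile.2
  measurable := hA.measurableFrom hE []
  consistent := hA.consistent hE
  sender_rational := hA.sender_rational hE
  receiver_rational := hA.receiver_rational hE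

end Scheme
end Env

namespace Env

variable {ψ : Signal}

/-! ## The payoffs of schemes -/

open Classical in
/-- A function of states, averaged over a signal realization. -/
noncomputable def cellMean (E : Env) (ψ : Signal) (f : ℝ → ℝ) (s : Set ℝ) : ℝ :=
  if ∃ θ ∈ Icc (0 : ℝ) 1, ψ.cell θ = s then ∫ x, f x ∂condLaw E.prior s else 0

lemma cellMean_cell (E : Env) (f : ℝ → ℝ) {θ : ℝ} (hθ : θ ∈ Icc (0 : ℝ) 1) :
    E.cellMean ψ f (ψ.cell θ) = ∫ x, f x ∂condLaw E.prior (ψ.cell θ) :=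
  if_pos ⟨θ, hθ, rfl⟩

/-- The joint payoff in `K`, minus the payoffs of the sender in `P` and of the receiver in `B`,
plus `L`. -/
noncomputable def slack (E : Env) (K P B : Mode ψ) (L : ℝ) (s : Set ℝ) : ℝ :=
  E.cellMean ψ (K.uS E) s + E.cellMean ψ (K.uR E) s - E.cellMean ψ (P.uS E) s -
    E.cellMean ψ (B.uR E) s + L

/-- The receiver's net ex-ante payment, when the sender gets a fraction `a` of the slack and a
fraction `z` of it is burned. -/
noncomputable def dues (E : Env) (K P B : Mode ψ) (L a z : ℝ) (s : Set ℝ) : ℝ :=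
  E.cellMean ψ (P.uS E) s - E.cellMean ψ (K.uS E) s + (a + z) * E.slack K P B L s

/-- The scheme in which the sender gets a fraction `a` of the slack in the first period, and a
fraction `z` is burned. -/
noncomputable def sharingScheme (E : Env) (K P B : Mode ψ) (L a z : ℝ) : Scheme ψ where
  K := K
  P := P
  B := B
  -- The positive part of the dues is paid by the receiver and the negative part by the sender, who
  -- also burns. After the first period both fractions are zero: the sender is held to his payoff in
  -- `P`, and the receiver's future share serves as her collateral.
  exS b s := ((-E.dues K P B L (if b then a else 0) (if b then z else 0) s).toNNReal,
    ((if b then z else 0) * E.slack K P B L s).toNNReal)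
  exR b s := (E.dues K P B L (if b then a else 0) (if b then z else 0) s).toNNReal

namespace Standing

variable {E : Env} (hE : E.Standing)
include hE

lemma exists_bound_cellMean {f : ℝ → ℝ} {C : ℝ} (hC : ∀ θ ∈ Icc (0 : ℝ) 1, |f θ| ≤ C)
    (s : Set ℝ) : |E.cellMean ψ f s| ≤ C := by
  unfold cellMean
  split_ifs with h
  · obtain ⟨θ, hθ, rfl⟩ := h
    have hc := ψ.isCell subset_rfl hθ
    have := hE.isProbabilityMeasure_condLaw hc
    have := norm_integral_le_of_norm_le_const (μ := condLaw E.prior (ψ.cell θ)) (f := f) (C := C)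
      ((hE.ae_unit_condLaw hc).mono fun x hx => hC x hx)
    simpa using this
  · rw [abs_zero]
    exact (abs_nonneg _).trans (hC 0 (by simp))

lemma integral_cellMean {f : ℝ → ℝ} (hf : AEMeasurable f E.prior) {C : ℝ}
    (hC : ∀ θ ∈ Icc (0 : ℝ) 1, |f θ| ≤ C) :
    Integrable (fun θ => E.cellMean ψ f (ψ.cell θ)) E.prior ∧
      ∫ θ, E.cellMean ψ f (ψ.cell θ) ∂E.prior = ∫ θ, f θ ∂E.prior := by
  obtain ⟨h1, h2⟩ := hE.integral_integral_cell ψ hf hC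
  have hae : (fun θ => ∫ x, f x ∂condLaw E.prior (ψ.cell θ)) =ᵐ[E.prior]
      fun θ => E.cellMean ψ f (ψ.cell θ) :=
    hE.ae_mem.mono fun θ hθ => (cellMean_cell E f hθ).symm
  exact ⟨h1.congr hae, by rw [← integral_congr_ae hae, h2]⟩

lemma aemeasurable_mode {M : Mode ψ} {L : ℝ} (hM : M.Valid E L) :
    AEMeasurable (M.uS E) E.prior ∧ AEMeasurable (M.uR E) E.prior :=
  ⟨(hE.aemeasurable_u hE.ae_mem _ hM.aemeasurable_dec).sub hM.aemeasurable_pay,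
    (hE.aemeasurable_u hE.ae_mem _ hM.aemeasurable_dec).add hM.aemeasurable_pay⟩

variable {K P B : Mode ψ} {L : ℝ} (hK : K.Valid E L) (hP : P.Valid E L) (hB : B.Valid E 0)
  (hconst : ∀ θ ∈ Icc (0 : ℝ) 1, ∀ θ' ∈ ψ.cell θ, B.dec θ' = B.dec θ ∧ B.pay θ' = 0)
include hB hconst

/-- In `B` the receiver gets no payment and takes one decision on the whole realization, as if she
ignored the reports in `M`. By `integral_const_le_mode` that gains at most `L`. -/
lemma babble_le {M : Mode ψ} (hM : M.Valid E L) {θ : ℝ} (hθ : θ ∈ Icc (0 : ℝ) 1) :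
    E.cellMean ψ (B.uR E) (ψ.cell θ) ≤ E.cellMean ψ (M.uR E) (ψ.cell θ) + L := by
  rw [cellMean_cell E _ hθ, cellMean_cell E _ hθ]
  refine le_trans (le_of_eq ?_) (hE.integral_const_le_mode hM hθ (B.dec θ))
  refine integral_congr_ae ((hE.ae_mem_condLaw (ψ.isCell subset_rfl hθ)).mono fun x hx => ?_)
  obtain ⟨h1, h2⟩ := hconst θ hθ x hx
  simp only [Mode.uR, h1, h2, NNReal.coe_zero, add_zero]

variable (hle : ∀ θ ∈ Icc (0 : ℝ) 1,
    (∫ x, P.uS E x ∂condLaw E.prior (ψ.cell θ)) + (∫ x, P.uR E x ∂condLaw E.prior (ψ.cell θ)) ≤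
      (∫ x, K.uS E x ∂condLaw E.prior (ψ.cell θ)) + ∫ x, K.uR E x ∂condLaw E.prior (ψ.cell θ))
include hK hP hle

/-- On each realization `K` is jointly at least as good as `P`, and in `P` the receiver gets at
least her payoff in `B` minus `L`. -/
lemma slack_nonneg {θ : ℝ} (hθ : θ ∈ Icc (0 : ℝ) 1) : 0 ≤ E.slack K P B L (ψ.cell θ) := by
  have h1 := hE.babble_le hB hconst hP hθ
  have h2 := hle θ hθ
  simp only [← cellMean_cell E _ hθ] at h2
  unfold slack
  linarith

/-- Payoffs between the worst ones and the Pareto frontier are equilibrium payoffs. -/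
theorem mem_equilibriumPayoffs
    (hL : (1 - E.δ) * L = E.δ * ((∫ θ, K.uS E θ ∂E.prior) + (∫ θ, K.uR E θ ∂E.prior) -
      (∫ θ, P.uS E θ ∂E.prior) - ∫ θ, B.uR E θ ∂E.prior)) {v : ℝ × ℝ}
    (h1 : ∫ θ, P.uS E θ ∂E.prior ≤ v.1) (h2 : ∫ θ, B.uR E θ ∂E.prior ≤ v.2)
    (h3 : v.1 + v.2 ≤ (∫ θ, K.uS E θ ∂E.prior) + ∫ θ, K.uR E θ ∂E.prior) :
    v ∈ E.equilibriumPayoffs ψ := by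
  have := hE.isProbabilityMeasure
  have hδ : 0 < 1 - E.δ := sub_pos.2 hE.delta_lt_one
  set kS := ∫ θ, K.uS E θ ∂E.prior with hkS
  set kR := ∫ θ, K.uR E θ ∂E.prior with hkR
  set pS := ∫ θ, P.uS E θ ∂E.prior with hpS
  set bR := ∫ θ, B.uR E θ ∂E.prior with hbR
  set Δ := kS + kR - pS - bR with hΔ
  -- Expected slack is `Δ + L`, and the condition on `L` says `(1 - δ)(Δ + L) = Δ`. So the fractions
  -- `a` and `z` of first-period slack are worth `a Δ` and `z Δ`. If `Δ = 0` the bounds on `v` leave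
  -- nothing to divide, and division by zero gives the right fractions.
  set a := (v.1 - pS) / Δ with ha
  set z := (kS + kR - v.1 - v.2) / Δ with hz
  have hΔ0 : 0 ≤ Δ := by linarith
  have ha0 : 0 ≤ a := div_nonneg (by linarith) hΔ0
  have hz0 : 0 ≤ z := div_nonneg (by linarith) hΔ0
  have haΔ : a * Δ = v.1 - pS := by
    rcases hΔ0.lt_or_eq with h | h
    · exact div_mul_cancel₀ _ h.ne'
    · rw [← h, mul_zero]; linarith
  have hzΔ : z * Δ = kS + kR - v.1 - v.2 := by
    rcases hΔ0.lt_or_eq with h | h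
    · exact div_mul_cancel₀ _ h.ne'
    · rw [← h, mul_zero]; linarith
  have haz : a + z ≤ 1 := by
    rw [ha, hz, ← add_div]
    exact div_le_one_of_le₀ (by linarith) hΔ0
  obtain ⟨cK, hcK⟩ := hE.exists_bound_mode hK
  obtain ⟨cP, hcP⟩ := hE.exists_bound_mode hP
  obtain ⟨cB, hcB⟩ := hE.exists_bound_mode hB
  obtain ⟨mK1, mK2⟩ := hE.aemeasurable_mode hK
  obtain ⟨mP1, mP2⟩ := hE.aemeasurable_mode hP
  obtain ⟨mB1, mB2⟩ := hE.aemeasurable_mode hB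
  obtain ⟨iKS, eKS⟩ := hE.integral_cellMean (ψ := ψ) mK1 fun θ hθ => (hcK θ hθ).1
  obtain ⟨iKR, eKR⟩ := hE.integral_cellMean (ψ := ψ) mK2 fun θ hθ => (hcK θ hθ).2
  obtain ⟨iPS, ePS⟩ := hE.integral_cellMean (ψ := ψ) mP1 fun θ hθ => (hcP θ hθ).1
  obtain ⟨iBR, eBR⟩ := hE.integral_cellMean (ψ := ψ) mB2 fun θ hθ => (hcB θ hθ).2
  have iκ : Integrable (fun θ => E.slack K P B L (ψ.cell θ)) E.prior :=
    (((iKS.add iKR).sub iPS).sub iBR).add (integrable_const _)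
  have eκ : ∫ θ, E.slack K P B L (ψ.cell θ) ∂E.prior = Δ + L := by
    unfold slack
    have i1 : Integrable (fun θ => E.cellMean ψ (K.uS E) (ψ.cell θ) +
      E.cellMean ψ (K.uR E) (ψ.cell θ)) E.prior := iKS.add iKR
    have i2 : Integrable (fun θ => E.cellMean ψ (K.uS E) (ψ.cell θ) +
      E.cellMean ψ (K.uR E) (ψ.cell θ) - E.cellMean ψ (P.uS E) (ψ.cell θ)) E.prior := i1.sub iPS
    have i3 : Integrable (fun θ => E.cellMean ψ (K.uS E) (ψ.cell θ) +
      E.cellMean ψ (K.uR E) (ψ.cell θ) - E.cellMean ψ (P.uS E) (ψ.cell θ) -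
        E.cellMean ψ (B.uR E) (ψ.cell θ)) E.prior := i2.sub iBR
    rw [integral_add i3 (integrable_const _), integral_sub i2 iBR, integral_sub i1 iPS,
      integral_add iKS iKR, eKS, eKR, ePS, eBR]
    simp [hΔ]
    rfl
  have idues : ∀ a z, Integrable (fun θ => E.dues K P B L a z (ψ.cell θ)) E.prior := fun a z =>
    (iPS.sub iKS).add (iκ.const_mul _)
  have edues : ∀ a z, ∫ θ, E.dues K P B L a z (ψ.cell θ) ∂E.prior =
      pS - kS + (a + z) * (Δ + L) := fun a z => by
    unfold dues
    have i1 : Integrable (fun θ => E.cellMean ψ (P.uS E) (ψ.cell θ) -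
      E.cellMean ψ (K.uS E) (ψ.cell θ)) E.prior := iPS.sub iKS
    rw [integral_add i1 (iκ.const_mul _), integral_sub iPS iKS, ePS, eKS, integral_const_mul, eκ]
  set A : Scheme ψ := E.sharingScheme K P B L a z with hA
  have hexnet : ∀ b, ∀ θ ∈ Icc (0 : ℝ) 1,
      netTransfer (A.exS b (ψ.cell θ)) (A.exR b (ψ.cell θ), 0) =
        -E.dues K P B L (if b then a else 0) (if b then z else 0) (ψ.cell θ) +
          (if b then z else 0) * E.slack K P B L (ψ.cell θ) := fun b θ hθ => by
    have hs := hE.slack_nonneg hK hP hB hconst hle hθ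
    have hz1 : (0 : ℝ) ≤ if b then z else 0 := by split_ifs <;> linarith
    simp only [hA, sharingScheme, netTransfer, Real.coe_toNNReal']
    rw [max_eq_left (mul_nonneg hz1 hs)]
    have := max_zero_sub_max_neg_zero_eq_self
      (E.dues K P B L (if b then a else 0) (if b then z else 0) (ψ.cell θ))
    linarith
  have hexnet' : ∀ b, ∀ θ ∈ Icc (0 : ℝ) 1,
      netTransfer (A.exR b (ψ.cell θ), 0) (A.exS b (ψ.cell θ)) =
        E.dues K P B L (if b then a else 0) (if b then z else 0) (ψ.cell θ) := fun b θ hθ => by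
    simp only [hA, sharingScheme, netTransfer, Real.coe_toNNReal', NNReal.coe_zero, add_zero]
    rw [max_zero_sub_max_neg_zero_eq_self]
  obtain ⟨-, -, -⟩ := hE.integrable_mode hK hE.ae_mem hK.aemeasurable_dec hK.aemeasurable_pay
  obtain ⟨iuS, iuR, -⟩ := hE.integrable_mode hK hE.ae_mem hK.aemeasurable_dec hK.aemeasurable_pay
  have flowS : ∀ b : Bool, A.flow E b .sender = pS + (if b then a else 0) * (Δ + L) := fun b => by
    rw [Scheme.flow, integral_congr_ae (hE.ae_mem.mono fun θ hθ => by
      rw [show exNet (A.exS b (ψ.cell θ)) (A.exR b (ψ.cell θ), 0) .sender = _ from hexnet b θ hθ])]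
    have i1 : Integrable (fun θ => -E.dues K P B L (if b then a else 0) (if b then z else 0)
        (ψ.cell θ) + (if b then z else 0) * E.slack K P B L (ψ.cell θ)) E.prior :=
      (idues _ _).neg.add (iκ.const_mul _)
    have i2 : Integrable (fun θ => -E.dues K P B L (if b then a else 0) (if b then z else 0)
        (ψ.cell θ)) E.prior := (idues _ _).neg
    simp only [hA, sharingScheme, Mode.payoff]
    rw [integral_sub iuS i1, integral_add i2 (iκ.const_mul _), integral_neg, edues,
      integral_const_mul, eκ]
    ring
  have flowR : ∀ b : Bool, A.flow E b .receiver =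
      kS + kR - pS - ((if b then a else 0) + (if b then z else 0)) * (Δ + L) := fun b => by
    rw [Scheme.flow, integral_congr_ae (hE.ae_mem.mono fun θ hθ => by
      rw [show exNet (A.exS b (ψ.cell θ)) (A.exR b (ψ.cell θ), 0) .receiver = _ from
        hexnet' b θ hθ])]
    simp only [hA, sharingScheme, Mode.payoff]
    rw [integral_sub iuR (idues _ _), edues]
    ring
  have hAv : A.Valid E L := by
    refine ⟨hK, hP, hB, ?_, fun b => ?_, fun b => ?_, fun b => ?_, fun b θ hθ => ?_,
      fun b θ hθ => ?_, fun θ hθ => ?_, ?_⟩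
    · have hbs : ∀ s, |E.slack K P B L s| ≤ cK + cK + cP + cB + |L| := fun s => by
        have q1 := abs_le.1 (hE.exists_bound_cellMean (ψ := ψ) (fun θ hθ => (hcK θ hθ).1) s)
        have q2 := abs_le.1 (hE.exists_bound_cellMean (ψ := ψ) (fun θ hθ => (hcK θ hθ).2) s)
        have q3 := abs_le.1 (hE.exists_bound_cellMean (ψ := ψ) (fun θ hθ => (hcP θ hθ).1) s)
        have q4 := abs_le.1 (hE.exists_bound_cellMean (ψ := ψ) (fun θ hθ => (hcB θ hθ).2) s)
        have q5 := abs_le.1 (le_refl |L|)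
        unfold slack
        rw [abs_le]
        constructor <;> linarith
      set C := cK + cK + cP + cB + |L| with hC
      have hC0 : 0 ≤ C := (abs_nonneg _).trans (hbs ∅)
      have hmul : ∀ t s, 0 ≤ t → t ≤ 1 → |t * E.slack K P B L s| ≤ C := fun t s ht ht1 => by
        rw [abs_mul, abs_of_nonneg ht]
        nlinarith [hbs s, abs_nonneg (E.slack K P B L s)]
      have hbd : ∀ (b : Bool) s, |E.dues K P B L (if b then a else 0) (if b then z else 0) s| ≤
          cK + cP + C := fun b s => by
        have q1 := abs_le.1 (hE.exists_bound_cellMean (ψ := ψ) (fun θ hθ => (hcK θ hθ).1) s)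
        have q3 := abs_le.1 (hE.exists_bound_cellMean (ψ := ψ) (fun θ hθ => (hcP θ hθ).1) s)
        have q2 := abs_le.1 (hmul ((if b then a else 0) + (if b then z else 0)) s
          (by split_ifs <;> linarith) (by split_ifs <;> linarith))
        unfold dues
        rw [abs_le]
        constructor <;> linarith
      have hD0 : 0 ≤ cK + cP + C := (abs_nonneg _).trans (hbd true ∅)
      refine ⟨(cK + cP + C).toNNReal + C.toNNReal, fun b s => ⟨⟨?_, ?_⟩, ?_⟩⟩
      · exact (Real.toNNReal_le_toNNReal ((neg_le_abs _).trans (hbd b s))).trans le_self_add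
      · refine (Real.toNNReal_le_toNNReal ((le_abs_self _).trans (hmul _ s ?_ ?_))).trans le_add_self
        · split_ifs <;> linarith
        · split_ifs <;> linarith
      · exact (Real.toNNReal_le_toNNReal ((le_abs_self _).trans (hbd b s))).trans le_self_add
    · exact (idues _ _).aemeasurable.neg.real_toNNReal.coe_nnreal_real
    · exact (iκ.aemeasurable.const_mul _).real_toNNReal.coe_nnreal_real
    · exact (idues _ _).aemeasurable.real_toNNReal.coe_nnreal_real
    · rw [hexnet b θ hθ]
      have hs := hE.slack_nonneg hK hP hB hconst hle hθ
      have ha1 : (0 : ℝ) ≤ if b then a else 0 := by split_ifs <;> linarith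
      change (∫ x, P.uS E x ∂_) ≤ (∫ x, K.uS E x ∂_) - _
      unfold dues
      rw [cellMean_cell E _ hθ, cellMean_cell E _ hθ]
      have := mul_nonneg ha1 hs
      linarith
    · change (∫ x, B.uR E x ∂_) ≤ (∫ x, K.uR E x ∂_) - _ + L
      have hs := hE.slack_nonneg hK hP hB hconst hle hθ
      have q1 := hE.babble_le hB hconst hK hθ
      have haz1 : (if b then a else 0) + (if b then z else 0) ≤ 1 := by split_ifs <;> linarith
      have q2 := mul_le_mul_of_nonneg_right haz1 hs
      rw [← cellMean_cell E _ hθ, ← cellMean_cell E _ hθ]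
      simp only [hA, sharingScheme, Real.coe_toNNReal']
      rcases max_cases (E.dues K P B L (if b then a else 0) (if b then z else 0) (ψ.cell θ)) 0 with
        ⟨e, -⟩ | ⟨e, -⟩ <;> rw [e]
      · unfold dues
        rw [one_mul] at q2
        have : E.slack K P B L (ψ.cell θ) = E.cellMean ψ (K.uS E) (ψ.cell θ) +
          E.cellMean ψ (K.uR E) (ψ.cell θ) - E.cellMean ψ (P.uS E) (ψ.cell θ) -
            E.cellMean ψ (B.uR E) (ψ.cell θ) + L := rfl
        linarith
      · linarith
    · have := hE.babble_le hB hconst hP hθ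
      rwa [cellMean_cell E _ hθ, cellMean_cell E _ hθ] at this
    · rw [flowR]
      have : A.badFlow E .receiver = bR := rfl
      rw [this, hL, hΔ]
      simp
  refine ⟨A.profile, A.belief E.prior, hAv.isEquilibrium hE, ?_⟩
  have hΔL : (1 - E.δ) * (Δ + L) = Δ := by rw [mul_add, hL]; ring
  rw [Scheme.value_nil hE, Scheme.value_nil hE, flowS, flowS, flowR, flowR]
  simp only [if_true, Bool.false_eq_true, if_false]
  ext
  · have : v.1 = pS + a * ((1 - E.δ) * (Δ + L)) := by rw [hΔL, haΔ]; ring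
    rw [this]; ring
  · have : v.2 = kS + kR - pS - (a + z) * ((1 - E.δ) * (Δ + L)) := by
      rw [hΔL, add_mul, haΔ, hzΔ]; ring
    rw [this]; ring

end Standing
end Env

namespace Env

/-! ## Rent schedules -/

/-- The decision `p.2`, which some belief on the closure of `s` can induce, fits the decision rule
`D` at the state `p.1`. -/
structure Fits (E : Env) (L : ℝ) (s : Set ℝ) (D : ℝ → ℝ) (p : ℝ × ℝ) : Prop where
  mem : p.1 ∈ closure s
  tol : ∃ t ∈ closure s, E.Tol L (Measure.dirac t) p.2
  le : ∀ y ∈ s, y < p.1 → D y ≤ p.2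
  ge : ∀ y ∈ s, p.1 < y → p.2 ≤ D y

namespace Standing

variable {E : Env} (hE : E.Standing) {L : ℝ}
include hE

/-- The set is the projection of a compact set of pairs of a state and a decision. It makes limits
of possible reactions to unexpected reports possible reactions again. -/
lemma isCompact_tol_dirac {s : Set ℝ} (hs : IsCell s) (L : ℝ) :
    IsCompact {d | ∃ t ∈ closure s, E.Tol L (Measure.dirac t) d} := by
  obtain ⟨B, -, hB⟩ := hE.exists_abs_bound L
  have hcl := hs.closure
  have hc : IsCompact (closure s) := isCompact_Icc.of_isClosed_subset isClosed_closure hcl.subset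
  have h1 : IsClosed {p : ℝ × ℝ | ∀ d', E.u .receiver d' (clampUnit p.1) -
      E.u .receiver p.2 (clampUnit p.1) ≤ L} := by
    simp only [ofPred_forall]
    refine isClosed_iInter fun d' => isClosed_le (Continuous.sub ?_ ?_) continuous_const
    · exact (hE.continuous_u .receiver).comp (continuous_const.prodMk continuous_fst)
    · exact (hE.continuous_u .receiver).comp (continuous_snd.prodMk continuous_fst)
  have h2 : ∀ t ∈ closure s, ∀ d, E.Tol L (Measure.dirac t) d ↔ ∀ d', E.u .receiver d' (clampUnit t) -
      E.u .receiver d (clampUnit t) ≤ L := fun t ht d => by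
    simp only [Tol, integral_dirac, clampUnit_of_mem (hcl.subset ht)]
  convert ((hc.prod (isCompact_Icc (a := -B) (b := B))).inter_right h1).image continuous_snd
  ext d
  constructor
  · rintro ⟨t, ht, h⟩
    exact ⟨(t, d), ⟨⟨ht, abs_le.1 (hB _ (hE.ae_dirac (hcl.subset ht)) d h)⟩, (h2 t ht d).1 h⟩, rfl⟩
  · rintro ⟨⟨t, d'⟩, ⟨⟨ht, -⟩, h⟩, rfl⟩
    exact ⟨t, ht, (h2 t ht _).2 h⟩

/-- To the right of `p.1` the rule `D` is above `p.2` and to the left below. By sorting, the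
envelope integral along `D` is then at least the change of `u_S` at the constant decision `p.2`. -/
lemma Fits.u_le {s : Set ℝ} (hs : IsCell s) {D : ℝ → ℝ} (hD : MonotoneOn D (Icc 0 1)) {p : ℝ × ℝ}
    (hp : E.Fits L s D p) {θ : ℝ} (hθ : θ ∈ s) :
    E.u .sender p.2 θ ≤ E.u .sender p.2 p.1 +
      ∫ x in p.1..θ, partialTheta (E.u .sender) (D x) x := by
  obtain ⟨a, b, -, hcl, hIoo⟩ := exists_closure_eq_Icc hs
  have h1 := hs.closure.subset hp.mem
  have h2 := hs.subset hθ
  have hp1 := hp.mem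
  have hθ1 := subset_closure hθ
  rw [hcl] at hp1 hθ1
  have hc : MonotoneOn (fun _ => p.2) (Icc (0 : ℝ) 1) := monotoneOn_const
  have i1 := fun {x y : ℝ} hx hy =>
    hE.intervalIntegrable_partialTheta ordConnected_Icc subset_rfl .sender hD (a := x) (b := y) hx hy
  have i2 := fun {x y : ℝ} hx hy =>
    hE.intervalIntegrable_partialTheta ordConnected_Icc subset_rfl .sender hc (a := x) (b := y) hx hy
  have e := hE.integral_partialTheta .sender p.2 h1 h2
  rcases le_total p.1 θ with h | h
  · have := intervalIntegral.integral_mono_on_of_le_Ioo h (i2 h1 h2) (i1 h1 h2) fun y hy =>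
      (hE.strictMono_partialTheta .sender ⟨h1.1.trans hy.1.le, hy.2.le.trans h2.2⟩).monotone
        (hp.ge y (hIoo ⟨hp1.1.trans_lt hy.1, hy.2.trans_le hθ1.2⟩) hy.1)
    linarith
  · have := intervalIntegral.integral_mono_on_of_le_Ioo h (i1 h2 h1) (i2 h2 h1) fun y hy =>
      (hE.strictMono_partialTheta .sender ⟨h2.1.trans hy.1.le, hy.2.le.trans h1.2⟩).monotone
        (hp.le y (hIoo ⟨hθ1.1.trans_lt hy.1, hy.2.trans_le hp1.2⟩) hy.2)
    rw [intervalIntegral.integral_symm] at e ⊢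
    linarith

/-- The smallest rents that deter the sender from unexpected messages. -/
lemma exists_schedule {s : Set ℝ} (hs : IsCell s) {D : ℝ → ℝ} (hD : MonotoneOn D (Icc 0 1))
    {𝒟 : Set (ℝ × ℝ)} (h𝒟 : ∀ p ∈ 𝒟, E.Fits L s D p) (hmem : ∀ θ ∈ s, (θ, D θ) ∈ 𝒟) :
    ∃ (W : ℝ → ℝ) (d₀ t₀ : ℝ), t₀ ∈ closure s ∧ E.Tol L (Measure.dirac t₀) d₀ ∧
      (∀ θ ∈ s, E.u .sender d₀ θ ≤ W θ) ∧ (∀ θ ∈ s, W θ ≤ E.u .sender (D θ) θ) ∧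
      (∀ θ θ', W θ' - W θ = (∫ x in 0..θ', partialTheta (E.u .sender) (D x) x) -
        ∫ x in 0..θ, partialTheta (E.u .sender) (D x) x) ∧
      (∀ p ∈ 𝒟, ∀ θ ∈ s, W θ ≤ E.u .sender p.2 p.1 +
        ∫ x in p.1..θ, partialTheta (E.u .sender) (D x) x) ∧
      ∀ θ ∈ s, ∀ w, (∀ p ∈ 𝒟, w ≤ E.u .sender p.2 p.1 +
        ∫ x in p.1..θ, partialTheta (E.u .sender) (D x) x) → w ≤ W θ := by
  have h0 : (0 : ℝ) ∈ Icc (0 : ℝ) 1 := by simp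
  have h1 : (1 : ℝ) ∈ Icc (0 : ℝ) 1 := by simp
  obtain ⟨B, -, hB⟩ := hE.exists_abs_bound L
  obtain ⟨C, hC⟩ := hE.bounded_u B
  have hDb : ∀ θ ∈ Icc (0 : ℝ) 1, |D θ| ≤ max |D 0| |D 1| := fun θ hθ =>
    abs_le_max_abs_abs (hD h0 hθ hθ.1) (hD hθ h1 hθ.2)
  obtain ⟨C', hC0, hC'⟩ := hE.lipschitz_integral_partialTheta ordConnected_Icc subset_rfl .sender hD hDb
  set I : ℝ → ℝ := fun θ => ∫ x in 0..θ, partialTheta (E.u .sender) (D x) x with hI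
  have hIab : ∀ a ∈ Icc (0 : ℝ) 1, ∀ b ∈ Icc (0 : ℝ) 1,
      ∫ x in a..b, partialTheta (E.u .sender) (D x) x = I b - I a := fun a ha b hb => by
    have := hE.integral_partialTheta_adjacent ordConnected_Icc subset_rfl .sender hD h0 ha hb
    simp only [hI, ← this, add_sub_cancel_left]
  set G : ℝ × ℝ → ℝ := fun p => E.u .sender p.2 p.1 - I p.1 with hG
  have hunit : ∀ p ∈ 𝒟, p.1 ∈ Icc (0 : ℝ) 1 := fun p hp => hs.closure.subset (h𝒟 p hp).mem
  have hbdd : BddBelow (G '' 𝒟) := by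
    refine ⟨-C - C', ?_⟩
    rintro _ ⟨p, hp, rfl⟩
    obtain ⟨t, ht, htol⟩ := (h𝒟 p hp).tol
    have q1 := hB _ (hE.ae_dirac (hs.closure.subset ht)) _ htol
    have q2 := abs_le.1 (hC .sender _ _ q1 (hunit p hp))
    have q3 := abs_le.1 (hC' 0 h0 p.1 (hunit p hp))
    rw [sub_zero, abs_of_nonneg (hunit p hp).1] at q3
    have q4 := mul_le_mul_of_nonneg_left (hunit p hp).2 hC0
    simp only [hG, hI]
    linarith
  obtain ⟨q, hq⟩ := hs.nonempty
  have hne : (G '' 𝒟).Nonempty := ⟨_, _, hmem q hq, rfl⟩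
  -- By the envelope formula a rent is `I` plus a constant. The constant `c` makes it the largest
  -- one below the payoffs that all pairs in `𝒟` allow.
  set c := sInf (G '' 𝒟) with hc
  have hcle : ∀ p ∈ 𝒟, c ≤ G p := fun p hp => csInf_le hbdd ⟨p, hp, rfl⟩
  -- The infimum need not be attained. By `Fits.u_le` the decisions of nearly minimizing pairs give
  -- no type much more than the rent; a limit `d₀` of them gives no type more and is the reaction to
  -- unexpected reports.
  have hex : ∀ n : ℕ, ∃ d ∈ {d | ∃ t ∈ closure s, E.Tol L (Measure.dirac t) d},
      ∀ θ ∈ s, E.u .sender d θ ≤ c + I θ + 1 / (n + 1) := fun n => by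
    obtain ⟨_, ⟨p, hp, rfl⟩, hlt⟩ := exists_lt_of_csInf_lt hne
      (show sInf (G '' 𝒟) < c + 1 / ((n : ℝ) + 1) by
        have : (0 : ℝ) < 1 / (n + 1) := by positivity
        linarith)
    refine ⟨p.2, (h𝒟 p hp).tol, fun θ hθ => ?_⟩
    have := Fits.u_le hE hs hD (h𝒟 p hp) hθ
    rw [hIab _ (hunit p hp) _ (hs.subset hθ)] at this
    simp only [hG] at hlt
    linarith
  choose d hd hdle using hex
  obtain ⟨d₀, ⟨t₀, ht₀, htol⟩, φ, hφ, hlim⟩ := (hE.isCompact_tol_dirac hs L).tendsto_subseq hd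
  refine ⟨fun θ => c + I θ, d₀, t₀, ht₀, htol, fun θ hθ => ?_, fun θ hθ => ?_, fun θ θ' => by ring,
    fun p hp θ hθ => ?_, fun θ hθ w hw => ?_⟩
  · have l1 := ((hE.continuous_u_left .sender (hs.subset hθ)).tendsto d₀).comp hlim
    have l2 : Filter.Tendsto (fun n => c + I θ + 1 / ((φ n : ℝ) + 1)) Filter.atTop
        (nhds (c + I θ + 0)) :=
      (tendsto_one_div_add_atTop_nhds_zero_nat.comp hφ.tendsto_atTop).const_add _
    rw [add_zero] at l2
    exact le_of_tendsto_of_tendsto' l1 l2 fun n => hdle (φ n) θ hθ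
  · have := hcle _ (hmem θ hθ)
    simp only [hG] at this
    linarith
  · have := hcle p hp
    rw [hIab _ (hunit p hp) _ (hs.subset hθ)]
    simp only [hG] at this
    linarith
  · rw [← sub_le_iff_le_add]
    refine le_csInf hne ?_
    rintro _ ⟨p, hp, rfl⟩
    have := hw p hp
    rw [hIab _ (hunit p hp) _ (hs.subset hθ)] at this
    simp only [hG]
    linarith

lemma fits_self {ψ msg : Signal} (hmsg : ∀ θ ∈ Icc (0 : ℝ) 1, msg.cell θ ⊆ ψ.cell θ)
    {D : ℝ → ℝ} (hD : MonotoneOn D (Icc 0 1)) {θ y : ℝ} (hθ : θ ∈ Icc (0 : ℝ) 1)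
    (hy : y ∈ ψ.cell θ) (htol : E.Tol L (condLaw E.prior (msg.cell y)) (D y)) :
    E.Fits L (ψ.cell θ) D (y, D y) := by
  have hy1 := ψ.cell_subset θ hθ hy
  have hm := msg.isCell subset_rfl hy1
  have := hE.isProbabilityMeasure_condLaw hm
  obtain ⟨t, ht, h⟩ := hE.exists_tol_dirac hm.closure isClosed_closure
    ((hE.ae_mem_condLaw hm).mono fun x hx => subset_closure hx) htol
  have hsub : msg.cell y ⊆ ψ.cell θ := (hmsg y hy1).trans (ψ.cell_eq θ hθ y hy).subset
  exact ⟨subset_closure hy, ⟨t, closure_mono hsub ht, h⟩,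
    fun z hz hlt => hD (ψ.cell_subset θ hθ hz) hy1 hlt.le,
    fun z hz hlt => hD hy1 (ψ.cell_subset θ hθ hz) hlt.le⟩

open Classical in
/-- A monotone decision rule that the receiver is willing to follow is part of a mode in which the
rents of the sender are as low as any fitting decision allows. -/
lemma exists_mode {ψ : Signal} (msg : Signal) (hmsg : ∀ θ ∈ Icc (0 : ℝ) 1, msg.cell θ ⊆ ψ.cell θ)
    {D : ℝ → ℝ} (hD : MonotoneOn D (Icc 0 1))
    (hconst : ∀ θ ∈ Icc (0 : ℝ) 1, ∀ θ' ∈ msg.cell θ, D θ' = D θ)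
    (htol : ∀ θ ∈ Icc (0 : ℝ) 1, E.Tol L (condLaw E.prior (msg.cell θ)) (D θ))
    (q : ℝ → ℝ × ℝ) (hq : ∀ θ ∈ Icc (0 : ℝ) 1, E.Fits L (ψ.cell θ) D (q θ))
    (hq1 : ∀ θ ∈ Icc (0 : ℝ) 1, ψ.cell θ = {θ} → q θ = (θ, D θ)) :
    ∃ M : Mode ψ, M.Valid E L ∧ (∀ θ ∈ Icc (0 : ℝ) 1, M.dec θ = D θ) ∧
      ∀ θ ∈ Icc (0 : ℝ) 1, ∀ θ' ∈ ψ.cell θ, M.uS E θ' ≤ E.u .sender (q θ).2 (q θ).1 +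
        ∫ x in (q θ).1..θ', partialTheta (E.u .sender) (D x) x := by
  have h0 : (0 : ℝ) ∈ Icc (0 : ℝ) 1 := by simp
  have h1 : (1 : ℝ) ∈ Icc (0 : ℝ) 1 := by simp
  have hcells := fun θ hθ => ψ.isCell subset_rfl (θ := θ) hθ
  -- The pairs `(θ, D θ)` keep the rent below the payoff from the decision, so that the sender's
  -- payments are nonnegative. The pairs `q θ` bring the rents down to the required level.
  set 𝒟 : Set ℝ → Set (ℝ × ℝ) := fun s => {p | ∃ θ ∈ s, p = (θ, D θ) ∨ p = q θ} with h𝒟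
  have hfit : ∀ θ ∈ Icc (0 : ℝ) 1, ∀ p ∈ 𝒟 (ψ.cell θ), E.Fits L (ψ.cell θ) D p := by
    rintro θ hθ _ ⟨y, hy, rfl | rfl⟩
    · exact hE.fits_self hmsg hD hθ hy (htol y (ψ.cell_subset θ hθ hy))
    · have := hq y (ψ.cell_subset θ hθ hy)
      rwa [ψ.cell_eq θ hθ y hy] at this
  have hW : ∀ s : Set ℝ, ∃ (W : ℝ → ℝ) (d₀ t₀ : ℝ), (∃ θ ∈ Icc (0 : ℝ) 1, ψ.cell θ = s) →
      t₀ ∈ closure s ∧ E.Tol L (Measure.dirac t₀) d₀ ∧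
      (∀ θ ∈ s, E.u .sender d₀ θ ≤ W θ) ∧ (∀ θ ∈ s, W θ ≤ E.u .sender (D θ) θ) ∧
      (∀ θ θ', W θ' - W θ = (∫ x in 0..θ', partialTheta (E.u .sender) (D x) x) -
        ∫ x in 0..θ, partialTheta (E.u .sender) (D x) x) ∧
      (∀ p ∈ 𝒟 s, ∀ θ ∈ s, W θ ≤ E.u .sender p.2 p.1 +
        ∫ x in p.1..θ, partialTheta (E.u .sender) (D x) x) ∧
      ∀ θ ∈ s, ∀ w, (∀ p ∈ 𝒟 s, w ≤ E.u .sender p.2 p.1 +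
        ∫ x in p.1..θ, partialTheta (E.u .sender) (D x) x) → w ≤ W θ := fun s => by
    by_cases h : ∃ θ ∈ Icc (0 : ℝ) 1, ψ.cell θ = s
    · obtain ⟨θ, hθ, rfl⟩ := h
      obtain ⟨W, d₀, t₀, H⟩ := hE.exists_schedule (hcells θ hθ) hD (hfit θ hθ)
        fun y hy => ⟨y, hy, .inl rfl⟩
      exact ⟨W, d₀, t₀, fun _ => H⟩
    · exact ⟨0, 0, 0, fun h' => absurd h' h⟩
  choose W d₀ t₀ H using hW
  have H' : ∀ θ ∈ Icc (0 : ℝ) 1, _ := fun θ hθ => H (ψ.cell θ) ⟨θ, hθ, rfl⟩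
  set V : ℝ → ℝ := fun θ => W (ψ.cell θ) θ with hV
  have hVle : ∀ θ ∈ Icc (0 : ℝ) 1, V θ ≤ E.u .sender (D θ) θ := fun θ hθ =>
    (H' θ hθ).2.2.2.1 θ (ψ.mem_cell θ hθ)
  have hI0 := fun {a b : ℝ} ha hb =>
    hE.integral_partialTheta_adjacent ordConnected_Icc subset_rfl .sender hD h0 (b := a) (c := b) ha hb
  have hVsub : ∀ θ ∈ Icc (0 : ℝ) 1, ∀ θ' ∈ ψ.cell θ, V θ' - V θ =
      ∫ x in θ..θ', partialTheta (E.u .sender) (D x) x := fun θ hθ θ' hθ' => by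
    have e := ψ.cell_eq θ hθ θ' hθ'
    simp only [hV, e]
    rw [(H' θ hθ).2.2.2.2.1 θ θ', ← hI0 hθ (ψ.cell_subset θ hθ hθ'), add_sub_cancel_left]
  -- On one-point realizations the payment vanishes. The choice `q` need not be measurable across
  -- realizations, and this is what makes the payment measurable.
  have hVsing : ∀ θ ∈ Icc (0 : ℝ) 1, ψ.cell θ = {θ} → E.u .sender (D θ) θ ≤ V θ := fun θ hθ e => by
    refine (H' θ hθ).2.2.2.2.2.2 θ (ψ.mem_cell θ hθ) _ ?_
    rintro _ ⟨y, hy, hp⟩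
    rw [e, mem_singleton_iff] at hy
    rw [hy, hq1 θ hθ e, or_self] at hp
    rw [hp, intervalIntegral.integral_same, add_zero]
  set pay : ℝ → ℝ≥0 := fun θ => (E.u .sender (D (clampUnit θ)) (clampUnit θ) - V (clampUnit θ)).toNNReal
    with hpay
  have hpay' : ∀ θ ∈ Icc (0 : ℝ) 1, (pay θ : ℝ) = E.u .sender (D θ) θ - V θ := fun θ hθ => by
    simp only [hpay, clampUnit_of_mem hθ]
    exact Real.coe_toNNReal _ (sub_nonneg.2 (hVle θ hθ))
  have hpay0 : ∀ θ ∈ Icc (0 : ℝ) 1, ψ.cell θ = {θ} → pay θ = 0 := fun θ hθ e => by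
    simp only [hpay, clampUnit_of_mem hθ]
    exact Real.toNNReal_of_nonpos (sub_nonpos.2 (hVsing θ hθ e))
  have hin : ∀ θ ∈ Icc (0 : ℝ) 1, ∀ θ' ∈ msg.cell θ, θ' ∈ Icc (0 : ℝ) 1 := fun θ hθ θ' h =>
    msg.cell_subset θ hθ h
  have hDm : AEMeasurable D E.prior := by
    rw [← hE.restrict_unit]
    exact aemeasurable_restrict_of_monotoneOn measurableSet_Icc hD
  have hDb : ∀ θ ∈ Icc (0 : ℝ) 1, |D θ| ≤ max |D 0| |D 1| := fun θ hθ =>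
    abs_le_max_abs_abs (hD h0 hθ hθ.1) (hD hθ h1 hθ.2)
  obtain ⟨B, hB0, hB⟩ := hE.exists_abs_bound L
  obtain ⟨C, hC⟩ := hE.bounded_u (max (max |D 0| |D 1|) B)
  have hdb : ∀ θ ∈ Icc (0 : ℝ) 1, |d₀ (ψ.cell θ)| ≤ B := fun θ hθ =>
    hB _ (hE.ae_dirac ((hcells θ hθ).closure.subset (H' θ hθ).1)) _ (H' θ hθ).2.1
  have hpayb : ∀ θ, (pay θ : ℝ) ≤ 2 * C := fun θ => by
    have hc := clampUnit_mem θ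
    have e : pay θ = pay (clampUnit θ) := by simp only [hpay, clampUnit_of_mem hc]
    rw [e, hpay' _ hc]
    have q1 := abs_le.1 (hC .sender _ _ ((hDb _ hc).trans (le_max_left _ _)) hc)
    have q2 := abs_le.1 (hC .sender _ _ ((hdb _ hc).trans (le_max_right _ _)) hc)
    have q3 := (H' _ hc).2.2.1 _ (ψ.mem_cell _ hc)
    simp only [hV]
    linarith
  let M : Mode ψ :=
    { msg := msg
      dec := fun θ => D (clampUnit θ)
      pay := pay
      offDec := fun s => if ∃ θ ∈ Icc (0 : ℝ) 1, ψ.cell θ = s then d₀ s else 0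
      offState := t₀
      refines := hmsg
      dec_eq := fun θ hθ θ' h => by
        rw [clampUnit_of_mem hθ, clampUnit_of_mem (hin θ hθ θ' h), hconst θ hθ θ' h]
      pay_eq := fun θ hθ θ' h => by
        have hθ' := hin θ hθ θ' h
        rw [← NNReal.coe_inj, hpay' θ hθ, hpay' θ' hθ']
        -- Within a message the decision is constant, so the rent and the payoff from the decision
        -- change by the same amount and the payment does not reveal the state.
        have e1 := hVsub θ hθ θ' (hmsg θ hθ h)
        have hoc := msg.ordConnected θ hθ
        rw [intervalIntegral.integral_congr (g := fun x => partialTheta (E.u .sender) (D θ) x)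
          fun x hx => by
            simp only [hconst θ hθ x (hoc.uIcc_subset (msg.mem_cell θ hθ) h hx)],
          hE.integral_partialTheta .sender _ hθ hθ'] at e1
        rw [hconst θ hθ θ' h]
        linarith
      off_mem := fun θ hθ => (H' θ hθ).1 }
  have hdec : ∀ θ ∈ Icc (0 : ℝ) 1, M.dec θ = D θ := fun θ hθ => by
    simp only [M, clampUnit_of_mem hθ]
  have hoff : ∀ θ ∈ Icc (0 : ℝ) 1, M.offDec (ψ.cell θ) = d₀ (ψ.cell θ) := fun θ hθ =>
    if_pos ⟨θ, hθ, rfl⟩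
  have huS : ∀ θ ∈ Icc (0 : ℝ) 1, M.uS E θ = V θ := fun θ hθ => by
    rw [Mode.uS, hdec θ hθ]
    change _ - (pay θ : ℝ) = _
    rw [hpay' θ hθ]; ring
  have hVm : AEMeasurable (fun θ => (pay θ : ℝ)) E.prior := by
    have : AEMeasurable (fun θ => (pay θ : ℝ)) (E.prior.restrict (Icc 0 1)) := by
      refine hE.aemeasurable_of_cells isCell_unit ψ (g := fun _ => 0) aemeasurable_const
        (fun θ hθ _ => ⟨fun θ' => E.u .sender (D θ') θ' - W (ψ.cell θ) θ', ?_, fun θ' h => ?_⟩)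
        fun θ hθ e => by rw [hpay0 θ hθ e, NNReal.coe_zero]
      · have hκ : ∀ᵐ x ∂E.prior.restrict (ψ.cell θ), x ∈ Icc (0 : ℝ) 1 :=
          ae_restrict_of_ae hE.ae_mem
        refine (hE.aemeasurable_u hκ _ hDm.restrict).sub ?_
        have hcont : ContinuousOn (W (ψ.cell θ)) (ψ.cell θ) := by
          have := (hE.continuousOn_integral_partialTheta ordConnected_Icc subset_rfl .sender hD hDb
            h0).const_add (W (ψ.cell θ) 0)
          refine (this.mono (ψ.cell_subset θ hθ)).congr fun x hx => ?_
          have := (H' θ hθ).2.2.2.2.1 0 x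
          rw [intervalIntegral.integral_same] at this
          linarith
        exact hcont.aemeasurable (hcells θ hθ).measurableSet
      · have h' := ψ.cell_subset θ hθ h
        rw [hpay' θ' h']
        simp only [hV, ψ.cell_eq θ hθ θ' h]
    rwa [hE.restrict_unit] at this
  refine ⟨M, ⟨?_, ?_, hVm, fun θ hθ => ?_, fun θ hθ => ?_, fun θ hθ θ' h => ?_, fun θ hθ => ?_⟩, hdec,
    fun θ hθ θ' h => ?_⟩
  · have hC0 : 0 ≤ 2 * C := (pay 0).2.trans (hpayb 0)
    have e : ((2 * C).toNNReal : ℝ) = 2 * C := Real.coe_toNNReal _ hC0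
    have hm0 : 0 ≤ max |D 0| |D 1| := (abs_nonneg _).trans (le_max_left _ _)
    refine ⟨(2 * C).toNNReal + (max |D 0| |D 1|).toNNReal + B.toNNReal, fun θ => ?_, fun θ => ?_,
      fun s => ?_⟩
    · have := hDb _ (clampUnit_mem θ)
      simp only [M, NNReal.coe_add, e, Real.coe_toNNReal _ hm0, Real.coe_toNNReal _ hB0]
      linarith
    · have := hpayb θ
      rw [← NNReal.coe_le_coe]
      simp only [M, NNReal.coe_add, e, Real.coe_toNNReal _ hm0, Real.coe_toNNReal _ hB0]
      linarith
    · simp only [M, NNReal.coe_add, e, Real.coe_toNNReal _ hm0, Real.coe_toNNReal _ hB0]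
      split_ifs with h
      · obtain ⟨θ, hθ, rfl⟩ := h
        linarith [hdb θ hθ]
      · rw [abs_zero]; linarith
  · exact hDm.congr (hE.ae_mem.mono fun θ hθ => (hdec θ hθ).symm)
  · rw [hdec θ hθ]; exact htol θ hθ
  · rw [hoff θ hθ]; exact (H' θ hθ).2.1
  · have hθ' := ψ.cell_subset θ hθ h
    have key := hE.deter_of_envelope (hcells θ hθ).ordConnected (hcells θ hθ).subset .sender
      (hD.mono (ψ.cell_subset θ hθ)) (W := V) (fun x hx y hy => by
        have := ψ.cell_eq θ hθ x hx
        exact hVsub x (ψ.cell_subset θ hθ hx) y (this ▸ hy)) h (ψ.mem_cell θ hθ)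
    rw [huS θ hθ, hdec θ' hθ']
    change _ - (pay θ' : ℝ) ≤ _
    rw [hpay' θ' hθ']
    linarith
  · rw [hoff θ hθ, huS θ hθ]
    exact (H' θ hθ).2.2.1 θ (ψ.mem_cell θ hθ)
  · rw [huS θ' (ψ.cell_subset θ hθ h)]
    simp only [hV, ψ.cell_eq θ hθ θ' h]
    exact (H' θ hθ).2.2.2.2.2.1 _ ⟨θ, ψ.mem_cell θ hθ, .inr rfl⟩ θ' h

end Standing
end Env

namespace Env
namespace Standing

variable {E : Env} (hE : E.Standing) {L : ℝ}
include hE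

/-! ## The penal mode -/

lemma tol_of_penalFeasible {S : Set ℝ} (hS : IsCell S) {r : PenalRules S}
    (hr : E.PenalFeasible L r) {θ : ℝ} (hθ : θ ∈ S) :
    E.Tol L (condLaw E.prior (r.msg.cell θ)) (r.outcome θ) := by
  rw [← hE.temptation_le_iff (r.msg.isCell hS.subset hθ)]
  by_cases e : r.msg.cell θ = r.msg.cell r.pt
  · have e' : r.outcome θ = r.outcome r.pt := by simp only [PenalRules.outcome, e]
    rw [e, e']
    exact hr.at_pt.elim (fun h => h.1) fun h => h.1
  · have hne : θ ≠ r.pt := fun h => e (by rw [h])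
    rcases hne.lt_or_gt with h | h
    · exact (hr.below θ hθ (r.msg.below_or hθ hr.pt_mem h e)).1
    · exact (hr.above θ hθ (r.msg.below_or hr.pt_mem hθ h (Ne.symm e))).1

/-- Under a less informative signal the sender can be held to the value of the penal problem. -/
lemma exists_penal_mode {ψ ψ' : Signal} (hψ : MoreInformative ψ ψ')
    {r : (s : Set ℝ) → PenalRules (closure s)}
    (hr : ∀ θ ∈ Icc (0 : ℝ) 1, E.PenalFeasible L (r (ψ.cell θ)))
    (hmono : ∀ θ ∈ Icc (0 : ℝ) 1, ∀ θ' ∈ Icc (0 : ℝ) 1, θ ≤ θ' →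
        ∀ x ∈ closure (ψ.cell θ), ∀ y ∈ closure (ψ.cell θ'), x ≤ y →
          (r (ψ.cell θ)).outcome x ≤ (r (ψ.cell θ')).outcome y) :
    ∃ P : Mode ψ', P.Valid E L ∧ ∀ θ ∈ Icc (0 : ℝ) 1,
      ∫ x, P.uS E x ∂condLaw E.prior (ψ.cell θ) ≤ E.penalValue (r (ψ.cell θ)) := by
  have h0 : (0 : ℝ) ∈ Icc (0 : ℝ) 1 := by simp
  have h1 : (1 : ℝ) ∈ Icc (0 : ℝ) 1 := by simp
  have hcells := fun θ hθ => ψ.isCell subset_rfl (θ := θ) hθ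
  have hmem : ∀ θ ∈ Icc (0 : ℝ) 1, θ ∈ closure (ψ.cell θ) := fun θ hθ =>
    subset_closure (ψ.mem_cell θ hθ)
  have hcong : ∀ {s s' : Set ℝ}, s = s' → (r s).outcome = (r s').outcome := by rintro s _ rfl; rfl
  set D : ℝ → ℝ := fun θ => (r (ψ.cell θ)).outcome θ with hD
  -- Monotonicity across realizations of `ψ` is what allows the sender's reports to induce this
  -- outcome within a coarser realization.
  have hDm : MonotoneOn D (Icc 0 1) := fun θ hθ θ' hθ' h =>
    hmono θ hθ θ' hθ' h θ (hmem θ hθ) θ' (hmem θ' hθ') h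
  -- The sender reports the realization of `ψ` together with the penal message. Penal messages live
  -- on the closure and are cut down to the realization itself.
  let msg : Signal :=
    { cell := fun θ => (r (ψ.cell θ)).msg.cell θ ∩ ψ.cell θ
      mem_cell := fun θ hθ => ⟨(r (ψ.cell θ)).msg.mem_cell θ (hmem θ hθ), ψ.mem_cell θ hθ⟩
      cell_subset := fun θ hθ x hx => ψ.cell_subset θ hθ hx.2
      cell_eq := fun θ hθ x hx => by
        rw [ψ.cell_eq θ hθ x hx.2, (r (ψ.cell θ)).msg.cell_eq θ (hmem θ hθ) x hx.1]
      ordConnected := fun θ hθ => ((r (ψ.cell θ)).msg.ordConnected θ (hmem θ hθ)).inter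
        (ψ.ordConnected θ hθ) }
  have hpt : ∀ θ ∈ Icc (0 : ℝ) 1, (r (ψ.cell θ)).pt ∈ closure (ψ.cell θ) := fun θ hθ =>
    (hr θ hθ).pt_mem
  have hbetween : ∀ θ ∈ Icc (0 : ℝ) 1, ∀ p ∈ closure (ψ.cell θ), ∀ y,
      (θ < y ∧ y < p ∨ p < y ∧ y < θ) → y ∈ ψ.cell θ := fun θ hθ p hp y hy => by
    obtain ⟨a, b, -, hcl, hIoo⟩ := exists_closure_eq_Icc (hcells θ hθ)
    have ht := hmem θ hθ
    rw [hcl] at hp ht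
    rcases hy with h | h
    · exact hIoo ⟨ht.1.trans_lt h.1, h.2.trans_le hp.2⟩
    · exact hIoo ⟨hp.1.trans_lt h.1, h.2.trans_le ht.2⟩
  obtain ⟨P, hP, -, hle⟩ := hE.exists_mode (ψ := ψ') (L := L) msg
    (fun θ hθ => inter_subset_right.trans (hψ θ hθ)) hDm
    (fun θ hθ x hx => by
      change (r (ψ.cell x)).outcome x = (r (ψ.cell θ)).outcome θ
      rw [hcong (ψ.cell_eq θ hθ x hx.2)]
      simp only [PenalRules.outcome, (r (ψ.cell θ)).msg.cell_eq θ (hmem θ hθ) x hx.1])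
    (fun θ hθ => by
      have hm := (r (ψ.cell θ)).msg.isCell (hcells θ hθ).closure.subset (hmem θ hθ)
      rw [hE.condLaw_congr_finite (msg.isCell subset_rfl hθ) hm inter_subset_left
        ((closure_diff_finite (hcells θ hθ)).mono
          (show (r (ψ.cell θ)).msg.cell θ \ msg.cell θ ⊆ closure (ψ.cell θ) \ ψ.cell θ from
            fun x hx => ⟨(r (ψ.cell θ)).msg.cell_subset θ (hmem θ hθ) hx.1,
              fun h => hx.2 ⟨hx.1, h⟩⟩))]
      exact hE.tol_of_penalFeasible (hcells θ hθ).closure (hr θ hθ) (hmem θ hθ))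
    -- Each realization of `ψ` contributes its punishment state and decision as a candidate reaction
    -- to unexpected reports. So the rent given this realization is at most its penal value.
    (fun θ => ((r (ψ.cell θ)).pt, (r (ψ.cell θ)).outcome (r (ψ.cell θ)).pt))
    (fun θ hθ => by
      have hp := hpt θ hθ
      refine ⟨closure_mono (hψ θ hθ) hp, ?_, fun y hy hlt => ?_, fun y hy hlt => ?_⟩
      · have hm := (r (ψ.cell θ)).msg.isCell (hcells θ hθ).closure.subset hp
        have := hE.isProbabilityMeasure_condLaw hm
        obtain ⟨t, ht, h⟩ := hE.exists_tol_dirac hm.closure isClosed_closure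
          ((hE.ae_mem_condLaw hm).mono fun x hx => subset_closure hx)
          (hE.tol_of_penalFeasible (hcells θ hθ).closure (hr θ hθ) hp)
        exact ⟨t, closure_mono (hψ θ hθ) (closure_minimal
          ((r (ψ.cell θ)).msg.cell_subset _ hp) isClosed_closure ht), h⟩
      · have hy1 := ψ'.cell_subset θ hθ hy
        rcases le_or_gt y θ with h | h
        · exact hmono y hy1 θ hθ h y (hmem y hy1) _ hp hlt.le
        · have hyc := hbetween θ hθ _ hp y (.inl ⟨h, hlt⟩)
          have e := ψ.cell_eq θ hθ y hyc
          have := hmono y hy1 y hy1 le_rfl y (hmem y hy1) (r (ψ.cell θ)).pt (e ▸ hp) hlt.le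
          rw [← hcong e]
          exact this
      · have hy1 := ψ'.cell_subset θ hθ hy
        rcases le_or_gt θ y with h | h
        · exact hmono θ hθ y hy1 h _ hp y (hmem y hy1) hlt.le
        · have hyc := hbetween θ hθ _ hp y (.inr ⟨hlt, h⟩)
          have e := ψ.cell_eq θ hθ y hyc
          have := hmono y hy1 y hy1 le_rfl (r (ψ.cell θ)).pt (e ▸ hp) y (hmem y hy1) hlt.le
          rw [← hcong e]
          exact this)
    fun θ hθ e => by
      have e1 : ψ.cell θ = {θ} := subset_antisymm ((hψ θ hθ).trans e.subset)
        (singleton_subset_iff.2 (ψ.mem_cell θ hθ))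
      have h2 : ∀ x ∈ closure (ψ.cell θ), x = θ := by rw [e1]; simp
      simp only [hD, h2 _ (hpt θ hθ)]
  refine ⟨P, hP, fun θ hθ => ?_⟩
  set s := ψ.cell θ with hs
  have hc := hcells θ hθ
  have := hE.isProbabilityMeasure_condLaw hc
  have hp1 := hc.closure.subset (hpt θ hθ)
  have hDb : ∀ θ ∈ Icc (0 : ℝ) 1, |D θ| ≤ max |D 0| |D 1| := fun θ hθ =>
    abs_le_max_abs_abs (hDm h0 hθ hθ.1) (hDm hθ h1 hθ.2)
  obtain ⟨C, hC0, hC⟩ := hE.lipschitz_integral_partialTheta ordConnected_Icc subset_rfl .sender hDm hDb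
  have hcont := hE.continuousOn_integral_partialTheta ordConnected_Icc subset_rfl .sender hDm hDb hp1
  have hi : Integrable (fun θ => ∫ x in (r s).pt..θ, partialTheta (E.u .sender) (D x) x)
      (condLaw E.prior s) := by
    refine integrable_of_bounded (C := C) (hE.aemeasurable_condLaw_of_restrict hc
      ((hcont.mono hc.subset).aemeasurable hc.measurableSet)) ?_
    filter_upwards [hE.ae_unit_condLaw hc] with x hx
    refine (hC _ hp1 x hx).trans (mul_le_of_le_one_right hC0 ?_)
    rw [abs_le]
    constructor <;> linarith [hp1.1, hp1.2, hx.1, hx.2]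
  have hi' : Integrable (fun θ => E.u .sender ((r s).outcome (r s).pt) (r s).pt +
      ∫ x in (r s).pt..θ, partialTheta (E.u .sender) (D x) x) (condLaw E.prior s) :=
    (integrable_const _).add hi
  have hiS : Integrable (P.uS E) (condLaw E.prior s) := (hE.integrable_mode_cell hP hc).1
  have key := integral_mono_ae hiS hi' ((hE.ae_mem_condLaw hc).mono fun x hx =>
    hle θ hθ x (hψ θ hθ hx))
  rw [integral_add (integrable_const _) hi] at key
  refine key.trans_eq ?_
  rw [penalValue, hE.condLaw_closure hc]
  simp only [integral_const, probReal_univ, one_smul]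
  congr 1
  -- Along the path of integration `D` is the outcome on `s`, except possibly at endpoints that `s`
  -- lacks.
  refine integral_congr_ae ((hE.ae_mem_condLaw hc).mono fun y hy =>
    intervalIntegral.integral_congr_ae ?_)
  filter_upwards [(closure_diff_finite hc).ae_notMem volume] with x hx hxy
  have hxs : x ∈ s := by
    by_contra h
    exact hx ⟨hc.closure.ordConnected.uIcc_subset (hpt θ hθ) (subset_closure hy)
      (uIoc_subset_uIcc hxy), h⟩
  rw [show D x = (r s).outcome x from congrFun (hcong (ψ.cell_eq θ hθ x hxs)) x]

end Standing
end Env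

namespace Env
namespace Standing

variable {E : Env} (hE : E.Standing) {L : ℝ}
include hE

/-! ## The cooperative mode -/

/-- The largest of the best decisions for the two players that the receiver is willing to take. -/
lemma exists_best_joint (hL : 0 ≤ L) {m : Set ℝ} (hm : IsCell m) :
    ∃ d, E.Tol L (condLaw E.prior m) d ∧ ∀ d', E.Tol L (condLaw E.prior m) d' →
      E.mean .sender d' m + E.mean .receiver d' m ≤ E.mean .sender d m + E.mean .receiver d m ∧
      (E.mean .sender d m + E.mean .receiver d m ≤ E.mean .sender d' m + E.mean .receiver d' m →
        d' ≤ d) := by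
  have := hE.isProbabilityMeasure_condLaw hm
  have hβ := hE.ae_unit_condLaw hm
  have hcont : Continuous fun d => E.mean .sender d m + E.mean .receiver d m :=
    (hE.continuous_integral hβ .sender).add (hE.continuous_integral hβ .receiver)
  have hK := hE.isCompact_tol hβ L
  obtain ⟨d1, h1, hmax⟩ := hK.exists_isMaxOn ⟨_, hE.tol_lo hm hL⟩ hcont.continuousOn
  -- Choosing the largest maximizer makes the selection monotone in the message without an argument
  -- about uniqueness.
  obtain ⟨d, hd, hgr⟩ := (hK.inter_right (isClosed_le continuous_const hcont :
    IsClosed {d | E.mean .sender d1 m + E.mean .receiver d1 m ≤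
      E.mean .sender d m + E.mean .receiver d m})).exists_isGreatest ⟨d1, h1, le_refl (E.mean .sender d1 m + E.mean .receiver d1 m)⟩
  exact ⟨d, hd.1, fun d' hd' => ⟨(hmax hd').trans hd.2, fun h => hgr ⟨hd', hd.2.trans h⟩⟩⟩

/-- An equilibrium outcome of a period, improved upon, is a mode under a less informative signal. -/
lemma exists_cooperative_mode (hL : 0 ≤ L) {ψ ψ' : Signal} (hψ : MoreInformative ψ ψ')
    {ρ : Set ℝ → ℝ → ℝ} (hρ : ∀ θ ∈ Icc (0 : ℝ) 1, E.Poolable L (ψ.cell θ) (ρ (ψ.cell θ)))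
    (hρm : AEMeasurable (fun θ => ρ (ψ.cell θ) θ) E.prior) {B : ℝ} (hB : ∀ s θ, |ρ s θ| ≤ B) :
    ∃ C : Mode ψ', C.Valid E L ∧
      ∫ θ, (E.u .sender (ρ (ψ.cell θ) θ) θ + E.u .receiver (ρ (ψ.cell θ) θ) θ) ∂E.prior ≤
        (∫ θ, C.uS E θ ∂E.prior) + ∫ θ, C.uR E θ ∂E.prior ∧
      ∀ θ ∈ Icc (0 : ℝ) 1, ψ'.cell θ = {θ} → ∀ d, E.Tol L (Measure.dirac θ) d →
        E.u .sender d θ + E.u .receiver d θ ≤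
          E.u .sender (C.dec θ) θ + E.u .receiver (C.dec θ) θ := by
  have := hE.isProbabilityMeasure
  have hcells := fun θ hθ => ψ.isCell subset_rfl (θ := θ) hθ
  -- States in one realization of `ψ` with the same decision are pooled. That decision stays
  -- tolerable on the pool, so improving on it there loses no joint payoff.
  let msg : Signal :=
    { cell := fun θ => level (ψ.cell θ) (ρ (ψ.cell θ)) θ
      mem_cell := fun θ hθ => ⟨ψ.mem_cell θ hθ, rfl⟩
      cell_subset := fun θ hθ x hx => ψ.cell_subset θ hθ hx.1
      cell_eq := fun θ hθ x hx => by
        rw [ψ.cell_eq θ hθ x hx.1]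
        exact level_eq hx.2
      ordConnected := fun θ hθ =>
        ordConnected_level (ψ.ordConnected θ hθ) (hρ θ hθ).monotone θ }
  have hm := fun θ hθ => msg.isCell subset_rfl (θ := θ) hθ
  have hg : ∀ m : Set ℝ, ∃ d, IsCell m → E.Tol L (condLaw E.prior m) d ∧
      ∀ d', E.Tol L (condLaw E.prior m) d' →
      E.mean .sender d' m + E.mean .receiver d' m ≤ E.mean .sender d m + E.mean .receiver d m ∧
      (E.mean .sender d m + E.mean .receiver d m ≤ E.mean .sender d' m + E.mean .receiver d' m →
        d' ≤ d) := fun m => by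
    by_cases h : IsCell m
    · exact (hE.exists_best_joint hL h).imp fun d hd _ => hd
    · exact ⟨0, fun h' => absurd h' h⟩
  choose g hg using hg
  -- Monotone comparative statics: the tolerable interval moves up with the message and the joint
  -- payoff has increasing differences. Unlike the penal outcome, this one needs no hypothesis to be
  -- monotone across realizations.
  have hgmono : ∀ m m', IsCell m → IsCell m' → Below m m' → g m ≤ g m' := fun m m' h h' hlt => by
    have hle : ∀ x ∈ m, ∀ y ∈ m', x ≤ y := fun x hx y hy => (hlt x hx y hy).le
    have := hE.isProbabilityMeasure_condLaw h
    have := hE.isProbabilityMeasure_condLaw h'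
    by_contra hd
    push Not at hd
    obtain ⟨t1, o1⟩ := hg m h
    obtain ⟨t2, o2⟩ := hg m' h'
    have q1 := (hE.tol_condLaw_iff h hL).1 t1
    have q2 := (hE.tol_condLaw_iff h' hL).1 t2
    have q3 := o1 _ ((hE.tol_condLaw_iff h hL).2
      ⟨(hE.lo_mono h h' hle hL).trans q2.1, hd.le.trans q1.2⟩)
    have q4 := o2 _ ((hE.tol_condLaw_iff h' hL).2
      ⟨q2.1.trans hd.le, q1.2.trans (hE.hi_mono h h' hle hL)⟩)
    have q5 := fun i => hE.integral_sub_mono h.subset h'.subset (hE.ae_mem_condLaw h)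
      (hE.ae_mem_condLaw h') hle i hd.le
    have q6 := q5 .sender
    have q7 := q5 .receiver
    refine absurd (q4.2 ?_) (not_le.2 hd)
    simp only [mean] at *
    linarith
  set D : ℝ → ℝ := fun θ => g (msg.cell θ) with hD
  have hDm : MonotoneOn D (Icc 0 1) := fun θ hθ θ' hθ' h => by
    rcases h.eq_or_lt with rfl | h
    · exact le_rfl
    by_cases e : msg.cell θ = msg.cell θ'
    · simp only [hD, e, le_refl]
    · exact hgmono _ _ (hm θ hθ) (hm θ' hθ') (msg.below_or hθ hθ' h e)
  have hmsg : ∀ θ ∈ Icc (0 : ℝ) 1, msg.cell θ ⊆ ψ'.cell θ := fun θ hθ x hx => hψ θ hθ hx.1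
  have htol : ∀ θ ∈ Icc (0 : ℝ) 1, E.Tol L (condLaw E.prior (msg.cell θ)) (D θ) := fun θ hθ =>
    (hg _ (hm θ hθ)).1
  obtain ⟨C, hC, hdec, -⟩ := hE.exists_mode (ψ := ψ') (L := L) msg hmsg hDm (fun θ hθ x hx => by
      simp only [hD, msg.cell_eq θ hθ x hx]) htol (fun θ => (θ, D θ))
    (fun θ hθ => hE.fits_self hmsg hDm hθ (ψ'.mem_cell θ hθ) (htol θ hθ)) fun _ _ _ => rfl
  refine ⟨C, hC, ?_, fun θ hθ e d hd => ?_⟩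
  · obtain ⟨i1, i2, iu, -⟩ := hE.integrable_mode hC hE.ae_mem hC.aemeasurable_dec hC.aemeasurable_pay
    have iρ := fun i => hE.integrable_u hE.ae_mem i hρm (B := B) (.of_forall fun θ => hB _ θ)
    rw [← integral_add i1 i2]
    refine hE.integral_prior_le_of_cells msg ((iρ .sender).add (iρ .receiver)) (i1.add i2)
      fun θ hθ => ?_
    have hc := hm θ hθ
    have := hE.isProbabilityMeasure_condLaw hc
    have hi := fun i d => hE.integrable_u_const (hE.ae_unit_condLaw hc) i d
    have hcell : ∀ x ∈ msg.cell θ, ρ (ψ.cell x) x = ρ (ψ.cell θ) θ := fun x hx => by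
      rw [ψ.cell_eq θ hθ x hx.1]; exact hx.2
    have hpt : E.Tol L (condLaw E.prior (msg.cell θ)) (ρ (ψ.cell θ) θ) := by
      have hp := hρ θ hθ
      have hsat : ∀ x ∈ msg.cell θ, ∀ y ∈ ψ.cell θ, ρ (ψ.cell θ) y = ρ (ψ.cell θ) x →
          y ∈ msg.cell θ := fun x hx y hy e => ⟨hy, e.trans hx.2⟩
      exact tol_iff.2 ⟨hp.below _ hc (fun x hx => hx.1) hsat _ fun x hx => hx.2.ge,
        hp.above _ hc (fun x hx => hx.1) hsat _ fun x hx => hx.2.le⟩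
    have key := ((hg _ hc).2 _ hpt).1
    simp only [mean] at key
    rw [← integral_add (hi _ _) (hi _ _), ← integral_add (hi _ _) (hi _ _)] at key
    refine (le_of_eq ?_).trans (key.trans (le_of_eq ?_))
    · exact integral_congr_ae ((hE.ae_mem_condLaw hc).mono fun x hx => by
        simp only [hcell x hx])
    · refine integral_congr_ae ((hE.ae_mem_condLaw hc).mono fun x hx => ?_)
      have hx1 := msg.cell_subset θ hθ hx
      simp only [Mode.uS, Mode.uR, hdec x hx1, hD, msg.cell_eq θ hθ x hx]
      ring
  · have e1 : msg.cell θ = {θ} := subset_antisymm ((hmsg θ hθ).trans e.subset)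
      (singleton_subset_iff.2 (msg.mem_cell θ hθ))
    have hc := hm θ hθ
    rw [hdec θ hθ]
    have := ((hg _ hc).2 d (by rwa [e1, hE.condLaw_singleton])).1
    simp only [hD]
    rw [e1] at this ⊢
    simpa only [mean, hE.condLaw_singleton, integral_dirac] using this

/-- In some period of an equilibrium the joint payoff is at least the equilibrium payoff. -/
lemma exists_stage_ge {ψ : Signal} {σ : Profile} {β : History → Reported → Measure ℝ}
    (H : E.IsEquilibrium ψ σ β) : ∃ h, E.value ψ σ .sender [] + E.value ψ σ .receiver [] ≤
      E.ahead ψ σ .sender 0 h + E.ahead ψ σ .receiver 0 h := by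
  have := hE.isProbabilityMeasure
  have hδ : 0 < 1 - E.δ := sub_pos.2 hE.delta_lt_one
  obtain ⟨C, -, hC⟩ := hE.exists_ahead_bound ψ H.sender_bounded H.receiver_bounded
  set w := E.value ψ σ .sender [] + E.value ψ σ .receiver [] with hw
  -- A joint payoff `k + 1` periods ahead is an average of those `k` periods ahead after the
  -- possible records, one of which does at least as well.
  have hdesc : ∀ k h, w ≤ E.ahead ψ σ .sender k h + E.ahead ψ σ .receiver k h →
      ∃ h, w ≤ E.ahead ψ σ .sender 0 h + E.ahead ψ σ .receiver 0 h := fun k => by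
    induction k with
    | zero => exact fun h hh => ⟨h, hh⟩
    | succ k ih =>
      intro h hh
      have hi := fun i => integrable_of_bounded (C := C)
        ((H.measurable h List.nil_prefix).1.2.2 i k) (.of_forall fun θ => hC i k _)
      simp only [ahead] at hh
      rw [← integral_add (hi _) (hi _)] at hh
      obtain ⟨θ, hθ⟩ := exists_integral_le ((hi .sender).add (hi .receiver))
      exact ih _ (hh.trans hθ)
  suffices h : ∃ k, w ≤ E.ahead ψ σ .sender k [] + E.ahead ψ σ .receiver k [] by
    obtain ⟨k, hk⟩ := h
    exact hdesc k [] hk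
  by_contra! hcon
  have hs := fun i => hE.summable_ahead (ψ := ψ) (σ := σ) (i := i) (h := []) fun k => hC i k []
  have hg := summable_geometric_of_lt_one hE.delta_nonneg hE.delta_lt_one
  have hlt : ∑' k, (E.δ ^ k * E.ahead ψ σ .sender k [] + E.δ ^ k * E.ahead ψ σ .receiver k []) <
      ∑' k, E.δ ^ k * w := by
    refine Summable.tsum_lt_tsum (i := 0) (fun k => ?_) ?_ ((hs _).add (hs _)) (hg.mul_right w)
    · rw [← mul_add]
      exact mul_le_mul_of_nonneg_left (hcon k).le (pow_nonneg hE.delta_nonneg k)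
    · have := hcon 0
      simp only [pow_zero, one_mul]
      exact this
  rw [(hs _).tsum_add (hs _), tsum_mul_right,
    tsum_geometric_of_lt_one hE.delta_nonneg hE.delta_lt_one] at hlt
  have h1 := mul_lt_mul_of_pos_left hlt hδ
  rw [mul_inv_cancel_left₀ hδ.ne', mul_add] at h1
  exact lt_irrefl _ h1

/-- Every equilibrium payoff is dominated by a mode under a less informative signal. -/
lemma exists_mode_of_equilibrium {ψ ψ' : Signal} (hψ : MoreInformative ψ ψ') {σ : Profile}
    {β : History → Reported → Measure ℝ} (H : E.IsEquilibrium ψ σ β) {vS vR vbar : ℝ}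
    (hb : E.PayoffBounds ψ vS vR vbar) (hL : 0 ≤ E.δ / (1 - E.δ) * (vbar - vS - vR)) :
    ∃ C : Mode ψ', C.Valid E (E.δ / (1 - E.δ) * (vbar - vS - vR)) ∧
      E.value ψ σ .sender [] + E.value ψ σ .receiver [] ≤
        (∫ θ, C.uS E θ ∂E.prior) + ∫ θ, C.uR E θ ∂E.prior ∧
      ∀ θ ∈ Icc (0 : ℝ) 1, ψ'.cell θ = {θ} →
        ∀ d, E.Tol (E.δ / (1 - E.δ) * (vbar - vS - vR)) (Measure.dirac θ) d →
        E.u .sender d θ + E.u .receiver d θ ≤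
          E.u .sender (C.dec θ) θ + E.u .receiver (C.dec θ) θ := by
  have := hE.isProbabilityMeasure
  obtain ⟨h, hh⟩ := hE.exists_stage_ge H
  obtain ⟨B, -, hB⟩ := Profile.exists_bound_afterSignal H.sender_bounded H.receiver_bounded
  have hm := (H.measurable h List.nil_prefix).1
  obtain ⟨C, hC, hle, hsing⟩ := hE.exists_cooperative_mode hL hψ
    (ρ := fun s θ => (σ.afterSignal h s θ).dec)
    (fun θ hθ => hE.poolable_of_equilibrium H hb hθ h (x := ⟨ψ.cell θ, σ.S.exAnte h (ψ.cell θ),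
      σ.R.exAnte h (ψ.cell θ) (σ.S.exAnte h (ψ.cell θ))⟩) rfl) hm.1 (fun s θ => (hB h s θ).1)
  refine ⟨C, hC, hh.trans (le_trans ?_ hle), hsing⟩
  obtain ⟨C', -, hC'⟩ := hE.exists_stage_bound B
  have is := fun i => integrable_of_bounded (C := C') (hE.aemeasurable_stage hE.ae_mem hm i)
    (hE.ae_mem.mono fun θ hθ => hC' i θ _ hθ (hB h _ θ).1 ((hB h _ θ).2 i))
  have iu := fun i => hE.integrable_u hE.ae_mem i hm.1 (B := B) (.of_forall fun θ => (hB h _ θ).1)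
  simp only [ahead]
  rw [← integral_add (is _) (is _)]
  refine integral_mono ((is _).add (is _)) ((iu .sender).add (iu .receiver)) fun θ => ?_
  set x := σ.play h ψ θ with hx
  have n1 := fun p : Transfer => p.2.2
  simp only [NNReal.val_eq_coe] at n1
  -- Transfers between the players cancel in the joint payoff; burned money remains and only lowers
  -- it.
  have e : x.net .sender + x.net .receiver = x.exS.2 + x.exR.2 + x.inS.2 + x.inR.2 + x.postS.2 +
      x.postR.2 := by
    simp only [Record.net, netTransfer]; ring
  have := n1 x.exS
  have := n1 x.exR
  have := n1 x.inS
  have := n1 x.inR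
  have := n1 x.postS
  have := n1 x.postR
  change E.u .sender x.dec θ - x.net .sender + (E.u .receiver x.dec θ - x.net .receiver) ≤
    E.u .sender x.dec θ + E.u .receiver x.dec θ
  linarith

end Standing
end Env

namespace Env

/-! ## Selecting the better of two modes -/

/-- The mode that follows `F s` after the signal `s`. -/
noncomputable def Mode.glue {ψ : Signal} (F : Set ℝ → Mode ψ) : Mode ψ where
  msg :=
    { cell := fun θ => (F (ψ.cell θ)).msg.cell θ
      mem_cell := fun θ hθ => (F (ψ.cell θ)).msg.mem_cell θ hθ
      cell_subset := fun θ hθ => (F (ψ.cell θ)).msg.cell_subset θ hθ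
      cell_eq := fun θ hθ x hx => by
        rw [ψ.cell_eq θ hθ x ((F (ψ.cell θ)).refines θ hθ hx)]
        exact (F (ψ.cell θ)).msg.cell_eq θ hθ x hx
      ordConnected := fun θ hθ => (F (ψ.cell θ)).msg.ordConnected θ hθ }
  dec := fun θ => (F (ψ.cell θ)).dec θ
  pay := fun θ => (F (ψ.cell θ)).pay θ
  offDec := fun s => (F s).offDec s
  offState := fun s => (F s).offState s
  refines := fun θ hθ => (F (ψ.cell θ)).refines θ hθ
  dec_eq := fun θ hθ x hx => by
    rw [ψ.cell_eq θ hθ x ((F (ψ.cell θ)).refines θ hθ hx)]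
    exact (F (ψ.cell θ)).dec_eq θ hθ x hx
  pay_eq := fun θ hθ x hx => by
    rw [ψ.cell_eq θ hθ x ((F (ψ.cell θ)).refines θ hθ hx)]
    exact (F (ψ.cell θ)).pay_eq θ hθ x hx
  off_mem := fun θ hθ => (F (ψ.cell θ)).off_mem θ hθ

lemma Mode.Valid.mono {E : Env} {ψ : Signal} {M : Mode ψ} {L L' : ℝ} (hM : M.Valid E L)
    (h : L ≤ L') : M.Valid E L' :=
  { hM with
    tol := fun θ hθ => (hM.tol θ hθ).mono h
    off_tol := fun θ hθ => (hM.off_tol θ hθ).mono h }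

namespace Standing

variable {E : Env} (hE : E.Standing) {ψ : Signal} {L : ℝ}
include hE

/-- Incentives concern one realization at a time. Measurability holds for an arbitrary selection
because positive-probability realizations are countably many and all one-point realizations use `C`.
-/
lemma valid_glue {F : Set ℝ → Mode ψ} {C P : Mode ψ} (hC : C.Valid E L) (hP : P.Valid E L)
    (hF : ∀ s, F s = C ∨ F s = P)
    (hs : ∀ θ ∈ Icc (0 : ℝ) 1, ψ.cell θ = {θ} → F (ψ.cell θ) = C) :
    (Mode.glue F).Valid E L := by
  have hv : ∀ s, (F s).Valid E L := fun s => by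
    rcases hF s with h | h <;> rw [h] <;> assumption
  obtain ⟨B, b1, b2, b3⟩ := hC.bounded
  obtain ⟨B', b1', b2', b3'⟩ := hP.bounded
  have hb : ∀ s, (∀ θ, |(F s).dec θ| ≤ (max B B' : ℝ≥0)) ∧ (∀ θ, (F s).pay θ ≤ max B B') ∧
      ∀ s', |(F s).offDec s'| ≤ (max B B' : ℝ≥0) := fun s => by
    have e1 : (B : ℝ) ≤ (max B B' : ℝ≥0) := by exact_mod_cast le_max_left B B'
    have e2 : (B' : ℝ) ≤ (max B B' : ℝ≥0) := by exact_mod_cast le_max_right B B'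
    rcases hF s with h | h <;> rw [h]
    · exact ⟨fun θ => (b1 θ).trans e1, fun θ => (b2 θ).trans (le_max_left _ _),
        fun s' => (b3 s').trans e1⟩
    · exact ⟨fun θ => (b1' θ).trans e2, fun θ => (b2' θ).trans (le_max_right _ _),
        fun s' => (b3' s').trans e2⟩
  refine ⟨⟨max B B', fun θ => (hb _).1 θ, fun θ => (hb _).2.1 θ, fun s => (hb s).2.2 s⟩, ?_, ?_,
    fun θ hθ => (hv _).tol θ hθ, fun θ hθ => (hv _).off_tol θ hθ, fun θ hθ x hx => ?_,
    fun θ hθ => (hv _).off_ic θ hθ⟩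
  · rw [← hE.restrict_unit]
    exact hE.aemeasurable_of_cells isCell_unit ψ hC.aemeasurable_dec.restrict
      (fun θ hθ _ => ⟨_, (hv (ψ.cell θ)).aemeasurable_dec.restrict, fun x hx => by
        simp only [Mode.glue, ψ.cell_eq θ hθ x hx]⟩)
      fun θ hθ e => by simp only [Mode.glue, hs θ hθ e]
  · rw [← hE.restrict_unit]
    exact hE.aemeasurable_of_cells isCell_unit ψ hC.aemeasurable_pay.restrict
      (fun θ hθ _ => ⟨_, (hv (ψ.cell θ)).aemeasurable_pay.restrict, fun x hx => by
        simp only [Mode.glue, ψ.cell_eq θ hθ x hx]⟩)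
      fun θ hθ e => by simp only [Mode.glue, hs θ hθ e]
  · have := (hv (ψ.cell θ)).ic θ hθ x hx
    simp only [Mode.glue, Mode.uS, ψ.cell_eq θ hθ x hx] at *
    exact this

/-- After every signal, one can choose the mode with the larger joint payoff. -/
lemma exists_better_mode {C P : Mode ψ} (hC : C.Valid E L) (hP : P.Valid E L)
    (hs : ∀ θ ∈ Icc (0 : ℝ) 1, ψ.cell θ = {θ} → ∀ d, E.Tol L (Measure.dirac θ) d →
      E.u .sender d θ + E.u .receiver d θ ≤
        E.u .sender (C.dec θ) θ + E.u .receiver (C.dec θ) θ) :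
    ∃ K : Mode ψ, K.Valid E L ∧
      (∀ θ ∈ Icc (0 : ℝ) 1,
        (∫ x, P.uS E x ∂condLaw E.prior (ψ.cell θ)) + (∫ x, P.uR E x ∂condLaw E.prior (ψ.cell θ)) ≤
        (∫ x, K.uS E x ∂condLaw E.prior (ψ.cell θ)) + ∫ x, K.uR E x ∂condLaw E.prior (ψ.cell θ)) ∧
      (∫ θ, C.uS E θ ∂E.prior) + (∫ θ, C.uR E θ ∂E.prior) ≤
        (∫ θ, K.uS E θ ∂E.prior) + ∫ θ, K.uR E θ ∂E.prior := by
  classical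
  have := hE.isProbabilityMeasure
  set J : Mode ψ → Set ℝ → ℝ := fun M s =>
    (∫ x, M.uS E x ∂condLaw E.prior s) + ∫ x, M.uR E x ∂condLaw E.prior s with hJ
  -- The selection makes `K` jointly at least as good as `P` on every realization, not just on
  -- average; `slack_nonneg` rests on this.
  set F : Set ℝ → Mode ψ := fun s => if J P s ≤ J C s then C else P with hF
  have hFs : ∀ s, J P s ≤ J (F s) s ∧ J C s ≤ J (F s) s := fun s => by
    by_cases h : J P s ≤ J C s
    · simp only [hF, if_pos h]; exact ⟨h, le_rfl⟩
    · simp only [hF, if_neg h]; exact ⟨le_rfl, (not_le.1 h).le⟩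
  have hK : (Mode.glue F).Valid E L := by
    refine hE.valid_glue hC hP (fun s => by simp only [hF]; split_ifs <;> simp) fun θ hθ e => ?_
    have hm : P.msg.cell θ = {θ} := subset_antisymm ((P.refines θ hθ).trans e.subset)
      (singleton_subset_iff.2 (P.msg.mem_cell θ hθ))
    have ht := hP.tol θ hθ
    rw [hm, hE.condLaw_singleton] at ht
    -- On a one-point realization the decision of `P` is tolerable under certainty, and by `hs` the
    -- decision of `C` is jointly at least as good.
    refine if_pos ?_
    have := hs θ hθ e _ ht
    simp only [hJ, e, hE.condLaw_singleton, integral_dirac, Mode.uS, Mode.uR]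
    linarith
  have hKs : ∀ θ ∈ Icc (0 : ℝ) 1, J (Mode.glue F) (ψ.cell θ) = J (F (ψ.cell θ)) (ψ.cell θ) :=
    fun θ hθ => by
      have hae := hE.ae_mem_condLaw (ψ.isCell subset_rfl hθ)
      simp only [hJ]
      refine congrArg₂ (· + ·) (integral_congr_ae ?_) (integral_congr_ae ?_) <;>
        filter_upwards [hae] with x hx <;>
        simp only [Mode.uS, Mode.uR, Mode.glue, ψ.cell_eq θ hθ x hx]
  refine ⟨_, hK, fun θ hθ => (hFs _).1.trans (hKs θ hθ).ge, ?_⟩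
  have i1 := hE.integrable_mode hC hE.ae_mem hC.aemeasurable_dec hC.aemeasurable_pay
  have i2 := hE.integrable_mode hK hE.ae_mem hK.aemeasurable_dec hK.aemeasurable_pay
  rw [← integral_add i1.1 i1.2.1, ← integral_add i2.1 i2.2.1]
  refine hE.integral_prior_le_of_cells ψ (i1.1.add i1.2.1) (i2.1.add i2.2.1) fun θ hθ => ?_
  have hc := ψ.isCell subset_rfl hθ
  have j1 := hE.integrable_mode_cell hC hc
  have j2 := hE.integrable_mode_cell hK hc
  rw [integral_add j1.1 j1.2.1, integral_add j2.1 j2.2.1]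
  exact (hFs _).2.trans (hKs θ hθ).ge

/-! ## The receiver's worst mode -/

/-- The receiver's best decision under her information. -/
noncomputable def babbleDec (E : Env) (ψ : Signal) (θ : ℝ) : ℝ := E.lo 0 (ψ.cell θ)

omit hE in
lemma babbleDec_eq {θ : ℝ} (hθ : θ ∈ Icc (0 : ℝ) 1) {x : ℝ} (hx : x ∈ ψ.cell θ) :
    babbleDec E ψ x = babbleDec E ψ θ := by
  rw [babbleDec, ψ.cell_eq θ hθ x hx, babbleDec]

lemma tol_babbleDec {θ : ℝ} (hθ : θ ∈ Icc (0 : ℝ) 1) :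
    E.Tol 0 (condLaw E.prior (ψ.cell θ)) (babbleDec E ψ θ) :=
  hE.tol_lo (ψ.isCell subset_rfl hθ) le_rfl

lemma monotoneOn_babbleDec : MonotoneOn (babbleDec E ψ) (Icc 0 1) := fun θ hθ θ' hθ' h => by
  by_cases e : ψ.cell θ = ψ.cell θ'
  · rw [babbleDec, e, babbleDec]
  · exact hE.lo_mono (ψ.isCell subset_rfl hθ) (ψ.isCell subset_rfl hθ') (fun x hx y hy =>
      (ψ.below_or hθ hθ' (h.lt_of_ne fun e' => e (by rw [e'])) e x hx y hy).le) le_rfl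

lemma integrable_babbleDec : Integrable (fun θ => E.u .receiver (babbleDec E ψ θ) θ) E.prior := by
  have := hE.isProbabilityMeasure
  obtain ⟨B, -, hB⟩ := hE.exists_abs_bound 0
  refine hE.integrable_u hE.ae_mem _ ?_ (B := B) (hE.ae_mem.mono fun θ hθ => ?_)
  · rw [← hE.restrict_unit]
    exact aemeasurable_restrict_of_monotoneOn measurableSet_Icc hE.monotoneOn_babbleDec
  · have hc := ψ.isCell subset_rfl hθ
    have := hE.isProbabilityMeasure_condLaw hc
    exact hB _ (hE.ae_unit_condLaw hc) _ (hE.tol_babbleDec hθ)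

/-- The mode in which the sender sends no information. -/
lemma exists_babble_mode (ψ : Signal) : ∃ B : Mode ψ, B.Valid E 0 ∧
    (∀ θ ∈ Icc (0 : ℝ) 1, ∀ x ∈ ψ.cell θ, B.dec x = B.dec θ ∧ B.pay x = 0) ∧
    ∫ θ, B.uR E θ ∂E.prior = ∫ θ, E.u .receiver (babbleDec E ψ θ) θ ∂E.prior := by
  classical
  obtain ⟨b, hb0, hb⟩ := hE.exists_abs_bound 0
  have hbd : ∀ θ ∈ Icc (0 : ℝ) 1, |babbleDec E ψ θ| ≤ b := fun θ hθ => by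
    have hc := ψ.isCell subset_rfl hθ
    have := hE.isProbabilityMeasure_condLaw hc
    exact hb _ (hE.ae_unit_condLaw hc) _ (hE.tol_babbleDec hθ)
  have hst : ∀ s : Set ℝ, ∃ x, ∀ θ ∈ Icc (0 : ℝ) 1, s = ψ.cell θ →
      x ∈ closure s ∧ E.Tol 0 (Measure.dirac x) (E.lo 0 s) := fun s => by
    by_cases h : ∃ θ ∈ Icc (0 : ℝ) 1, s = ψ.cell θ
    · obtain ⟨θ, hθ, rfl⟩ := h
      have hc := ψ.isCell subset_rfl hθ
      have := hE.isProbabilityMeasure_condLaw hc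
      obtain ⟨x, hx, ht⟩ := hE.exists_tol_dirac hc.closure isClosed_closure
        ((hE.ae_mem_condLaw hc).mono fun x hx => subset_closure hx) (hE.tol_babbleDec hθ)
      exact ⟨x, fun _ _ _ => ⟨hx, ht⟩⟩
    · exact ⟨0, fun θ hθ e => absurd ⟨θ, hθ, e⟩ h⟩
  choose st hst using hst
  have hcl : ∀ θ ∈ Icc (0 : ℝ) 1, ∀ x ∈ ψ.cell θ,
      babbleDec E ψ (clampUnit x) = babbleDec E ψ (clampUnit θ) := fun θ hθ x hx => by
    rw [clampUnit_of_mem hθ, clampUnit_of_mem (ψ.cell_subset θ hθ hx), babbleDec_eq hθ hx]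
  let B : Mode ψ :=
    { msg := ψ
      dec := fun θ => babbleDec E ψ (clampUnit θ)
      pay := fun _ => 0
      -- The truncation has no effect on signal realizations; it only keeps the decision bounded on
      -- other sets.
      offDec := fun s => max (-b) (min (E.lo 0 s) b)
      offState := st
      refines := fun _ _ => subset_rfl
      dec_eq := hcl
      pay_eq := fun _ _ _ _ => rfl
      off_mem := fun θ hθ => (hst _ θ hθ rfl).1 }
  have hoff : ∀ θ ∈ Icc (0 : ℝ) 1, B.offDec (ψ.cell θ) = E.lo 0 (ψ.cell θ) := fun θ hθ => by
    have := abs_le.1 (hbd θ hθ)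
    rw [babbleDec] at this
    simp only [B, min_eq_left this.2, max_eq_right this.1]
  have hdec : ∀ θ ∈ Icc (0 : ℝ) 1, B.dec θ = babbleDec E ψ θ := fun θ hθ => by
    simp only [B, clampUnit_of_mem hθ]
  refine ⟨B, ⟨⟨⟨b, hb0⟩, fun θ => hbd _ (clampUnit_mem θ), fun θ => zero_le, fun s => ?_⟩, ?_,
    aemeasurable_const, fun θ hθ => ?_, fun θ hθ => ?_, fun θ hθ x hx => ?_, fun θ hθ => ?_⟩,
    fun θ hθ x hx => ⟨hcl θ hθ x hx, rfl⟩, integral_congr_ae (hE.ae_mem.mono fun θ hθ => ?_)⟩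
  · exact abs_le.2 ⟨le_max_left _ _, max_le (by change -b ≤ b; linarith) (min_le_right _ _)⟩
  · rw [← hE.restrict_unit]
    exact aemeasurable_restrict_of_monotoneOn measurableSet_Icc
      (hE.monotoneOn_babbleDec.congr fun θ hθ => (hdec θ hθ).symm)
  · rw [hdec θ hθ]; exact hE.tol_babbleDec hθ
  · rw [hoff θ hθ]; exact (hst _ θ hθ rfl).2
  · have := hcl θ hθ x hx
    simp only [Mode.uS, B, this, le_refl]
  · rw [hoff θ hθ, Mode.uS, hdec θ hθ]
    simp [B, babbleDec]
  · simp only [Mode.uR, hdec θ hθ]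
    simp [B]

end Standing
end Env

namespace Env
namespace Standing

variable {E : Env} (hE : E.Standing) {ψ ψ' : Signal}
include hE

/-! ## The value of information for the receiver -/

/-- The first-order condition for a best decision. -/
lemma integral_partialD_eq_zero {m : Set ℝ} (hm : IsCell m) {d : ℝ}
    (hd : E.Tol 0 (condLaw E.prior m) d) :
    Integrable (fun θ => partialD (E.u .receiver) d (clampUnit θ)) (condLaw E.prior m) ∧
      ∫ θ, partialD (E.u .receiver) d (clampUnit θ) ∂condLaw E.prior m = 0 := by
  have := hE.isProbabilityMeasure_condLaw hm
  have hu := hE.ae_unit_condLaw hm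
  have hc := (hE.twice_differentiable .receiver).continuous_partialD_clamped
  obtain ⟨C, hC⟩ := (isCompact_Icc (a := d - 1) (b := d + 1)).prod
    (isCompact_Icc (a := (0 : ℝ)) (b := 1)) |>.exists_bound_of_continuousOn hc.continuousOn
  have hi := fun d => hE.integrable_u_const hu .receiver d
  obtain ⟨h1, h2⟩ := hasDerivAt_integral_of_dominated_loc_of_deriv_le
    (F := fun d' θ => E.u .receiver d' θ)
    (F' := fun d' θ => partialD (E.u .receiver) d' (clampUnit θ)) (bound := fun _ => C)
    (Icc_mem_nhds (by linarith : d - 1 < d) (by linarith : d < d + 1))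
    (.of_forall fun d' => (hi d').aestronglyMeasurable) (hi d)
    (hc.comp (continuous_const.prodMk continuous_id)).aestronglyMeasurable
    (hu.mono fun θ hθ d' hd' => hC (d', θ) ⟨hd', hθ⟩) (integrable_const _)
    (hu.mono fun θ hθ d' _ => by
      rw [clampUnit_of_mem hθ]; exact hE.hasDerivAt_u .receiver d' hθ)
  refine ⟨h1, IsLocalMax.hasDerivAt_eq_zero (.of_forall fun d' => ?_) h2⟩
  linarith [hd d']

/-- The receiver reacts to news. -/
lemma not_tol_of_below {m m' : Set ℝ} (hm : IsCell m) (hm' : IsCell m') (hlt : Below m m') {d : ℝ}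
    (hd : E.Tol 0 (condLaw E.prior m) d) : ¬ E.Tol 0 (condLaw E.prior m') d := fun hd' => by
  have := hE.isProbabilityMeasure_condLaw hm
  have := hE.isProbabilityMeasure_condLaw hm'
  obtain ⟨i1, e1⟩ := hE.integral_partialD_eq_zero hm hd
  obtain ⟨i2, e2⟩ := hE.integral_partialD_eq_zero hm' hd'
  -- At `d` the marginal payoff averages to zero on both sets. So it is nonnegative at some `x ∈ m`
  -- and nonpositive at some `y ∈ m'`, although `x < y` and it increases strictly in the state.
  obtain ⟨x, hx, hx'⟩ := exists_notMem_null_integral_le i1 (hE.condLaw_compl hm)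
  obtain ⟨y, hy, hy'⟩ := exists_notMem_null_le_integral i2 (hE.condLaw_compl hm')
  rw [notMem_compl_iff] at hx hy
  rw [e1, clampUnit_of_mem (hm.subset hx)] at hx'
  rw [e2, clampUnit_of_mem (hm'.subset hy)] at hy'
  exact (hE.strictMonoOn_partialD .receiver d (hm.subset hx) (hm'.subset hy)
    (hlt x hx y hy)).not_ge (hy'.trans hx')

/-- Without reports, the receiver is strictly worse off under a strictly less informative signal. -/
lemma integral_babbleDec_lt (hψ : StrictlyMoreInformative E ψ ψ') :
    ∫ θ, E.u .receiver (babbleDec E ψ' θ) θ ∂E.prior <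
      ∫ θ, E.u .receiver (babbleDec E ψ θ) θ ∂E.prior := by
  obtain ⟨hle, hpos⟩ := hψ
  have i1 := hE.integrable_babbleDec (ψ := ψ)
  have i2 := hE.integrable_babbleDec (ψ := ψ')
  set f : ℝ → ℝ := fun θ => E.u .receiver (babbleDec E ψ θ) θ - E.u .receiver (babbleDec E ψ' θ) θ
    with hf
  have hfc : ∀ θ ∈ Icc (0 : ℝ) 1, ∫ x, f x ∂condLaw E.prior (ψ.cell θ) =
      (∫ x, E.u .receiver (babbleDec E ψ θ) x ∂condLaw E.prior (ψ.cell θ)) -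
        ∫ x, E.u .receiver (babbleDec E ψ' θ) x ∂condLaw E.prior (ψ.cell θ) := fun θ hθ => by
    have hc := ψ.isCell subset_rfl hθ
    have := hE.isProbabilityMeasure_condLaw hc
    have hi := fun d => hE.integrable_u_const (hE.ae_unit_condLaw hc) .receiver d
    rw [← integral_sub (hi _) (hi _)]
    refine integral_congr_ae ((hE.ae_mem_condLaw hc).mono fun x hx => ?_)
    simp only [hf, babbleDec_eq hθ hx, babbleDec_eq hθ (hle θ hθ hx)]
  have hf0 : ∀ θ ∈ Icc (0 : ℝ) 1, 0 ≤ ∫ x, f x ∂condLaw E.prior (ψ.cell θ) := fun θ hθ => by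
    rw [hfc θ hθ]
    linarith [hE.tol_babbleDec (ψ := ψ) hθ (babbleDec E ψ' θ)]
  have key := (hE.setIntegral_nonneg_of_cells isCell_unit ψ (f := f) (i1.sub i2).integrableOn hf0).2
  rw [hE.restrict_unit, hf, integral_sub i1 i2, sub_pos] at key
  refine key (pos_iff_ne_zero.2 fun hN => ?_)
  -- Outside `N` the decision based on `ψ'` is also best given `ψ`. If `N` were null, two states
  -- outside it would share a realization of `ψ'` but not of `ψ`, and one decision would be best on
  -- two ordered realizations.
  set N := {θ | θ ∈ Icc (0 : ℝ) 1 ∧ 0 < ∫ x, f x ∂condLaw E.prior (ψ.cell θ)} with hNdef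
  have hgood : ∀ θ ∈ Icc (0 : ℝ) 1, θ ∉ N →
      E.Tol 0 (condLaw E.prior (ψ.cell θ)) (babbleDec E ψ' θ) := fun θ hθ hn d => by
    have h1 := not_lt.1 fun h => hn ⟨hθ, h⟩
    rw [hfc θ hθ] at h1
    linarith [hE.tol_babbleDec (ψ := ψ) hθ d]
  rw [← measure_sdiff_null hN] at hpos
  obtain ⟨θ, ⟨hθ, hA⟩, hθN⟩ := nonempty_of_measure_ne_zero hpos.ne'
  rw [← measure_sdiff_null hN] at hA
  obtain ⟨y, ⟨hy, hyn⟩, hyN⟩ := nonempty_of_measure_ne_zero hA.ne'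
  have hy1 := ψ'.cell_subset θ hθ hy
  have t1 := hgood θ hθ hθN
  have t2 := hgood y hy1 hyN
  rw [babbleDec_eq hθ hy] at t2
  have c1 := ψ.isCell subset_rfl hθ
  have c2 := ψ.isCell subset_rfl hy1
  have hne : ψ.cell θ ≠ ψ.cell y := fun e => hyn (e ▸ ψ.mem_cell y hy1)
  rcases lt_or_gt_of_ne (fun e => hne (by rw [e]) : θ ≠ y) with h | h
  · exact hE.not_tol_of_below c1 c2 (ψ.below_or hθ hy1 h hne) t1 t2
  · exact hE.not_tol_of_below c2 c1 (ψ.below_or hy1 hθ h hne.symm) t2 t1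

/-! ## Comparison of signals -/

/-- A lower bound for an equilibrium payoff from lower bounds given the signal. -/
lemma le_value_of_cells {σ : Profile} {β : History → Reported → Measure ℝ}
    (H : E.IsEquilibrium ψ σ β) (i : Player) {f : ℝ → ℝ} (hf : Integrable f E.prior)
    (hfc : ∀ θ ∈ Icc (0 : ℝ) 1, Integrable f (condLaw E.prior (ψ.cell θ))) {c : ℝ}
    (h : ∀ θ ∈ Icc (0 : ℝ) 1, (1 - E.δ) * (∫ x, f x ∂condLaw E.prior (ψ.cell θ)) + E.δ * c ≤
      ∫ x, E.total ψ σ i [] x (σ.afterSignal [] (ψ.cell θ) x) ∂condLaw E.prior (ψ.cell θ)) :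
    (1 - E.δ) * (∫ θ, f θ ∂E.prior) + E.δ * c ≤ E.value ψ σ i [] := by
  have := hE.isProbabilityMeasure
  have hm := (H.measurable [] List.nil_prefix).1
  obtain ⟨B, -, hB⟩ := Profile.exists_bound_afterSignal H.sender_bounded H.receiver_bounded
  have hg := hE.integrable_total H.sender_bounded H.receiver_bounded hE.ae_mem hm
    (.of_forall fun θ => hB [] (ψ.cell θ) θ) i
  rw [hE.value_eq_integral H.sender_bounded H.receiver_bounded hm i]
  have e : ∀ (κ : Measure ℝ) [IsProbabilityMeasure κ], Integrable f κ →
      (1 - E.δ) * (∫ x, f x ∂κ) + E.δ * c = ∫ x, ((1 - E.δ) * f x + E.δ * c) ∂κ := fun κ _ hκ => by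
    rw [integral_add (hκ.const_mul _) (integrable_const _), integral_const_mul]
    simp
  rw [e _ hf]
  refine hE.integral_prior_le_of_cells ψ ((hf.const_mul _).add (integrable_const _)) hg
    fun θ hθ => ?_
  have hc := ψ.isCell subset_rfl hθ
  have := hE.isProbabilityMeasure_condLaw hc
  rw [← e _ (hfc θ hθ)]
  refine (h θ hθ).trans (le_of_eq (integral_congr_ae ((hE.ae_mem_condLaw hc).mono fun x hx => ?_)))
  simp only [Profile.play, ψ.cell_eq θ hθ x hx]

/-- If the penal outcome of the sender is monotone, coarser signals enlarge the equilibrium payoff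
set. -/
theorem equilibriumPayoffs_ssubset (hψ : StrictlyMoreInformative E ψ ψ')
    (hpen : E.PenalOutcomeMonotone ψ) : E.equilibriumPayoffs ψ ⊂ E.equilibriumPayoffs ψ' := by
  have := hE.isProbabilityMeasure
  have hδ : 0 < 1 - E.δ := sub_pos.2 hE.delta_lt_one
  obtain ⟨vS, vR, vbar, hS, hR, hV, r, hr, hmono⟩ := hpen
  have hb : E.PayoffBounds ψ vS vR vbar := fun v hv =>
    ⟨hS.1 ⟨v, hv, rfl⟩, hR.1 ⟨v, hv, rfl⟩, hV.1 ⟨v, hv, rfl⟩⟩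
  set L := E.δ / (1 - E.δ) * (vbar - vS - vR) with hLdef
  obtain ⟨_, w₀, hw₀, rfl⟩ := hS.nonempty
  have hq : 0 ≤ E.δ / (1 - E.δ) := div_nonneg hE.delta_nonneg hδ.le
  have hL : 0 ≤ L := by
    obtain ⟨h1, h2, h3⟩ := hb w₀ hw₀
    exact mul_nonneg hq (by linarith)
  obtain ⟨P, hP, hPr⟩ := hE.exists_penal_mode hψ.1 (fun θ hθ => (hr θ hθ).1) hmono
  obtain ⟨B, hB, hBc, hBR⟩ := hE.exists_babble_mode ψ'
  set pS := ∫ θ, P.uS E θ ∂E.prior with hpS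
  set pR := ∫ θ, B.uR E θ ∂E.prior with hpR
  have hSle : pS ≤ vS := by
    -- The left side bounds every equilibrium payoff of the sender from below, hence also their
    -- infimum `vS`.
    suffices h : (1 - E.δ) * pS + E.δ * vS ≤ vS by nlinarith
    refine (le_isGLB_iff hS).2 ?_
    rintro _ ⟨_, ⟨σ, β, H, rfl⟩, rfl⟩
    refine hE.le_value_of_cells H .sender
      (hE.integrable_mode hP hE.ae_mem hP.aemeasurable_dec hP.aemeasurable_pay).1
      (fun θ hθ => (hE.integrable_mode_cell hP (ψ.isCell subset_rfl hθ)).1) fun θ hθ => ?_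
    obtain ⟨ρ, W, hpool, hrent, hle⟩ := hE.exists_rent H hb hθ []
    have h2 := (hPr θ hθ).trans (hE.penalValue_le_rent hL (ψ.isCell subset_rfl hθ) hpool hrent
      (hr θ hθ))
    linarith [mul_le_mul_of_nonneg_left h2 hδ.le]
  have hRlt : pR < vR := by
    refine (hBR.trans_lt (hE.integral_babbleDec_lt hψ)).trans_le ?_
    suffices h : (1 - E.δ) * (∫ θ, E.u .receiver (babbleDec E ψ θ) θ ∂E.prior) + E.δ * vR ≤ vR by
      nlinarith
    refine (le_isGLB_iff hR).2 ?_
    rintro _ ⟨_, ⟨σ, β, H, rfl⟩, rfl⟩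
    have hcell : ∀ θ ∈ Icc (0 : ℝ) 1, (fun x => E.u .receiver (babbleDec E ψ x) x)
        =ᵐ[condLaw E.prior (ψ.cell θ)] fun x => E.u .receiver (babbleDec E ψ θ) x := fun θ hθ =>
      (hE.ae_mem_condLaw (ψ.isCell subset_rfl hθ)).mono fun x hx => by
        simp only [babbleDec_eq hθ hx]
    refine hE.le_value_of_cells H .receiver hE.integrable_babbleDec (fun θ hθ => ?_) fun θ hθ => ?_
    · have hc := ψ.isCell subset_rfl hθ
      have := hE.isProbabilityMeasure_condLaw hc
      exact (hE.integrable_u_const (hE.ae_unit_condLaw hc) _ _).congr (hcell θ hθ).symm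
    · rw [integral_congr_ae (hcell θ hθ)]
      exact hE.receiver_lower H hb hθ [] _
  -- The supremum `vbar` need not be attained. A payoff `w` within `vR - pR` of it suffices, because
  -- the receiver's floor falls by exactly this amount. The surplus `L'` under `ψ'` is then at least
  -- `L`, so modes valid at `L` remain valid.
  have hmem : ∀ w ∈ E.equilibriumPayoffs ψ, vbar - (vR - pR) ≤ w.1 + w.2 → ∀ v : ℝ × ℝ,
      pS ≤ v.1 → pR ≤ v.2 → v.1 + v.2 ≤ w.1 + w.2 → v ∈ E.equilibriumPayoffs ψ' := by
    rintro _ ⟨σ, β, H, rfl⟩ hw v h1 h2 h3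
    obtain ⟨C, hC, hCw, hCs⟩ := hE.exists_mode_of_equilibrium hψ.1 H hb hL
    obtain ⟨K, hK, hKP, hKC⟩ := hE.exists_better_mode hC hP hCs
    set L' := E.δ / (1 - E.δ) * ((∫ θ, K.uS E θ ∂E.prior) + (∫ θ, K.uR E θ ∂E.prior) - pS - pR)
      with hL'
    have hLL : L ≤ L' := mul_le_mul_of_nonneg_left (by dsimp only at hw; linarith) hq
    refine hE.mem_equilibriumPayoffs (hK.mono hLL) (hP.mono hLL) hB hBc hKP ?_ h1 h2
      (h3.trans (hCw.trans hKC))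
    rw [hL', ← mul_assoc, mul_div_cancel₀ _ hδ.ne']
  -- A payoff `v` with a smaller sum than `w` is supported by the mode obtained from `w`, and one
  -- with a larger sum by its own. The pair of floors is the new payoff, since `pR < vR`.
  obtain ⟨_, ⟨w, hw, rfl⟩, hlt, -⟩ := hV.exists_between (by linarith : vbar - (vR - pR) < vbar)
  refine (ssubset_iff_of_subset fun v hv => ?_).2 ⟨(pS, pR), ?_, fun h => hRlt.not_ge (hb _ h).2.1⟩
  · obtain ⟨g1, g2, -⟩ := hb v hv
    rcases le_total (v.1 + v.2) (w.1 + w.2) with h | h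
    · exact hmem w hw hlt.le v (hSle.trans g1) (hRlt.le.trans g2) h
    · exact hmem v hv (hlt.le.trans h) v (hSle.trans g1) (hRlt.le.trans g2) le_rfl
  · obtain ⟨g1, g2, -⟩ := hb w hw
    exact hmem w hw hlt.le _ le_rfl le_rfl (add_le_add (hSle.trans g1) (hRlt.le.trans g2))

end Standing
end Env

end RepeatedCommunication

theorem proposition10 (E : RepeatedCommunication.Env) (hE : E.Standing)
    (ψ ψ' : RepeatedCommunication.Signal)
    (hψ : RepeatedCommunication.StrictlyMoreInformative E ψ ψ')
    (hpen : E.PenalOutcomeMonotone ψ) :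
    E.equilibriumPayoffs ψ ⊂ E.equilibriumPayoffs ψ' := by
  exact hE.equilibriumPayoffs_ssubset hψ hpen
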